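/- **Setting.** Let $L>0$ and let $\omega\subset\mathbb R^2$ be a nonempty bounded open set with Lipschitz boundary, area $A$, and $\int_\omega x_2=\int_\omega x_3=\int_\omega x_2x_3=0$; put $\mu(\omega)=\int_\omega(x_2^2+x_3^2)\,dx_2dx_3$, $\Omega=(0,L)\times\omega$, $P^h(x)=(x_1,hx_2,hx_3)$. Let $\theta_2,\theta_3\in C^3(0,L)$ with $(\theta_2'')^2+(\theta_3'')^2\neq0$ on $(0,L)$, let $p_k=\theta_k''/\sqrt{(\theta_2'')^2+(\theta_3'')^2}$ and suppose $p_2,p_3\in C^1(0,L)$; here $C^n(0,L)$ means that the derivatives up to order $n$ exist, are continuous and are bounded on $(0,L)$. Let $t^h,n^h,b^h$ be the unit tangent, principal normal and binormal of the curve $(x_1,h\theta_2(x_1),h\theta_3(x_1))$, let $$\Theta^h(x)=(x_1,h\theta_2(x_1),h\theta_3(x_1))+x_2n^h(x_1)+x_3b^h(x_1),\qquad \hat\Omega^h=\Theta^h((0,L)\times h\omega).$$ Let $R_e(x_1)=\begin{pmatrix}1&0&0\\0&p_2&-p_3\\0&p_3&p_2\end{pmatrix}$, $x'=x'(x)=R_e(x_1)x$,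 $\Omega'=x'(\Omega)$, $(x')^\perp=(0,-x_3',x_2')$. Let $W:\Omega\times\mathbb R^{3\times3}\to[0,\infty]$ be a Carathéodory function such that, for some $\delta,c,C>0$ and a.e. $x\in\Omega$: $W(x,\cdot)$ is finite and of class $C^2$ on $\{\operatorname{dist}(F,SO(3))<\delta\}$, $\partial^2W/\partial F^2$ is Carathéodory there and $|\frac{\partial^2W}{\partial F^2}(x,F)[G,G]|\le c|G|^2$ for symmetric $G$; $W(x,RF)=W(x,F)$ for all $R\in SO(3)$ and all $F$; $W(x,\cdot)=0$ on $SO(3)$; $W(x,F)\ge C\operatorname{dist}^2(F,SO(3))$ for all $F$. Put $Q_3(x,G)=\frac{\partial^2W}{\partial F^2}(x,I)[G,G]$. Let $0<h_0\le1$ and, for $0<h\le h_0$, let $W^h$ satisfy $\det(\nabla\Theta^h(P^hx))\,W^h(\Theta^h(P^hx),F)=W(x,F)$ for all $x\in\Omega$, $F\in\mathbb R^{3\times3}$. For $y:\hat\Omega^h\to\mathbb R^3$ write $Y=y\circ\Theta^h\circ P^h$ and set, for $k=2,3$, $$u^h=\frac1A\int_\omega\frac{Y_1-x_1}{h^2}\,dx_2dx_3,\quad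 v_k^h=\frac1A\int_\omega\frac{Y_k-h\theta_k}{h}\,dx_2dx_3,\quad w^h=\frac1{\mu(\omega)}\int_\omega\frac{x_2'Y_3-x_3'Y_2}{h^2}\,dx_2dx_3,$$ $$\gamma_1^h=\tfrac1h\Big(\tfrac{Y_1-x_1}{h^2}-u^h+\sum_{k=2,3}x_k'\big((v_k^h)'+\theta_k'\big)\Big),\qquad \gamma_k^h=\tfrac1{h^2}\Big(\tfrac{Y_k-h\theta_k-hx_k'}{h}-v_k^h-h(x')^\perp_kw^h\Big),$$ $$\eta_1^h=\tfrac1h\Big(\tfrac{Y_1-\Theta^h_1\circ P^h}{h^2}-u^h+\sum_{k=2,3}x_k'(v_k^h)'\Big),\qquad \eta_k^h=\tfrac1{h^2}\Big(\tfrac{Y_k-\Theta^h_k\circ P^h}{h}-v_k^h-h(x')^\perp_kw^h\Big).$$ Let $$\mathcal C=\Big\{\gamma\in L^2(\Omega;\mathbb R^3):\ \partial_2\gamma,\partial_3\gamma\in L^2,\ \int_\omega\gamma(x_1,\cdot)=0,\ \int_\omega(x_3'\gamma_2-x_2'\gamma_3)(x_1,\cdot)=0\text{ for a.e. }x_1\in(0,L)\Big\}.$$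 **Theorem.** Let $u,w\in W^{1,2}(0,L)$, $v_2,v_3\in W^{2,2}(0,L)$, $\gamma\in\mathcal C$. With $a=\theta_2'p_2+\theta_3'p_3$ and $c=\theta_3'p_2-\theta_2'p_3$ put $$\eta=\gamma-x_2\Big(0,\ \tfrac{a^2}2p_2-a\theta_2',\ \tfrac{a^2}2p_3-a\theta_3'\Big)-x_3\Big(0,\ \tfrac{c^2}2p_3,\ -\tfrac{c^2}2p_2\Big),\qquad \kappa=\eta\circ(x')^{-1}:\Omega'\to\mathbb R^3,$$ $$\mathbf A=\begin{pmatrix}0&-v_2'&-v_3'\\v_2'&0&-w\\v_3'&w&0\end{pmatrix},\quad \mathbf J=\begin{pmatrix}u'+v_2'\theta_2'+v_3'\theta_3'&0&0\\w\theta_3'&v_2'\theta_2'&v_2'\theta_3'\\-w\theta_2'&v_3'\theta_2'&v_3'\theta_3'\end{pmatrix},$$ $$\mathbf K=\left(\begin{array}{c}-x_2'v_2''-x_3'v_3''\\-x_3'w'\\x_2'w'\end{array}\ \middle|\ (\partial_2\kappa)(x'(x))\ \middle|\ (\partial_3\kappa)(x'(x))\right),\qquad \tilde G=\operatorname{sym}\big(\mathbf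 J-\tfrac12\mathbf A^2+\mathbf K\big).$$ Then there are $\hat y^h\in W^{1,2}(\hat\Omega^h;\mathbb R^3)$, $0<h\le h_0$, such that, as $h\to0$, with $u^h,v^h_k,w^h,\gamma^h,\eta^h$ formed from $y=\hat y^h$: (a) $u^h\rightharpoonup u$ weakly in $W^{1,2}(0,L)$; (b) $v^h_k\to v_k$ strongly in $W^{1,2}(0,L)$, $k=2,3$; (c) $w^h\rightharpoonup w$ weakly in $W^{1,2}(0,L)$; (d) $\frac1h\big((\nabla\hat y^h)\circ\Theta^h\circ P^h-I\big)\to\mathbf A$ strongly in $L^2(\Omega;\mathbb R^{3\times3})$; (f) $\gamma^h\rightharpoonup\gamma$ and $\partial_k\gamma^h\rightharpoonup\partial_k\gamma$, $k=2,3$, weakly in $L^2(\Omega;\mathbb R^3)$; likewise $\eta^h\rightharpoonup\eta$ and $\partial_k\eta^h\rightharpoonup\partial_k\eta$, $k=2,3$, weakly in $L^2(\Omega;\mathbb R^3)$. Moreover $Q_3(\cdot,\tilde G)$ is integrable on $\Omega$ and $$\lim_{h\to0}\frac1{h^6}\int_{\hat\Omega^h}W^h(z,\nabla\hat y^h(z))\,dz=\frac12\int_\Omega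 Q_3(x,\tilde G(x))\,dx.$$ -/

import Mathlib

open MeasureTheory Filter Topology Set
open scoped ENNReal Matrix Pointwise

attribute [local instance] Matrix.frobeniusNormedAddCommGroup Matrix.frobeniusNormedSpace

noncomputable section

namespace CurvedRod

/-! Coordinates `1, 2, 3` of the mathematics are the indices `0, 1, 2` of `Fin 3`. Points and
vectors are functions `Fin n → ℝ` with Lebesgue measure; their norm is used only where all norms
are equivalent. Matrices carry the Frobenius norm. -/

/-- Points and vectors of three-dimensional space. -/
abbrev V3 := Fin 3 → ℝ

/-- Points of the plane of the cross-section. -/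
abbrev V2 := Fin 2 → ℝ

/-- Real `3 × 3` matrices. -/
abbrev M3 := Matrix (Fin 3) (Fin 3) ℝ

/-! ### Function spaces -/

section Sobolev

variable {E : Type*} [NormedAddCommGroup E] [NormedSpace ℝ E] [MeasureSpace E]

/-- `g` is the weak derivative of `f` on `U` in the direction `v`: both are locally integrable on
`U` and `∫_U f ∂_v φ = - ∫_U g φ` for every test function `φ ∈ C¹_c(U)` (testing with `C¹_c` or
with `C^∞_c` is equivalent, by mollification). -/
def IsWeakDeriv (U : Set E) (v : E) (f g : E → ℝ) : Prop :=
  LocallyIntegrableOn f U ∧ LocallyIntegrableOn g U ∧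
    ∀ φ : E → ℝ, ContDiff ℝ 1 φ → HasCompactSupport φ → tsupport φ ⊆ U →
      ∫ x in U, f x * fderiv ℝ φ x v = - ∫ x in U, g x * φ x

open Classical in
/-- The weak derivative of `f` on `U` in the direction `v` (a representative of it; `0` if there
is none). -/
def weakDeriv (U : Set E) (v : E) (f : E → ℝ) : E → ℝ :=
  if hf : ∃ g, IsWeakDeriv U v f g then hf.choose else 0

/-- `f` has a weak derivative on `U` in the direction `v`, and it is in `L²(U)`. -/
def HasL2Deriv (U : Set E) (v : E) (f : E → ℝ) : Prop :=
  ∃ g, IsWeakDeriv U v f g ∧ MemLp g 2 (volume.restrict U)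

end Sobolev

/-- `f ∈ W^{1,2}(0,L)`. -/
def MemW12 (L : ℝ) (f : ℝ → ℝ) : Prop :=
  MemLp f 2 (volume.restrict (Ioo 0 L)) ∧ HasL2Deriv (Ioo 0 L) 1 f

/-- The weak derivative of a function on `(0,L)`. -/
def wd (L : ℝ) (f : ℝ → ℝ) : ℝ → ℝ := weakDeriv (Ioo 0 L) 1 f

/-- `f ∈ W^{2,2}(0,L)`. -/
def MemW22 (L : ℝ) (f : ℝ → ℝ) : Prop := MemW12 L f ∧ MemW12 L (wd L f)

/-- `f ∈ C^n(0,L)` with finite `C^n` norm. -/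
def MemC (n : ℕ) (L : ℝ) (f : ℝ → ℝ) : Prop :=
  ContDiffOn ℝ n f (Ioo 0 L) ∧
    ∀ j ≤ n, ∃ C : ℝ, ∀ t ∈ Ioo 0 L, |iteratedDeriv j f t| ≤ C

/-- The `k`-th vector of the canonical basis of `ℝ³`. -/
def e (k : Fin 3) : V3 := Pi.single k 1

/-- The weak partial derivative `∂_k f` on `U ⊆ ℝ³`. -/
def pd (U : Set V3) (k : Fin 3) (f : V3 → ℝ) : V3 → ℝ := weakDeriv U (e k) f

/-- `y ∈ W^{1,2}(U; ℝ³)`. -/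
def MemW12V (U : Set V3) (y : V3 → V3) : Prop :=
  ∀ i, MemLp (fun x => y x i) 2 (volume.restrict U) ∧
    ∀ k, HasL2Deriv U (e k) (fun x => y x i)

/-- The weak gradient `(∇ y)_{ik} = ∂_k y_i` on `U`. -/
def grad (U : Set V3) (y : V3 → V3) (x : V3) : M3 :=
  Matrix.of fun i k => pd U k (fun z => y z i) x

section Convergence

variable {α : Type*} [MeasurableSpace α]

/-- `F h → f` strongly in `L²(μ)` as `h → 0⁺`. -/
def TendstoL2 (μ : Measure α) (F : ℝ → α → ℝ) (f : α → ℝ) : Prop :=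
  MemLp f 2 μ ∧ (∀ᶠ h in 𝓝[>] (0 : ℝ), MemLp (F h) 2 μ) ∧
    Tendsto (fun h => eLpNorm (fun x => F h x - f x) 2 μ) (𝓝[>] 0) (𝓝 0)

/-- `F h ⇀ f` weakly in `L²(μ)` as `h → 0⁺`. -/
def TendstoWeakL2 (μ : Measure α) (F : ℝ → α → ℝ) (f : α → ℝ) : Prop :=
  MemLp f 2 μ ∧ (∀ᶠ h in 𝓝[>] (0 : ℝ), MemLp (F h) 2 μ) ∧
    ∀ φ : α → ℝ, MemLp φ 2 μ →
      Tendsto (fun h => ∫ x, F h x * φ x ∂μ) (𝓝[>] 0) (𝓝 (∫ x, f x * φ x ∂μ))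

end Convergence

/-- `F h → f` strongly in `W^{1,2}(0,L)` as `h → 0⁺`. -/
def TendstoW12 (L : ℝ) (F : ℝ → ℝ → ℝ) (f : ℝ → ℝ) : Prop :=
  MemW12 L f ∧ (∀ᶠ h in 𝓝[>] (0 : ℝ), MemW12 L (F h)) ∧
    TendstoL2 (volume.restrict (Ioo 0 L)) F f ∧
    TendstoL2 (volume.restrict (Ioo 0 L)) (fun h => wd L (F h)) (wd L f)

/-- `F h ⇀ f` weakly in `W^{1,2}(0,L)` as `h → 0⁺`. -/
def TendstoWeakW12 (L : ℝ) (F : ℝ → ℝ → ℝ) (f : ℝ → ℝ) : Prop :=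
  MemW12 L f ∧ (∀ᶠ h in 𝓝[>] (0 : ℝ), MemW12 L (F h)) ∧
    TendstoWeakL2 (volume.restrict (Ioo 0 L)) F f ∧
    TendstoWeakL2 (volume.restrict (Ioo 0 L)) (fun h => wd L (F h)) (wd L f)

/-- `F h ⇀ f` weakly in `L²(U)` and `∂_k (F h) ⇀ ∂_k f` weakly in `L²(U)` for `k = 2, 3`, as
`h → 0⁺`, in each component. -/
def TendstoWeakSection (U : Set V3) (F : ℝ → V3 → V3) (f : V3 → V3) : Prop :=
  ∀ i, TendstoWeakL2 (volume.restrict U) (fun h x => F h x i) (fun x => f x i) ∧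
    ∀ k : Fin 3, k ≠ 0 →
      HasL2Deriv U (e k) (fun x => f x i) ∧
      (∀ᶠ h in 𝓝[>] (0 : ℝ), HasL2Deriv U (e k) (fun x => F h x i)) ∧
      TendstoWeakL2 (volume.restrict U) (fun h => pd U k (fun x => F h x i))
        (pd U k (fun x => f x i))

/-! ### Geometry of the rod -/

/-- The open set `ω ⊆ ℝ²` has Lipschitz boundary: near each boundary point it is, in suitable
orthonormal coordinates, the strict epigraph of a Lipschitz function. -/
def HasLipschitzBoundary (ω : Set V2) : Prop :=
  ∀ z ∈ frontier ω, ∃ R ∈ Matrix.orthogonalGroup (Fin 2) ℝ, ∃ (K : NNReal) (g : ℝ → ℝ),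
    LipschitzWith K g ∧ ∀ᶠ x in 𝓝 z, (x ∈ ω ↔ g ((R *ᵥ x) 0) < (R *ᵥ x) 1)

/-- The cross-section: a nonempty bounded open set with Lipschitz boundary, with
`∫ x₂ = ∫ x₃ = ∫ x₂ x₃ = 0`. -/
structure IsCrossSection (ω : Set V2) : Prop where
  isOpen : IsOpen ω
  nonempty : ω.Nonempty
  isBounded : Bornology.IsBounded ω
  lipschitz : HasLipschitzBoundary ω
  moment₂ : ∫ s in ω, s 0 = 0
  moment₃ : ∫ s in ω, s 1 = 0
  moment₂₃ : ∫ s in ω, s 0 * s 1 = 0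

/-- The cylinder `(0,L) × ω`. -/
def cyl (L : ℝ) (ω : Set V2) : Set V3 := {x | x 0 ∈ Ioo 0 L ∧ ![x 1, x 2] ∈ ω}

/-- The area `A` of the cross-section. -/
def area (ω : Set V2) : ℝ := (volume ω).toReal

/-- `μ(ω) = ∫_ω (x₂² + x₃²)`. -/
def polarMoment (ω : Set V2) : ℝ := ∫ s in ω, (s 0 ^ 2 + s 1 ^ 2)

/-- The integral `∫_ω f(t, x₂, x₃) dx₂ dx₃` over the cross-section at `t`. -/
def secInt (ω : Set V2) (f : V3 → ℝ) (t : ℝ) : ℝ := ∫ s in ω, f ![t, s 0, s 1]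

section Frame

variable (θ₂ θ₃ : ℝ → ℝ)

/-- Unit tangent of the curve `t ↦ (t, h θ₂ t, h θ₃ t)`. -/
def tangent (h t : ℝ) : V3 :=
  (Real.sqrt (1 + (h * deriv θ₂ t) ^ 2 + (h * deriv θ₃ t) ^ 2))⁻¹ •
    ![1, h * deriv θ₂ t, h * deriv θ₃ t]

/-- Principal normal `t' / |t'|`, with the Euclidean length. -/
def normal (h t : ℝ) : V3 :=
  (Real.sqrt (deriv (tangent θ₂ θ₃ h) t ⬝ᵥ deriv (tangent θ₂ θ₃ h) t))⁻¹ •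
    deriv (tangent θ₂ θ₃ h) t

/-- Binormal. -/
def binormal (h t : ℝ) : V3 := crossProduct (tangent θ₂ θ₃ h t) (normal θ₂ θ₃ h t)

/-- The map `Θ^h`. -/
def Theta (h : ℝ) (x : V3) : V3 :=
  ![x 0, h * θ₂ (x 0), h * θ₃ (x 0)] + x 1 • normal θ₂ θ₃ h (x 0) +
    x 2 • binormal θ₂ θ₃ h (x 0)

/-- The scaling `P^h`. -/
def P (h : ℝ) (x : V3) : V3 := ![x 0, h * x 1, h * x 2]

/-- `Θ^h ∘ P^h`. -/
def ThetaP (h : ℝ) (x : V3) : V3 := Theta θ₂ θ₃ h (P h x)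

/-- `det ∇Θ^h`. -/
def detTheta (h : ℝ) (x : V3) : ℝ := (fderiv ℝ (Theta θ₂ θ₃ h) x).det

/-- The curved rod `Θ^h((0,L) × hω)`. -/
def rodHat (L : ℝ) (ω : Set V2) (h : ℝ) : Set V3 := Theta θ₂ θ₃ h '' cyl L (h • ω)

/-- `p₂ = θ₂'' / √(θ₂''² + θ₃''²)`. -/
def p₂ (t : ℝ) : ℝ :=
  deriv (deriv θ₂) t / Real.sqrt (deriv (deriv θ₂) t ^ 2 + deriv (deriv θ₃) t ^ 2)

/-- `p₃ = θ₃'' / √(θ₂''² + θ₃''²)`. -/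
def p₃ (t : ℝ) : ℝ :=
  deriv (deriv θ₃) t / Real.sqrt (deriv (deriv θ₂) t ^ 2 + deriv (deriv θ₃) t ^ 2)

/-- The rotation `R_e` of the cross-section. -/
def Re (t : ℝ) : M3 :=
  !![1, 0, 0;
     0, p₂ θ₂ θ₃ t, - p₃ θ₂ θ₃ t;
     0, p₃ θ₂ θ₃ t, p₂ θ₂ θ₃ t]

/-- The change of coordinates `x' = R_e(x₁) x`. -/
def xp (x : V3) : V3 := Re θ₂ θ₃ (x 0) *ᵥ x

/-- Its inverse. -/
def xpInv (z : V3) : V3 := (Re θ₂ θ₃ (z 0))ᵀ *ᵥ z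

/-- `(x')^⊥ = (0, -x₃', x₂')`. -/
def perp (x : V3) : V3 := ![0, - xp θ₂ θ₃ x 2, xp θ₂ θ₃ x 1]

/-- `a = θ₂' p₂ + θ₃' p₃`. -/
def aCoef (t : ℝ) : ℝ := deriv θ₂ t * p₂ θ₂ θ₃ t + deriv θ₃ t * p₃ θ₂ θ₃ t

/-- `c = θ₃' p₂ - θ₂' p₃`. -/
def cCoef (t : ℝ) : ℝ := deriv θ₃ t * p₂ θ₂ θ₃ t - deriv θ₂ t * p₃ θ₂ θ₃ t

/-- The `h²`-coefficient of the normal in the `(e₂, e₃)` plane, `(1/2) a² p - a θ'`: the normal is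
`-h a e₁ + p₂ e₂ + p₃ e₃ + h² fN + O(h³)`. -/
def fN (t : ℝ) : V3 :=
  ![0, aCoef θ₂ θ₃ t ^ 2 / 2 * p₂ θ₂ θ₃ t - aCoef θ₂ θ₃ t * deriv θ₂ t,
    aCoef θ₂ θ₃ t ^ 2 / 2 * p₃ θ₂ θ₃ t - aCoef θ₂ θ₃ t * deriv θ₃ t]

/-- The `h²`-coefficient of the binormal in the `(e₂, e₃)` plane, `(1/2) c² (p₃, -p₂)`: the
binormal is `-h c e₁ - p₃ e₂ + p₂ e₃ + h² fB + O(h³)`. -/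
def fB (t : ℝ) : V3 :=
  ![0, cCoef θ₂ θ₃ t ^ 2 / 2 * p₃ θ₂ θ₃ t, - (cCoef θ₂ θ₃ t ^ 2 / 2 * p₂ θ₂ θ₃ t)]

end Frame

/-! ### Scaled displacements of a deformation -/

section Displacements

variable (θ₂ θ₃ : ℝ → ℝ) (L : ℝ) (ω : Set V2)

/-- `u^h` for a deformation `y` of the rod of thickness `h`. -/
def uOf (h : ℝ) (y : V3 → V3) : ℝ → ℝ :=
  fun t => (area ω)⁻¹ * secInt ω (fun x => (y (ThetaP θ₂ θ₃ h x) 0 - x 0) / h ^ 2) t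

/-- `v₂^h`. -/
def v₂Of (h : ℝ) (y : V3 → V3) : ℝ → ℝ :=
  fun t => (area ω)⁻¹ * secInt ω (fun x => (y (ThetaP θ₂ θ₃ h x) 1 - h * θ₂ (x 0)) / h) t

/-- `v₃^h`. -/
def v₃Of (h : ℝ) (y : V3 → V3) : ℝ → ℝ :=
  fun t => (area ω)⁻¹ * secInt ω (fun x => (y (ThetaP θ₂ θ₃ h x) 2 - h * θ₃ (x 0)) / h) t

/-- The twist `w^h`. -/
def wOf (h : ℝ) (y : V3 → V3) : ℝ → ℝ :=
  fun t => (polarMoment ω)⁻¹ * secInt ω (fun x =>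
    (xp θ₂ θ₃ x 1 * y (ThetaP θ₂ θ₃ h x) 2 - xp θ₂ θ₃ x 2 * y (ThetaP θ₂ θ₃ h x) 1) / h ^ 2) t

/-- `γ^h`. -/
def gammaOf (h : ℝ) (y : V3 → V3) (x : V3) : V3 :=
  ![1 / h * ((y (ThetaP θ₂ θ₃ h x) 0 - x 0) / h ^ 2 - uOf θ₂ θ₃ ω h y (x 0)
      + xp θ₂ θ₃ x 1 * (wd L (v₂Of θ₂ θ₃ ω h y) (x 0) + deriv θ₂ (x 0))
      + xp θ₂ θ₃ x 2 * (wd L (v₃Of θ₂ θ₃ ω h y) (x 0) + deriv θ₃ (x 0))),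
    1 / h ^ 2 * ((y (ThetaP θ₂ θ₃ h x) 1 - h * θ₂ (x 0) - h * xp θ₂ θ₃ x 1) / h
      - v₂Of θ₂ θ₃ ω h y (x 0) - h * perp θ₂ θ₃ x 1 * wOf θ₂ θ₃ ω h y (x 0)),
    1 / h ^ 2 * ((y (ThetaP θ₂ θ₃ h x) 2 - h * θ₃ (x 0) - h * xp θ₂ θ₃ x 2) / h
      - v₃Of θ₂ θ₃ ω h y (x 0) - h * perp θ₂ θ₃ x 2 * wOf θ₂ θ₃ ω h y (x 0))]

/-- `η^h`. -/
def etaOf (h : ℝ) (y : V3 → V3) (x : V3) : V3 :=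
  ![1 / h * ((y (ThetaP θ₂ θ₃ h x) 0 - ThetaP θ₂ θ₃ h x 0) / h ^ 2 - uOf θ₂ θ₃ ω h y (x 0)
      + xp θ₂ θ₃ x 1 * wd L (v₂Of θ₂ θ₃ ω h y) (x 0)
      + xp θ₂ θ₃ x 2 * wd L (v₃Of θ₂ θ₃ ω h y) (x 0)),
    1 / h ^ 2 * ((y (ThetaP θ₂ θ₃ h x) 1 - ThetaP θ₂ θ₃ h x 1) / h
      - v₂Of θ₂ θ₃ ω h y (x 0) - h * perp θ₂ θ₃ x 1 * wOf θ₂ θ₃ ω h y (x 0)),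
    1 / h ^ 2 * ((y (ThetaP θ₂ θ₃ h x) 2 - ThetaP θ₂ θ₃ h x 2) / h
      - v₃Of θ₂ θ₃ ω h y (x 0) - h * perp θ₂ θ₃ x 2 * wOf θ₂ θ₃ ω h y (x 0))]

/-- The space `𝒞`. -/
def MemSpaceC (γ : V3 → V3) : Prop :=
  (∀ i, MemLp (fun x => γ x i) 2 (volume.restrict (cyl L ω)) ∧
    ∀ k : Fin 3, k ≠ 0 → HasL2Deriv (cyl L ω) (e k) (fun x => γ x i)) ∧
  ∀ᵐ t ∂(volume.restrict (Ioo 0 L)),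
    (∀ i, secInt ω (fun x => γ x i) t = 0) ∧
    secInt ω (fun x => xp θ₂ θ₃ x 2 * γ x 1 - xp θ₂ θ₃ x 1 * γ x 2) t = 0

/-- `η = γ - x₂ fN - x₃ fB`. -/
def eta (γ : V3 → V3) (x : V3) : V3 :=
  γ x - x 1 • fN θ₂ θ₃ (x 0) - x 2 • fB θ₂ θ₃ (x 0)

/-- `κ = η ∘ (x')⁻¹`, a function on `Ω' = x'(Ω)`. -/
def kappa (γ : V3 → V3) (z : V3) : V3 := eta θ₂ θ₃ γ (xpInv θ₂ θ₃ z)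

/-! ### Limit strain -/

/-- The skew matrix `A`. -/
def Amat (v₂ v₃ w : ℝ → ℝ) (t : ℝ) : M3 :=
  !![0, - wd L v₂ t, - wd L v₃ t;
     wd L v₂ t, 0, - w t;
     wd L v₃ t, w t, 0]

/-- The matrix `J`. -/
def Jmat (u v₂ v₃ w : ℝ → ℝ) (t : ℝ) : M3 :=
  !![wd L u t + wd L v₂ t * deriv θ₂ t + wd L v₃ t * deriv θ₃ t, 0, 0;
     w t * deriv θ₃ t, wd L v₂ t * deriv θ₂ t, wd L v₂ t * deriv θ₃ t;
     - (w t * deriv θ₂ t), wd L v₃ t * deriv θ₂ t, wd L v₃ t * deriv θ₃ t]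

/-- `∂_k κ_i` at the point `x'(x)`; the derivative is taken in the variables `x'`, on `Ω'`. -/
def dkappa (γ : V3 → V3) (k i : Fin 3) (x : V3) : ℝ :=
  pd (xp θ₂ θ₃ '' cyl L ω) k (fun z => kappa θ₂ θ₃ γ z i) (xp θ₂ θ₃ x)

/-- The matrix `K`. -/
def Kmat (v₂ v₃ w : ℝ → ℝ) (γ : V3 → V3) (x : V3) : M3 :=
  !![- (xp θ₂ θ₃ x 1 * wd L (wd L v₂) (x 0)) - xp θ₂ θ₃ x 2 * wd L (wd L v₃) (x 0),
        dkappa θ₂ θ₃ L ω γ 1 0 x, dkappa θ₂ θ₃ L ω γ 2 0 x;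
     - (xp θ₂ θ₃ x 2 * wd L w (x 0)),
        dkappa θ₂ θ₃ L ω γ 1 1 x, dkappa θ₂ θ₃ L ω γ 2 1 x;
     xp θ₂ θ₃ x 1 * wd L w (x 0),
        dkappa θ₂ θ₃ L ω γ 1 2 x, dkappa θ₂ θ₃ L ω γ 2 2 x]

/-- The symmetric part of a matrix. -/
def symPart (M : M3) : M3 := (1 / 2 : ℝ) • (M + Mᵀ)

/-- The limit strain `sym (J - A²/2 + K)`. -/
def Gmat (u v₂ v₃ w : ℝ → ℝ) (γ : V3 → V3) (x : V3) : M3 :=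
  symPart (Jmat θ₂ θ₃ L u v₂ v₃ w (x 0)
    - (1 / 2 : ℝ) • (Amat L v₂ v₃ w (x 0) * Amat L v₂ v₃ w (x 0))
    + Kmat θ₂ θ₃ L ω v₂ v₃ w γ x)

end Displacements

/-! ### Stored energy -/

/-- The rotations `SO(3)`. -/
def SO3 : Set M3 := {R | Rᵀ * R = 1 ∧ R.det = 1}

/-- `{F : dist(F, SO(3)) < δ}`. -/
def tube (δ : ℝ) : Set M3 := {F | Metric.infDist F SO3 < δ}

/-- The second derivative `∂²W/∂F² (F)[G, H]` of a stored energy at a fixed material point. -/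
def D2 (W : M3 → ℝ≥0∞) (F G H : M3) : ℝ :=
  iteratedFDeriv ℝ 2 (fun F' => (W F').toReal) F ![G, H]

/-- The quadratic form `Q₃(x, G) = ∂²W/∂F² (x, I)[G, G]`. -/
def Q3 (W : V3 → M3 → ℝ≥0∞) (x : V3) (G : M3) : ℝ := D2 (W x) 1 G G

/-- The assumptions on the stored energy density `W : Ω × ℝ^{3×3} → [0,∞]`. -/
structure IsStoredEnergy (Ω : Set V3) (W : V3 → M3 → ℝ≥0∞) : Prop where
  measurable : ∀ F, AEMeasurable (fun x => W x F) (volume.restrict Ω)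
  continuous : ∀ᵐ x ∂(volume.restrict Ω), Continuous (W x)
  smooth : ∃ δ > 0,
    (∀ᵐ x ∂(volume.restrict Ω), (∀ F ∈ tube δ, W x F ≠ ⊤) ∧
      ContDiffOn ℝ 2 (fun F => (W x F).toReal) (tube δ)) ∧
    (∀ F ∈ tube δ, ∀ G H, AEMeasurable (fun x => D2 (W x) F G H) (volume.restrict Ω)) ∧
    (∀ᵐ x ∂(volume.restrict Ω), ∀ G H, ContinuousOn (fun F => D2 (W x) F G H) (tube δ)) ∧
    ∃ c > 0, ∀ᵐ x ∂(volume.restrict Ω), ∀ F ∈ tube δ, ∀ G : M3, Gᵀ = G →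
      |D2 (W x) F G G| ≤ c * ‖G‖ ^ 2
  frame_indifferent : ∀ᵐ x ∂(volume.restrict Ω), ∀ F, ∀ R ∈ SO3, W x F = W x (R * F)
  zero_on_rotations : ∀ᵐ x ∂(volume.restrict Ω), ∀ R ∈ SO3, W x R = 0
  coercive : ∃ C > 0, ∀ᵐ x ∂(volume.restrict Ω), ∀ F,
    ENNReal.ofReal (C * Metric.infDist F SO3 ^ 2) ≤ W x F

end CurvedRod

end

open CurvedRod

noncomputable section

namespace CurvedRod

/-! ### Weak derivatives -/

section WeakDerivative

variable {E : Type*} [NormedAddCommGroup E] [NormedSpace ℝ E] [FiniteDimensional ℝ E]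
  [MeasureSpace E] [BorelSpace E] {U : Set E} {v : E} {f g f' g' : E → ℝ}

/-! The recovery sequence is explicit for regular data; density and a diagonal argument transfer it
to general data.

Regular data. Let `γ` satisfy the mean and twist constraints on every section. In the coordinates of
the cylinder put Y = Θ^h∘P^h + (h²u, hv₂, hv₃) + h²(-x₂'v₂' - x₃'v₃', -x₃'w, x₂'w) - h(x₂ν_N +
x₃ν_B) + h³γ, where ν_N and ν_B (`nuN`, `nuB`) are the deviations of the normal and binormal from
their first-order expansions. The ν terms strip Θ^h∘P^h of its frame error, so for small h the
averages u^h, v_k^h, w^h and the warping γ^h give back the data exactly (up to null sets for γ^h):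
`Disp.IsSmooth.uOf_eq`, `Disp.IsSmooth.gammaOf_eq`. The frame error reappears in η^h, and ν = h²f +
O(h³) (`IsCurve.O1_nuN`, `IsCurve.O1_nuB`) turns it into the correction that separates η from γ.

Energy. The deformation gradient is F = 1 + hA + h²B + O(h³) with A skew and B = J + K
(`Disp.IsSmooth.exists_expansion`), hence FᵀF - 1 = 2h² sym(B - A²/2) + O(h³)
(`norm_strain_sub_le`). Polar decomposition (`exists_polar`) and frame indifference replace F by a
symmetric 1 + V with V close to (FᵀF - 1)/2. A second-order expansion at the identity then gives
h⁻⁴W(x,F) → Q₃(x,G)/2 pointwise with a uniform bound (`IsDensity.tendsto_of_strain`,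
`IsDensity.le_of_strain`), and dominated convergence applies. Two further powers of h come from the
Jacobian h² det ∇Θ^h, whose second factor is absorbed by the normalisation of W^h. That Θ^h∘P^h is a
change of variables for small h is `IsCurve.isChart_ThetaP`.

General data. Mollification after an inward shift, possible under the cone property, makes C¹
functions dense (`exists_contDiff_approx`). The warping needs only its two cross-sectional
derivatives approximated, and its constraints are restored by subtracting means and twist
(`MemSpaceC.exists_approx`). Since A enters quadratically, w and v_k' are approximated uniformly as
well; the limit strains then converge strongly in L² (`IsCurve.gMat_cv`), and the limit energy is
L²-continuous (`IsStoredEnergy.exists_abs_integral_Q3_sub_le`). The strain is stated through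
derivatives of κ on Ω'; `IsCurve.Gmat_ae_eq` moves it back to the cylinder. `Near` collects all
conclusions at accuracy ε, and `exists_diagonal` makes one choice of deformations for every
accuracy. All convergences obtained are strong; the weak ones are read off. -/

theorem integrableOn_mul_of_tsupport_subset (hf : LocallyIntegrableOn f U) {φ : E → ℝ}
    (hφ : Continuous φ) (hc : HasCompactSupport φ) (hs : tsupport φ ⊆ U) :
    Integrable (fun x => f x * φ x) := by
  have h1 : IntegrableOn f (tsupport φ) := hf.integrableOn_compact_subset hs hc
  have h2 : IntegrableOn (fun x => f x * φ x) (tsupport φ) :=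
    h1.mul_continuousOn hφ.continuousOn hc
  refine (integrableOn_iff_integrable_of_support_subset ?_).1 h2
  intro x hx
  refine subset_tsupport φ ?_
  intro h0
  exact hx (by simp [h0])

theorem tsupport_fderiv_apply_subset' (φ : E → ℝ) (v : E) :
    tsupport (fun x => fderiv ℝ φ x v) ⊆ tsupport φ := by
  refine (closure_mono ?_).trans (tsupport_fderiv_subset ℝ (f := φ))
  intro x hx h0
  exact hx (by simp [h0])

theorem setIntegral_eq_integral_of_tsupport {φ : E → ℝ} (f : E → ℝ)
    (hs : tsupport φ ⊆ U) : ∫ x in U, f x * φ x = ∫ x, f x * φ x := by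
  apply setIntegral_eq_integral_of_forall_compl_eq_zero
  intro x hx
  have : φ x = 0 := by
    by_contra h
    exact hx (hs (subset_tsupport φ h))
  simp [this]

/-- The fundamental lemma of the calculus of variations: smooth test functions detect an a.e. zero
locally integrable function on an open set. -/
theorem IsWeakDeriv.ae_eq (hU : IsOpen U) (h : IsWeakDeriv U v f g) (h' : IsWeakDeriv U v f g') :
    g =ᵐ[volume.restrict U] g' := by
  have key : ∀ᵐ x, x ∈ U → g x - g' x = 0 := by
    refine hU.ae_eq_zero_of_integral_contDiff_smul_eq_zero (h.2.1.sub h'.2.1) ?_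
    intro φ hφ hc hs
    have e1 := h.2.2 φ (hφ.of_le (by exact_mod_cast le_top)) hc hs
    have e2 := h'.2.2 φ (hφ.of_le (by exact_mod_cast le_top)) hc hs
    rw [e1] at e2
    rw [setIntegral_eq_integral_of_tsupport g hs,
      setIntegral_eq_integral_of_tsupport g' hs] at e2
    have i1 := integrableOn_mul_of_tsupport_subset h.2.1 hφ.continuous hc hs
    have i2 := integrableOn_mul_of_tsupport_subset h'.2.1 hφ.continuous hc hs
    have : ∀ x, φ x • (g x - g' x) = g x * φ x - g' x * φ x := fun x => by
      simp only [smul_eq_mul]; ring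
    simp only [this]
    rw [integral_sub i1 i2]
    linarith
  rw [Filter.EventuallyEq, ae_restrict_iff' hU.measurableSet]
  filter_upwards [key] with x hx hxU
  linarith [hx hxU]

theorem IsWeakDeriv.isWeakDeriv_weakDeriv (h : IsWeakDeriv U v f g) :
    IsWeakDeriv U v f (weakDeriv U v f) := by
  have hex : ∃ g, IsWeakDeriv U v f g := ⟨g, h⟩
  rw [weakDeriv, dif_pos hex]
  exact hex.choose_spec

/-- `weakDeriv` is an arbitrary choice of representative, so it is evaluated by exhibiting some weak
derivative and passing through this a.e. equality. -/
theorem IsWeakDeriv.weakDeriv_ae_eq (hU : IsOpen U) (h : IsWeakDeriv U v f g) :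
    weakDeriv U v f =ᵐ[volume.restrict U] g :=
  h.isWeakDeriv_weakDeriv.ae_eq hU h

theorem IsWeakDeriv.congr (h : IsWeakDeriv U v f g) (hf : f =ᵐ[volume.restrict U] f')
    (hg : g =ᵐ[volume.restrict U] g') : IsWeakDeriv U v f' g' := by
  refine ⟨h.1.congr hf, h.2.1.congr hg, fun φ hφ hc hs => ?_⟩
  have e1 : ∫ x in U, f' x * fderiv ℝ φ x v = ∫ x in U, f x * fderiv ℝ φ x v :=
    integral_congr_ae (by filter_upwards [hf] with x hx; rw [hx])
  have e2 : ∫ x in U, g' x * φ x = ∫ x in U, g x * φ x :=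
    integral_congr_ae (by filter_upwards [hg] with x hx; rw [hx])
  rw [e1, e2, h.2.2 φ hφ hc hs]

theorem hasCompactSupport_fderiv_apply' {φ : E → ℝ} (hc : HasCompactSupport φ) (v : E) :
    HasCompactSupport (fun x => fderiv ℝ φ x v) :=
  hc.mono' (by
    refine (subset_tsupport _).trans (tsupport_fderiv_apply_subset' φ v))

theorem continuous_fderiv_apply' {φ : E → ℝ} (hφ : ContDiff ℝ 1 φ) (v : E) :
    Continuous (fun x => fderiv ℝ φ x v) :=
  (hφ.continuous_fderiv one_ne_zero).clm_apply continuous_const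

theorem IsWeakDeriv.add (h : IsWeakDeriv U v f g) (h' : IsWeakDeriv U v f' g') :
    IsWeakDeriv U v (fun x => f x + f' x) (fun x => g x + g' x) := by
  refine ⟨h.1.add h'.1, h.2.1.add h'.2.1, fun φ hφ hc hs => ?_⟩
  have hs' := (tsupport_fderiv_apply_subset' φ v).trans hs
  have i1 := (integrableOn_mul_of_tsupport_subset h.1 (continuous_fderiv_apply' hφ v)
    (hasCompactSupport_fderiv_apply' hc v) hs').integrableOn (s := U)
  have i2 := (integrableOn_mul_of_tsupport_subset h'.1 (continuous_fderiv_apply' hφ v)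
    (hasCompactSupport_fderiv_apply' hc v) hs').integrableOn (s := U)
  have i3 := (integrableOn_mul_of_tsupport_subset h.2.1 hφ.continuous hc hs).integrableOn (s := U)
  have i4 := (integrableOn_mul_of_tsupport_subset h'.2.1 hφ.continuous hc hs).integrableOn (s := U)
  simp only [add_mul]
  rw [integral_add i1 i2, integral_add i3 i4, h.2.2 φ hφ hc hs, h'.2.2 φ hφ hc hs]
  ring

theorem IsWeakDeriv.const_mul (h : IsWeakDeriv U v f g) (c : ℝ) :
    IsWeakDeriv U v (fun x => c * f x) (fun x => c * g x) := by
  refine ⟨h.1.smul c, h.2.1.smul c, fun φ hφ hc hs => ?_⟩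
  simp only [mul_assoc]
  rw [integral_const_mul, integral_const_mul, h.2.2 φ hφ hc hs]
  ring

theorem IsWeakDeriv.sub (h : IsWeakDeriv U v f g) (h' : IsWeakDeriv U v f' g') :
    IsWeakDeriv U v (fun x => f x - f' x) (fun x => g x - g' x) := by
  have := h.add (h'.const_mul (-1))
  simpa only [neg_one_mul, ← sub_eq_add_neg] using this

/-- The product `χ φ` is again an admissible test function for `f`; the product rule for it is the
claim. -/
theorem IsWeakDeriv.mul_contDiff (hU : IsOpen U) (h : IsWeakDeriv U v f g) {χ : E → ℝ}
    (hχ : ContDiff ℝ 1 χ) :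
    IsWeakDeriv U v (fun x => f x * χ x) (fun x => g x * χ x + f x * fderiv ℝ χ x v) := by
  have l1 : LocallyIntegrableOn (fun x => f x * χ x) U :=
    h.1.mul_continuousOn hχ.continuous.continuousOn hU.isLocallyClosed
  have l2 : LocallyIntegrableOn (fun x => g x * χ x) U :=
    h.2.1.mul_continuousOn hχ.continuous.continuousOn hU.isLocallyClosed
  have l3 : LocallyIntegrableOn (fun x => f x * fderiv ℝ χ x v) U :=
    h.1.mul_continuousOn (continuous_fderiv_apply' hχ v).continuousOn hU.isLocallyClosed
  refine ⟨l1, l2.add l3, fun φ hφ hc hs => ?_⟩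
  have e := h.2.2 (fun x => χ x * φ x) (hχ.mul hφ) (hc.mul_left)
    ((closure_mono (Function.support_mul_subset_right _ _)).trans hs)
  have hd : ∀ x, fderiv ℝ (fun x => χ x * φ x) x v
      = χ x * fderiv ℝ φ x v + φ x * fderiv ℝ χ x v := by
    intro x
    rw [fderiv_fun_mul ((hχ.differentiable one_ne_zero) x) ((hφ.differentiable one_ne_zero) x)]
    simp
  have hs' := (tsupport_fderiv_apply_subset' φ v).trans hs
  have i1 := (integrableOn_mul_of_tsupport_subset l1 (continuous_fderiv_apply' hφ v)
    (hasCompactSupport_fderiv_apply' hc v) hs').integrableOn (s := U)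
  have i2 := (integrableOn_mul_of_tsupport_subset l2 hφ.continuous hc hs).integrableOn (s := U)
  have i3 := (integrableOn_mul_of_tsupport_subset l3 hφ.continuous hc hs).integrableOn (s := U)
  have e1 : ∫ x in U, f x * fderiv ℝ (fun x => χ x * φ x) x v
      = (∫ x in U, f x * χ x * fderiv ℝ φ x v) + ∫ x in U, f x * fderiv ℝ χ x v * φ x := by
    rw [← integral_add i1 i3]
    congr 1; ext x; rw [hd]; ring
  have e2 : ∫ x in U, (g x * χ x + f x * fderiv ℝ χ x v) * φ x
      = (∫ x in U, g x * (χ x * φ x)) + ∫ x in U, f x * fderiv ℝ χ x v * φ x := by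
    rw [show (∫ x in U, g x * (χ x * φ x)) = ∫ x in U, g x * χ x * φ x by
      congr 1; ext x; ring]
    rw [← integral_add i2 i3]
    congr 1; ext x; ring
  rw [e2]
  linarith [e, e1]

/-- The classical derivative need not be continuous: integration by parts only needs
differentiability on the support of the test function and integrability of the products. -/
theorem isWeakDeriv_of_differentiableAt [(volume : Measure E).IsAddHaarMeasure]
    (hU : IsOpen U) (hf : ∀ x ∈ U, DifferentiableAt ℝ f x)
    (hg : LocallyIntegrableOn (fun x => fderiv ℝ f x v) U) :
    IsWeakDeriv U v f (fun x => fderiv ℝ f x v) := by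
  have hl : LocallyIntegrableOn f U :=
    ContinuousOn.locallyIntegrableOn (fun x hx => (hf x hx).continuousAt.continuousWithinAt)
      hU.measurableSet
  refine ⟨hl, hg, fun φ hφ hc hs => ?_⟩
  have hs' := (tsupport_fderiv_apply_subset' φ v).trans hs
  rw [setIntegral_eq_integral_of_tsupport _ hs,
    setIntegral_eq_integral_of_tsupport _ hs']
  exact integral_mul_fderiv_eq_neg_fderiv_mul_of_integrable
    (integrableOn_mul_of_tsupport_subset hg hφ.continuous hc hs)
    (integrableOn_mul_of_tsupport_subset hl (continuous_fderiv_apply' hφ v)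
      (hasCompactSupport_fderiv_apply' hc v) hs')
    (integrableOn_mul_of_tsupport_subset hl hφ.continuous hc hs)
    (fun x hx => hf x (hs hx)) (fun x _ => (hφ.differentiable one_ne_zero) x)

theorem locallyIntegrableOn_of_bounded [IsLocallyFiniteMeasure (volume : Measure E)]
    (hU : IsOpen U) (hm : AEStronglyMeasurable f (volume.restrict U)) {C : ℝ}
    (hb : ∀ x ∈ U, |f x| ≤ C) : LocallyIntegrableOn f U := by
  intro x hx
  obtain ⟨K, hK, hKf⟩ := (volume : Measure E).finiteAt_nhds x
  obtain ⟨V, hVK, hVo, hxV⟩ := mem_nhds_iff.1 hK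
  refine ⟨V ∩ U, inter_mem (mem_nhdsWithin_of_mem_nhds (hVo.mem_nhds hxV)) self_mem_nhdsWithin, ?_⟩
  have : IsFiniteMeasure ((volume : Measure E).restrict (V ∩ U)) :=
    ⟨by simpa using (measure_mono (inter_subset_left.trans hVK)).trans_lt hKf⟩
  refine Integrable.of_bound (hm.mono_measure
    (Measure.restrict_mono inter_subset_right le_rfl)) C ?_
  rw [ae_restrict_iff' (hVo.measurableSet.inter hU.measurableSet)]
  exact .of_forall fun y hy => hb y hy.2

/-- A function with bounded derivative has its classical derivative as weak derivative. -/
theorem isWeakDeriv_of_bounded [(volume : Measure E).IsAddHaarMeasure]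
    (hU : IsOpen U) (hf : ∀ x ∈ U, DifferentiableAt ℝ f x) {C : ℝ}
    (hb : ∀ x ∈ U, |fderiv ℝ f x v| ≤ C) :
    IsWeakDeriv U v f (fun x => fderiv ℝ f x v) :=
  isWeakDeriv_of_differentiableAt hU hf (locallyIntegrableOn_of_bounded hU
    (measurable_fderiv_apply_const ℝ f v).aestronglyMeasurable hb)

theorem memLp_of_bounded' {α : Type*} [MeasurableSpace α] {μ : Measure α} [IsFiniteMeasure μ]
    {f : α → ℝ} (hm : AEStronglyMeasurable f μ) {C : ℝ} (hb : ∀ᵐ x ∂μ, |f x| ≤ C) (p : ℝ≥0∞) :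
    MemLp f p μ :=
  MemLp.of_bound hm C (by simpa using hb)

theorem HasL2Deriv.isWeakDeriv (h : HasL2Deriv U v f) : IsWeakDeriv U v f (weakDeriv U v f) := by
  obtain ⟨g, hg, -⟩ := h
  exact hg.isWeakDeriv_weakDeriv

theorem HasL2Deriv.memLp (hU : IsOpen U) (h : HasL2Deriv U v f) :
    MemLp (weakDeriv U v f) 2 (volume.restrict U) := by
  obtain ⟨g, hg, hm⟩ := h
  exact hm.ae_eq (hg.weakDeriv_ae_eq hU).symm

end WeakDerivative

/-! ### Mollification and density of smooth functions -/

section Density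

variable {E : Type*} [NormedAddCommGroup E] [NormedSpace ℝ E] [FiniteDimensional ℝ E]
  [MeasureSpace E] [BorelSpace E] [(volume : Measure E).IsAddHaarMeasure]

/-- Translations act continuously on L²; the claim is continuity of the orbit map of `F` at the zero
translation. -/
theorem tendsto_eLpNorm_translate {F : E → ℝ} (hF : MemLp F 2 volume) :
    Tendsto (fun w : E => eLpNorm (fun x => F (w + x) - F x) 2 volume) (𝓝 0) (𝓝 0) := by
  have : Fact ((2 : ℝ≥0∞) ≠ ⊤) := ⟨by simp⟩
  have hc : Tendsto (fun w : E => DomAddAct.mk w +ᵥ hF.toLp F) (𝓝 0)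
      (𝓝 (DomAddAct.mk (0 : E) +ᵥ hF.toLp F)) := by
    have h1 : Continuous (fun w : E => DomAddAct.mk w +ᵥ hF.toLp F) :=
      DomAddAct.continuous_mk.vadd continuous_const
    exact h1.tendsto 0
  have h0 : DomAddAct.mk (0 : E) +ᵥ hF.toLp F = hF.toLp F := by simp
  rw [h0, tendsto_iff_edist_tendsto_0] at hc
  refine hc.congr fun w => ?_
  rw [DomAddAct.mk_vadd_toLp, Lp.edist_toLp_toLp]
  rfl

theorem eLpNorm_two_sq {α : Type*} [MeasurableSpace α] (μ : Measure α) (f : α → ℝ) :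
    eLpNorm f 2 μ ^ 2 = ∫⁻ x, ‖f x‖ₑ ^ 2 ∂μ := by
  have := eLpNorm_nnreal_pow_eq_lintegral (μ := μ) (f := f) (p := 2) two_ne_zero
  simpa using this

/-- Jensen's inequality for the square, obtained from Hölder against the constant 1. -/
theorem sq_lintegral_le {α : Type*} [MeasurableSpace α] {P : Measure α} [IsProbabilityMeasure P]
    {g : α → ℝ≥0∞} (hg : AEMeasurable g P) : (∫⁻ t, g t ∂P) ^ 2 ≤ ∫⁻ t, g t ^ 2 ∂P := by
  have h := ENNReal.lintegral_mul_le_Lp_mul_Lq P Real.HolderConjugate.two_two hg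
    (aemeasurable_const (b := (1 : ℝ≥0∞)))
  simp only [Pi.mul_apply, mul_one, ENNReal.rpow_ofNat, one_pow, lintegral_const, measure_univ,
    ENNReal.one_rpow] at h
  calc (∫⁻ t, g t ∂P) ^ 2 ≤ ((∫⁻ t, g t ^ 2 ∂P) ^ (1 / 2 : ℝ)) ^ 2 := by gcongr
    _ = ∫⁻ t, g t ^ 2 ∂P := by
      rw [← ENNReal.rpow_natCast, ← ENNReal.rpow_mul]; simp

/-- A nonnegative kernel of mass one is a probability density, so `k * F - F` is an average of
differences of translates; Jensen and Tonelli bound it by the worst translate in the support. One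
`δ` serves every kernel supported in the ball, so the kernel may sit off centre. -/
theorem exists_eLpNorm_convolution_sub_le {F : E → ℝ} (hF : MemLp F 2 volume) {ε : ℝ≥0∞}
    (hε : ε ≠ 0) : ∃ δ > 0, ∀ k : E → ℝ, Continuous k → HasCompactSupport k → (∀ t, 0 ≤ k t) →
      ∫ t, k t = 1 → Function.support k ⊆ Metric.ball 0 δ →
      eLpNorm (fun x => convolution k F (ContinuousLinearMap.lsmul ℝ ℝ) volume x - F x) 2 volume
        ≤ ε := by
  -- A strongly measurable representative provides the joint measurability of (x, t) ↦ F (x - t) - F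
  -- x that Tonelli needs.
  wlog hm : StronglyMeasurable F generalizing F with H
  · obtain ⟨δ, hδ, h⟩ := H (hF.ae_eq hF.1.ae_eq_mk) hF.1.stronglyMeasurable_mk
    refine ⟨δ, hδ, fun k h1 h2 h3 h4 h5 => ?_⟩
    convert! h k h1 h2 h3 h4 h5 using 1
    refine eLpNorm_congr_ae ?_
    rw [convolution_congr _ (EventuallyEq.refl _ k) hF.1.ae_eq_mk]
    filter_upwards [hF.1.ae_eq_mk] with x hx
    rw [hx]
  obtain ⟨δ, hδ, hb⟩ := Metric.eventually_nhds_iff_ball.1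
    ((tendsto_eLpNorm_translate hF).eventually (Iic_mem_nhds (pos_iff_ne_zero.2 hε)))
  refine ⟨δ, hδ, fun k hk hkc hk0 hk1 hks => ?_⟩
  have hki : Integrable k := hk.integrable_of_hasCompactSupport hkc
  set P : Measure E := volume.withDensity (fun t => ENNReal.ofReal (k t)) with hP
  have hPp : IsProbabilityMeasure P := by
    constructor
    rw [hP, withDensity_apply _ MeasurableSet.univ, Measure.restrict_univ,
      ← ofReal_integral_eq_lintegral_ofReal hki (.of_forall hk0), hk1, ENNReal.ofReal_one]
  have hkm : Measurable (fun t => ENNReal.ofReal (k t)) := by fun_prop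
  have hFl : LocallyIntegrable F := hF.locallyIntegrable (by norm_num)
  have hpt : ∀ x, ‖convolution k F (ContinuousLinearMap.lsmul ℝ ℝ) volume x - F x‖ₑ
      ≤ ∫⁻ t, ‖F (x - t) - F x‖ₑ ∂P := by
    intro x
    have i1 : Integrable (fun t => k t • F (x - t)) :=
      hkc.convolutionExists_left (ContinuousLinearMap.lsmul ℝ ℝ) hk hFl x
    have e1 : convolution k F (ContinuousLinearMap.lsmul ℝ ℝ) volume x - F x
        = ∫ t, k t • (F (x - t) - F x) := by
      simp only [smul_sub]
      rw [integral_sub i1 (hki.smul_const _), integral_smul_const, hk1, one_smul]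
      rfl
    rw [e1, lintegral_withDensity_eq_lintegral_mul _ hkm
      (by
        have : Measurable F := hm.measurable
        fun_prop)]
    refine (enorm_integral_le_lintegral_enorm _).trans (lintegral_mono fun t => ?_)
    rw [enorm_smul, Pi.mul_apply, Real.enorm_of_nonneg (hk0 t)]
  have hFm : Measurable F := hm.measurable
  have hsq : eLpNorm (fun x => convolution k F (ContinuousLinearMap.lsmul ℝ ℝ) volume x - F x)
      2 volume ^ 2 ≤ ε ^ 2 := by
    rw [eLpNorm_two_sq]
    calc ∫⁻ x, ‖convolution k F (ContinuousLinearMap.lsmul ℝ ℝ) volume x - F x‖ₑ ^ 2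
        ≤ ∫⁻ x, ∫⁻ t, ‖F (x - t) - F x‖ₑ ^ 2 ∂P := by
          refine lintegral_mono fun x => ?_
          refine (pow_le_pow_left' (hpt x) 2).trans (sq_lintegral_le ?_)
          fun_prop
      _ = ∫⁻ t, (∫⁻ x, ‖F (x - t) - F x‖ₑ ^ 2) ∂P := by
          rw [lintegral_lintegral_swap]
          apply Measurable.aemeasurable
          fun_prop
      _ ≤ ∫⁻ t, ε ^ 2 ∂P := by
          refine lintegral_mono_ae ?_
          rw [hP, ae_withDensity_iff hkm]
          refine .of_forall fun t ht => ?_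
          have hts : t ∈ Metric.ball (0 : E) δ := hks (by
            intro h0; simp [h0] at ht)
          have := hb (-t) (by simpa using hts)
          rw [← eLpNorm_two_sq]
          have h2 : eLpNorm (fun x => F (x - t) - F x) 2 volume ≤ ε := by
            simpa [sub_eq_neg_add] using this
          gcongr
      _ = ε ^ 2 := by simp
  by_contra hcon
  push Not at hcon
  exact absurd hsq (not_le.2 (ENNReal.pow_lt_pow_left two_ne_zero hcon))

/-- Smooth approximation of `f χ` where `χ` is supported in a ball in which `U` has the uniform
cone property. -/
theorem exists_contDiff_approx_patch {ι : Type*} [Finite ι] {U : Set E} (hU : IsOpen U) {z e : E}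
    {r : ℝ} (hr : 0 < r)
    (hcone : ∀ x ∈ U, x ∈ Metric.ball z r → ∀ y ∈ Metric.ball e r, ∀ s ∈ Ioo 0 r, x + s • y ∈ U)
    {χ : E → ℝ} (hχ : ContDiff ℝ 1 χ) (hχc : HasCompactSupport χ)
    (hχs : tsupport χ ⊆ Metric.ball z r) {f : E → ℝ} {v : ι → E} {g : ι → E → ℝ}
    (hw : ∀ i, IsWeakDeriv U (v i) f (g i)) (hf : MemLp f 2 (volume.restrict U))
    (hg : ∀ i, MemLp (g i) 2 (volume.restrict U)) {ε : ℝ≥0∞} (hε : ε ≠ 0) :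
    ∃ F : E → ℝ, ContDiff ℝ 1 F ∧
      eLpNorm (fun x => F x - f x * χ x) 2 (volume.restrict U) ≤ ε ∧
      ∀ i, eLpNorm (fun x => fderiv ℝ F x (v i) - (g i x * χ x + f x * fderiv ℝ χ x (v i))) 2
        (volume.restrict U) ≤ ε := by
  obtain ⟨C0, hC0⟩ := hχc.exists_bound_of_continuous hχ.continuous
  have mb : ∀ {p q : E → ℝ}, MemLp p 2 (volume.restrict U) → Continuous q → HasCompactSupport q →
      MemLp (fun x => p x * q x) 2 (volume.restrict U) := by
    intro p q hp hq hqc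
    obtain ⟨C, hC⟩ := hqc.exists_bound_of_continuous hq
    exact MemLp.of_le_mul (c := C) hp (hp.1.mul hq.aestronglyMeasurable) (.of_forall fun x => by
      rw [norm_mul, mul_comm]; gcongr; exact hC x)
  set F0 : E → ℝ := U.indicator (fun x => f x * χ x) with hF0
  set G0 : ι → E → ℝ := fun i => U.indicator (fun x => g i x * χ x + f x * fderiv ℝ χ x (v i))
    with hG0
  have mF : MemLp F0 2 volume := (memLp_indicator_iff_restrict hU.measurableSet).2
    (mb hf hχ.continuous hχc)
  have mG : ∀ i, MemLp (G0 i) 2 volume := fun i =>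
    (memLp_indicator_iff_restrict hU.measurableSet).2 ((mb (hg i) hχ.continuous hχc).add
      (mb hf (continuous_fderiv_apply' hχ (v i)) (hasCompactSupport_fderiv_apply' hχc (v i))))
  obtain ⟨δ, hδ, hF⟩ := exists_eLpNorm_convolution_sub_le mF hε
  choose δ' hδ' hG using fun i => exists_eLpNorm_convolution_sub_le (mG i) hε
  obtain ⟨δ'', hδ'', hle⟩ : ∃ d > 0, ∀ i, d ≤ δ' i := by
    cases nonempty_fintype ι
    by_cases hι : Nonempty ι
    · refine ⟨Finset.univ.inf' Finset.univ_nonempty δ', ?_, fun i => Finset.inf'_le _ (by simp)⟩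
      simpa [Finset.lt_inf'_iff] using hδ'
    · exact ⟨1, one_pos, fun i => (hι ⟨i⟩).elim⟩
  -- Room between the support of `χ` and the boundary of the ball: points outside the ball lie
  -- farther than `d` from that support, hence out of reach of the kernel.
  obtain ⟨d, hd, hdU⟩ := hχc.isCompact.exists_cthickening_subset_open Metric.isOpen_ball hχs
  obtain ⟨s, hs, hs1⟩ : ∃ s > 0, s < r ∧ s * (‖e‖ + r) < min (min δ δ'') d := by
    have hpos : 0 < min (min δ δ'') d := lt_min (lt_min hδ hδ'') hd
    have : 0 < ‖e‖ + r := by positivity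
    refine ⟨min (r / 2) (min (min δ δ'') d / (2 * (‖e‖ + r))), by positivity, ?_, ?_⟩
    · exact (min_le_left _ _).trans_lt (by linarith)
    · calc _ ≤ min (min δ δ'') d / (2 * (‖e‖ + r)) * (‖e‖ + r) := by
            gcongr; exact min_le_right _ _
        _ = min (min δ δ'') d / 2 := by field_simp
        _ < _ := by linarith
  obtain ⟨hsr, hsm⟩ := hs1
  -- The kernel is centred at `-s e` with radius `s r / 2`, so the convolution at x averages over
  -- points x + s y with y in the ball about `e`. The cone property keeps these points in `U`, and
  -- the jump of the zero extension across the boundary is never seen.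
  let b : ContDiffBump (-(s • e)) := ⟨s * r / 4, s * r / 2, by positivity, by nlinarith⟩
  set k : E → ℝ := b.normed volume with hk
  have hkc : Continuous k := b.continuous_normed
  have hkd : ContDiff ℝ 1 k := b.contDiff_normed
  have hkcs : HasCompactSupport k := b.hasCompactSupport_normed
  have hk0 : ∀ t, 0 ≤ k t := b.nonneg_normed
  have hk1 : ∫ t, k t = 1 := b.integral_normed
  have hts : tsupport k = Metric.closedBall (-(s • e)) (s * r / 2) := b.tsupport_normed_eq
  have hnorm : ∀ t ∈ tsupport k, ‖t‖ < min (min δ δ'') d := by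
    intro t ht
    rw [hts, Metric.mem_closedBall, dist_eq_norm] at ht
    have h1 : ‖t‖ ≤ ‖t - -(s • e)‖ + ‖-(s • e)‖ := by
      simpa using norm_add_le (t - -(s • e)) (-(s • e))
    rw [norm_neg, norm_smul, Real.norm_of_nonneg hs.le] at h1
    nlinarith
  have hsupp : ∀ D, min (min δ δ'') d ≤ D → Function.support k ⊆ Metric.ball 0 D := by
    intro D hD t ht
    rw [mem_ball_zero_iff]
    exact (hnorm t (subset_tsupport _ ht)).trans_le hD
  have hFl : LocallyIntegrable F0 := mF.locallyIntegrable (by norm_num)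
  refine ⟨convolution k F0 (ContinuousLinearMap.lsmul ℝ ℝ) volume,
    hkcs.contDiff_convolution_left _ hkd hFl, ?_, fun i => ?_⟩
  · have h1 := hF k hkc hkcs hk0 hk1 (hsupp δ ((min_le_left _ _).trans (min_le_left _ _)))
    refine le_trans (le_of_eq_of_le ?_ (eLpNorm_restrict_le _ 2 volume U)) h1
    refine eLpNorm_congr_ae ?_
    filter_upwards [ae_restrict_mem hU.measurableSet] with x hx
    rw [hF0, indicator_of_mem hx]
  · have h1 := hG i k hkc hkcs hk0 hk1
      (hsupp _ (((min_le_left _ _).trans (min_le_right _ _)).trans (hle i)))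
    refine le_trans (le_of_eq_of_le ?_ (eLpNorm_restrict_le _ 2 volume U)) h1
    refine eLpNorm_congr_ae ?_
    filter_upwards [ae_restrict_mem hU.measurableSet] with x hx
    have e1 : fderiv ℝ (convolution k F0 (ContinuousLinearMap.lsmul ℝ ℝ) volume) x (v i)
        = convolution k (G0 i) (ContinuousLinearMap.lsmul ℝ ℝ) volume x := by
      rw [(hkcs.hasFDerivAt_convolution_left (ContinuousLinearMap.lsmul ℝ ℝ) hkd hFl x).fderiv]
      have hex : ConvolutionExistsAt (fderiv ℝ k) F0 x
          ((ContinuousLinearMap.lsmul ℝ ℝ).precompL E) volume :=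
        (hkcs.fderiv ℝ).convolutionExists_left _ (hkd.continuous_fderiv one_ne_zero) hFl x
      have e2 : (convolution (fderiv ℝ k) F0 ((ContinuousLinearMap.lsmul ℝ ℝ).precompL E) volume x)
          (v i) = ∫ t, fderiv ℝ k t (v i) * F0 (x - t) := by
        rw [convolution, ContinuousLinearMap.integral_apply hex]
        rfl
      have e3 : convolution k (G0 i) (ContinuousLinearMap.lsmul ℝ ℝ) volume x
        = ∫ t, k t * G0 i (x - t) := rfl
      have e4 : ∫ t, fderiv ℝ k t (v i) * F0 (x - t) = ∫ t, fderiv ℝ k (x - t) (v i) * F0 t := by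
        rw [← integral_sub_left_eq_self (fun t => fderiv ℝ k t (v i) * F0 (x - t)) volume x]
        simp only [sub_sub_cancel]
      have e5 : ∫ t, k t * G0 i (x - t) = ∫ t, k (x - t) * G0 i t := by
        rw [← integral_sub_left_eq_self (fun t => k t * G0 i (x - t)) volume x]
        simp only [sub_sub_cancel]
      rw [e2, e3, e4, e5]
      set φ : E → ℝ := fun t => k (x - t) with hφ
      have hφd : ContDiff ℝ 1 φ := hkd.comp (contDiff_const.sub contDiff_id)
      have hφ' : ∀ t, fderiv ℝ φ t (v i) = - fderiv ℝ k (x - t) (v i) := by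
        intro t
        have h2 : HasFDerivAt φ ((fderiv ℝ k (x - t)).comp (-ContinuousLinearMap.id ℝ E)) t :=
          ((hkd.differentiable one_ne_zero) (x - t)).hasFDerivAt.comp t
            ((hasFDerivAt_id t).const_sub x)
        rw [h2.fderiv]
        simp
      have hφts : tsupport φ ⊆ {t | x - t ∈ tsupport k} := by
        refine closure_minimal ?_ ((isClosed_tsupport k).preimage (by fun_prop))
        intro t ht
        exact subset_tsupport _ ht
      have hφc : HasCompactSupport φ := by
        have := hkcs.comp_homeomorph (Homeomorph.subLeft x)
        exact this
      have eU : ∀ p q : E → ℝ, ∫ t, q t * U.indicator p t = ∫ t in U, p t * q t := by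
        intro p q
        rw [← integral_indicator hU.measurableSet]
        congr 1; ext t
        by_cases ht : t ∈ U <;> simp [ht, mul_comm]
      -- Inside the ball, t ↦ k (x - t) is a legitimate test function on `U` and the weak derivative
      -- of f χ applies. Outside the ball both integrands vanish, because k (x - t) ≠ 0 forces t off
      -- the support of `χ`.
      have goal2 : ∫ t in U, f t * χ t * fderiv ℝ k (x - t) (v i)
          = ∫ t in U, (g i t * χ t + f t * fderiv ℝ χ t (v i)) * φ t := by
        by_cases hxb : x ∈ Metric.ball z r
        · have hsub : tsupport φ ⊆ U := by
            intro t ht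
            have h3 := hφts ht
            rw [mem_ofPred_eq, hts, Metric.mem_closedBall, dist_eq_norm] at h3
            have h4 := hcone x hx hxb (s⁻¹ • (t - x)) (by
              rw [Metric.mem_ball, dist_eq_norm]
              have : s⁻¹ • (t - x) - e = (-s⁻¹) • (x - t - -(s • e)) := by
                rw [smul_sub, smul_sub, smul_sub, neg_smul, neg_smul, neg_smul, smul_neg, smul_smul,
                  inv_mul_cancel₀ hs.ne']
                simp only [one_smul]; abel
              rw [this, norm_smul, norm_neg, norm_inv, Real.norm_of_nonneg hs.le]
              calc s⁻¹ * ‖x - t - -(s • e)‖ ≤ s⁻¹ * (s * r / 2) := by gcongr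
                _ = r / 2 := by field_simp
                _ < r := by linarith) s ⟨hs, hsr⟩
            rw [smul_smul, mul_inv_cancel₀ hs.ne', one_smul] at h4
            simpa using h4
          have h5 := ((hw i).mul_contDiff hU hχ).2.2 φ hφd hφc hsub
          simp only [hφ', mul_neg, integral_neg, neg_inj] at h5
          exact h5
        · have hz : ∀ t, x - t ∈ tsupport k → t ∉ tsupport χ := by
            intro t ht htχ
            apply hxb
            apply hdU
            refine Metric.mem_cthickening_of_dist_le x t d _ htχ ?_
            rw [dist_eq_norm]
            exact ((hnorm _ ht).trans_le (min_le_right _ _)).le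
          congr 1; ext t
          by_cases ht : x - t ∈ tsupport k
          · have h6 := hz t ht
            have h7 : χ t = 0 := image_eq_zero_of_notMem_tsupport h6
            have h8 : fderiv ℝ χ t = 0 := fderiv_of_notMem_tsupport (𝕜 := ℝ) h6
            simp [h7, h8]
          · have h7 : k (x - t) = 0 := image_eq_zero_of_notMem_tsupport ht
            have h8 : fderiv ℝ k (x - t) = 0 := fderiv_of_notMem_tsupport (𝕜 := ℝ) ht
            simp [hφ, h7, h8]
      rw [hF0, eU, goal2]
      exact (eU _ _).symm
    have e6 : G0 i x = g i x * χ x + f x * fderiv ℝ χ x (v i) := indicator_of_mem hx _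
    rw [e1, e6]

/-- The uniform interior cone property. -/
def HasConeProperty (U : Set E) : Prop :=
  ∀ z ∈ closure U, ∃ (e : E) (r : ℝ), 0 < r ∧
    ∀ x ∈ U, x ∈ Metric.ball z r → ∀ y ∈ Metric.ball e r, ∀ s ∈ Ioo 0 r, x + s • y ∈ U

/-- Local approximations are glued by a finite smooth partition of unity on the compact closure.
Only derivatives in the chosen directions `v i` enter, so the result also covers functions that are
weakly differentiable along the cross-section only. -/
theorem exists_contDiff_approx {ι : Type*} [Finite ι] {U : Set E} (hU : IsOpen U)
    (hUb : Bornology.IsBounded U) (hcone : HasConeProperty U) {f : E → ℝ} {v : ι → E}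
    {g : ι → E → ℝ}
    (hw : ∀ i, IsWeakDeriv U (v i) f (g i)) (hf : MemLp f 2 (volume.restrict U))
    (hg : ∀ i, MemLp (g i) 2 (volume.restrict U)) {ε : ℝ≥0∞} (hε : ε ≠ 0) :
    ∃ F : E → ℝ, ContDiff ℝ 1 F ∧
      eLpNorm (fun x => F x - f x) 2 (volume.restrict U) ≤ ε ∧
      ∀ i, eLpNorm (fun x => fderiv ℝ F x (v i) - g i x) 2 (volume.restrict U) ≤ ε := by
  have hK : IsCompact (closure U) := hUb.isCompact_closure
  choose! e r hr hc using hcone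
  obtain ⟨T, hcov⟩ := hK.elim_nhds_subcover' (fun z hz => Metric.ball z (r z))
    (fun z hz => Metric.ball_mem_nhds z (hr z hz))
  obtain ⟨χ, hχ⟩ := SmoothPartitionOfUnity.exists_isSubordinate (modelWithCornersSelf ℝ E)
    (isClosed_closure (s := U)) (fun z : T => Metric.ball (z : E) (r z))
    (fun z => Metric.isOpen_ball) (by
      refine hcov.trans ?_
      simp only [iUnion_subset_iff]
      intro z hz
      exact subset_iUnion (fun z : T => Metric.ball (z : E) (r z)) ⟨z, hz⟩)
  have hχd : ∀ i, ContDiff ℝ 1 (χ i) := fun i =>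
    ((χ i).contMDiff.contDiff).of_le (by exact_mod_cast le_top)
  have hχc : ∀ i, HasCompactSupport (χ i) := fun i =>
    HasCompactSupport.of_support_subset_isCompact (isCompact_closedBall (i : E) (r i))
      ((subset_tsupport _).trans ((hχ i).trans Metric.ball_subset_closedBall))
  have hsum : ∀ x ∈ U, ∑ i, χ i x = 1 := by
    intro x hx
    have := χ.sum_eq_one (subset_closure hx)
    rwa [finsum_eq_sum_of_fintype] at this
  -- The partition sums to the constant 1 near each point of `U`, so the terms f ∂χᵢ produced by the
  -- product rule cancel in the sum.
  have hdsum : ∀ x ∈ U, ∀ w, ∑ i, fderiv ℝ (χ i) x w = 0 := by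
    intro x hx w
    have h1 : fderiv ℝ (fun x => ∑ i, χ i x) x = ∑ i, fderiv ℝ (χ i) x :=
      fderiv_fun_sum fun i _ => (hχd i).differentiable one_ne_zero x
    have h2 : (fun x => ∑ i, χ i x) =ᶠ[𝓝 x] fun _ => (1 : ℝ) := by
      filter_upwards [hU.mem_nhds hx] with y hy using hsum y hy
    rw [h2.fderiv_eq] at h1
    have h3 := congrArg (fun A => A w) h1
    simpa using h3.symm
  set N : ℝ≥0∞ := (Fintype.card T : ℝ≥0∞) + 1 with hN
  have hNt : N ≠ ⊤ := by simp [hN]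
  have hε' : ε / N ≠ 0 := by simp [hε, hNt]
  choose F hFd hF hFg using fun i : T => exists_contDiff_approx_patch hU
    (hr i i.1.2) (hc i i.1.2) (hχd i) (hχc i) (hχ i) hw hf hg hε'
  have hle : (Fintype.card T : ℝ≥0∞) * (ε / N) ≤ ε := by
    calc (Fintype.card T : ℝ≥0∞) * (ε / N) ≤ N * (ε / N) := by
          gcongr; simp [hN]
      _ = ε := ENNReal.mul_div_cancel (by simp [hN]) hNt
  refine ⟨fun x => ∑ i, F i x, ContDiff.sum fun i _ => hFd i, ?_, fun j => ?_⟩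
  · have e1 : (fun x => ∑ i, F i x - f x) =ᵐ[volume.restrict U]
        ∑ i, fun x => F i x - f x * χ i x := by
      filter_upwards [ae_restrict_mem hU.measurableSet] with x hx
      rw [Finset.sum_apply, Finset.sum_sub_distrib, ← Finset.mul_sum, hsum x hx, mul_one]
    rw [eLpNorm_congr_ae e1]
    refine (eLpNorm_sum_le (fun i _ => ?_) (by norm_num)).trans ?_
    · exact (hFd i).continuous.aestronglyMeasurable.sub
        (hf.1.mul (hχd i).continuous.aestronglyMeasurable)
    · refine (Finset.sum_le_sum fun i _ => hF i).trans ?_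
      simpa using hle
  · have e1 : (fun x => fderiv ℝ (fun x => ∑ i, F i x) x (v j) - g j x) =ᵐ[volume.restrict U]
        ∑ i, fun x => fderiv ℝ (F i) x (v j) - (g j x * χ i x + f x * fderiv ℝ (χ i) x (v j)) := by
      filter_upwards [ae_restrict_mem hU.measurableSet] with x hx
      rw [Finset.sum_apply, Finset.sum_sub_distrib, Finset.sum_add_distrib, ← Finset.mul_sum,
        ← Finset.mul_sum, hsum x hx, mul_one, hdsum x hx, mul_zero, add_zero,
        fderiv_fun_sum fun i _ => (hFd i).differentiable one_ne_zero x]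
      simp
    rw [eLpNorm_congr_ae e1]
    refine (eLpNorm_sum_le (fun i _ => ?_) (by norm_num)).trans ?_
    · exact (continuous_fderiv_apply' (hFd i) _).aestronglyMeasurable.sub
        (((hg j).1.mul (hχd i).continuous.aestronglyMeasurable).add
          (hf.1.mul (continuous_fderiv_apply' (hχd i) _).aestronglyMeasurable))
    · refine (Finset.sum_le_sum fun i _ => hFg i j).trans ?_
      simpa using hle

end Density

/-! ### Sobolev functions on an interval -/

section Interval

variable {L : ℝ}

theorem isWeakDeriv_deriv {F : ℝ → ℝ} (hF : ContDiff ℝ 1 F) :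
    IsWeakDeriv (Ioo 0 L) 1 F (deriv F) := by
  have h := isWeakDeriv_of_differentiableAt (v := (1 : ℝ)) (f := F) (isOpen_Ioo (a := 0) (b := L))
    (fun x _ => hF.differentiable one_ne_zero x)
    ((continuous_fderiv_apply' hF 1).continuousOn.locallyIntegrableOn measurableSet_Ioo)
  simpa only [fderiv_apply_one_eq_deriv] using h

theorem memLp_Ioo_of_continuous {F : ℝ → ℝ} (hF : Continuous F) (p : ℝ≥0∞) :
    MemLp F p (volume.restrict (Ioo 0 L)) := by
  obtain ⟨C, hC⟩ := (isCompact_Icc (a := (0 : ℝ)) (b := L)).exists_bound_of_continuousOn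
    hF.continuousOn
  exact MemLp.of_bound hF.aestronglyMeasurable C
    ((ae_restrict_iff' measurableSet_Ioo).2 (.of_forall fun x hx => hC x (Ioo_subset_Icc_self hx)))

theorem memW12_of_eqOn {f F : ℝ → ℝ} (hF : ContDiff ℝ 1 F) (h : EqOn f F (Ioo 0 L)) :
    MemW12 L f ∧ wd L f =ᵐ[volume.restrict (Ioo 0 L)] deriv F := by
  have he : F =ᵐ[volume.restrict (Ioo 0 L)] f :=
    (ae_restrict_iff' measurableSet_Ioo).2 (.of_forall fun x hx => (h hx).symm)
  have hw : IsWeakDeriv (Ioo 0 L) 1 f (deriv F) := (isWeakDeriv_deriv hF).congr he .rfl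
  exact ⟨⟨(memLp_Ioo_of_continuous hF.continuous 2).ae_eq he, _, hw,
    memLp_Ioo_of_continuous (hF.continuous_deriv_one) 2⟩, hw.weakDeriv_ae_eq isOpen_Ioo⟩

theorem hasConeProperty_Ioo (hL : 0 < L) : HasConeProperty (Ioo 0 L) := by
  intro z hz
  rw [closure_Ioo hL.ne] at hz
  have hr : 0 < min (1 / 2) (L / 8) := by positivity
  have h1 := min_le_left (1 / 2) (L / 8)
  have h2 := min_le_right (1 / 2) (L / 8)
  rcases le_total z (L / 2) with h | h
  · refine ⟨1, min (1 / 2) (L / 8), hr, fun x hx hxz y hy s hs => ?_⟩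
    rw [Metric.mem_ball, Real.dist_eq, abs_lt] at hxz hy
    simp only [smul_eq_mul, mem_Ioo] at hx hs ⊢
    have : 0 < s * y := mul_pos hs.1 (by linarith)
    have : s * y < L / 8 * (3 / 2) := by
      apply mul_lt_mul'' (by linarith) (by linarith) hs.1.le (by linarith)
    constructor <;> linarith
  · refine ⟨-1, min (1 / 2) (L / 8), hr, fun x hx hxz y hy s hs => ?_⟩
    rw [Metric.mem_ball, Real.dist_eq, abs_lt] at hxz hy
    simp only [smul_eq_mul, mem_Ioo] at hx hs ⊢
    have : 0 < s * (-y) := mul_pos hs.1 (by linarith)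
    have : s * (-y) < L / 8 * (3 / 2) := by
      apply mul_lt_mul'' (by linarith) (by linarith) hs.1.le (by linarith)
    constructor <;> linarith

/-- `L²`-approximation in `W^{1,2}(0,L)` by functions of class `C¹`. -/
theorem MemW12.exists_contDiff_approx (hL : 0 < L) {f : ℝ → ℝ} (hf : MemW12 L f) {ε : ℝ≥0∞}
    (hε : ε ≠ 0) : ∃ F : ℝ → ℝ, ContDiff ℝ 1 F ∧
      eLpNorm (fun x => F x - f x) 2 (volume.restrict (Ioo 0 L)) ≤ ε ∧
      eLpNorm (fun x => deriv F x - wd L f x) 2 (volume.restrict (Ioo 0 L)) ≤ ε := by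
  obtain ⟨F, h1, h2, h3⟩ := CurvedRod.exists_contDiff_approx (ι := Unit) (v := fun _ => (1 : ℝ))
    (g := fun _ => wd L f) isOpen_Ioo (Metric.isBounded_Ioo 0 L) (hasConeProperty_Ioo hL)
    (fun _ => hf.2.isWeakDeriv) hf.1 (fun _ => hf.2.memLp isOpen_Ioo) hε
  exact ⟨F, h1, h2, by simpa using h3 ()⟩

theorem lintegral_enorm_le_eLpNorm_two (f : ℝ → ℝ)
    (hf : AEStronglyMeasurable f (volume.restrict (Ioo 0 L))) :
    ∫⁻ x in Ioo 0 L, ‖f x‖ₑ ≤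
      eLpNorm f 2 (volume.restrict (Ioo 0 L)) * ENNReal.ofReal L ^ (1 / 2 : ℝ) := by
  have h := eLpNorm_le_eLpNorm_mul_rpow_measure_univ (μ := volume.restrict (Ioo 0 L))
    (p := 1) (q := 2) (by norm_num) hf
  rw [eLpNorm_one_eq_lintegral_enorm] at h
  convert h using 2
  rw [Measure.restrict_apply_univ, Real.volume_Ioo, sub_zero]
  norm_num

theorem enorm_sub_le_lintegral_deriv {F : ℝ → ℝ} (hF : ContDiff ℝ 1 F) {s t : ℝ}
    (hs : s ∈ Icc 0 L) (ht : t ∈ Icc 0 L) : ‖F t - F s‖ₑ ≤ ∫⁻ x in Ioo 0 L, ‖deriv F x‖ₑ := by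
  wlog hst : s ≤ t generalizing s t with H
  · rw [← enorm_neg, neg_sub]
    exact H ht hs (le_of_not_ge hst)
  refine (enorm_sub_le_lintegral_deriv_of_contDiffOn_Icc hF.contDiffOn hst).trans ?_
  rw [restrict_Ioo_eq_restrict_Icc]
  exact lintegral_mono_set (Icc_subset_Icc hs.1 ht.2)

/-- The constant of the embedding `W^{1,2}(0,L) ⊆ L^∞`. -/
def embConst (L : ℝ) : ℝ≥0∞ :=
  ((ENNReal.ofReal L)⁻¹ + 1) * ENNReal.ofReal L ^ (1 / 2 : ℝ)

theorem embConst_ne_top (hL : 0 < L) : embConst L ≠ ⊤ := by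
  refine ENNReal.mul_ne_top (ENNReal.add_ne_top.2 ⟨?_, by simp⟩) ?_
  · simpa using hL
  · exact ENNReal.rpow_ne_top_of_nonneg (by norm_num) (by simp)

/-- For every s, |F t| ≤ |F s| + ∫|F'|; averaging over s and using Cauchy–Schwarz gives the sup
bound. -/
theorem enorm_le_of_contDiff (hL : 0 < L) {F : ℝ → ℝ} (hF : ContDiff ℝ 1 F) {t : ℝ}
    (ht : t ∈ Icc 0 L) : ‖F t‖ₑ ≤ embConst L *
      (eLpNorm F 2 (volume.restrict (Ioo 0 L)) +
        eLpNorm (deriv F) 2 (volume.restrict (Ioo 0 L))) := by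
  set D := ∫⁻ x in Ioo 0 L, ‖deriv F x‖ₑ with hD
  have h1 : ∀ s ∈ Ioo 0 L, ‖F t‖ₑ ≤ ‖F s‖ₑ + D := by
    intro s hs
    calc ‖F t‖ₑ = ‖F s + (F t - F s)‖ₑ := by rw [add_sub_cancel]
      _ ≤ _ := (enorm_add_le _ _).trans
        (by gcongr; exact enorm_sub_le_lintegral_deriv hF (Ioo_subset_Icc_self hs) ht)
  have h2 : ‖F t‖ₑ * ENNReal.ofReal L ≤ (∫⁻ s in Ioo 0 L, ‖F s‖ₑ) + D * ENNReal.ofReal L := by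
    have := setLIntegral_mono' (μ := volume) measurableSet_Ioo h1
    rw [lintegral_add_right _ measurable_const] at this
    simpa using this
  have hL0 : ENNReal.ofReal L ≠ 0 := by simpa using hL
  have hLt : ENNReal.ofReal L ≠ ⊤ := by simp
  have h3 : ‖F t‖ₑ ≤ (ENNReal.ofReal L)⁻¹ * (∫⁻ s in Ioo 0 L, ‖F s‖ₑ) + D := by
    calc ‖F t‖ₑ = (ENNReal.ofReal L)⁻¹ * (‖F t‖ₑ * ENNReal.ofReal L) := by
          rw [mul_comm ‖F t‖ₑ, ← mul_assoc, ENNReal.inv_mul_cancel hL0 hLt, one_mul]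
      _ ≤ (ENNReal.ofReal L)⁻¹ * ((∫⁻ s in Ioo 0 L, ‖F s‖ₑ) + D * ENNReal.ofReal L) := by gcongr
      _ = _ := by
          rw [mul_add, mul_comm D, ← mul_assoc _ _ D, ENNReal.inv_mul_cancel hL0 hLt, one_mul]
  have hF1 := lintegral_enorm_le_eLpNorm_two F (L := L) hF.continuous.aestronglyMeasurable
  have hF2 := lintegral_enorm_le_eLpNorm_two (deriv F) (L := L)
    hF.continuous_deriv_one.aestronglyMeasurable
  set a := eLpNorm F 2 (volume.restrict (Ioo 0 L))
  set b := eLpNorm (deriv F) 2 (volume.restrict (Ioo 0 L))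
  set r := ENNReal.ofReal L ^ (1 / 2 : ℝ) with hr
  calc ‖F t‖ₑ ≤ (ENNReal.ofReal L)⁻¹ * (a * r) + b * r := h3.trans (by gcongr)
    _ ≤ (ENNReal.ofReal L)⁻¹ * ((a + b) * r) + (a + b) * r := by
        gcongr
        · exact le_self_add
        · exact le_add_self
    _ = embConst L * (a + b) := by rw [embConst, ← hr]; ring

/-- The bound for C¹ functions passes to an L² limit along an a.e. convergent subsequence. -/
theorem MemW12.ae_enorm_le (hL : 0 < L) {f : ℝ → ℝ} (hf : MemW12 L f) :
    ∀ᵐ t ∂volume.restrict (Ioo 0 L), ‖f t‖ₑ ≤ embConst L *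
      (eLpNorm f 2 (volume.restrict (Ioo 0 L)) +
        eLpNorm (wd L f) 2 (volume.restrict (Ioo 0 L))) := by
  have hε : ∀ n : ℕ, ((n : ℝ≥0∞) + 1)⁻¹ ≠ 0 := fun n => by simp
  choose F hF h1 h2 using fun n => hf.exists_contDiff_approx hL (hε n)
  have hlim : Tendsto (fun n : ℕ => ((n : ℝ≥0∞) + 1)⁻¹) atTop (𝓝 0) := by
    have := (tendsto_add_atTop_iff_nat 1).2 ENNReal.tendsto_inv_nat_nhds_zero
    simpa using this
  have ht : TendstoInMeasure (volume.restrict (Ioo 0 L)) F atTop f := by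
    refine tendstoInMeasure_of_tendsto_eLpNorm (p := 2) (by norm_num)
      (fun n => (hF n).continuous.aestronglyMeasurable) hf.1.1 ?_
    exact tendsto_of_tendsto_of_tendsto_of_le_of_le tendsto_const_nhds hlim
      (fun _ => zero_le) h1
  obtain ⟨ns, hns, hae⟩ := ht.exists_seq_tendsto_ae
  filter_upwards [hae, ae_restrict_mem measurableSet_Ioo] with t htt htI
  set a := eLpNorm f 2 (volume.restrict (Ioo 0 L))
  set b := eLpNorm (wd L f) 2 (volume.restrict (Ioo 0 L))
  have hb : ∀ n, ‖F n t‖ₑ ≤ embConst L * (a + b + ((n : ℝ≥0∞) + 1)⁻¹ + ((n : ℝ≥0∞) + 1)⁻¹) := by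
    intro n
    refine (enorm_le_of_contDiff hL (hF n) (Ioo_subset_Icc_self htI)).trans ?_
    have e1 : eLpNorm (F n) 2 (volume.restrict (Ioo 0 L)) ≤ a + ((n : ℝ≥0∞) + 1)⁻¹ := by
      have := eLpNorm_add_le hf.1.1 ((hF n).continuous.aestronglyMeasurable.sub hf.1.1)
        (p := 2) (by norm_num)
      simp only [add_sub_cancel] at this
      exact this.trans (by gcongr; exact h1 n)
    have e2 : eLpNorm (deriv (F n)) 2 (volume.restrict (Ioo 0 L)) ≤ b + ((n : ℝ≥0∞) + 1)⁻¹ := by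
      have hm : AEStronglyMeasurable (wd L f) (volume.restrict (Ioo 0 L)) :=
        (hf.2.memLp isOpen_Ioo).1
      have := eLpNorm_add_le hm ((hF n).continuous_deriv_one.aestronglyMeasurable.sub hm)
        (p := 2) (by norm_num)
      simp only [add_sub_cancel] at this
      exact this.trans (by gcongr; exact h2 n)
    refine mul_le_mul_right ((add_le_add e1 e2).trans (le_of_eq ?_)) _
    ring
  have hlim2 : Tendsto (fun n : ℕ => embConst L *
      (a + b + ((n : ℝ≥0∞) + 1)⁻¹ + ((n : ℝ≥0∞) + 1)⁻¹)) atTop (𝓝 (embConst L * (a + b))) := by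
    have := ENNReal.Tendsto.const_mul (a := embConst L) ((hlim.const_add (a + b)).add hlim)
      (Or.inr (embConst_ne_top hL))
    simpa using this
  exact le_of_tendsto_of_tendsto' (htt.enorm) (hlim2.comp hns.tendsto_atTop) (fun n => hb _)

theorem MemW12.sub_contDiff {f F : ℝ → ℝ} (hf : MemW12 L f) (hF : ContDiff ℝ 1 F) :
    MemW12 L (fun t => F t - f t) ∧
      wd L (fun t => F t - f t) =ᵐ[volume.restrict (Ioo 0 L)] fun t => deriv F t - wd L f t := by
  have hw := (isWeakDeriv_deriv (L := L) hF).sub hf.2.isWeakDeriv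
  exact ⟨⟨(memLp_Ioo_of_continuous hF.continuous 2).sub hf.1, _, hw,
    (memLp_Ioo_of_continuous hF.continuous_deriv_one 2).sub (hf.2.memLp isOpen_Ioo)⟩,
    hw.weakDeriv_ae_eq isOpen_Ioo⟩

theorem exists_pos_mul_le {C ε : ℝ≥0∞} (hC : C ≠ ⊤) (hε : ε ≠ 0) :
    ∃ δ : ℝ≥0∞, δ ≠ 0 ∧ δ ≤ ε ∧ C * δ ≤ ε := by
  refine ⟨min ε (ε / (C + 1)), ?_, min_le_left _ _, ?_⟩
  · rw [← pos_iff_ne_zero, lt_min_iff]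
    exact ⟨pos_iff_ne_zero.2 hε, ENNReal.div_pos hε (by simp [hC])⟩
  · calc C * min ε (ε / (C + 1)) ≤ (C + 1) * (ε / (C + 1)) := by
          gcongr
          · exact le_self_add
          · exact min_le_right _ _
      _ = ε := ENNReal.mul_div_cancel (by simp) (by simp [hC])

/-- The uniform closeness is what later lets the quadratic term A² of the strain converge in L². -/
theorem MemW12.exists_approx (hL : 0 < L) {f : ℝ → ℝ} (hf : MemW12 L f) {ε : ℝ≥0∞}
    (hε : ε ≠ 0) : ∃ F : ℝ → ℝ, ContDiff ℝ 1 F ∧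
      eLpNorm (fun x => F x - f x) 2 (volume.restrict (Ioo 0 L)) ≤ ε ∧
      eLpNorm (fun x => deriv F x - wd L f x) 2 (volume.restrict (Ioo 0 L)) ≤ ε ∧
      ∀ᵐ t ∂volume.restrict (Ioo 0 L), ‖F t - f t‖ₑ ≤ ε := by
  obtain ⟨δ, hδ, hδε, hCδ⟩ := exists_pos_mul_le (C := embConst L * 2)
    (ENNReal.mul_ne_top (embConst_ne_top hL) (by simp)) hε
  obtain ⟨F, hF, h1, h2⟩ := hf.exists_contDiff_approx hL hδ
  refine ⟨F, hF, h1.trans hδε, h2.trans hδε, ?_⟩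
  obtain ⟨hm, hwd⟩ := hf.sub_contDiff hF
  filter_upwards [hm.ae_enorm_le hL] with t ht
  refine ht.trans (le_trans ?_ hCδ)
  rw [eLpNorm_congr_ae hwd, mul_assoc, two_mul]
  gcongr

/-- The weak derivative is approximated first and the approximation is integrated; a separate
approximation of `f` itself supplies the constant of integration. -/
theorem MemW22.exists_approx (hL : 0 < L) {f : ℝ → ℝ} (hf : MemW22 L f) {ε : ℝ≥0∞}
    (hε : ε ≠ 0) : ∃ F : ℝ → ℝ, ContDiff ℝ 2 F ∧
      eLpNorm (fun x => F x - f x) 2 (volume.restrict (Ioo 0 L)) ≤ ε ∧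
      eLpNorm (fun x => deriv F x - wd L f x) 2 (volume.restrict (Ioo 0 L)) ≤ ε ∧
      eLpNorm (fun x => deriv (deriv F) x - wd L (wd L f) x) 2 (volume.restrict (Ioo 0 L)) ≤ ε ∧
      ∀ᵐ t ∂volume.restrict (Ioo 0 L), ‖deriv F t - wd L f t‖ₑ ≤ ε := by
  set ℓ := ENNReal.ofReal L ^ (1 / 2 : ℝ) with hℓ
  have hℓt : ℓ ≠ ⊤ := ENNReal.rpow_ne_top_of_nonneg (by norm_num) (by simp)
  obtain ⟨δ, hδ, hδε, hCδ⟩ := exists_pos_mul_le (C := 2 * ℓ * ℓ + 1) (by finiteness) hε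
  obtain ⟨q, hq, hq1, hq2, hq3⟩ := hf.2.exists_approx hL hδ
  obtain ⟨G, hG, hG1, hG2, -⟩ := hf.1.exists_approx hL hδ
  -- `F` and `G` agree at 0 and both derivatives are L²-close to that of `f`, so `F - G` is
  -- uniformly small and `F` inherits the closeness of `G` to `f`.
  set F : ℝ → ℝ := fun t => G 0 + ∫ s in (0 : ℝ)..t, q s with hFdef
  have hFd : ∀ t, HasDerivAt F (q t) t := fun t =>
    (intervalIntegral.integral_hasDerivAt_right (hq.continuous.intervalIntegrable _ _)
      hq.continuous.stronglyMeasurable.stronglyMeasurableAtFilter hq.continuous.continuousAt).const_add _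
  have hF' : deriv F = q := funext fun t => (hFd t).deriv
  have hF2 : ContDiff ℝ 2 F := by
    rw [show (2 : WithTop ℕ∞) = 1 + 1 by norm_num, contDiff_succ_iff_deriv, hF']
    exact ⟨fun t => (hFd t).differentiableAt, by simp, hq⟩
  have hF1 : ContDiff ℝ 1 F := hF2.of_le (by norm_num)
  refine ⟨F, hF2, ?_, by rw [hF']; exact hq1.trans hδε, by rw [hF']; exact hq2.trans hδε, ?_⟩
  · have hd : ContDiff ℝ 1 (fun t => F t - G t) := hF1.sub hG
    have hdd : deriv (fun t => F t - G t) = fun t => q t - deriv G t := by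
      ext t
      rw [deriv_fun_sub (hFd t).differentiableAt (hG.differentiable one_ne_zero t), hF']
    have hb : ∀ t ∈ Ioo 0 L, ‖F t - G t‖ₑ ≤ 2 * δ * ℓ := by
      intro t ht
      have h0 : F 0 - G 0 = 0 := by simp [hFdef]
      have h1 := enorm_sub_le_lintegral_deriv hd (L := L) (s := 0) (t := t)
        ⟨le_rfl, hL.le⟩ (Ioo_subset_Icc_self ht)
      rw [h0, sub_zero, hdd] at h1
      have hm : AEStronglyMeasurable (fun t => q t - deriv G t) (volume.restrict (Ioo 0 L)) :=
        (hq.continuous.sub hG.continuous_deriv_one).aestronglyMeasurable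
      refine h1.trans ((lintegral_enorm_le_eLpNorm_two _ hm).trans ?_)
      rw [← hℓ]
      gcongr
      have hwm := (hf.1.2.memLp isOpen_Ioo).1
      have := eLpNorm_sub_le (hq.continuous.aestronglyMeasurable.sub hwm)
        (hG.continuous_deriv_one.aestronglyMeasurable.sub hwm) (p := 2) (by norm_num)
      simp only [sub_sub_sub_cancel_right] at this
      refine this.trans ?_
      rw [two_mul]
      exact add_le_add hq1 hG2
    have e1 : eLpNorm (fun t => F t - G t) 2 (volume.restrict (Ioo 0 L)) ≤ 2 * δ * ℓ * ℓ := by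
      have h3 := eLpNorm_le_of_ae_enorm_bound (p := 2) (μ := volume.restrict (Ioo 0 L))
        (f := fun t => F t - G t) (C := 2 * δ * ℓ)
        ((ae_restrict_iff' measurableSet_Ioo).2 (.of_forall hb))
      refine h3.trans (le_of_eq ?_)
      rw [Measure.restrict_apply_univ, Real.volume_Ioo, sub_zero, smul_eq_mul, hℓ]
      norm_num
    have e2 : eLpNorm (fun t => F t - f t) 2 (volume.restrict (Ioo 0 L))
        ≤ 2 * δ * ℓ * ℓ + δ := by
      have := eLpNorm_add_le (hF1.continuous.aestronglyMeasurable.sub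
        hG.continuous.aestronglyMeasurable)
        (hG.continuous.aestronglyMeasurable.sub hf.1.1.1) (p := 2) (by norm_num)
      simp only [sub_add_sub_cancel] at this
      exact this.trans (add_le_add e1 hG1)
    refine e2.trans (le_trans (le_of_eq ?_) hCδ)
    ring
  · rw [hF']
    filter_upwards [hq3] with t ht using ht.trans hδε

end Interval

/-! ### The cylinder -/

section Cylinder

variable {L : ℝ} {ω : Set V2}

/-- The cross-sectional part of a point. -/
def sec (x : V3) : V2 := ![x 1, x 2]

theorem continuous_sec : Continuous sec := by
  unfold sec
  refine continuous_pi fun i => ?_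
  fin_cases i <;> simp <;> fun_prop

theorem mem_cyl {x : V3} : x ∈ cyl L ω ↔ x 0 ∈ Ioo 0 L ∧ sec x ∈ ω := Iff.rfl

theorem isOpen_cyl (hω : IsOpen ω) : IsOpen (cyl L ω) :=
  (isOpen_Ioo.preimage (continuous_apply 0)).inter (hω.preimage continuous_sec)

theorem isBounded_cyl (hω : Bornology.IsBounded ω) : Bornology.IsBounded (cyl L ω) := by
  obtain ⟨C, hC⟩ := hω.exists_norm_le
  rw [isBounded_iff_forall_norm_le]
  refine ⟨max L C, fun x hx => ?_⟩
  have h1 := hx.1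
  have h2 := hC _ hx.2
  have h3 : |x 1| ≤ C := by simpa using (norm_le_pi_norm (![x 1, x 2] : V2) 0).trans h2
  have h4 : |x 2| ≤ C := by simpa using (norm_le_pi_norm (![x 1, x 2] : V2) 1).trans h2
  refine (pi_norm_le_iff_of_nonneg ((abs_nonneg _).trans (h3.trans (le_max_right _ _)))).2 ?_
  intro i
  fin_cases i
  · simp only [Fin.zero_eta, Real.norm_eq_abs]
    rw [abs_of_pos h1.1]
    exact h1.2.le.trans (le_max_left _ _)
  · exact h3.trans (le_max_right _ _)
  · exact h4.trans (le_max_right _ _)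

/-- The measurable equivalence between `ℝ × ℝ²` and `ℝ³`. -/
def cylEquiv : ℝ × V2 ≃ᵐ V3 := (MeasurableEquiv.piFinSuccAbove (fun _ : Fin 3 => ℝ) 0).symm

theorem cylEquiv_apply (p : ℝ × V2) : cylEquiv p = ![p.1, p.2 0, p.2 1] := by
  ext i
  fin_cases i <;> rfl

theorem measurePreserving_cylEquiv : MeasurePreserving cylEquiv (volume.prod volume) volume :=
  (volume_preserving_piFinSuccAbove (fun _ : Fin 3 => ℝ) 0).symm

theorem cylEquiv_preimage_cyl : cylEquiv ⁻¹' cyl L ω = Ioo 0 L ×ˢ ω := by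
  ext p
  rw [mem_preimage, cylEquiv_apply, mem_cyl]
  simp only [mem_prod, sec, Matrix.cons_val_zero, Matrix.cons_val_one, Matrix.cons_val]
  rw [show (![p.2 0, p.2 1] : V2) = p.2 by ext i; fin_cases i <;> rfl]

theorem measurePreserving_cylEquiv_restrict :
    MeasurePreserving cylEquiv ((volume.restrict (Ioo 0 L)).prod (volume.restrict ω))
      (volume.restrict (cyl L ω)) := by
  have := measurePreserving_cylEquiv.restrict_preimage_emb cylEquiv.measurableEmbedding (cyl L ω)
  rwa [cylEquiv_preimage_cyl, ← Measure.prod_restrict] at this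

theorem lintegral_cyl {f : V3 → ℝ≥0∞} (hf : AEMeasurable f (volume.restrict (cyl L ω))) :
    ∫⁻ x in cyl L ω, f x = ∫⁻ t in Ioo 0 L, ∫⁻ s in ω, f ![t, s 0, s 1] := by
  rw [← measurePreserving_cylEquiv_restrict.lintegral_comp_emb cylEquiv.measurableEmbedding,
    lintegral_prod]
  · simp only [cylEquiv_apply]
  · exact hf.comp_quasiMeasurePreserving
      measurePreserving_cylEquiv_restrict.quasiMeasurePreserving

theorem quasiMeasurePreserving_fst_cyl :
    Measure.QuasiMeasurePreserving (fun x : V3 => x 0) (volume.restrict (cyl L ω))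
      (volume.restrict (Ioo 0 L)) := by
  have h1 : Measure.QuasiMeasurePreserving (Prod.fst : ℝ × V2 → ℝ)
      ((volume.restrict (Ioo 0 L)).prod (volume.restrict ω)) (volume.restrict (Ioo 0 L)) :=
    Measure.quasiMeasurePreserving_fst
  have h2 := (measurePreserving_cylEquiv_restrict (L := L) (ω := ω)).symm cylEquiv
  exact h1.comp h2.quasiMeasurePreserving

theorem ae_cyl_of_ae {p : ℝ → Prop} (h : ∀ᵐ t ∂volume.restrict (Ioo 0 L), p t) :
    ∀ᵐ x ∂volume.restrict (cyl L ω), p (x 0) :=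
  quasiMeasurePreserving_fst_cyl.ae h

theorem ae_mem_cyl (hω : IsOpen ω) : ∀ᵐ x ∂volume.restrict (cyl L ω), x ∈ cyl L ω :=
  ae_restrict_mem (isOpen_cyl hω).measurableSet

theorem eLpNorm_fst_cyl {f : ℝ → ℝ}
    (hf : AEStronglyMeasurable f (volume.restrict (Ioo 0 L))) :
    eLpNorm (fun x : V3 => f (x 0)) 2 (volume.restrict (cyl L ω)) =
      volume ω ^ (1 / 2 : ℝ) * eLpNorm f 2 (volume.restrict (Ioo 0 L)) := by
  have h1 : eLpNorm (fun x : V3 => f (x 0)) 2 (volume.restrict (cyl L ω)) ^ 2 =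
      volume ω * eLpNorm f 2 (volume.restrict (Ioo 0 L)) ^ 2 := by
    have hm : AEStronglyMeasurable (fun x : V3 => f (x 0)) (volume.restrict (cyl L ω)) :=
      hf.comp_quasiMeasurePreserving quasiMeasurePreserving_fst_cyl
    rw [eLpNorm_two_sq, eLpNorm_two_sq, lintegral_cyl (hm.enorm.pow_const 2)]
    simp only [Matrix.cons_val_zero, lintegral_const, Measure.restrict_apply_univ]
    rw [lintegral_mul_const'' _ (hf.enorm.pow_const 2), mul_comm]
  have h2 : (volume ω ^ (1 / 2 : ℝ) * eLpNorm f 2 (volume.restrict (Ioo 0 L))) ^ 2 =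
      volume ω * eLpNorm f 2 (volume.restrict (Ioo 0 L)) ^ 2 := by
    rw [mul_pow, ← ENNReal.rpow_natCast, ← ENNReal.rpow_mul]
    simp
  exact (ENNReal.pow_right_strictMono two_ne_zero).injective (h1.trans h2.symm)

theorem IsCrossSection.volume_lt_top (hω : IsCrossSection ω) : volume ω < ⊤ :=
  hω.isBounded.measure_lt_top

theorem IsCrossSection.volume_cyl_lt_top (hω : IsCrossSection ω) : volume (cyl L ω) < ⊤ :=
  (isBounded_cyl hω.isBounded).measure_lt_top

theorem isFiniteMeasure_cyl (hω : IsCrossSection ω) :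
    IsFiniteMeasure (volume.restrict (cyl L ω)) :=
  ⟨by simpa using hω.volume_cyl_lt_top⟩

theorem memLp_fst_cyl (hω : IsCrossSection ω) {f : ℝ → ℝ}
    (hf : MemLp f 2 (volume.restrict (Ioo 0 L))) :
    MemLp (fun x : V3 => f (x 0)) 2 (volume.restrict (cyl L ω)) := by
  refine ⟨hf.1.comp_quasiMeasurePreserving quasiMeasurePreserving_fst_cyl, ?_⟩
  rw [eLpNorm_fst_cyl hf.1]
  exact ENNReal.mul_lt_top (ENNReal.rpow_lt_top_of_nonneg (by norm_num) hω.volume_lt_top.ne) hf.2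

theorem area_pos (hω : IsCrossSection ω) : 0 < area ω :=
  ENNReal.toReal_pos (hω.isOpen.measure_pos volume hω.nonempty).ne' hω.volume_lt_top.ne

theorem exists_bound_sec (hω : IsCrossSection ω) :
    ∃ M : ℝ, 0 < M ∧ (∀ s ∈ ω, |s 0| ≤ M ∧ |s 1| ≤ M) := by
  obtain ⟨C, hC⟩ := hω.isBounded.exists_norm_le
  refine ⟨max C 1, by positivity, fun s hs => ⟨?_, ?_⟩⟩
  · exact (norm_le_pi_norm s 0).trans ((hC s hs).trans (le_max_left _ _))
  · exact (norm_le_pi_norm s 1).trans ((hC s hs).trans (le_max_left _ _))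

theorem integrableOn_of_continuous (hω : IsCrossSection ω) {f : V2 → ℝ} (hf : Continuous f) :
    IntegrableOn f ω :=
  (hf.continuousOn.integrableOn_compact hω.isBounded.isCompact_closure).mono_set subset_closure

theorem polarMoment_pos (hω : IsCrossSection ω) : 0 < polarMoment ω := by
  rw [polarMoment, setIntegral_pos_iff_support_of_nonneg_ae]
  · have h0 : (ω \ {0}) ⊆ Function.support (fun s : V2 => s 0 ^ 2 + s 1 ^ 2) ∩ ω := by
      intro s hs
      refine ⟨?_, hs.1⟩
      intro h
      apply hs.2
      simp only at h
      have h1 : s 0 = 0 := by nlinarith [sq_nonneg (s 0), sq_nonneg (s 1)]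
      have h2 : s 1 = 0 := by nlinarith [sq_nonneg (s 0), sq_nonneg (s 1)]
      ext i; fin_cases i <;> simpa
    refine lt_of_lt_of_le ?_ (measure_mono h0)
    rw [measure_sdiff_null (by simp)]
    exact hω.isOpen.measure_pos volume hω.nonempty
  · exact .of_forall fun s => by positivity
  · exact integrableOn_of_continuous hω (by fun_prop)

theorem HasConeProperty.mono_radius {E : Type*} [NormedAddCommGroup E] [NormedSpace ℝ E]
    {U : Set E} {z e : E} {r r' : ℝ} (hr : r' ≤ r)
    (h : ∀ x ∈ U, x ∈ Metric.ball z r → ∀ y ∈ Metric.ball e r, ∀ s ∈ Ioo 0 r, x + s • y ∈ U) :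
    ∀ x ∈ U, x ∈ Metric.ball z r' → ∀ y ∈ Metric.ball e r', ∀ s ∈ Ioo 0 r', x + s • y ∈ U :=
  fun x hx hxz y hy s hs => h x hx (Metric.ball_subset_ball hr hxz) y
    (Metric.ball_subset_ball hr hy) s ⟨hs.1, hs.2.trans_le hr⟩

/-- At a boundary point the cone points along the vertical of the local graph coordinates. A step `s
y` with y near this direction gains height at least s(1 - 2r), while the graph rises by at most
2Krs. At points of `ω` the zero direction with a small radius is enough. -/
theorem hasConeProperty_of_lipschitz (ho : IsOpen ω) (hl : HasLipschitzBoundary ω) :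
    HasConeProperty ω := by
  intro z hz
  by_cases hzω : z ∈ ω
  · obtain ⟨ρ, hρ, hb⟩ := Metric.isOpen_iff.1 ho z hzω
    refine ⟨0, min 1 (ρ / 2), by positivity, fun x _ hxz y hy s hs => hb ?_⟩
    have h1 : min 1 (ρ / 2) ≤ 1 := min_le_left _ _
    have h2 : min 1 (ρ / 2) ≤ ρ / 2 := min_le_right _ _
    rw [Metric.mem_ball, dist_eq_norm] at hxz ⊢
    rw [mem_ball_zero_iff] at hy
    have h3 : x + s • y - z = (x - z) + s • y := by abel
    have h4 : ‖s • y‖ ≤ ‖y‖ := by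
      rw [norm_smul, Real.norm_of_nonneg hs.1.le]
      exact mul_le_of_le_one_left (norm_nonneg _) (hs.2.le.trans h1)
    rw [h3]
    have := norm_add_le (x - z) (s • y)
    linarith
  · obtain ⟨R, hR, K, g, hg, hev⟩ := hl z ⟨hz, by rwa [ho.interior_eq]⟩
    obtain ⟨ρ, hρ, hb⟩ := Metric.eventually_nhds_iff_ball.1 hev
    have hRR : R * Rᵀ = 1 := by
      have := (Matrix.mem_orthogonalGroup_iff (Fin 2) ℝ).1 hR
      simpa [Matrix.star_eq_conjTranspose] using this
    have hent : ∀ i j, |R i j| ≤ 1 := by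
      intro i j
      have h1 : (R * Rᵀ) i i = 1 := by rw [hRR]; simp
      simp only [Matrix.mul_apply, Matrix.transpose_apply, Fin.sum_univ_two] at h1
      rw [abs_le_one_iff_mul_self_le_one]
      fin_cases j <;> simp <;> nlinarith [mul_self_nonneg (R i 0), mul_self_nonneg (R i 1)]
    set e₀ : V2 := Rᵀ *ᵥ ![0, 1] with he
    have hRe : R *ᵥ e₀ = ![0, 1] := by
      rw [he, Matrix.mulVec_mulVec, hRR, Matrix.one_mulVec]
    have hcomp : ∀ (y : V2) (i : Fin 2), |(R *ᵥ y) i| ≤ 2 * ‖y‖ := by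
      intro y i
      have h0 := norm_le_pi_norm y 0
      have h1 := norm_le_pi_norm y 1
      rw [Real.norm_eq_abs] at h0 h1
      simp only [Matrix.mulVec, dotProduct, Fin.sum_univ_two]
      calc |R i 0 * y 0 + R i 1 * y 1| ≤ |R i 0| * |y 0| + |R i 1| * |y 1| := by
            rw [← abs_mul, ← abs_mul]; exact abs_add_le _ _
        _ ≤ 1 * ‖y‖ + 1 * ‖y‖ := by
            gcongr
            · exact hent i 0
            · exact hent i 1
        _ = 2 * ‖y‖ := by ring
    -- The first inequality keeps the shifted point where the graph description holds; the second is
    -- exactly 2Kr < 1 - 2r.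
    obtain ⟨r, hr, hr1, hr2⟩ : ∃ r > 0, r + r * (‖e₀‖ + r) < ρ ∧ 2 * r * (K + 1) < 1 := by
      have h0 : 0 < (K : ℝ) + 1 := by positivity
      refine ⟨min 1 (min (ρ / (2 * (2 + ‖e₀‖))) (1 / (4 * (K + 1)))), by positivity, ?_, ?_⟩
      · set r := min 1 (min (ρ / (2 * (2 + ‖e₀‖))) (1 / (4 * ((K : ℝ) + 1)))) with hr
        have h1 : r ≤ 1 := min_le_left _ _
        have h2 : r ≤ ρ / (2 * (2 + ‖e₀‖)) := (min_le_right _ _).trans (min_le_left _ _)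
        have h3 : 0 < r := by positivity
        have h4 : r * (2 * (2 + ‖e₀‖)) ≤ ρ := by
          rwa [le_div_iff₀ (by positivity)] at h2
        nlinarith [norm_nonneg e₀]
      · set r := min 1 (min (ρ / (2 * (2 + ‖e₀‖))) (1 / (4 * ((K : ℝ) + 1)))) with hr
        have h2 : r ≤ 1 / (4 * (K + 1)) := (min_le_right _ _).trans (min_le_right _ _)
        rw [le_div_iff₀ (by positivity)] at h2
        linarith
    refine ⟨e₀, r, hr, fun x hx hxz y hy s hs => ?_⟩
    rw [Metric.mem_ball, dist_eq_norm] at hxz hy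
    have hyn : ‖y‖ ≤ ‖e₀‖ + r := by
      have := norm_add_le (y - e₀) e₀
      rw [sub_add_cancel] at this
      linarith
    have hx1 : x ∈ Metric.ball z ρ := by
      rw [Metric.mem_ball, dist_eq_norm]
      nlinarith [norm_nonneg e₀]
    have hx2 : x + s • y ∈ Metric.ball z ρ := by
      rw [Metric.mem_ball, dist_eq_norm]
      have h3 : x + s • y - z = (x - z) + s • y := by abel
      have h4 : ‖s • y‖ ≤ r * (‖e₀‖ + r) := by
        rw [norm_smul, Real.norm_of_nonneg hs.1.le]
        exact mul_le_mul hs.2.le hyn (norm_nonneg _) hr.le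
      rw [h3]
      have := norm_add_le (x - z) (s • y)
      linarith
    have hx' := (hb x hx1).1 hx
    rw [hb _ hx2]
    have hy0 : |(R *ᵥ y) 0| ≤ 2 * r := by
      have := hcomp (y - e₀) 0
      rw [Matrix.mulVec_sub, hRe] at this
      simp only [Pi.sub_apply, Matrix.cons_val_zero, sub_zero] at this
      linarith
    have hy1 : 1 - 2 * r ≤ (R *ᵥ y) 1 := by
      have := hcomp (y - e₀) 1
      rw [Matrix.mulVec_sub, hRe] at this
      simp only [Pi.sub_apply, Matrix.cons_val_one, Matrix.cons_val_zero] at this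
      have := (abs_le.1 this).1
      linarith
    rw [Matrix.mulVec_add, Matrix.mulVec_smul]
    simp only [Pi.add_apply, Pi.smul_apply, smul_eq_mul]
    have hgl := hg.dist_le_mul ((R *ᵥ x) 0 + s * (R *ᵥ y) 0) ((R *ᵥ x) 0)
    rw [Real.dist_eq, Real.dist_eq, add_sub_cancel_left, abs_mul, abs_of_pos hs.1] at hgl
    have h5 := (abs_le.1 hgl).2
    have h6 : (K : ℝ) * (s * |(R *ᵥ y) 0|) ≤ K * (s * (2 * r)) := by
      have := hs.1.le
      gcongr
    have h7 : s * (1 - 2 * r) ≤ s * (R *ᵥ y) 1 := by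
      have := hs.1.le
      gcongr
    nlinarith [hs.1]

theorem hasConeProperty_cyl (hL : 0 < L) (hω : IsCrossSection ω) :
    HasConeProperty (cyl L ω) := by
  intro z hz
  have h0 : z 0 ∈ closure (Ioo 0 L) :=
    map_mem_closure (f := fun x : V3 => x 0) (t := Ioo 0 L) (continuous_apply 0) hz
      fun x hx => hx.1
  have h1 : sec z ∈ closure ω := map_mem_closure continuous_sec hz fun x hx => hx.2
  obtain ⟨e₁, r₁, hr₁, hc₁⟩ := hasConeProperty_Ioo hL _ h0
  obtain ⟨e₂, r₂, hr₂, hc₂⟩ := hasConeProperty_of_lipschitz hω.isOpen hω.lipschitz _ h1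
  have hsec : ∀ {x z : V3} {r : ℝ}, 0 < r → dist x z < r → dist (sec x) (sec z) < r := by
    intro x z r hr h
    rw [dist_pi_lt_iff hr] at h ⊢
    intro i
    fin_cases i
    · exact h 1
    · exact h 2
  refine ⟨![e₁, e₂ 0, e₂ 1], min r₁ r₂, lt_min hr₁ hr₂, fun x hx hxz y hy s hs => ?_⟩
  have hr := lt_min hr₁ hr₂
  refine ⟨HasConeProperty.mono_radius (min_le_left _ _) hc₁ (x 0) hx.1 ?_ (y 0) ?_ s hs, ?_⟩
  · exact (dist_pi_lt_iff hr).1 hxz 0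
  · exact (dist_pi_lt_iff hr).1 hy 0
  · have h2 := HasConeProperty.mono_radius (min_le_right _ _) hc₂ (sec x) hx.2 (hsec hr hxz)
      (sec y) (by
        have := hsec hr hy
        have he : sec ![e₁, e₂ 0, e₂ 1] = e₂ := by ext i; fin_cases i <;> rfl
        rwa [he] at this) s hs
    convert h2 using 1
    ext i
    fin_cases i <;> simp [sec]

end Cylinder

/-! ### Families of functions of order `h^k` on `(0,L)` -/

section OrderInterval

/-- `F h` is of class `C¹` on `(0,L)` and of order `h^k` together with its derivative. -/
def O1 (L : ℝ) (k : ℕ) (F : ℝ → ℝ → ℝ) : Prop :=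
  ∃ C : ℝ, ∀ h ∈ Ioc (0 : ℝ) 1, ContDiffOn ℝ 1 (F h) (Ioo 0 L) ∧
    ∀ t ∈ Ioo 0 L, |F h t| ≤ C * h ^ k ∧ |deriv (F h) t| ≤ C * h ^ k

variable {L : ℝ} {k l : ℕ} {F G : ℝ → ℝ → ℝ}

theorem differentiableAt_of_contDiffOn {n : ℕ∞} (hn : 1 ≤ n) {f : ℝ → ℝ}
    (hf : ContDiffOn ℝ n f (Ioo 0 L)) {t : ℝ} (ht : t ∈ Ioo 0 L) : DifferentiableAt ℝ f t :=
  (hf.differentiableOn (by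
    have : n ≠ 0 := by rintro rfl; simp at hn
    exact_mod_cast this)).differentiableAt (isOpen_Ioo.mem_nhds ht)

theorem O1.differentiableAt (hF : O1 L k F) {h : ℝ} (hh : h ∈ Ioc (0 : ℝ) 1) {t : ℝ}
    (ht : t ∈ Ioo 0 L) : DifferentiableAt ℝ (F h) t := by
  obtain ⟨C, hC⟩ := hF
  exact differentiableAt_of_contDiffOn (n := 1) le_rfl (by exact_mod_cast (hC h hh).1) ht

theorem O1.add (hF : O1 L k F) (hG : O1 L k G) : O1 L k (fun h t => F h t + G h t) := by
  have hF' := hF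
  have hG' := hG
  obtain ⟨C, hC⟩ := hF
  obtain ⟨D, hD⟩ := hG
  refine ⟨C + D, fun h hh => ⟨(hC h hh).1.add (hD h hh).1, fun t ht => ?_⟩⟩
  rw [deriv_fun_add (hF'.differentiableAt hh ht) (hG'.differentiableAt hh ht), add_mul]
  exact ⟨(abs_add_le _ _).trans (add_le_add ((hC h hh).2 t ht).1 ((hD h hh).2 t ht).1),
    (abs_add_le _ _).trans (add_le_add ((hC h hh).2 t ht).2 ((hD h hh).2 t ht).2)⟩

theorem O1.mul (hF : O1 L k F) (hG : O1 L l G) : O1 L (k + l) (fun h t => F h t * G h t) := by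
  have hF' := hF
  have hG' := hG
  obtain ⟨C, hC⟩ := hF
  obtain ⟨D, hD⟩ := hG
  refine ⟨2 * |C| * |D|, fun h hh => ⟨(hC h hh).1.mul (hD h hh).1, fun t ht => ?_⟩⟩
  have hk : 0 ≤ h ^ k := pow_nonneg hh.1.le _
  have hl : 0 ≤ h ^ l := pow_nonneg hh.1.le _
  have f1 : |F h t| ≤ |C| * h ^ k := ((hC h hh).2 t ht).1.trans (by gcongr; exact le_abs_self _)
  have f2 : |deriv (F h) t| ≤ |C| * h ^ k :=
    ((hC h hh).2 t ht).2.trans (by gcongr; exact le_abs_self _)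
  have g1 : |G h t| ≤ |D| * h ^ l := ((hD h hh).2 t ht).1.trans (by gcongr; exact le_abs_self _)
  have g2 : |deriv (G h) t| ≤ |D| * h ^ l :=
    ((hD h hh).2 t ht).2.trans (by gcongr; exact le_abs_self _)
  have e1 : |F h t| * |G h t| ≤ |C| * h ^ k * (|D| * h ^ l) := by gcongr
  have e2 : |deriv (F h) t| * |G h t| ≤ |C| * h ^ k * (|D| * h ^ l) := by gcongr
  have e3 : |F h t| * |deriv (G h) t| ≤ |C| * h ^ k * (|D| * h ^ l) := by gcongr
  have e4 : 2 * |C| * |D| * h ^ (k + l) = |C| * h ^ k * (|D| * h ^ l) +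
    |C| * h ^ k * (|D| * h ^ l) := by ring
  have e5 : 0 ≤ |C| * h ^ k * (|D| * h ^ l) := by positivity
  rw [deriv_fun_mul (hF'.differentiableAt hh ht) (hG'.differentiableAt hh ht), e4, abs_mul]
  refine ⟨by linarith, (abs_add_le _ _).trans ?_⟩
  rw [abs_mul, abs_mul]
  linarith

theorem O1.mono (hF : O1 L l F) (hkl : k ≤ l) : O1 L k F := by
  obtain ⟨C, hC⟩ := hF
  refine ⟨|C|, fun h hh => ⟨(hC h hh).1, fun t ht => ?_⟩⟩
  have h1 : C * h ^ l ≤ |C| * h ^ k := by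
    have : h ^ l ≤ h ^ k := pow_le_pow_of_le_one hh.1.le hh.2 hkl
    have h0 : 0 ≤ h ^ l := pow_nonneg hh.1.le _
    calc C * h ^ l ≤ |C| * h ^ l := by gcongr; exact le_abs_self _
      _ ≤ _ := by gcongr
  exact ⟨((hC h hh).2 t ht).1.trans h1, ((hC h hh).2 t ht).2.trans h1⟩

theorem O1.congr (hF : O1 L k F) (h : ∀ h ∈ Ioc (0 : ℝ) 1, ∀ t ∈ Ioo 0 L, G h t = F h t) :
    O1 L k G := by
  obtain ⟨C, hC⟩ := hF
  refine ⟨C, fun s hs => ⟨(hC s hs).1.congr (h s hs), fun t ht => ?_⟩⟩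
  have : G s =ᶠ[𝓝 t] F s := by
    filter_upwards [isOpen_Ioo.mem_nhds ht] with r hr using h s hs r hr
  rw [h s hs t ht, this.deriv_eq]
  exact (hC s hs).2 t ht

theorem O1.const (L : ℝ) (c : ℝ) : O1 L 0 (fun _ _ => c) :=
  ⟨|c|, fun h _ => ⟨contDiffOn_const, fun t _ => by simp⟩⟩

theorem O1.pow (L : ℝ) (k : ℕ) : O1 L k (fun h _ => h ^ k) :=
  ⟨1, fun h hh => ⟨contDiffOn_const, fun t _ => by
    have : 0 ≤ h ^ k := pow_nonneg hh.1.le _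
    simp [this, abs_of_pos hh.1]⟩⟩

theorem O1.neg (hF : O1 L k F) : O1 L k (fun h t => - F h t) :=
  (((O1.const L (-1)).mul hF).mono (by simp)).congr fun h _ t _ => by ring

theorem O1.sub (hF : O1 L k F) (hG : O1 L k G) : O1 L k (fun h t => F h t - G h t) :=
  (hF.add hG.neg).congr fun h _ t _ => by ring

theorem O1.of_bounded {f : ℝ → ℝ} (hf : ContDiffOn ℝ 1 f (Ioo 0 L))
    (h0 : ∃ C : ℝ, ∀ t ∈ Ioo 0 L, |f t| ≤ C) (h1 : ∃ C : ℝ, ∀ t ∈ Ioo 0 L, |deriv f t| ≤ C) :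
    O1 L 0 (fun _ => f) := by
  obtain ⟨C, hC⟩ := h0
  obtain ⟨D, hD⟩ := h1
  exact ⟨max C D, fun h _ => ⟨hf, fun t ht => by
    simpa using ⟨Or.inl (hC t ht), Or.inr (hD t ht)⟩⟩⟩

theorem MemC.toO1 {f : ℝ → ℝ} (hf : MemC 1 L f) : O1 L 0 (fun _ => f) :=
  O1.of_bounded (by exact_mod_cast hf.1) (by simpa using hf.2 0 (by norm_num))
    (by simpa using hf.2 1 le_rfl)

theorem O1.of_contDiff {f : ℝ → ℝ} (hf : ContDiff ℝ 1 f) : O1 L 0 (fun _ => f) := by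
  refine O1.of_bounded hf.contDiffOn ?_ ?_
  · obtain ⟨C, hC⟩ := (isCompact_Icc (a := (0 : ℝ)) (b := L)).exists_bound_of_continuousOn
      hf.continuous.continuousOn
    exact ⟨C, fun t ht => hC t (Ioo_subset_Icc_self ht)⟩
  · obtain ⟨C, hC⟩ := (isCompact_Icc (a := (0 : ℝ)) (b := L)).exists_bound_of_continuousOn
      hf.continuous_deriv_one.continuousOn
    exact ⟨C, fun t ht => hC t (Ioo_subset_Icc_self ht)⟩

theorem hasDerivAt_invSqrt {x : ℝ} (hx : 0 ≤ x) :
    HasDerivAt (fun x : ℝ => (√(1 + x))⁻¹ - 1 + x / 2) (1 / 2 * (1 - (√(1 + x) ^ 3)⁻¹)) x := by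
  have hp : (0 : ℝ) < 1 + x := by linarith
  have h1 : HasDerivAt (fun x : ℝ => 1 + x) 1 x := (hasDerivAt_id x).const_add 1
  have h2 := ((h1.sqrt hp.ne').inv (Real.sqrt_pos.2 hp).ne').sub_const 1
  have h3 := h2.add ((hasDerivAt_id x).div_const 2)
  convert! h3 using 1
  have : √(1 + x) ≠ 0 := (Real.sqrt_pos.2 hp).ne'
  field_simp
  ring

/-- In terms of y = √(1 + x) both expressions factor into manifestly nonnegative polynomials over
powers of y. -/
theorem invSqrt_bounds {x : ℝ} (hx : 0 ≤ x) :
    |(√(1 + x))⁻¹ - 1 + x / 2| ≤ x ^ 2 ∧ |1 / 2 * (1 - (√(1 + x) ^ 3)⁻¹)| ≤ x := by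
  set y := √(1 + x) with hy
  have hy2 : y ^ 2 = 1 + x := Real.sq_sqrt (by linarith)
  have hy1 : 1 ≤ y := by rw [hy, Real.one_le_sqrt]; linarith
  have hxy : x = y ^ 2 - 1 := by linarith
  have hy0 : 0 < y := by linarith
  have e1 : y⁻¹ - 1 + x / 2 = (y - 1) ^ 2 * (y + 2) / (2 * y) := by
    rw [hxy]; field_simp; ring
  have e2 : 1 / 2 * (1 - (y ^ 3)⁻¹) = (y - 1) * (y ^ 2 + y + 1) / (2 * y ^ 3) := by
    field_simp; ring
  have hm : 0 ≤ y - 1 := by linarith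
  rw [e1, e2, abs_of_nonneg (by positivity), abs_of_nonneg (by positivity),
    div_le_iff₀ (by positivity), div_le_iff₀ (by positivity)]
  constructor
  · have : x ^ 2 * (2 * y) = (y - 1) ^ 2 * ((y + 1) ^ 2 * (2 * y)) := by rw [hxy]; ring
    rw [this]
    gcongr
    nlinarith
  · have : x * (2 * y ^ 3) = (y - 1) * ((y + 1) * (2 * y ^ 3)) := by rw [hxy]; ring
    rw [this]
    gcongr
    nlinarith [pow_le_pow_right₀ hy1 (show 2 ≤ 3 by norm_num), sq_nonneg (y - 1), one_le_pow₀ hy1 (n := 3)]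

/-- Second-order expansion of `(1 + h² F)^{-1/2}`. -/
theorem O1.invSqrt (hF : O1 L 0 F) (hpos : ∀ h ∈ Ioc (0 : ℝ) 1, ∀ t ∈ Ioo 0 L, 0 ≤ F h t) :
    O1 L 4 (fun h t => (√(1 + h ^ 2 * F h t))⁻¹ - 1 + h ^ 2 * F h t / 2) := by
  have hF' := hF
  obtain ⟨C, hC⟩ := hF
  refine ⟨C ^ 2, fun h hh => ⟨?_, fun t ht => ?_⟩⟩
  · have h1 : ContDiffOn ℝ 1 (fun t => 1 + h ^ 2 * F h t) (Ioo 0 L) :=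
      contDiffOn_const.add (contDiffOn_const.mul (hC h hh).1)
    have hne : ∀ t ∈ Ioo 0 L, 1 + h ^ 2 * F h t ≠ 0 := fun t ht => by
      have := hpos h hh t ht
      positivity
    refine (((h1.sqrt hne).inv fun t ht => ?_).sub contDiffOn_const).add
      ((contDiffOn_const.mul (hC h hh).1).div_const 2)
    have := hpos h hh t ht
    exact (Real.sqrt_pos.2 (by positivity)).ne'
  · have hx : 0 ≤ h ^ 2 * F h t := mul_nonneg (sq_nonneg h) (hpos h hh t ht)
    obtain ⟨b1, b2⟩ := invSqrt_bounds hx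
    have hd : HasDerivAt (fun t => h ^ 2 * F h t) (h ^ 2 * deriv (F h) t) t :=
      (hF'.differentiableAt hh ht).hasDerivAt.const_mul _
    have hcomp := (hasDerivAt_invSqrt hx).comp t hd
    have f1 : |F h t| ≤ C := by simpa using ((hC h hh).2 t ht).1
    have f2 : |deriv (F h) t| ≤ C := by simpa using ((hC h hh).2 t ht).2
    have f1' : F h t ≤ C := (le_abs_self _).trans f1
    have f0 := hpos h hh t ht
    constructor
    · refine b1.trans ?_
      calc (h ^ 2 * F h t) ^ 2 ≤ (h ^ 2 * C) ^ 2 := by gcongr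
        _ = C ^ 2 * h ^ 4 := by ring
    · have e := hcomp.deriv
      simp only [Function.comp_def] at e
      rw [e, abs_mul, abs_mul (h ^ 2), abs_of_nonneg (sq_nonneg h)]
      calc _ ≤ h ^ 2 * F h t * (h ^ 2 * C) := by gcongr
        _ ≤ h ^ 2 * C * (h ^ 2 * C) := by
          have : 0 ≤ C := f0.trans f1'
          gcongr
        _ = C ^ 2 * h ^ 4 := by ring

end OrderInterval

/-! ### The frame of the rod -/

section FrameExpansion

/-- The hypotheses on the middle curve. -/
structure IsCurve (L : ℝ) (θ₂ θ₃ : ℝ → ℝ) : Prop where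
  memC₂ : MemC 3 L θ₂
  memC₃ : MemC 3 L θ₃
  ne : ∀ t ∈ Ioo 0 L, deriv (deriv θ₂) t ^ 2 + deriv (deriv θ₃) t ^ 2 ≠ 0
  p₂ : MemC 1 L (CurvedRod.p₂ θ₂ θ₃)
  p₃ : MemC 1 L (CurvedRod.p₃ θ₂ θ₃)

variable {L : ℝ} {θ₂ θ₃ : ℝ → ℝ}

theorem MemC.O1_deriv {f : ℝ → ℝ} (hf : MemC 3 L f) : O1 L 0 (fun _ => deriv f) := by
  refine O1.of_bounded ?_ ?_ ?_
  · refine ContDiffOn.deriv_of_isOpen (n := 3) (by exact_mod_cast hf.1) isOpen_Ioo ?_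
    norm_num
  · simpa using hf.2 1 (by norm_num)
  · simpa [iteratedDeriv_succ] using hf.2 2 (by norm_num)

theorem MemC.O1_self {f : ℝ → ℝ} (hf : MemC 3 L f) : O1 L 0 (fun _ => f) := by
  refine O1.of_bounded (hf.1.of_le (by norm_num)) ?_ ?_
  · simpa using hf.2 0 (by norm_num)
  · simpa using hf.2 1 (by norm_num)

namespace IsCurve

theorem p_sq (hc : IsCurve L θ₂ θ₃) {t : ℝ} (ht : t ∈ Ioo 0 L) :
    CurvedRod.p₂ θ₂ θ₃ t ^ 2 + CurvedRod.p₃ θ₂ θ₃ t ^ 2 = 1 := by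
  have h1 := hc.ne t ht
  have h0 : 0 ≤ deriv (deriv θ₂) t ^ 2 + deriv (deriv θ₃) t ^ 2 := by positivity
  rw [CurvedRod.p₂, CurvedRod.p₃, div_pow, div_pow, Real.sq_sqrt h0, ← add_div, div_self h1]

/-- The vectors (p₂, p₃) and (-p₃, p₂) are orthonormal, and `aCoef`, `cCoef` are the coordinates of
(θ₂', θ₃') in this basis. All frame computations are carried out in these coordinates. -/
theorem theta₂_eq (hc : IsCurve L θ₂ θ₃) {t : ℝ} (ht : t ∈ Ioo 0 L) :
    deriv θ₂ t = aCoef θ₂ θ₃ t * CurvedRod.p₂ θ₂ θ₃ t - cCoef θ₂ θ₃ t * CurvedRod.p₃ θ₂ θ₃ t := by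
  have := hc.p_sq ht
  rw [aCoef, cCoef]
  linear_combination (-deriv θ₂ t) * this

theorem theta₃_eq (hc : IsCurve L θ₂ θ₃) {t : ℝ} (ht : t ∈ Ioo 0 L) :
    deriv θ₃ t = aCoef θ₂ θ₃ t * CurvedRod.p₃ θ₂ θ₃ t + cCoef θ₂ θ₃ t * CurvedRod.p₂ θ₂ θ₃ t := by
  have := hc.p_sq ht
  rw [aCoef, cCoef]
  linear_combination (-deriv θ₃ t) * this

theorem O1_a (hc : IsCurve L θ₂ θ₃) : O1 L 0 (fun _ => aCoef θ₂ θ₃) :=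
  (hc.memC₂.O1_deriv.mul hc.p₂.toO1).add (hc.memC₃.O1_deriv.mul hc.p₃.toO1)

theorem O1_c (hc : IsCurve L θ₂ θ₃) : O1 L 0 (fun _ => cCoef θ₂ θ₃) :=
  (hc.memC₃.O1_deriv.mul hc.p₂.toO1).sub (hc.memC₂.O1_deriv.mul hc.p₃.toO1)

end IsCurve

variable (θ₂ θ₃) in
/-- `1 / (s r)` with `s² = 1 + h²(a² + c²)`, `r² = 1 + h² c²`. -/
def alphaN (h t : ℝ) : ℝ :=
  (√(1 + h ^ 2 * (aCoef θ₂ θ₃ t ^ 2 + 2 * cCoef θ₂ θ₃ t ^ 2 +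
    h ^ 2 * (aCoef θ₂ θ₃ t ^ 2 + cCoef θ₂ θ₃ t ^ 2) * cCoef θ₂ θ₃ t ^ 2)))⁻¹

variable (θ₂ θ₃) in
/-- `1 / r` with `r² = 1 + h² c²`. -/
def betaB (h t : ℝ) : ℝ := (√(1 + h ^ 2 * cCoef θ₂ θ₃ t ^ 2))⁻¹

theorem alphaN_eq (h t : ℝ) : alphaN θ₂ θ₃ h t =
    (√(1 + h ^ 2 * (aCoef θ₂ θ₃ t ^ 2 + cCoef θ₂ θ₃ t ^ 2)) *
      √(1 + h ^ 2 * cCoef θ₂ θ₃ t ^ 2))⁻¹ := by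
  rw [alphaN, ← Real.sqrt_mul (by positivity)]
  congr 2
  ring

/-- The curvature factor κ = √(θ₂''² + θ₃''²) splits off because θ'' = κ p; it is positive and
disappears when the principal normal is normalised. -/
theorem hasDerivAt_tangent (hc : IsCurve L θ₂ θ₃) (h : ℝ) {t : ℝ} (ht : t ∈ Ioo 0 L) :
    HasDerivAt (tangent θ₂ θ₃ h)
      ((h * √(deriv (deriv θ₂) t ^ 2 + deriv (deriv θ₃) t ^ 2) /
          √(1 + h ^ 2 * (aCoef θ₂ θ₃ t ^ 2 + cCoef θ₂ θ₃ t ^ 2))) •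
        ![-(h * aCoef θ₂ θ₃ t / (1 + h ^ 2 * (aCoef θ₂ θ₃ t ^ 2 + cCoef θ₂ θ₃ t ^ 2))),
          CurvedRod.p₂ θ₂ θ₃ t - h ^ 2 * deriv θ₂ t * aCoef θ₂ θ₃ t /
            (1 + h ^ 2 * (aCoef θ₂ θ₃ t ^ 2 + cCoef θ₂ θ₃ t ^ 2)),
          CurvedRod.p₃ θ₂ θ₃ t - h ^ 2 * deriv θ₃ t * aCoef θ₂ θ₃ t /
            (1 + h ^ 2 * (aCoef θ₂ θ₃ t ^ 2 + cCoef θ₂ θ₃ t ^ 2))]) t := by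
  have d2 : HasDerivAt (deriv θ₂) (deriv (deriv θ₂) t) t :=
    (hc.memC₂.O1_deriv.differentiableAt (h := 1) ⟨one_pos, le_rfl⟩ ht).hasDerivAt
  have d3 : HasDerivAt (deriv θ₃) (deriv (deriv θ₃) t) t :=
    (hc.memC₃.O1_deriv.differentiableAt (h := 1) ⟨one_pos, le_rfl⟩ ht).hasDerivAt
  set κ := √(deriv (deriv θ₂) t ^ 2 + deriv (deriv θ₃) t ^ 2) with hκ
  have hκp : 0 < κ := Real.sqrt_pos.2 (lt_of_le_of_ne (by positivity) (hc.ne t ht).symm)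
  have k2 : deriv (deriv θ₂) t = κ * CurvedRod.p₂ θ₂ θ₃ t := by
    rw [CurvedRod.p₂, ← hκ, mul_div_cancel₀ _ hκp.ne']
  have k3 : deriv (deriv θ₃) t = κ * CurvedRod.p₃ θ₂ θ₃ t := by
    rw [CurvedRod.p₃, ← hκ, mul_div_cancel₀ _ hκp.ne']
  have hS : 1 + h ^ 2 * (aCoef θ₂ θ₃ t ^ 2 + cCoef θ₂ θ₃ t ^ 2)
      = 1 + (h * deriv θ₂ t) ^ 2 + (h * deriv θ₃ t) ^ 2 := by
    rw [hc.theta₂_eq ht, hc.theta₃_eq ht]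
    linear_combination (- h ^ 2 * (aCoef θ₂ θ₃ t ^ 2 + cCoef θ₂ θ₃ t ^ 2)) * hc.p_sq ht
  rw [hS]
  set S := 1 + (h * deriv θ₂ t) ^ 2 + (h * deriv θ₃ t) ^ 2 with hSdef
  have hSp : 0 < S := by positivity
  have dS : HasDerivAt (fun t => 1 + (h * deriv θ₂ t) ^ 2 + (h * deriv θ₃ t) ^ 2)
      (2 * h ^ 2 * κ * aCoef θ₂ θ₃ t) t := by
    have := (((d2.const_mul h).pow 2).const_add 1).add ((d3.const_mul h).pow 2)
    convert! this using 1
    rw [k2, k3, aCoef]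
    simp only [Nat.cast_ofNat, Nat.add_one_sub_one, pow_one]
    ring
  have hsp : 0 < √S := Real.sqrt_pos.2 hSp
  have ds : HasDerivAt (fun t => (√(1 + (h * deriv θ₂ t) ^ 2 + (h * deriv θ₃ t) ^ 2))⁻¹)
      (-(h ^ 2 * κ * aCoef θ₂ θ₃ t) / (√S * S)) t := by
    have := (dS.sqrt hSp.ne').fun_inv hsp.ne'
    convert! this using 1
    change _ = -(2 * h ^ 2 * κ * aCoef θ₂ θ₃ t / (2 * √S)) / √S ^ 2
    rw [Real.sq_sqrt hSp.le]
    field_simp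
  have hsq : √S ^ 2 = S := Real.sq_sqrt hSp.le
  rw [hasDerivAt_pi]
  intro i
  fin_cases i
  · have := ds.mul_const 1
    convert! this using 1
    simp
    field_simp
  · have := ds.mul (d2.const_mul h)
    convert! this using 1
    rw [k2]
    simp only [← hSdef]
    simp
    field_simp
    ring
  · have := ds.mul (d3.const_mul h)
    convert! this using 1
    rw [k3]
    simp only [← hSdef]
    simp
    field_simp
    ring

/-- With S = 1 + h²(a² + c²) and R = 1 + h²c², the vector in brackets has squared length R² + h²a² +
h⁴a²c² = R S, which explains the factor `alphaN` = (√S √R)⁻¹. -/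
theorem normal_eq (hc : IsCurve L θ₂ θ₃) {h : ℝ} (hh : 0 < h) {t : ℝ} (ht : t ∈ Ioo 0 L) :
    normal θ₂ θ₃ h t = alphaN θ₂ θ₃ h t •
      ![-(h * aCoef θ₂ θ₃ t),
        (1 + h ^ 2 * cCoef θ₂ θ₃ t ^ 2) * CurvedRod.p₂ θ₂ θ₃ t +
          h ^ 2 * aCoef θ₂ θ₃ t * cCoef θ₂ θ₃ t * CurvedRod.p₃ θ₂ θ₃ t,
        (1 + h ^ 2 * cCoef θ₂ θ₃ t ^ 2) * CurvedRod.p₃ θ₂ θ₃ t -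
          h ^ 2 * aCoef θ₂ θ₃ t * cCoef θ₂ θ₃ t * CurvedRod.p₂ θ₂ θ₃ t] := by
  rw [normal, (hasDerivAt_tangent hc h ht).deriv, alphaN_eq, hc.theta₂_eq ht, hc.theta₃_eq ht]
  have hp := hc.p_sq ht
  have hκp : 0 < √(deriv (deriv θ₂) t ^ 2 + deriv (deriv θ₃) t ^ 2) :=
    Real.sqrt_pos.2 (lt_of_le_of_ne (by positivity) (hc.ne t ht).symm)
  set κ := √(deriv (deriv θ₂) t ^ 2 + deriv (deriv θ₃) t ^ 2)
  set a := aCoef θ₂ θ₃ t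
  set c := cCoef θ₂ θ₃ t
  set p := CurvedRod.p₂ θ₂ θ₃ t
  set q := CurvedRod.p₃ θ₂ θ₃ t
  set S := 1 + h ^ 2 * (a ^ 2 + c ^ 2) with hS
  set R := 1 + h ^ 2 * c ^ 2 with hR
  have hSp : 0 < S := by positivity
  have hRp : 0 < R := by positivity
  have hs : √S ^ 2 = S := Real.sq_sqrt hSp.le
  have hr : √R ^ 2 = R := Real.sq_sqrt hRp.le
  have hsp : 0 < √S := Real.sqrt_pos.2 hSp
  have hrp : 0 < √R := Real.sqrt_pos.2 hRp
  have hdot : (h * κ / √S) • ![-(h * a / S), p - h ^ 2 * (a * p - c * q) * a / S,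
      q - h ^ 2 * (a * q + c * p) * a / S] ⬝ᵥ (h * κ / √S) • ![-(h * a / S),
        p - h ^ 2 * (a * p - c * q) * a / S, q - h ^ 2 * (a * q + c * p) * a / S]
      = (h * κ * √R / S) ^ 2 := by
    simp only [dotProduct, Fin.sum_univ_three]
    simp
    have e1 : (p - h ^ 2 * (a * p - c * q) * a / S) = (R * p + h ^ 2 * a * c * q) / S := by
      field_simp
      rw [hS, hR]; ring
    have e2 : (q - h ^ 2 * (a * q + c * p) * a / S) = (R * q - h ^ 2 * a * c * p) / S := by
      field_simp
      rw [hS, hR]; ring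
    rw [e1, e2]
    have e0 : ∀ x y z : ℝ, h * κ / √S * (x / S) * (h * κ / √S * (x / S)) +
        h * κ / √S * (y / S) * (h * κ / √S * (y / S)) +
        h * κ / √S * (z / S) * (h * κ / √S * (z / S)) =
        (h * κ) ^ 2 / (√S ^ 2 * S ^ 2) * (x ^ 2 + (y ^ 2 + z ^ 2)) := fun x y z => by
      field_simp
      ring
    rw [e0, show (R * p + h ^ 2 * a * c * q) ^ 2 + (R * q - h ^ 2 * a * c * p) ^ 2 =
        (R ^ 2 + (h ^ 2 * a * c) ^ 2) * (p ^ 2 + q ^ 2) by ring]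
    rw [hp, hs, div_pow, mul_pow (h * κ) (√R), hr]
    field_simp
    rw [hS, hR]; ring
  rw [hdot, Real.sqrt_sq (by positivity), smul_smul]
  have e3 : (h * κ * √R / S)⁻¹ * (h * κ / √S) = (√S * √R)⁻¹ * S := by
    field_simp
  rw [e3, mul_smul]
  congr 1
  ext i
  fin_cases i
  · simp; field_simp
  · simp; field_simp; rw [hS, hR]; ring
  · simp; field_simp; rw [hS, hR]; ring

theorem binormal_eq (hc : IsCurve L θ₂ θ₃) {h : ℝ} (hh : 0 < h) {t : ℝ} (ht : t ∈ Ioo 0 L) :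
    binormal θ₂ θ₃ h t = betaB θ₂ θ₃ h t •
      ![-(h * cCoef θ₂ θ₃ t), -CurvedRod.p₃ θ₂ θ₃ t, CurvedRod.p₂ θ₂ θ₃ t] := by
  rw [binormal, normal_eq hc hh ht, tangent, alphaN_eq, betaB]
  have hp := hc.p_sq ht
  have hS : 1 + h ^ 2 * (aCoef θ₂ θ₃ t ^ 2 + cCoef θ₂ θ₃ t ^ 2)
      = 1 + (h * deriv θ₂ t) ^ 2 + (h * deriv θ₃ t) ^ 2 := by
    rw [hc.theta₂_eq ht, hc.theta₃_eq ht]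
    linear_combination (- h ^ 2 * (aCoef θ₂ θ₃ t ^ 2 + cCoef θ₂ θ₃ t ^ 2)) * hc.p_sq ht
  rw [← hS, hc.theta₂_eq ht, hc.theta₃_eq ht]
  set a := aCoef θ₂ θ₃ t
  set c := cCoef θ₂ θ₃ t
  set p := CurvedRod.p₂ θ₂ θ₃ t
  set q := CurvedRod.p₃ θ₂ θ₃ t
  set S := 1 + h ^ 2 * (a ^ 2 + c ^ 2) with hS
  set R := 1 + h ^ 2 * c ^ 2 with hR
  have hSp : 0 < S := by positivity
  have hRp : 0 < R := by positivity
  have hs : √S ^ 2 = S := Real.sq_sqrt hSp.le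
  have hr : √R ^ 2 = R := Real.sq_sqrt hRp.le
  have hsp : 0 < √S := Real.sqrt_pos.2 hSp
  have hrp : 0 < √R := Real.sqrt_pos.2 hRp
  rw [map_smul, LinearMap.map_smul₂, smul_smul, mul_comm]
  have e : (√S)⁻¹ * (√S * √R)⁻¹ = (√R)⁻¹ * S⁻¹ := by
    rw [mul_inv, ← mul_assoc, ← mul_inv, ← pow_two, hs, mul_comm]
  rw [e, mul_smul]
  congr 1
  rw [cross_apply]
  ext i
  fin_cases i
  · simp
    rw [inv_mul_eq_iff_eq_mul₀ hSp.ne', hS, hR]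
    linear_combination (-(h * c * (1 + h ^ 2 * (a ^ 2 + c ^ 2)))) * hp
  · simp
    rw [inv_mul_eq_iff_eq_mul₀ hSp.ne', hS, hR]
    ring
  · simp
    rw [inv_mul_eq_iff_eq_mul₀ hSp.ne', hS, hR]
    ring

variable (θ₂ θ₃) in
/-- The deviation of the normal from its first-order expansion. -/
def nuN (h t : ℝ) : V3 :=
  normal θ₂ θ₃ h t - ![-(h * aCoef θ₂ θ₃ t), p₂ θ₂ θ₃ t, p₃ θ₂ θ₃ t]

variable (θ₂ θ₃) in
/-- The deviation of the binormal from its first-order expansion. -/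
def nuB (h t : ℝ) : V3 :=
  binormal θ₂ θ₃ h t - ![-(h * cCoef θ₂ θ₃ t), -p₃ θ₂ θ₃ t, p₂ θ₂ θ₃ t]

namespace IsCurve

theorem O1_h (L : ℝ) : O1 L 1 (fun h _ => h) := (O1.pow L 1).congr fun h _ t _ => by simp

theorem O1_alphaN (hc : IsCurve L θ₂ θ₃) : O1 L 4 (fun h t => alphaN θ₂ θ₃ h t - 1 +
    h ^ 2 * (aCoef θ₂ θ₃ t ^ 2 + 2 * cCoef θ₂ θ₃ t ^ 2 +
      h ^ 2 * (aCoef θ₂ θ₃ t ^ 2 + cCoef θ₂ θ₃ t ^ 2) * cCoef θ₂ θ₃ t ^ 2) / 2) := by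
  have ha2 := hc.O1_a.mul hc.O1_a
  have hc2 := hc.O1_c.mul hc.O1_c
  refine O1.invSqrt ?_ fun h hh t ht => by positivity
  refine ((ha2.add ((O1.const L 2).mul hc2)).add
    ((((O1.pow L 2).mul (ha2.add hc2)).mul hc2).mono (Nat.zero_le _))).congr fun h _ t _ => ?_
  ring

theorem O1_betaB (hc : IsCurve L θ₂ θ₃) : O1 L 4 (fun h t => betaB θ₂ θ₃ h t - 1 +
    h ^ 2 * cCoef θ₂ θ₃ t ^ 2 / 2) := by
  refine O1.invSqrt ((hc.O1_c.mul hc.O1_c).congr fun h _ t _ => ?_) fun h hh t ht => by positivity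
  ring

theorem O1_fN (hc : IsCurve L θ₂ θ₃) (i : Fin 3) : O1 L 0 (fun _ t => fN θ₂ θ₃ t i) := by
  have ha2 := hc.O1_a.mul hc.O1_a
  fin_cases i
  · exact (O1.const L 0).congr fun h _ t _ => by simp [fN]
  · exact (((O1.const L (1 / 2)).mul (ha2.mul hc.p₂.toO1)).sub
      (hc.O1_a.mul hc.memC₂.O1_deriv)).congr fun h _ t _ => by simp [fN]; ring
  · exact (((O1.const L (1 / 2)).mul (ha2.mul hc.p₃.toO1)).sub
      (hc.O1_a.mul hc.memC₃.O1_deriv)).congr fun h _ t _ => by simp [fN]; ring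

theorem O1_fB (hc : IsCurve L θ₂ θ₃) (i : Fin 3) : O1 L 0 (fun _ t => fB θ₂ θ₃ t i) := by
  have hc2 := hc.O1_c.mul hc.O1_c
  fin_cases i
  · exact (O1.const L 0).congr fun h _ t _ => by simp [fB]
  · exact ((O1.const L (1 / 2)).mul (hc2.mul hc.p₃.toO1)).congr
      fun h _ t _ => by simp [fB]; ring
  · exact ((O1.const L (-1 / 2)).mul (hc2.mul hc.p₂.toO1)).congr
      fun h _ t _ => by simp [fB]; ring

/-- Up to O(h⁴), (1 + h²c²)α = 1 - h²a²/2 and h²acα = h²ac, where α is `alphaN`. Hence the in-plane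
h² coefficient is -(a²/2)p plus ac times (p₃, -p₂), which equals (a²/2)p - aθ' by the decomposition
of θ'. The first component -ha(α - 1) is already of order h³. -/
theorem O1_nuN (hc : IsCurve L θ₂ θ₃) (i : Fin 3) :
    O1 L 3 (fun h t => nuN θ₂ θ₃ h t i - h ^ 2 * fN θ₂ θ₃ t i) := by
  have ha := hc.O1_a
  have hcc := hc.O1_c
  have ha2 := ha.mul ha
  have hc2 := hcc.mul hcc
  have hal := hc.O1_alphaN
  set r : ℝ → ℝ → ℝ := fun h t => alphaN θ₂ θ₃ h t - 1 +
    h ^ 2 * (aCoef θ₂ θ₃ t ^ 2 + 2 * cCoef θ₂ θ₃ t ^ 2 +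
      h ^ 2 * (aCoef θ₂ θ₃ t ^ 2 + cCoef θ₂ θ₃ t ^ 2) * cCoef θ₂ θ₃ t ^ 2) / 2 with hr
  have hf : O1 L 0 (fun h t => aCoef θ₂ θ₃ t ^ 2 + 2 * cCoef θ₂ θ₃ t ^ 2 +
      h ^ 2 * (aCoef θ₂ θ₃ t ^ 2 + cCoef θ₂ θ₃ t ^ 2) * cCoef θ₂ θ₃ t ^ 2) :=
    ((ha2.add ((O1.const L 2).mul hc2)).add
      ((((O1.pow L 2).mul (ha2.add hc2)).mul hc2).mono (Nat.zero_le _))).congr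
      fun h _ t _ => by ring
  set f : ℝ → ℝ → ℝ := fun h t => aCoef θ₂ θ₃ t ^ 2 + 2 * cCoef θ₂ θ₃ t ^ 2 +
      h ^ 2 * (aCoef θ₂ θ₃ t ^ 2 + cCoef θ₂ θ₃ t ^ 2) * cCoef θ₂ θ₃ t ^ 2 with hfd
  have hα : ∀ h t, alphaN θ₂ θ₃ h t = 1 - h ^ 2 * f h t / 2 + r h t := fun h t => by
    simp only [hr, hfd]; ring
  have h4 := O1.pow L 4
  -- the fourth-order factor of the in-plane parts
  have hw : O1 L 4 (fun h t => (1 + h ^ 2 * cCoef θ₂ θ₃ t ^ 2) * alphaN θ₂ θ₃ h t - 1 +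
      h ^ 2 * aCoef θ₂ θ₃ t ^ 2 / 2) := by
    refine (((hal.add ((((O1.pow L 2).mul hc2).mul hal).mono (by norm_num))).sub
      (((O1.const L (1 / 2)).mul (h4.mul (hc2.mul hf))).mono (by norm_num))).sub
      (((O1.const L (1 / 2)).mul (h4.mul ((ha2.add hc2).mul hc2))).mono (by norm_num))).congr
      fun h _ t _ => ?_
    rw [hα]
    simp only [hfd]
    ring
  -- The product of h²ac with α - 1 = O(h²): replacing α by 1 in the transverse term costs only
  -- order four.
  have hv : O1 L 4 (fun h t => h ^ 2 * (aCoef θ₂ θ₃ t * cCoef θ₂ θ₃ t) *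
      (alphaN θ₂ θ₃ h t - 1)) := by
    refine ((((O1.pow L 2).mul (ha.mul hcc)).mul hal).mono (by norm_num : 4 ≤ _)).sub
      (((O1.const L (1 / 2)).mul (h4.mul ((ha.mul hcc).mul hf))).mono (by norm_num)) |>.congr
      fun h _ t _ => ?_
    rw [hα]
    ring
  fin_cases i
  · refine ((((O1.const L (1 / 2)).mul ((O1.pow L 3).mul (ha.mul hf))).mono (by norm_num)).sub
      (((O1_h L).mul (ha.mul hal)).mono (by norm_num : 3 ≤ _))).congr fun h hh t ht => ?_
    simp only [nuN, normal_eq hc hh.1 ht, fN]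
    simp
    rw [hα]
    ring
  · refine ((((hw.mul hc.p₂.toO1).add (hv.mul hc.p₃.toO1))).mono (by norm_num : 3 ≤ _)).congr
      fun h hh t ht => ?_
    simp only [nuN, normal_eq hc hh.1 ht, fN]
    simp
    rw [hc.theta₂_eq ht]
    ring
  · refine ((((hw.mul hc.p₃.toO1).sub (hv.mul hc.p₂.toO1))).mono (by norm_num : 3 ≤ _)).congr
      fun h hh t ht => ?_
    simp only [nuN, normal_eq hc hh.1 ht, fN]
    simp
    rw [hc.theta₃_eq ht]
    ring

theorem O1_nuB (hc : IsCurve L θ₂ θ₃) (i : Fin 3) :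
    O1 L 3 (fun h t => nuB θ₂ θ₃ h t i - h ^ 2 * fB θ₂ θ₃ t i) := by
  have hcc := hc.O1_c
  have hc2 := hcc.mul hcc
  have hb := hc.O1_betaB
  fin_cases i
  · refine ((((O1.const L (1 / 2)).mul ((O1.pow L 3).mul (hcc.mul hc2))).mono (by norm_num)).sub
      (((O1_h L).mul (hcc.mul hb)).mono (by norm_num : 3 ≤ _))).congr fun h hh t ht => ?_
    simp only [nuB, binormal_eq hc hh.1 ht, fB]
    simp
    ring
  · refine ((hb.mul hc.p₃.toO1.neg).mono (by norm_num : 3 ≤ _)).congr fun h hh t ht => ?_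
    simp only [nuB, binormal_eq hc hh.1 ht, fB]
    simp
    ring
  · refine ((hb.mul hc.p₂.toO1).mono (by norm_num : 3 ≤ _)).congr fun h hh t ht => ?_
    simp only [nuB, binormal_eq hc hh.1 ht, fB]
    simp
    ring

end IsCurve

end FrameExpansion

/-! ### Deformations of the image of a domain -/

section Transport

/-- The linear functional with coefficients `v`. -/
def rowL (v : V3) : V3 →L[ℝ] ℝ := ∑ k, v k • ContinuousLinearMap.proj (R := ℝ) (φ := fun _ => ℝ) k

theorem rowL_apply (v w : V3) : rowL v w = ∑ k, v k * w k := by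
  simp [rowL]

/-- The linear map with matrix `M`. -/
def matL (M : M3) : V3 →L[ℝ] V3 := ContinuousLinearMap.pi fun i => rowL (M i)

theorem matL_apply (M : M3) (w : V3) : matL M w = M *ᵥ w := by
  ext i
  simp [matL, rowL_apply, Matrix.mulVec, dotProduct]

theorem matL_comp (M N : M3) : (matL M).comp (matL N) = matL (M * N) := by
  ext1 w
  simp [matL_apply]

theorem det_matL (M : M3) : (matL M).det = M.det := by
  have : ((matL M : V3 →L[ℝ] V3) : V3 →ₗ[ℝ] V3) = Matrix.toLin' M := by
    ext1 w
    ext i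
    simp [matL_apply]
  rw [ContinuousLinearMap.det, this, LinearMap.det_toLin']

theorem matL_e (M : M3) (i k : Fin 3) : matL M (e k) i = M i k := by
  rw [matL_apply, e, Matrix.mulVec_single_one]
  rfl

theorem hasFDerivAt_matL_iff {f : V3 → V3} {M : M3} {x : V3} :
    HasFDerivAt f (matL M) x ↔ ∀ i, HasFDerivAt (fun z => f z i) (rowL (M i)) x :=
  hasFDerivAt_pi'

/-- The linear equivalence with an invertible matrix `M`. -/
def matE (M : M3) (h : IsUnit M.det) : V3 ≃L[ℝ] V3 :=
  ContinuousLinearEquiv.equivOfInverse (matL M) (matL M⁻¹)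
    (fun w => by simp [matL_apply, Matrix.nonsing_inv_mul _ h])
    (fun w => by simp [matL_apply, Matrix.mul_nonsing_inv _ h])

variable {Ω : Set V3} {Φ : V3 → V3} {M : V3 → M3}

/-- The data of a bi-Lipschitz change of variables on `Ω`. -/
structure IsChart (Ω : Set V3) (Φ : V3 → V3) (M : V3 → M3) : Prop where
  isOpen : IsOpen Ω
  hasDeriv : ∀ x ∈ Ω, HasStrictFDerivAt Φ (matL (M x)) x
  det_ne : ∀ x ∈ Ω, (M x).det ≠ 0
  antilipschitz : ∃ K : ℝ, ∀ x ∈ Ω, ∀ y ∈ Ω, dist x y ≤ K * dist (Φ x) (Φ y)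
  bounded : Bornology.IsBounded (Φ '' Ω)

namespace IsChart

theorem injOn (hΦ : IsChart Ω Φ M) : InjOn Φ Ω := by
  obtain ⟨K, hK⟩ := hΦ.antilipschitz
  intro x hx y hy h
  have := hK x hx y hy
  rw [h, dist_self, mul_zero] at this
  exact dist_le_zero.1 this

theorem isOpen_image (hΦ : IsChart Ω Φ M) : IsOpen (Φ '' Ω) := by
  rw [isOpen_iff_mem_nhds]
  rintro _ ⟨x, hx, rfl⟩
  have hs : HasStrictFDerivAt Φ ((matE (M x) (hΦ.det_ne x hx).isUnit : V3 ≃L[ℝ] V3) : V3 →L[ℝ] V3) x :=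
    hΦ.hasDeriv x hx
  rw [← hs.map_nhds_eq_of_equiv]
  exact image_mem_map (hΦ.isOpen.mem_nhds hx)

theorem leftInv (hΦ : IsChart Ω Φ M) {x : V3} (hx : x ∈ Ω) :
    Function.invFunOn Φ Ω (Φ x) = x :=
  hΦ.injOn.leftInvOn_invFunOn hx

/-- The lower Lipschitz bound makes the inverse Lipschitz; openness of the image ensures that nearby
points are images. -/
theorem continuousAt_inv (hΦ : IsChart Ω Φ M) {x : V3} (hx : x ∈ Ω) :
    ContinuousAt (Function.invFunOn Φ Ω) (Φ x) := by
  obtain ⟨K, hK⟩ := hΦ.antilipschitz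
  rw [Metric.continuousAt_iff]
  intro ε hε
  obtain ⟨ρ, hρ, hb⟩ := Metric.isOpen_iff.1 hΦ.isOpen_image _ (mem_image_of_mem Φ hx)
  refine ⟨min ρ (ε / (|K| + 1)), by positivity, fun {z} hz => ?_⟩
  obtain ⟨y, hy, rfl⟩ := hb (Metric.mem_ball.2 (hz.trans_le (min_le_left _ _)))
  rw [hΦ.leftInv hx, hΦ.leftInv hy]
  have h1 := hz.trans_le (min_le_right _ _)
  rw [lt_div_iff₀ (by positivity)] at h1
  calc dist y x ≤ K * dist (Φ y) (Φ x) := hK y hy x hx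
    _ ≤ (|K| + 1) * dist (Φ y) (Φ x) := by
        gcongr
        linarith [le_abs_self K]
    _ < ε := by linarith

theorem hasFDerivAt_inv (hΦ : IsChart Ω Φ M) {x : V3} (hx : x ∈ Ω) :
    HasFDerivAt (Function.invFunOn Φ Ω) (matL (M x)⁻¹) (Φ x) := by
  have hs : HasFDerivAt Φ ((matE (M x) (hΦ.det_ne x hx).isUnit : V3 ≃L[ℝ] V3) : V3 →L[ℝ] V3)
      (Function.invFunOn Φ Ω (Φ x)) := by
    rw [hΦ.leftInv hx]
    exact (hΦ.hasDeriv x hx).hasFDerivAt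
  exact HasFDerivAt.of_local_left_inverse (hΦ.continuousAt_inv hx) hs (by
    filter_upwards [hΦ.isOpen_image.mem_nhds (mem_image_of_mem Φ hx)] with z hz
    exact Function.invFunOn_eq hz)

theorem hasFDerivAt_comp_inv (hΦ : IsChart Ω Φ M) {Y : V3 → V3} {F : M3} {x : V3} (hx : x ∈ Ω)
    (hY : HasFDerivAt Y (matL (F * M x)) x) :
    HasFDerivAt (fun z => Y (Function.invFunOn Φ Ω z)) (matL F) (Φ x) := by
  have h1 : HasFDerivAt Y (matL (F * M x)) (Function.invFunOn Φ Ω (Φ x)) := by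
    rwa [hΦ.leftInv hx]
  have := h1.comp (Φ x) (hΦ.hasFDerivAt_inv hx)
  rwa [matL_comp, Matrix.mul_assoc, Matrix.mul_nonsing_inv _ (hΦ.det_ne x hx).isUnit,
    Matrix.mul_one] at this

/-- The inverse chart is differentiable on the image, hence maps null sets to null sets. -/
theorem ae_comp (hΦ : IsChart Ω Φ M) {p : V3 → Prop}
    (h : ∀ᵐ z ∂volume.restrict (Φ '' Ω), p z) : ∀ᵐ x ∂volume.restrict Ω, p (Φ x) := by
  rw [ae_restrict_iff' hΦ.isOpen_image.measurableSet] at h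
  rw [ae_restrict_iff' hΦ.isOpen.measurableSet]
  have h0 : volume {z | ¬(z ∈ Φ '' Ω → p z)} = 0 := h
  have h1 := addHaar_image_eq_zero_of_differentiableOn_of_addHaar_eq_zero volume
    (f := Function.invFunOn Φ Ω) (s := {z | ¬(z ∈ Φ '' Ω → p z)}) (by
      intro z hz
      simp only [mem_ofPred_eq, Classical.not_imp] at hz
      obtain ⟨⟨x, hx, rfl⟩, -⟩ := hz
      exact (hΦ.hasFDerivAt_inv hx).differentiableAt.differentiableWithinAt) h0
  refine measure_mono_null ?_ h1
  intro x hx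
  have hx' : ¬(x ∈ Ω → p (Φ x)) := hx
  simp only [Classical.not_imp] at hx'
  refine ⟨Φ x, ?_, hΦ.leftInv hx'.1⟩
  simp only [mem_ofPred_eq, Classical.not_imp]
  exact ⟨mem_image_of_mem Φ hx'.1, hx'.2⟩

theorem lintegral_image (hΦ : IsChart Ω Φ M) (f : V3 → ℝ≥0∞) :
    ∫⁻ z in Φ '' Ω, f z = ∫⁻ x in Ω, ENNReal.ofReal |(M x).det| * f (Φ x) := by
  rw [lintegral_image_eq_lintegral_abs_det_fderiv_mul volume hΦ.isOpen.measurableSet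
    (f' := fun x => matL (M x)) (fun x hx => (hΦ.hasDeriv x hx).hasFDerivAt.hasFDerivWithinAt)
    hΦ.injOn]
  simp only [det_matL]

/-- Writing the derivative of `Y` as `F x * M x` with `M` the derivative of the chart, the chain
rule gives the classical gradient F∘Φ⁻¹ on the image; being bounded, it is also the weak gradient.
-/
theorem weak_gradient (hΦ : IsChart Ω Φ M) {Y : V3 → V3} {F : V3 → M3} {C : ℝ}
    (hY : ∀ x ∈ Ω, HasFDerivAt Y (matL (F x * M x)) x) (hYb : ∀ x ∈ Ω, ∀ i, |Y x i| ≤ C)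
    (hF : ∀ x ∈ Ω, ∀ i j, |F x i j| ≤ C) :
    MemW12V (Φ '' Ω) (fun z => Y (Function.invFunOn Φ Ω z)) ∧
    (∀ᵐ z ∂volume.restrict (Φ '' Ω),
      grad (Φ '' Ω) (fun z => Y (Function.invFunOn Φ Ω z)) z = F (Function.invFunOn Φ Ω z)) := by
  set y : V3 → V3 := fun z => Y (Function.invFunOn Φ Ω z) with hy
  have hd : ∀ x ∈ Ω, ∀ i, HasFDerivAt (fun z => y z i) (rowL (F x i)) (Φ x) := fun x hx i =>
    hasFDerivAt_matL_iff.1 (hΦ.hasFDerivAt_comp_inv hx (hY x hx)) i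
  have hval : ∀ x ∈ Ω, ∀ i k, fderiv ℝ (fun z => y z i) (Φ x) (e k) = F x i k := by
    intro x hx i k
    rw [(hd x hx i).fderiv]
    exact matL_e (F x) i k
  have hdiff : ∀ i, ∀ z ∈ Φ '' Ω, DifferentiableAt ℝ (fun z => y z i) z := by
    rintro i _ ⟨x, hx, rfl⟩
    exact (hd x hx i).differentiableAt
  have hbd : ∀ i k, ∀ z ∈ Φ '' Ω, |fderiv ℝ (fun z => y z i) z (e k)| ≤ C := by
    rintro i k _ ⟨x, hx, rfl⟩
    rw [hval x hx]
    exact hF x hx i k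
  have hfin : IsFiniteMeasure (volume.restrict (Φ '' Ω)) :=
    ⟨by simpa using hΦ.bounded.measure_lt_top⟩
  have hw : ∀ i k, IsWeakDeriv (Φ '' Ω) (e k) (fun z => y z i)
      (fun z => fderiv ℝ (fun z => y z i) z (e k)) := fun i k =>
    isWeakDeriv_of_bounded hΦ.isOpen_image (hdiff i) (hbd i k)
  refine ⟨fun i => ⟨?_, fun k => ⟨_, hw i k, ?_⟩⟩, ?_⟩
  · refine memLp_of_bounded' (C := C) (ContinuousOn.aestronglyMeasurable (fun z hz =>
      (hdiff i z hz).continuousAt.continuousWithinAt) hΦ.isOpen_image.measurableSet) ?_ 2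
    rw [ae_restrict_iff' hΦ.isOpen_image.measurableSet]
    refine .of_forall ?_
    rintro _ ⟨x, hx, rfl⟩
    simp only [hy, hΦ.leftInv hx]
    exact hYb x hx i
  · refine memLp_of_bounded' (C := C)
      (measurable_fderiv_apply_const ℝ _ (e k)).aestronglyMeasurable ?_ 2
    rw [ae_restrict_iff' hΦ.isOpen_image.measurableSet]
    exact .of_forall (hbd i k)
  · have hall : ∀ᵐ z ∂volume.restrict (Φ '' Ω), ∀ i k, pd (Φ '' Ω) k (fun z => y z i) z =
        fderiv ℝ (fun z => y z i) z (e k) := by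
      rw [ae_all_iff]; intro i
      rw [ae_all_iff]; intro k
      exact (hw i k).weakDeriv_ae_eq hΦ.isOpen_image
    filter_upwards [hall, ae_restrict_mem hΦ.isOpen_image.measurableSet] with z hz hzm
    obtain ⟨x, hx, rfl⟩ := hzm
    ext i k
    rw [grad, Matrix.of_apply, hz i k, hval x hx, hΦ.leftInv hx]

end IsChart

end Transport

/-! ### The change of variables `Θ^h ∘ P^h` -/

section OrderCylinder

/-- `G h` is of order `h^k` on `Ω`, uniformly. -/
def Ob (Ω : Set V3) (k : ℕ) (G : ℝ → V3 → ℝ) : Prop :=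
  ∃ C : ℝ, ∀ h ∈ Ioc (0 : ℝ) 1, ∀ x ∈ Ω, |G h x| ≤ C * h ^ k

variable {Ω : Set V3} {k l : ℕ} {F G : ℝ → V3 → ℝ}

theorem Ob.add (hF : Ob Ω k F) (hG : Ob Ω k G) : Ob Ω k (fun h x => F h x + G h x) := by
  obtain ⟨C, hC⟩ := hF
  obtain ⟨D, hD⟩ := hG
  refine ⟨C + D, fun h hh x hx => ?_⟩
  rw [add_mul]
  exact (abs_add_le _ _).trans (add_le_add (hC h hh x hx) (hD h hh x hx))

theorem Ob.mul (hF : Ob Ω k F) (hG : Ob Ω l G) : Ob Ω (k + l) (fun h x => F h x * G h x) := by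
  obtain ⟨C, hC⟩ := hF
  obtain ⟨D, hD⟩ := hG
  refine ⟨C * D, fun h hh x hx => ?_⟩
  rw [abs_mul, show C * D * h ^ (k + l) = C * h ^ k * (D * h ^ l) by ring]
  exact mul_le_mul (hC h hh x hx) (hD h hh x hx) (abs_nonneg _)
    ((abs_nonneg _).trans (hC h hh x hx))

theorem Ob.mono (hF : Ob Ω l F) (hkl : k ≤ l) : Ob Ω k F := by
  obtain ⟨C, hC⟩ := hF
  refine ⟨|C|, fun h hh x hx => (hC h hh x hx).trans ?_⟩
  have : h ^ l ≤ h ^ k := pow_le_pow_of_le_one hh.1.le hh.2 hkl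
  have h0 : 0 ≤ h ^ l := pow_nonneg hh.1.le _
  calc C * h ^ l ≤ |C| * h ^ l := by gcongr; exact le_abs_self _
    _ ≤ _ := by gcongr

theorem Ob.congr (hF : Ob Ω k F) (h : ∀ h ∈ Ioc (0 : ℝ) 1, ∀ x ∈ Ω, G h x = F h x) :
    Ob Ω k G := by
  obtain ⟨C, hC⟩ := hF
  exact ⟨C, fun s hs x hx => by rw [h s hs x hx]; exact hC s hs x hx⟩

theorem Ob.const (Ω : Set V3) (c : ℝ) : Ob Ω 0 (fun _ _ => c) :=
  ⟨|c|, fun h _ x _ => by simp⟩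

theorem Ob.pow (Ω : Set V3) (k : ℕ) : Ob Ω k (fun h _ => h ^ k) :=
  ⟨1, fun h hh x _ => by
    have : 0 ≤ h ^ k := pow_nonneg hh.1.le _
    simp [abs_of_pos hh.1]⟩

theorem Ob.neg (hF : Ob Ω k F) : Ob Ω k (fun h x => - F h x) := by
  obtain ⟨C, hC⟩ := hF
  exact ⟨C, fun s hs x hx => by rw [abs_neg]; exact hC s hs x hx⟩

theorem Ob.sub (hF : Ob Ω k F) (hG : Ob Ω k G) : Ob Ω k (fun h x => F h x - G h x) :=
  (hF.add hG.neg).congr fun h _ x _ => by ring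

theorem O1.toOb {L : ℝ} {ω : Set V2} {F : ℝ → ℝ → ℝ} (hF : O1 L k F) :
    Ob (cyl L ω) k (fun h x => F h (x 0)) := by
  obtain ⟨C, hC⟩ := hF
  exact ⟨C, fun h hh x hx => ((hC h hh).2 _ hx.1).1⟩

theorem O1.toOb_deriv {L : ℝ} {ω : Set V2} {F : ℝ → ℝ → ℝ} (hF : O1 L k F) :
    Ob (cyl L ω) k (fun h x => deriv (F h) (x 0)) := by
  obtain ⟨C, hC⟩ := hF
  exact ⟨C, fun h hh x hx => ((hC h hh).2 _ hx.1).2⟩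

theorem Ob_coord {L : ℝ} {ω : Set V2} (hω : IsCrossSection ω) (j : Fin 3) :
    Ob (cyl L ω) 0 (fun _ x => x j) := by
  obtain ⟨C, hC⟩ := (isBounded_cyl (L := L) hω.isBounded).exists_norm_le
  exact ⟨C, fun h _ x hx => by simpa using (norm_le_pi_norm x j).trans (hC x hx)⟩

theorem Ob.exists_le_half (hF : Ob Ω 1 F) :
    ∃ h₁ ∈ Ioc (0 : ℝ) 1, ∀ h ∈ Ioc (0 : ℝ) h₁, ∀ x ∈ Ω, |F h x| ≤ 1 / 2 := by
  obtain ⟨C, hC⟩ := hF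
  refine ⟨min 1 (1 / (2 * (|C| + 1))), ⟨by positivity, min_le_left _ _⟩, fun h hh x hx => ?_⟩
  have h1 : h ≤ 1 := hh.2.trans (min_le_left _ _)
  have h2 : h ≤ 1 / (2 * (|C| + 1)) := hh.2.trans (min_le_right _ _)
  refine (hC h ⟨hh.1, h1⟩ x hx).trans ?_
  rw [le_div_iff₀ (by positivity)] at h2
  have := le_abs_self C
  nlinarith [hh.1]

theorem O1.lipschitz {L : ℝ} {F : ℝ → ℝ → ℝ} (hF : O1 L k F) :
    ∃ C : ℝ, 0 ≤ C ∧ ∀ h ∈ Ioc (0 : ℝ) 1, ∀ s ∈ Ioo 0 L, ∀ t ∈ Ioo 0 L,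
      |F h s| ≤ C * h ^ k ∧ |F h s - F h t| ≤ C * h ^ k * |s - t| := by
  have hF' := hF
  obtain ⟨C, hC⟩ := hF
  refine ⟨|C|, abs_nonneg _, fun h hh s hs t ht => ?_⟩
  have hk : C * h ^ k ≤ |C| * h ^ k := by
    have : 0 ≤ h ^ k := pow_nonneg hh.1.le _
    gcongr
    exact le_abs_self _
  refine ⟨((hC h hh).2 s hs).1.trans hk, ?_⟩
  exact (convex_Ioo 0 L).norm_image_sub_le_of_norm_deriv_le
    (fun r hr => hF'.differentiableAt hh hr) (fun r hr => ((hC h hh).2 r hr).2.trans hk) ht hs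

end OrderCylinder

/-! ### `Θ^h∘P^h` as a change of variables on the cylinder -/

section Chart

variable {L : ℝ} {θ₂ θ₃ : ℝ → ℝ} {ω : Set V2}

theorem hasStrictFDerivAt_affine {A B C : ℝ → ℝ} {A' B' C' : ℝ} {x : V3}
    (hA : HasStrictDerivAt A A' (x 0)) (hB : HasStrictDerivAt B B' (x 0))
    (hC : HasStrictDerivAt C C' (x 0)) :
    HasStrictFDerivAt (fun z : V3 => A (z 0) + z 1 * B (z 0) + z 2 * C (z 0))
      (rowL ![A' + x 1 * B' + x 2 * C', B (x 0), C (x 0)]) x := by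
  have hp : ∀ j : Fin 3, HasStrictFDerivAt (fun z : V3 => z j)
      (ContinuousLinearMap.proj (R := ℝ) (φ := fun _ : Fin 3 => ℝ) j) x := fun j =>
    (ContinuousLinearMap.proj (R := ℝ) (φ := fun _ : Fin 3 => ℝ) j).hasStrictFDerivAt
  have h0 := hA.comp_hasStrictFDerivAt x (hp 0)
  have h1 := (hp 1).mul (hB.comp_hasStrictFDerivAt x (hp 0))
  have h2 := (hp 2).mul (hC.comp_hasStrictFDerivAt x (hp 0))
  convert! (h0.add h1).add h2 using 1
  ext w
  simp [rowL_apply, Fin.sum_univ_three]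
  ring

variable (θ₂ θ₃) in
/-- The matrix `∇Θ^h` at `P^h x`: its columns are the derivative along the rod, the normal and the
binormal. -/
def frameMat (h : ℝ) (x : V3) : M3 := Matrix.of fun i =>
  ![(![1, h * deriv θ₂ (x 0), h * deriv θ₃ (x 0)] : V3) i +
      h * x 1 * deriv (fun t => normal θ₂ θ₃ h t i) (x 0) +
      h * x 2 * deriv (fun t => binormal θ₂ θ₃ h t i) (x 0),
    normal θ₂ θ₃ h (x 0) i, binormal θ₂ θ₃ h (x 0) i]

/-- The scaling of the gradient. -/
def scaleMat (h : ℝ) : M3 := Matrix.diagonal ![1, h, h]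

theorem strictDeriv_of_contDiffOn {f : ℝ → ℝ} (hf : ContDiffOn ℝ 1 f (Ioo 0 L)) {t : ℝ}
    (ht : t ∈ Ioo 0 L) : HasStrictDerivAt f (deriv f t) t :=
  (hf.contDiffAt (isOpen_Ioo.mem_nhds ht)).hasStrictDerivAt one_ne_zero

theorem O1.strictDeriv {k : ℕ} {F : ℝ → ℝ → ℝ} (hF : O1 L k F) {h : ℝ} (hh : h ∈ Ioc (0 : ℝ) 1)
    {t : ℝ} (ht : t ∈ Ioo 0 L) : HasStrictDerivAt (F h) (deriv (F h) t) t := by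
  obtain ⟨C, hC⟩ := hF
  exact strictDeriv_of_contDiffOn (hC h hh).1 ht

namespace IsCurve

theorem O1_nuN' (hc : IsCurve L θ₂ θ₃) (i : Fin 3) : O1 L 2 (fun h t => nuN θ₂ θ₃ h t i) :=
  (((hc.O1_nuN i).mono (by norm_num)).add
    ((O1.pow L 2).mul (hc.O1_fN i))).congr fun h _ t _ => by ring

theorem O1_nuB' (hc : IsCurve L θ₂ θ₃) (i : Fin 3) : O1 L 2 (fun h t => nuB θ₂ θ₃ h t i) :=
  (((hc.O1_nuB i).mono (by norm_num)).add
    ((O1.pow L 2).mul (hc.O1_fB i))).congr fun h _ t _ => by ring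

theorem normal_apply (h t : ℝ) (i : Fin 3) : normal θ₂ θ₃ h t i = nuN θ₂ θ₃ h t i +
    (![-(h * aCoef θ₂ θ₃ t), CurvedRod.p₂ θ₂ θ₃ t, CurvedRod.p₃ θ₂ θ₃ t] : V3) i := by
  simp [nuN]

theorem binormal_apply (h t : ℝ) (i : Fin 3) : binormal θ₂ θ₃ h t i = nuB θ₂ θ₃ h t i +
    (![-(h * cCoef θ₂ θ₃ t), -CurvedRod.p₃ θ₂ θ₃ t, CurvedRod.p₂ θ₂ θ₃ t] : V3) i := by
  simp [nuB]

theorem O1_n0 (hc : IsCurve L θ₂ θ₃) (i : Fin 3) : O1 L 0 (fun h t =>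
    (![-(h * aCoef θ₂ θ₃ t), CurvedRod.p₂ θ₂ θ₃ t, CurvedRod.p₃ θ₂ θ₃ t] : V3) i) := by
  fin_cases i
  · exact ((O1_h L).mul hc.O1_a).neg.mono (by norm_num)
  · exact hc.p₂.toO1
  · exact hc.p₃.toO1

theorem O1_b0 (hc : IsCurve L θ₂ θ₃) (i : Fin 3) : O1 L 0 (fun h t =>
    (![-(h * cCoef θ₂ θ₃ t), -CurvedRod.p₃ θ₂ θ₃ t, CurvedRod.p₂ θ₂ θ₃ t] : V3) i) := by
  fin_cases i
  · exact ((O1_h L).mul hc.O1_c).neg.mono (by norm_num)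
  · exact hc.p₃.toO1.neg
  · exact hc.p₂.toO1

theorem O1_normal (hc : IsCurve L θ₂ θ₃) (i : Fin 3) :
    O1 L 0 (fun h t => normal θ₂ θ₃ h t i) :=
  (((hc.O1_nuN' i).mono (by norm_num)).add (hc.O1_n0 i)).congr
    fun h _ t _ => by rw [normal_apply]

theorem O1_binormal (hc : IsCurve L θ₂ θ₃) (i : Fin 3) :
    O1 L 0 (fun h t => binormal θ₂ θ₃ h t i) :=
  (((hc.O1_nuB' i).mono (by norm_num)).add (hc.O1_b0 i)).congr
    fun h _ t _ => by rw [binormal_apply]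

theorem O1_curve (hc : IsCurve L θ₂ θ₃) (i : Fin 3) :
    O1 L 0 (fun h t => (![t, h * θ₂ t, h * θ₃ t] : V3) i) := by
  fin_cases i
  · exact O1.of_contDiff contDiff_id
  · exact ((O1_h L).mul hc.memC₂.O1_self).mono (by norm_num)
  · exact ((O1_h L).mul hc.memC₃.O1_self).mono (by norm_num)

theorem deriv_curve (hc : IsCurve L θ₂ θ₃) {h : ℝ} (i : Fin 3) {t : ℝ} (ht : t ∈ Ioo 0 L) :
    deriv (fun t => (![t, h * θ₂ t, h * θ₃ t] : V3) i) t =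
      (![1, h * deriv θ₂ t, h * deriv θ₃ t] : V3) i := by
  fin_cases i
  · exact deriv_id t
  · exact deriv_const_mul _ (hc.memC₂.O1_self.differentiableAt (h := 1) ⟨one_pos, le_rfl⟩ ht)
  · exact deriv_const_mul _ (hc.memC₃.O1_self.differentiableAt (h := 1) ⟨one_pos, le_rfl⟩ ht)

theorem hasFDerivAt_Theta (hc : IsCurve L θ₂ θ₃) {h : ℝ} (hh : h ∈ Ioc (0 : ℝ) 1) {x : V3}
    (hx : x 0 ∈ Ioo 0 L) :
    HasFDerivAt (Theta θ₂ θ₃ h) (matL (frameMat θ₂ θ₃ h x)) (P h x) := by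
  rw [hasFDerivAt_matL_iff]
  intro i
  have h0 : P h x 0 = x 0 := rfl
  have hx' : P h x 0 ∈ Ioo 0 L := hx
  have := (hasStrictFDerivAt_affine (x := P h x) ((hc.O1_curve i).strictDeriv hh hx')
    ((hc.O1_normal i).strictDeriv hh hx') ((hc.O1_binormal i).strictDeriv hh hx')).hasFDerivAt
  rw [hc.deriv_curve i hx'] at this
  exact this

theorem detTheta_eq (hc : IsCurve L θ₂ θ₃) {h : ℝ} (hh : h ∈ Ioc (0 : ℝ) 1) {x : V3}
    (hx : x 0 ∈ Ioo 0 L) : detTheta θ₂ θ₃ h (P h x) = (frameMat θ₂ θ₃ h x).det := by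
  rw [detTheta, (hc.hasFDerivAt_Theta hh hx).fderiv, det_matL]

theorem frameMat_mul_scaleMat (h : ℝ) (x : V3) (i : Fin 3) :
    (frameMat θ₂ θ₃ h x * scaleMat h) i =
    ![(![1, h * deriv θ₂ (x 0), h * deriv θ₃ (x 0)] : V3) i +
        x 1 * (h * deriv (fun t => normal θ₂ θ₃ h t i) (x 0)) +
        x 2 * (h * deriv (fun t => binormal θ₂ θ₃ h t i) (x 0)),
      h * normal θ₂ θ₃ h (x 0) i, h * binormal θ₂ θ₃ h (x 0) i] := by
  ext j
  rw [scaleMat, Matrix.mul_diagonal, frameMat, Matrix.of_apply]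
  fin_cases j
  · simp only [Fin.zero_eta, Matrix.cons_val_zero]; ring
  · simp [mul_comm]
  · simp [mul_comm]

theorem ThetaP_apply (h : ℝ) (x : V3) (i : Fin 3) : ThetaP θ₂ θ₃ h x i =
    (![x 0, h * θ₂ (x 0), h * θ₃ (x 0)] : V3) i + h * x 1 * normal θ₂ θ₃ h (x 0) i +
      h * x 2 * binormal θ₂ θ₃ h (x 0) i := rfl

theorem hasStrictFDerivAt_ThetaP (hc : IsCurve L θ₂ θ₃) {h : ℝ} (hh : h ∈ Ioc (0 : ℝ) 1) {x : V3}
    (hx : x 0 ∈ Ioo 0 L) :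
    HasStrictFDerivAt (ThetaP θ₂ θ₃ h) (matL (frameMat θ₂ θ₃ h x * scaleMat h)) x := by
  refine hasStrictFDerivAt_pi'.2 fun i => ?_
  have := hasStrictFDerivAt_affine (x := x) ((hc.O1_curve i).strictDeriv hh hx)
    (((hc.O1_normal i).strictDeriv hh hx).const_mul h)
    (((hc.O1_binormal i).strictDeriv hh hx).const_mul h)
  rw [hc.deriv_curve i hx, ← frameMat_mul_scaleMat] at this
  convert! this using 1
  ext z
  rw [ThetaP_apply]
  ring

theorem P_image_cyl {h : ℝ} (hh : 0 < h) : P h '' cyl L ω = cyl L (h • ω) := by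
  ext z
  constructor
  · rintro ⟨x, hx, rfl⟩
    refine ⟨hx.1, ![x 1, x 2], hx.2, ?_⟩
    ext i; fin_cases i <;> simp [P]
  · rintro ⟨h1, s, hs, hsz⟩
    refine ⟨![z 0, s 0, s 1], ⟨h1, ?_⟩, ?_⟩
    · convert! hs using 1
      ext i; fin_cases i <;> simp
    · have e0 := congrFun hsz 0
      have e1 := congrFun hsz 1
      simp at e0 e1
      ext i; fin_cases i <;> simp [P, e0, e1]

theorem rodHat_eq {h : ℝ} (hh : 0 < h) :
    rodHat θ₂ θ₃ L ω h = ThetaP θ₂ θ₃ h '' cyl L ω := by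
  rw [rodHat, ← P_image_cyl hh, image_image]
  rfl

theorem Ob_frameMat (hc : IsCurve L θ₂ θ₃) (hω : IsCrossSection ω) (i j : Fin 3) :
    Ob (cyl L ω) 1 (fun h x => frameMat θ₂ θ₃ h x i j - Re θ₂ θ₃ (x 0) i j) := by
  have hn := fun i => (hc.O1_nuN' i).toOb (ω := ω)
  have hb := fun i => (hc.O1_nuB' i).toOb (ω := ω)
  have hn' := fun i => (hc.O1_normal i).toOb_deriv (ω := ω)
  have hb' := fun i => (hc.O1_binormal i).toOb_deriv (ω := ω)
  have h2 := hc.memC₂.O1_deriv.toOb (ω := ω)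
  have h3 := hc.memC₃.O1_deriv.toOb (ω := ω)
  have h1 := Ob.pow (cyl L ω) 1
  have x1 := Ob_coord (L := L) hω 1
  have x2 := Ob_coord (L := L) hω 2
  have ha := hc.O1_a.toOb (ω := ω)
  have hcc := hc.O1_c.toOb (ω := ω)
  have hcol : ∀ i, Ob (cyl L ω) 1 (fun h x =>
      h * x 1 * deriv (fun t => normal θ₂ θ₃ h t i) (x 0) +
      h * x 2 * deriv (fun t => binormal θ₂ θ₃ h t i) (x 0)) := fun i =>
    (((h1.mul x1).mul (hn' i)).add ((h1.mul x2).mul (hb' i))).congr fun h _ x _ => by ring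
  fin_cases j
  · fin_cases i
    · exact (hcol 0).congr fun h _ x _ => by simp [frameMat, Re]; ring
    · exact ((h1.mul h2).add (hcol 1)).congr fun h _ x _ => by simp [frameMat, Re]; ring
    · exact ((h1.mul h3).add (hcol 2)).congr fun h _ x _ => by simp [frameMat, Re]; ring
  · fin_cases i
    · exact (((hn 0).mono (by norm_num)).sub (h1.mul ha)).congr fun h _ x _ => by
        simp [frameMat, Re, normal_apply]; ring
    · exact ((hn 1).mono (by norm_num)).congr fun h _ x _ => by
        simp [frameMat, Re, normal_apply]
    · exact ((hn 2).mono (by norm_num)).congr fun h _ x _ => by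
        simp [frameMat, Re, normal_apply]
  · fin_cases i
    · exact (((hb 0).mono (by norm_num)).sub (h1.mul hcc)).congr fun h _ x _ => by
        simp [frameMat, Re, binormal_apply]; ring
    · exact ((hb 1).mono (by norm_num)).congr fun h _ x _ => by
        simp [frameMat, Re, binormal_apply]
    · exact ((hb 2).mono (by norm_num)).congr fun h _ x _ => by
        simp [frameMat, Re, binormal_apply]

theorem Ob_Re (hc : IsCurve L θ₂ θ₃) (i j : Fin 3) :
    Ob (cyl L ω) 0 (fun _ x => Re θ₂ θ₃ (x 0) i j) := by
  have h2 := hc.p₂.toO1.toOb (ω := ω)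
  have h3 := hc.p₃.toO1.toOb (ω := ω)
  fin_cases i <;> fin_cases j
  · exact Ob.const _ 1
  · exact Ob.const _ 0
  · exact Ob.const _ 0
  · exact Ob.const _ 0
  · exact h2
  · exact h3.neg
  · exact Ob.const _ 0
  · exact h3
  · exact h2

theorem det_Re (hc : IsCurve L θ₂ θ₃) {t : ℝ} (ht : t ∈ Ioo 0 L) : (Re θ₂ θ₃ t).det = 1 := by
  rw [Matrix.det_fin_three]
  simp [Re]
  linear_combination hc.p_sq ht

/-- Each triple product of entries of `frameMat` differs from the corresponding product for `Re` by
O(h), by telescoping; the determinant of the rotation is 1. -/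
theorem Ob_det_frameMat (hc : IsCurve L θ₂ θ₃) (hω : IsCrossSection ω) :
    Ob (cyl L ω) 1 (fun h x => (frameMat θ₂ θ₃ h x).det - 1) := by
  have hr := fun i j => hc.Ob_Re (ω := ω) i j
  have hd := hc.Ob_frameMat hω
  have hp : ∀ i j, Ob (cyl L ω) 0 (fun h x => frameMat θ₂ θ₃ h x i j) := fun i j =>
    (((hd i j).mono (by norm_num)).add (hr i j)).congr fun h _ x _ => by ring
  have key : ∀ i₁ j₁ i₂ j₂ i₃ j₃, Ob (cyl L ω) 1 (fun h x =>
      frameMat θ₂ θ₃ h x i₁ j₁ * frameMat θ₂ θ₃ h x i₂ j₂ * frameMat θ₂ θ₃ h x i₃ j₃ -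
      Re θ₂ θ₃ (x 0) i₁ j₁ * Re θ₂ θ₃ (x 0) i₂ j₂ * Re θ₂ θ₃ (x 0) i₃ j₃) := by
    intro i₁ j₁ i₂ j₂ i₃ j₃
    refine (((((hd i₁ j₁).mul (hp i₂ j₂)).mul (hp i₃ j₃)).add
      (((hr i₁ j₁).mul (hd i₂ j₂)).mul (hp i₃ j₃))).add
      (((hr i₁ j₁).mul (hr i₂ j₂)).mul (hd i₃ j₃))).congr fun h _ x _ => ?_
    ring
  refine ((((((key 0 0 1 1 2 2).sub (key 0 0 1 2 2 1)).sub (key 0 1 1 0 2 2)).add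
    (key 0 1 1 2 2 0)).add (key 0 2 1 0 2 1)).sub (key 0 2 1 1 2 0)).congr fun h _ x hx => ?_
  rw [← hc.det_Re hx.1, Matrix.det_fin_three, Matrix.det_fin_three]
  ring

/-- The section coordinate is bounded, so the product is Lipschitz on the cylinder with a constant
of order h^k. -/
theorem lipschitz_coord_mul {k : ℕ} {F : ℝ → ℝ → ℝ} (hF : O1 L k F) (hω : IsCrossSection ω)
    (j : Fin 3) : ∃ C : ℝ, 0 ≤ C ∧ ∀ h ∈ Ioc (0 : ℝ) 1, ∀ x ∈ cyl L ω, ∀ y ∈ cyl L ω,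
      |x j * F h (x 0) - y j * F h (y 0)| ≤ C * h ^ k * dist x y := by
  obtain ⟨C, hC0, hC⟩ := hF.lipschitz
  obtain ⟨R, hR⟩ := Ob_coord (L := L) hω j
  refine ⟨C + |R| * C, by positivity, fun h hh x hx y hy => ?_⟩
  have hk : 0 ≤ h ^ k := pow_nonneg hh.1.le _
  have h1 := hC h hh _ hx.1 _ hy.1
  have h2 : |y j| ≤ |R| := by simpa using (hR h hh y hy).trans (by simpa using le_abs_self R)
  have h3 : |x j - y j| ≤ dist x y := by
    rw [← Real.dist_eq]; exact dist_le_pi_dist x y j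
  have h4 : |x 0 - y 0| ≤ dist x y := by
    rw [← Real.dist_eq]; exact dist_le_pi_dist x y 0
  calc _ = |(x j - y j) * F h (x 0) + y j * (F h (x 0) - F h (y 0))| := by ring_nf
    _ ≤ |x j - y j| * |F h (x 0)| + |y j| * |F h (x 0) - F h (y 0)| := by
      rw [← abs_mul, ← abs_mul]; exact abs_add_le _ _
    _ ≤ dist x y * (C * h ^ k) + |R| * (C * h ^ k * dist x y) := by
      gcongr
      · exact h1.1
      · exact h1.2.trans (by gcongr)
    _ = _ := by ring

-- Divided by h, the last two components of Θ^h∘P^h are θ plus the rotated section coordinates plus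
-- a small Lipschitz remainder, while the first component is x₀ plus O(h). So the image controls x₀
-- first and then, after undoing the rotation, x₁ and x₂, up to an error C h dist(x, y) that small h
-- absorbs. The resulting constant degenerates like 1/h, which is harmless since h is fixed in each
-- chart.
set_option maxHeartbeats 1000000 in
theorem antilipschitz_ThetaP (hc : IsCurve L θ₂ θ₃) (hω : IsCrossSection ω) :
    ∃ h₁ ∈ Ioc (0 : ℝ) 1, ∀ h ∈ Ioc (0 : ℝ) h₁, ∃ K : ℝ, ∀ x ∈ cyl L ω, ∀ y ∈ cyl L ω,
      dist x y ≤ K * dist (ThetaP θ₂ θ₃ h x) (ThetaP θ₂ θ₃ h y) := by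
  have hnb : ∃ C : ℝ, 0 ≤ C ∧ ∀ h ∈ Ioc (0 : ℝ) 1, ∀ x ∈ cyl L ω, ∀ y ∈ cyl L ω,
      |(x 1 * normal θ₂ θ₃ h (x 0) 0 + x 2 * binormal θ₂ θ₃ h (x 0) 0) -
        (y 1 * normal θ₂ θ₃ h (y 0) 0 + y 2 * binormal θ₂ θ₃ h (y 0) 0)| ≤ C * dist x y := by
    obtain ⟨C, hC, hC'⟩ := lipschitz_coord_mul (hc.O1_normal 0) hω 1
    obtain ⟨D, hD, hD'⟩ := lipschitz_coord_mul (hc.O1_binormal 0) hω 2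
    refine ⟨C + D, by positivity, fun h hh x hx y hy => ?_⟩
    have h1 := hC' h hh x hx y hy
    have h2 := hD' h hh x hx y hy
    rw [pow_zero, mul_one] at h1 h2
    rw [abs_le] at *
    constructor <;> linarith
  have hnu : ∀ i, ∃ C : ℝ, 0 ≤ C ∧ ∀ h ∈ Ioc (0 : ℝ) 1, ∀ x ∈ cyl L ω, ∀ y ∈ cyl L ω,
      |(x 1 * nuN θ₂ θ₃ h (x 0) i + x 2 * nuB θ₂ θ₃ h (x 0) i) -
        (y 1 * nuN θ₂ θ₃ h (y 0) i + y 2 * nuB θ₂ θ₃ h (y 0) i)| ≤ C * h * dist x y := by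
    intro i
    obtain ⟨C, hC, hC'⟩ := lipschitz_coord_mul ((hc.O1_nuN' i).mono (k := 1) (by norm_num)) hω 1
    obtain ⟨D, hD, hD'⟩ := lipschitz_coord_mul ((hc.O1_nuB' i).mono (k := 1) (by norm_num)) hω 2
    refine ⟨C + D, by positivity, fun h hh x hx y hy => ?_⟩
    have h1 := hC' h hh x hx y hy
    have h2 := hD' h hh x hx y hy
    rw [pow_one] at h1 h2
    rw [abs_le] at *
    constructor <;> linarith
  obtain ⟨C₀, hC₀, hr0⟩ := hnb
  obtain ⟨C₁, hC₁, hr1⟩ := hnu 1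
  obtain ⟨C₂, hC₂, hr2⟩ := hnu 2
  obtain ⟨R₁, hR₁⟩ := Ob_coord (L := L) hω 1
  obtain ⟨R₂, hR₂⟩ := Ob_coord (L := L) hω 2
  obtain ⟨T₂, hT₂, ht2⟩ := hc.memC₂.O1_self.lipschitz
  obtain ⟨T₃, hT₃, ht3⟩ := hc.memC₃.O1_self.lipschitz
  obtain ⟨S₂, hS₂, hs2⟩ := hc.p₂.toO1.lipschitz
  obtain ⟨S₃, hS₃, hs3⟩ := hc.p₃.toO1.lipschitz
  set C := C₀ + C₁ + C₂ with hCdef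
  set M := T₂ + T₃ + (|R₁| + |R₂|) * (S₂ + S₃) with hM
  have hM0 : 0 ≤ M := by positivity
  have hCn : 0 ≤ C := by positivity
  set N := 2 * (M + 1) with hN
  -- This threshold gives N C h ≤ 1/2, so the error term goes to the left side at the price of a
  -- factor 2.
  refine ⟨min 1 (1 / (2 * (N * C + 1))), ⟨by positivity, min_le_left _ _⟩, fun h hh =>
    ⟨2 * N / h, fun x hx y hy => ?_⟩⟩
  have hh1 : h ≤ 1 := hh.2.trans (min_le_left _ _)
  have hh2 : h ≤ 1 / (2 * (N * C + 1)) := hh.2.trans (min_le_right _ _)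
  have hhI : h ∈ Ioc (0 : ℝ) 1 := ⟨hh.1, hh1⟩
  have h0 := hh.1
  rw [le_div_iff₀ (by positivity)] at hh2
  set δ := dist x y with hδ
  have hδ0 : 0 ≤ δ := dist_nonneg
  set D := dist (ThetaP θ₂ θ₃ h x) (ThetaP θ₂ θ₃ h y) / h with hD
  have hDi : ∀ i, |ThetaP θ₂ θ₃ h x i - ThetaP θ₂ θ₃ h y i| ≤ h * D := fun i => by
    rw [hD, mul_div_cancel₀ _ h0.ne', ← Real.dist_eq]; exact dist_le_pi_dist _ _ i
  have hD0 : 0 ≤ D := by positivity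
  set q := D + C * h * δ with hq
  have hq0 : 0 ≤ q := by positivity
  have e0 : |x 0 - y 0| ≤ q := by
    have h1 := hDi 0
    have h2 := hr0 h hhI x hx y hy
    rw [ThetaP_apply, ThetaP_apply] at h1
    simp only [Matrix.cons_val_zero] at h1
    rw [abs_le] at h1 h2 ⊢
    have h3 : C₀ * (h * δ) ≤ C * (h * δ) := by gcongr; linarith
    have h4 : h * D ≤ D := mul_le_of_le_one_left hD0 hh1
    have h5 : h * (C₀ * δ) ≤ C * h * δ := by linarith
    have h6 := mul_le_mul_of_nonneg_left h2.1 h0.le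
    have h7 := mul_le_mul_of_nonneg_left h2.2 h0.le
    constructor <;> linarith
  have hy1 : |y 1| ≤ |R₁| := by simpa using (hR₁ h hhI y hy).trans (by simpa using le_abs_self R₁)
  have hy2 : |y 2| ≤ |R₂| := by simpa using (hR₂ h hhI y hy).trans (by simpa using le_abs_self R₂)
  have l2 := (ht2 h hhI _ hx.1 _ hy.1).2
  have l3 := (ht3 h hhI _ hx.1 _ hy.1).2
  have m2 := (hs2 h hhI _ hx.1 _ hy.1).2
  have m3 := (hs3 h hhI _ hx.1 _ hy.1).2
  simp only [pow_zero, mul_one] at l2 l3 m2 m3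
  have hMq : (M + 1) * q = T₂ * q + T₃ * q + |R₁| * (S₂ * q) + |R₁| * (S₃ * q) +
      |R₂| * (S₂ * q) + |R₂| * (S₃ * q) + q := by rw [hM]; ring
  have nn1 : 0 ≤ T₂ * q := by positivity
  have nn2 : 0 ≤ T₃ * q := by positivity
  have nn3 : 0 ≤ |R₁| * (S₂ * q) := by positivity
  have nn4 : 0 ≤ |R₁| * (S₃ * q) := by positivity
  have nn5 : 0 ≤ |R₂| * (S₂ * q) := by positivity
  have nn6 : 0 ≤ |R₂| * (S₃ * q) := by positivity
  have combine : ∀ {E a b c d A B C' D' F : ℝ}, |E + (a + b + c + d)| ≤ F → |a| ≤ A → |b| ≤ B →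
      |c| ≤ C' → |d| ≤ D' → |E| ≤ F + A + B + C' + D' := by
    intro E a b c d A B C' D' F h1 h2 h3 h4 h5
    rw [abs_le] at *
    constructor <;> linarith
  have lip : ∀ {T a : ℝ}, 0 ≤ T → a ≤ T * |x 0 - y 0| → a ≤ T * q := fun hT ha =>
    ha.trans (mul_le_mul_of_nonneg_left e0 hT)
  replace l2 := lip hT₂ l2
  replace l3 := lip hT₃ l3
  replace m2 := lip hS₂ m2
  replace m3 := lip hS₃ m3
  have hmul : ∀ {a b A B : ℝ}, |a| ≤ A → |b| ≤ B → |a * b| ≤ A * B := fun ha hb => by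
    rw [abs_mul]; exact mul_le_mul ha hb (abs_nonneg _) ((abs_nonneg _).trans ha)
  have y12 := hmul hy1 m2
  have y13 := hmul hy1 m3
  have y22 := hmul hy2 m2
  have y23 := hmul hy2 m3
  have hps := hc.p_sq hx.1
  set P2 := CurvedRod.p₂ θ₂ θ₃ (x 0)
  set P3 := CurvedRod.p₃ θ₂ θ₃ (x 0)
  -- The rotation is frozen at `x`: the change of p₂, p₃ between the two points multiplies the
  -- bounded coordinates of `y` and is controlled by |x₀ - y₀|, already estimated by `q`.
  have eα : |P2 * (x 1 - y 1) - P3 * (x 2 - y 2)| ≤ (M + 1) * q := by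
    have h1 := hDi 1
    have h2 := hr1 h hhI x hx y hy
    have h3 : C₁ * h * δ ≤ C * h * δ := by gcongr; linarith
    rw [ThetaP_apply, ThetaP_apply, normal_apply, normal_apply, binormal_apply,
      binormal_apply] at h1
    simp only [Matrix.cons_val_one, Matrix.cons_val_zero] at h1
    have h4 : |(P2 * (x 1 - y 1) - P3 * (x 2 - y 2)) + ((θ₂ (x 0) - θ₂ (y 0)) +
        y 1 * (P2 - CurvedRod.p₂ θ₂ θ₃ (y 0)) + -(y 2 * (P3 - CurvedRod.p₃ θ₂ θ₃ (y 0))) +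
        ((x 1 * nuN θ₂ θ₃ h (x 0) 1 + x 2 * nuB θ₂ θ₃ h (x 0) 1) -
        (y 1 * nuN θ₂ θ₃ h (y 0) 1 + y 2 * nuB θ₂ θ₃ h (y 0) 1)))| ≤ D := by
      refine le_of_mul_le_mul_left ?_ h0
      refine le_trans (le_of_eq ?_) h1
      rw [← abs_of_pos h0, ← abs_mul, abs_of_pos h0]
      congr 1
      ring
    have := combine h4 l2 y12 ((abs_neg _).trans_le y23) (h2.trans h3)
    linarith
  have eβ : |P3 * (x 1 - y 1) + P2 * (x 2 - y 2)| ≤ (M + 1) * q := by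
    have h1 := hDi 2
    have h2 := hr2 h hhI x hx y hy
    have h3 : C₂ * h * δ ≤ C * h * δ := by gcongr; linarith
    rw [ThetaP_apply, ThetaP_apply, normal_apply, normal_apply, binormal_apply,
      binormal_apply] at h1
    simp only [Matrix.cons_val] at h1
    have h4 : |(P3 * (x 1 - y 1) + P2 * (x 2 - y 2)) + ((θ₃ (x 0) - θ₃ (y 0)) +
        y 1 * (P3 - CurvedRod.p₃ θ₂ θ₃ (y 0)) + y 2 * (P2 - CurvedRod.p₂ θ₂ θ₃ (y 0)) +
        ((x 1 * nuN θ₂ θ₃ h (x 0) 2 + x 2 * nuB θ₂ θ₃ h (x 0) 2) -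
        (y 1 * nuN θ₂ θ₃ h (y 0) 2 + y 2 * nuB θ₂ θ₃ h (y 0) 2)))| ≤ D := by
      refine le_of_mul_le_mul_left ?_ h0
      refine le_trans (le_of_eq ?_) h1
      rw [← abs_of_pos h0, ← abs_mul, abs_of_pos h0]
      congr 1
      ring
    have := combine h4 l3 y13 y22 (h2.trans h3)
    linarith
  have hP2 : |P2| ≤ 1 := abs_le_one_iff_mul_self_le_one.2 (by nlinarith)
  have hP3 : |P3| ≤ 1 := abs_le_one_iff_mul_self_le_one.2 (by nlinarith)
  have abs_neg_P3 : |-P3| ≤ 1 := (abs_neg _).trans_le hP3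
  have e1 : |x 1 - y 1| ≤ N * q := by
    rw [show x 1 - y 1 = P2 * (P2 * (x 1 - y 1) - P3 * (x 2 - y 2)) +
      P3 * (P3 * (x 1 - y 1) + P2 * (x 2 - y 2)) by linear_combination (-(x 1 - y 1)) * hps]
    refine (abs_add_le _ _).trans ((add_le_add (hmul hP2 eα) (hmul hP3 eβ)).trans (le_of_eq ?_))
    rw [hN]
    ring
  have e2 : |x 2 - y 2| ≤ N * q := by
    rw [show x 2 - y 2 = P2 * (P3 * (x 1 - y 1) + P2 * (x 2 - y 2)) +
      -P3 * (P2 * (x 1 - y 1) - P3 * (x 2 - y 2)) by linear_combination (-(x 2 - y 2)) * hps]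
    refine (abs_add_le _ _).trans ((add_le_add (hmul hP2 eβ)
      (hmul (abs_neg_P3 : |-P3| ≤ 1) eα)).trans (le_of_eq ?_))
    rw [hN]
    ring
  have hδq : δ ≤ N * q := by
    refine (dist_pi_le_iff (by positivity)).2 fun i => ?_
    fin_cases i
    · exact e0.trans (le_mul_of_one_le_left hq0 (by linarith))
    · exact e1
    · exact e2
  have hfin : δ ≤ 2 * N * D := by
    have : N * C * h * δ ≤ 1 / 2 * δ := by
      refine mul_le_mul_of_nonneg_right ?_ hδ0
      linarith
    have h5 : N * q = N * D + N * C * h * δ := by rw [hq]; ring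
    linarith
  refine hfin.trans (le_of_eq ?_)
  rw [hD]
  ring

theorem isChart_ThetaP (hc : IsCurve L θ₂ θ₃) (hω : IsCrossSection ω) :
    ∃ h₁ ∈ Ioc (0 : ℝ) 1, ∀ h ∈ Ioc (0 : ℝ) h₁,
      IsChart (cyl L ω) (ThetaP θ₂ θ₃ h) (fun x => frameMat θ₂ θ₃ h x * scaleMat h) ∧
      ∀ x ∈ cyl L ω, 1 / 2 ≤ (frameMat θ₂ θ₃ h x).det := by
  obtain ⟨h₁, hh₁, hdet⟩ := (hc.Ob_det_frameMat hω).exists_le_half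
  obtain ⟨h₂, hh₂, hanti⟩ := hc.antilipschitz_ThetaP hω
  refine ⟨min h₁ h₂, ⟨lt_min hh₁.1 hh₂.1, (min_le_left _ _).trans hh₁.2⟩, fun h hh => ?_⟩
  have hha : h ∈ Ioc 0 h₁ := ⟨hh.1, hh.2.trans (min_le_left _ _)⟩
  have hhb : h ∈ Ioc 0 h₂ := ⟨hh.1, hh.2.trans (min_le_right _ _)⟩
  have hh1 : h ∈ Ioc (0 : ℝ) 1 := ⟨hh.1, hha.2.trans hh₁.2⟩
  have hd : ∀ x ∈ cyl L ω, 1 / 2 ≤ (frameMat θ₂ θ₃ h x).det := fun x hx => by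
    have := (abs_le.1 (hdet h hha x hx)).1
    linarith
  refine ⟨⟨isOpen_cyl hω.isOpen, fun x hx => hc.hasStrictFDerivAt_ThetaP hh1 hx.1,
    fun x hx => ?_, hanti h hhb, ?_⟩, hd⟩
  · rw [Matrix.det_mul, scaleMat, Matrix.det_diagonal, Fin.prod_univ_three]
    have := hd x hx
    simp [hh.1.ne']
    linarith
  · have hcomp : ∀ i, Ob (cyl L ω) 0 (fun h x => ThetaP θ₂ θ₃ h x i) := fun i =>
      ((((hc.O1_curve i).toOb).add (((Ob.pow _ 1).mul ((Ob_coord hω 1).mul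
        (hc.O1_normal i).toOb)).mono (by norm_num))).add (((Ob.pow _ 1).mul ((Ob_coord hω 2).mul
        (hc.O1_binormal i).toOb)).mono (by norm_num))).congr fun h _ x _ => by
          rw [ThetaP_apply]; ring
    choose C hC using hcomp
    rw [isBounded_iff_forall_norm_le]
    refine ⟨∑ i, |C i|, ?_⟩
    rintro _ ⟨x, hx, rfl⟩
    refine (pi_norm_le_iff_of_nonneg (by positivity)).2 fun i => ?_
    have h1 := hC i h hh1 x hx
    rw [pow_zero, mul_one] at h1
    exact h1.trans ((le_abs_self _).trans
      (Finset.single_le_sum (f := fun i => |C i|) (fun _ _ => abs_nonneg _) (Finset.mem_univ i)))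

end IsCurve

end Chart

/-! ### Polar decomposition -/

section Polar

open scoped MatrixOrder in
theorem exists_posSemidef_sqrt {A : M3} (hA : A.PosSemidef) :
    ∃ S : M3, S.PosSemidef ∧ S * S = A :=
  ⟨CFC.sqrt A, Matrix.nonneg_iff_posSemidef.1 (CFC.sqrt_nonneg A),
    CFC.sqrt_mul_sqrt_self A hA.nonneg⟩

theorem frobenius_sq (A : M3) : ‖A‖ ^ 2 = ∑ i, ∑ j, A i j ^ 2 := by
  rw [Matrix.frobenius_norm_def, ← Real.sqrt_eq_rpow, Real.sq_sqrt (by positivity)]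
  simp

theorem abs_apply_le_frobenius (A : M3) (i j : Fin 3) : |A i j| ≤ ‖A‖ := by
  refine abs_le_of_sq_le_sq' ?_ (norm_nonneg _) |> abs_le.2
  rw [frobenius_sq]
  exact (Finset.single_le_sum (f := fun j => A i j ^ 2) (fun _ _ => sq_nonneg _)
    (Finset.mem_univ j)).trans (Finset.single_le_sum (f := fun i => ∑ j, A i j ^ 2)
      (fun _ _ => Finset.sum_nonneg fun _ _ => sq_nonneg _) (Finset.mem_univ i))

theorem frobenius_le_sum (A : M3) : ‖A‖ ≤ ∑ i, ∑ j, |A i j| := by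
  have h0 : 0 ≤ ∑ i, ∑ j, |A i j| := by positivity
  refine le_of_sq_le_sq ?_ h0 |> id
  rw [frobenius_sq, ← Finset.sum_product', ← Finset.sum_product', Finset.univ_product_univ]
  simpa using Finset.sum_sq_le_sq_sum_of_nonneg (s := Finset.univ)
    (f := fun p : Fin 3 × Fin 3 => |A p.1 p.2|) (fun _ _ => abs_nonneg _)

theorem trace_mul_le_frobenius (A B : M3) : (Aᵀ * B).trace ≤ ‖A‖ * ‖B‖ := by
  have h : (Aᵀ * B).trace = ∑ p : Fin 3 × Fin 3, A p.1 p.2 * B p.1 p.2 := by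
    rw [← Finset.univ_product_univ, Finset.sum_product_right]
    simp [Matrix.trace, Matrix.mul_apply]
  have h1 := Finset.sum_mul_sq_le_sq_mul_sq Finset.univ
    (fun p : Fin 3 × Fin 3 => A p.1 p.2) (fun p => B p.1 p.2)
  rw [h]
  refine le_trans (le_abs_self _) (abs_le_of_sq_le_sq ?_ (by positivity))
  rw [mul_pow, frobenius_sq, frobenius_sq, ← Finset.sum_product', ← Finset.sum_product',
    Finset.univ_product_univ]
  exact h1

theorem trace_transpose_mul_self (A : M3) : (Aᵀ * A).trace = ‖A‖ ^ 2 := by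
  rw [frobenius_sq, Finset.sum_comm]
  simp [Matrix.trace, Matrix.mul_apply, sq]

/-- Polar decomposition with estimates: `R F = 1 + V`, where `2 V + V² = Fᵀ F - 1`. -/
theorem exists_polar {F : M3} (hF : 0 < F.det) : ∃ R ∈ SO3, ∃ V : M3, Vᵀ = V ∧ R * F = 1 + V ∧
    ‖V‖ ≤ ‖Fᵀ * F - 1‖ ∧ ‖V - (1 / 2 : ℝ) • (Fᵀ * F - 1)‖ ≤ 1 / 2 * ‖Fᵀ * F - 1‖ ^ 2 := by
  have hps : (Fᵀ * F).PosSemidef := by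
    simpa using Matrix.posSemidef_conjTranspose_mul_self F
  obtain ⟨S, hS, hSS⟩ := exists_posSemidef_sqrt hps
  have hSt : Sᵀ = S := by
    have := hS.isHermitian
    rwa [Matrix.IsHermitian, Matrix.conjTranspose_eq_transpose_of_trivial] at this
  have hu : IsUnit F.det := hF.ne'.isUnit
  have hdet : S.det * S.det = F.det * F.det := by
    rw [← Matrix.det_mul, hSS, Matrix.det_mul, Matrix.det_transpose]
  have hdS : S.det = F.det := by
    have := hS.det_nonneg
    nlinarith
  -- `S` is the positive root of FᵀF, so S F⁻¹ is the inverse of the rotation in the usual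
  -- decomposition F = R S; `V` measures the stretch.
  refine ⟨S * F⁻¹, ⟨?_, ?_⟩, S - 1, ?_, ?_, ?_⟩
  · rw [Matrix.transpose_mul, hSt, Matrix.mul_assoc, ← Matrix.mul_assoc S, hSS,
      Matrix.transpose_nonsing_inv, Matrix.mul_assoc, Matrix.mul_nonsing_inv _ hu, Matrix.mul_one,
      Matrix.nonsing_inv_mul _ (by rwa [Matrix.det_transpose])]
  · rw [Matrix.det_mul, Matrix.det_nonsing_inv, hdS, Ring.mul_inverse_cancel _ hu]
  · rw [Matrix.transpose_sub, hSt, Matrix.transpose_one]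
  · rw [Matrix.mul_assoc, Matrix.nonsing_inv_mul _ hu, Matrix.mul_one, add_sub_cancel]
  · set V := S - 1 with hV
    have hVt : Vᵀ = V := by rw [hV, Matrix.transpose_sub, hSt, Matrix.transpose_one]
    have hE : Fᵀ * F - 1 = V + V + V * V := by
      rw [← hSS, hV]; noncomm_ring
    -- With E = FᵀF - 1 = V + S V, pairing E with V gives ⟨V, E⟩ = ‖V‖² + tr(Vᵀ S V) ≥ ‖V‖², and
    -- Cauchy–Schwarz concludes. No smallness of V is needed.
    have h1 : ‖V‖ ≤ ‖Fᵀ * F - 1‖ := by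
      have h2 : (Vᵀ * (Fᵀ * F - 1)).trace = ‖V‖ ^ 2 + (Vᵀ * S * V).trace := by
        rw [← trace_transpose_mul_self, ← Matrix.trace_add, hE, hVt,
          show S = V + 1 by rw [hV]; noncomm_ring]
        congr 1
        noncomm_ring
      have h3 : 0 ≤ (Vᵀ * S * V).trace := by
        simpa using (hS.conjTranspose_mul_mul_same V).trace_nonneg
      have h4 := trace_mul_le_frobenius V (Fᵀ * F - 1)
      by_contra! hlt
      nlinarith [norm_nonneg V, norm_nonneg (Fᵀ * F - 1)]
    refine ⟨h1, ?_⟩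
    have h5 : V - (1 / 2 : ℝ) • (Fᵀ * F - 1) = -((1 / 2 : ℝ) • (V * V)) := by
      rw [hE]; module
    rw [h5, norm_neg, norm_smul, Real.norm_of_nonneg (by norm_num)]
    have h6 := Matrix.frobenius_norm_mul V V
    have h7 := mul_self_le_mul_self (norm_nonneg V) h1
    linarith

end Polar

/-! ### The stored energy near the rotations -/

section Density

theorem tendsto_clm_apply {ι E F : Type*} [NormedAddCommGroup E] [NormedSpace ℝ E]
    [NormedAddCommGroup F] [NormedSpace ℝ F] {l : Filter ι} {T : ι → E →L[ℝ] F} {T₀ : E →L[ℝ] F}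
    {v : ι → E} {v₀ : E} (hT : Tendsto T l (𝓝 T₀)) (hv : Tendsto v l (𝓝 v₀)) :
    Tendsto (fun i => T i (v i)) l (𝓝 (T₀ v₀)) :=
  (isBoundedBilinearMap_apply.continuous.tendsto (T₀, v₀)).comp (hT.prodMk_nhds hv)

/-- The properties of the stored energy at a fixed material point. -/
structure IsDensity (δ c : ℝ) (f : M3 → ℝ≥0∞) : Prop where
  pos : 0 < δ
  cpos : 0 < c
  finite : ∀ F ∈ tube δ, f F ≠ ⊤
  smooth : ContDiffOn ℝ 2 (fun F => (f F).toReal) (tube δ)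
  bound : ∀ F ∈ tube δ, ∀ G : M3, Gᵀ = G → |D2 f F G G| ≤ c * ‖G‖ ^ 2
  frame : ∀ F, ∀ R ∈ SO3, f F = f (R * F)
  zero : f 1 = 0

theorem one_mem_SO3 : (1 : M3) ∈ SO3 := by simp [SO3]

theorem isOpen_tube (δ : ℝ) : IsOpen (tube δ) :=
  isOpen_lt (Metric.continuous_infDist_pt _) continuous_const

theorem one_add_mem_tube {δ : ℝ} {V : M3} (hV : ‖V‖ < δ) : 1 + V ∈ tube δ :=
  lt_of_le_of_lt (Metric.infDist_le_dist_of_mem one_mem_SO3) (by simpa [dist_eq_norm] using hV)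

theorem one_mem_tube {δ : ℝ} (hδ : 0 < δ) : (1 : M3) ∈ tube δ := by
  simpa using one_add_mem_tube (V := 0) (by simpa using hδ)

theorem D2_eq (f : M3 → ℝ≥0∞) (F G H : M3) :
    D2 f F G H = fderiv ℝ (fderiv ℝ fun F' => (f F').toReal) F G H := by
  rw [D2, iteratedFDeriv_two_apply]
  rfl

/-- Both mixed terms are kept, so symmetry of the second derivative is not invoked. -/
theorem D2_polar (f : M3 → ℝ≥0∞) (F G H : M3) : D2 f F (G + H) (G + H) =
    D2 f F G G + (D2 f F G H + D2 f F H G) + D2 f F H H := by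
  simp only [D2_eq, map_add, add_apply]
  ring

theorem D2_smul (f : M3 → ℝ≥0∞) (F G H : M3) (s t : ℝ) :
    D2 f F (s • G) (t • H) = s * t * D2 f F G H := by
  simp only [D2_eq, map_smul, smul_apply, smul_eq_mul]
  ring

namespace IsDensity

variable {δ c : ℝ} {f : M3 → ℝ≥0∞}

/-- The form `D2 f F` is continuous on symmetric matrices. -/
theorem abs_D2_sub_le (hf : IsDensity δ c f) {F : M3} (hF : F ∈ tube δ) {G H : M3}
    (hG : Gᵀ = G) (hH : Hᵀ = H) {t : ℝ} (ht : 0 < t) :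
    |D2 f F (G + H) (G + H) - D2 f F G G| ≤ c * (2 * t * ‖G‖ ^ 2 + (2 / t + 1) * ‖H‖ ^ 2) := by
  set s := t⁻¹ with hs
  have hs0 : 0 < s := by positivity
  have hst : t * s = 1 := mul_inv_cancel₀ ht.ne'
  have hsym : ∀ r : ℝ, (G + r • H)ᵀ = G + r • H := fun r => by
    rw [Matrix.transpose_add, Matrix.transpose_smul, hG, hH]
  have hb : ∀ r : ℝ, |r| = s → |D2 f F (G + r • H) (G + r • H)| ≤
      c * (2 * ‖G‖ ^ 2 + 2 * s ^ 2 * ‖H‖ ^ 2) := by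
    intro r hr
    refine (hf.bound F hF _ (hsym r)).trans ?_
    have h1 : ‖G + r • H‖ ≤ ‖G‖ + s * ‖H‖ := by
      refine (norm_add_le _ _).trans ?_
      rw [norm_smul, Real.norm_eq_abs, hr]
    refine mul_le_mul_of_nonneg_left ?_ hf.cpos.le
    have h2 : ‖G + r • H‖ ^ 2 ≤ (‖G‖ + s * ‖H‖) ^ 2 := by gcongr
    nlinarith [sq_nonneg (‖G‖ - s * ‖H‖)]
  have h1 := hb s (abs_of_pos hs0)
  have h2 := hb (-s) (by rw [abs_neg, abs_of_pos hs0])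
  have hH2 := hf.bound F hF H hH
  have e1 := D2_polar f F G (s • H)
  have e2 := D2_polar f F G ((-s) • H)
  have e3 : ∀ r : ℝ, D2 f F G (r • H) = r * D2 f F G H := fun r => by
    simpa using D2_smul f F G H 1 r
  have e4 : ∀ r : ℝ, D2 f F (r • H) G = r * D2 f F H G := fun r => by
    simpa using D2_smul f F H G r 1
  rw [e3, e4, D2_smul] at e1 e2
  rw [D2_polar]
  set X := D2 f F G H + D2 f F H G
  set Y := D2 f F (G + s • H) (G + s • H)
  set Z := D2 f F (G + (-s) • H) (G + (-s) • H)
  -- The hypothesis bounds only diagonal values on symmetric matrices, and the form need not be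
  -- nonnegative away from the identity. The mixed term is therefore recovered by polarisation from
  -- `G ± s H`, with s = 1/t balancing the two contributions.
  have hX : X = t / 2 * (Y - Z) := by
    linear_combination (-t / 2) * e1 + (t / 2) * e2 - X * hst
  have hXb : |X| ≤ c * (2 * t * ‖G‖ ^ 2 + 2 / t * ‖H‖ ^ 2) := by
    rw [hX, abs_mul, abs_of_pos (by positivity)]
    calc t / 2 * |Y - Z| ≤ t / 2 * (c * (2 * ‖G‖ ^ 2 + 2 * s ^ 2 * ‖H‖ ^ 2) +
          c * (2 * ‖G‖ ^ 2 + 2 * s ^ 2 * ‖H‖ ^ 2)) := by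
          gcongr
          exact (abs_sub _ _).trans (add_le_add h1 h2)
      _ = c * (2 * t * ‖G‖ ^ 2 + 2 / t * ‖H‖ ^ 2) := by
          rw [hs]; field_simp; ring
  calc _ = |X + D2 f F H H| := by congr 1; ring
    _ ≤ |X| + |D2 f F H H| := abs_add_le _ _
    _ ≤ c * (2 * t * ‖G‖ ^ 2 + 2 / t * ‖H‖ ^ 2) + c * ‖H‖ ^ 2 := add_le_add hXb hH2
    _ = _ := by ring

theorem one_add_smul_mem_tube {V : M3} (hV : ‖V‖ < δ) {t : ℝ} (ht : t ∈ Icc (0 : ℝ) 1) :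
    1 + t • V ∈ tube δ := by
  refine one_add_mem_tube (lt_of_le_of_lt ?_ hV)
  rw [norm_smul, Real.norm_of_nonneg ht.1]
  exact mul_le_of_le_one_left (norm_nonneg _) ht.2

/-- Second order expansion at the identity. -/
theorem exists_taylor (hf : IsDensity δ c f) {V : M3} (hV : ‖V‖ < δ) :
    ∃ ξ ∈ Icc (0 : ℝ) 1, (f (1 + V)).toReal = 1 / 2 * D2 f (1 + ξ • V) V V := by
  set g : M3 → ℝ := fun F => (f F).toReal with hg
  have hmem : ∀ {t : ℝ}, t ∈ Icc (0 : ℝ) 1 → 1 + t • V ∈ tube δ := one_add_smul_mem_tube hV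
  have hat : ∀ {t : ℝ}, t ∈ Icc (0 : ℝ) 1 → ContDiffAt ℝ 2 g (1 + t • V) := fun ht =>
    hf.smooth.contDiffAt ((isOpen_tube δ).mem_nhds (hmem ht))
  have hline : ∀ t : ℝ, HasDerivAt (fun t : ℝ => 1 + t • V) V t := fun t => by
    exact (((hasDerivAt_id t).smul_const V).const_add (1 : M3)).congr_deriv (one_smul _ _)
  have h1 : ∀ t ∈ Icc (0 : ℝ) 1, HasDerivAt (fun t : ℝ => g (1 + t • V))
      (fderiv ℝ g (1 + t • V) V) t := fun t ht => by
    have hd := ((hat ht).differentiableAt (by norm_num)).hasFDerivAt.comp_hasDerivAt t (hline t)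
    exact hd
  have h2 : ∀ t ∈ Icc (0 : ℝ) 1, HasDerivAt (fun t : ℝ => fderiv ℝ g (1 + t • V) V)
      (D2 f (1 + t • V) V V) t := fun t ht => by
    have hd := (((hat ht).fderiv_right (m := 1) (by norm_num)).differentiableAt
      (by norm_num)).hasFDerivAt.comp_hasDerivAt t (hline t)
    rw [D2_eq]
    exact hd.clm_apply (hasDerivAt_const t V) |>.congr_deriv (by simp [hg]; rfl)
  have h00 : (0 : ℝ) ∈ Icc (0 : ℝ) 1 := by simp
  -- The energy is nonnegative and vanishes at the identity, so 0 minimises it along the line.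
  have hz : fderiv ℝ g (1 + (0 : ℝ) • V) V = 0 := by
    have hmin : IsLocalMin (fun t : ℝ => g (1 + t • V)) 0 := by
      refine Filter.Eventually.of_forall fun t => ?_
      simp [hg, hf.zero]
    exact hmin.hasDerivAt_eq_zero (h1 0 h00)
  -- Cauchy's mean value theorem against t² gives g(1) = g'(s)/(2s); the ordinary one then gives
  -- g'(s)/s = g''(ξ), as g'(0) = 0.
  obtain ⟨s, hs, hs'⟩ := exists_ratio_hasDerivAt_eq_ratio_slope (fun t : ℝ => g (1 + t • V)) _
    zero_lt_one (fun t ht => (h1 t ht).continuousAt.continuousWithinAt)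
    (fun t ht => h1 t (Ioo_subset_Icc_self ht)) (fun t : ℝ => t ^ 2) (fun t => 2 * t)
    (by fun_prop) (fun t _ => by simpa using hasDerivAt_pow 2 t)
  obtain ⟨ξ, hξ, hξ'⟩ := exists_hasDerivAt_eq_slope (fun t : ℝ => fderiv ℝ g (1 + t • V) V) _
    hs.1 (fun t ht => (h2 t ⟨ht.1, ht.2.trans hs.2.le⟩).continuousAt.continuousWithinAt)
    (fun t ht => h2 t ⟨ht.1.le, (ht.2.trans hs.2).le⟩)
  refine ⟨ξ, ⟨hξ.1.le, (hξ.2.trans hs.2).le⟩, ?_⟩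
  have hs0 := hs.1.ne'
  rw [hξ', hz]
  simp [hg, hf.zero] at hs'
  field_simp
  simp only [hg]
  linarith

/-- If the form were negative at `G`, continuity of the second derivative and the Taylor formula
would make the energy negative at 1 + tG for some small t. -/
theorem D2_one_nonneg (hf : IsDensity δ c f) (G : M3) : 0 ≤ D2 f 1 G G := by
  set g : M3 → ℝ := fun F => (f F).toReal with hg
  have hcont : Tendsto (fun F => D2 f F G G) (𝓝 1) (𝓝 (D2 f 1 G G)) := by
    have := (hf.smooth.contDiffAt ((isOpen_tube δ).mem_nhds (one_mem_tube hf.pos)))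
    have h1 : ContinuousAt (fderiv ℝ (fderiv ℝ g)) 1 :=
      ((this.fderiv_right (m := 1) (by norm_num)).fderiv_right (m := 0)
        (by norm_num)).continuousAt
    simp only [D2_eq]
    exact ((h1.clm_apply continuousAt_const).clm_apply continuousAt_const)
  by_contra! hlt
  obtain ⟨r, hr, hr'⟩ := Metric.eventually_nhds_iff.1 (hcont.eventually_lt_const hlt)
  set m := min r δ
  have hm : 0 < m := lt_min hr hf.pos
  set t := m / (2 * (‖G‖ + 1)) with ht
  have ht0 : 0 < t := by positivity
  have htG : ‖t • G‖ < m := by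
    rw [norm_smul, Real.norm_of_nonneg ht0.le, ht, div_mul_eq_mul_div, div_lt_iff₀ (by positivity)]
    nlinarith [norm_nonneg G]
  obtain ⟨ξ, hξ, h1⟩ := hf.exists_taylor (htG.trans_le (min_le_right _ _))
  have h2 : D2 f (1 + ξ • t • G) G G < 0 := by
    apply hr'
    rw [dist_eq_norm, add_sub_cancel_left, norm_smul, Real.norm_of_nonneg hξ.1]
    exact (mul_le_of_le_one_left (norm_nonneg _) hξ.2).trans_lt (htG.trans_le (min_le_left _ _))
  rw [D2_smul] at h1
  have h3 : 0 ≤ (f (1 + t • G)).toReal := ENNReal.toReal_nonneg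
  have : t * t * D2 f (1 + ξ • t • G) G G < 0 := mul_neg_of_pos_of_neg (by positivity) h2
  linarith

/-- The value at `F` near the rotations, through the strain `Fᵀ F - 1`. -/
theorem toReal_eq (hf : IsDensity δ c f) {F : M3} (hF : 0 < F.det)
    (hE : ‖Fᵀ * F - 1‖ < δ) : ∃ V : M3, Vᵀ = V ∧ ‖V‖ ≤ ‖Fᵀ * F - 1‖ ∧
      ‖V - (1 / 2 : ℝ) • (Fᵀ * F - 1)‖ ≤ 1 / 2 * ‖Fᵀ * F - 1‖ ^ 2 ∧ f F ≠ ⊤ ∧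
      ∃ ξ ∈ Icc (0 : ℝ) 1, 1 + ξ • V ∈ tube δ ∧
        (f F).toReal = 1 / 2 * D2 f (1 + ξ • V) V V := by
  obtain ⟨R, hR, V, hVt, hRV, h1, h2⟩ := exists_polar hF
  obtain ⟨ξ, hξ, h3⟩ := hf.exists_taylor (h1.trans_lt hE)
  refine ⟨V, hVt, h1, h2, ?_, ξ, hξ, one_add_smul_mem_tube (h1.trans_lt hE) hξ, ?_⟩
  · rw [hf.frame F R hR, hRV]
    exact hf.finite _ (one_add_mem_tube (h1.trans_lt hE))
  · rw [hf.frame F R hR, hRV, h3]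

/-- Supplies the dominating constant for the convergence of the scaled energies. -/
theorem le_of_strain (hf : IsDensity δ c f) {F : M3} (hF : 0 < F.det) (hE : ‖Fᵀ * F - 1‖ < δ) :
    f F ≤ ENNReal.ofReal (c * ‖Fᵀ * F - 1‖ ^ 2) := by
  obtain ⟨V, hVt, h1, -, hfin, ξ, hξ, hmem, heq⟩ := hf.toReal_eq hF hE
  rw [← ENNReal.ofReal_toReal hfin, heq]
  refine ENNReal.ofReal_le_ofReal ?_
  have h2 := (abs_le.1 (hf.bound _ hmem V hVt)).2
  have h3 : c * ‖V‖ ^ 2 ≤ c * ‖Fᵀ * F - 1‖ ^ 2 := by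
    have := hf.cpos.le
    gcongr
  have : 0 ≤ c * ‖Fᵀ * F - 1‖ ^ 2 := by have := hf.cpos.le; positivity
  linarith

/-- If the strain is `2 h² G + O(h³)`, the energy is `h⁴ Q(G) / 2 + o(h⁴)`. -/
theorem tendsto_of_strain (hf : IsDensity δ c f) {F : ℝ → M3} {G : M3} {C : ℝ}
    (hF : ∀ᶠ h in 𝓝[>] (0 : ℝ), 0 < (F h).det ∧
      ‖(F h)ᵀ * F h - 1 - (2 * h ^ 2) • G‖ ≤ C * h ^ 3) :
    Tendsto (fun h => (ENNReal.ofReal (h ^ 4))⁻¹ * f (F h)) (𝓝[>] 0)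
      (𝓝 (ENNReal.ofReal (1 / 2 * D2 f 1 G G))) := by
  set K := 2 * ‖G‖ + |C| with hK
  have hK0 : 0 ≤ K := by positivity
  have hsmall : ∀ᶠ h in 𝓝[>] (0 : ℝ), 0 < h ∧ h ≤ 1 ∧ K * h ^ 2 < δ := by
    have h1 : Tendsto (fun h : ℝ => K * h ^ 2) (𝓝[>] 0) (𝓝 0) := by
      have : Tendsto (fun h : ℝ => K * h ^ 2) (𝓝 0) (𝓝 (K * 0 ^ 2)) :=
        Continuous.tendsto (by fun_prop) 0
      simpa using this.mono_left nhdsWithin_le_nhds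
    filter_upwards [self_mem_nhdsWithin, h1.eventually_lt_const hf.pos,
      Ioc_mem_nhdsGT (zero_lt_one (α := ℝ))] with h h1 h2 h3
    exact ⟨h1, h3.2, h2⟩
  -- The stretch divided by h² is within O(h) of `G`: the polar decomposition costs O(‖E‖²) = O(h⁴)
  -- before division, and the hypothesis on the strain costs O(h³).
  have hkey : ∀ᶠ h in 𝓝[>] (0 : ℝ), ∃ V : M3, ‖(h ^ 2)⁻¹ • V - G‖ ≤ (|C| + K ^ 2) * h ∧
      ‖V‖ ≤ K * h ^ 2 ∧ ∃ ξ ∈ Icc (0 : ℝ) 1, (ENNReal.ofReal (h ^ 4))⁻¹ * f (F h) =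
        ENNReal.ofReal (1 / 2 * D2 f (1 + ξ • V) ((h ^ 2)⁻¹ • V) ((h ^ 2)⁻¹ • V)) := by
    filter_upwards [hF, hsmall] with h ⟨hdet, hstr⟩ ⟨h0, h1, hK'⟩
    set E := (F h)ᵀ * F h - 1 with hE
    have hEK : ‖E‖ ≤ K * h ^ 2 := by
      have e1 : E = (E - (2 * h ^ 2) • G) + (2 * h ^ 2) • G := by abel
      have e2 : C * h ^ 3 ≤ |C| * h ^ 2 := by
        calc C * h ^ 3 ≤ |C| * h ^ 3 := by gcongr; exact le_abs_self _
          _ ≤ |C| * h ^ 2 := by gcongr ?_ * ?_; exact pow_le_pow_of_le_one h0.le h1 (by norm_num)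
      rw [e1]
      refine (norm_add_le _ _).trans ?_
      rw [norm_smul, Real.norm_of_nonneg (by positivity)]
      rw [hK]
      linarith
    obtain ⟨V, hVt, hV1, hV2, hfin, ξ, hξ, hmem, heq⟩ := hf.toReal_eq hdet (hEK.trans_lt hK')
    refine ⟨V, ?_, hV1.trans hEK, ξ, hξ, ?_⟩
    · have e1 : (h ^ 2)⁻¹ • V - G = (h ^ 2)⁻¹ • ((V - (1 / 2 : ℝ) • E) +
          (1 / 2 : ℝ) • (E - (2 * h ^ 2) • G)) := by
        have : (h ^ 2)⁻¹ * (1 / 2 * (2 * h ^ 2)) = 1 := by field_simp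
        have e0 : (h ^ 2)⁻¹ • (1 / 2 : ℝ) • (2 * h ^ 2) • G = G := by
          rw [smul_smul, smul_smul, mul_assoc, this, one_smul]
        rw [smul_add, smul_sub _ V, smul_sub _ E, smul_sub _ _ (_ • _ • G), e0]
        abel
      rw [e1, norm_smul, norm_inv, Real.norm_of_nonneg (by positivity), inv_mul_le_iff₀
        (by positivity)]
      refine (norm_add_le _ _).trans ?_
      rw [norm_smul, Real.norm_of_nonneg (by norm_num : (0 : ℝ) ≤ 1 / 2)]
      have e2 : ‖E‖ ^ 2 ≤ (K * h ^ 2) ^ 2 := by gcongr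
      have e3 : (K * h ^ 2) ^ 2 ≤ K ^ 2 * h ^ 3 := by
        rw [mul_pow, ← pow_mul]
        gcongr ?_ * ?_
        exact pow_le_pow_of_le_one h0.le h1 (by norm_num)
      have e4 : C * h ^ 3 ≤ |C| * h ^ 3 := by gcongr; exact le_abs_self _
      have e5 : 0 ≤ K ^ 2 * h ^ 3 := by positivity
      have e6 : 0 ≤ |C| * h ^ 3 := by positivity
      calc _ ≤ 1 / 2 * (K ^ 2 * h ^ 3) + 1 / 2 * (|C| * h ^ 3) := by linarith
        _ ≤ _ := by linarith
    · rw [← ENNReal.ofReal_toReal hfin, heq, ← ENNReal.ofReal_inv_of_pos (by positivity),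
        ← ENNReal.ofReal_mul (by positivity), D2_smul]
      congr 1
      field_simp
  have hex : ∃ (V : ℝ → M3) (ξ : ℝ → ℝ), ∀ᶠ h in 𝓝[>] (0 : ℝ),
      ‖(h ^ 2)⁻¹ • V h - G‖ ≤ (|C| + K ^ 2) * h ∧ ‖V h‖ ≤ K * h ^ 2 ∧ ξ h ∈ Icc (0 : ℝ) 1 ∧
      (ENNReal.ofReal (h ^ 4))⁻¹ * f (F h) =
        ENNReal.ofReal (1 / 2 * D2 f (1 + ξ h • V h) ((h ^ 2)⁻¹ • V h) ((h ^ 2)⁻¹ • V h)) := by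
    obtain ⟨s, hs, hs'⟩ := hkey.exists_mem
    choose! V h1 h2 ξ hξ h3 using hs'
    exact ⟨V, ξ, Filter.mem_of_superset hs fun h hh => ⟨h1 h hh, h2 h hh, hξ h hh, h3 h hh⟩⟩
  obtain ⟨V, ξ, hVξ⟩ := hex
  have hlin : Tendsto (fun h : ℝ => (|C| + K ^ 2) * h) (𝓝[>] 0) (𝓝 0) := by
    have : Tendsto (fun h : ℝ => (|C| + K ^ 2) * h) (𝓝 0) (𝓝 ((|C| + K ^ 2) * 0)) :=
      Continuous.tendsto (by fun_prop) 0
    simpa using this.mono_left nhdsWithin_le_nhds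
  have hquad : Tendsto (fun h : ℝ => K * h ^ 2) (𝓝[>] 0) (𝓝 0) := by
    have : Tendsto (fun h : ℝ => K * h ^ 2) (𝓝 0) (𝓝 (K * 0 ^ 2)) :=
      Continuous.tendsto (by fun_prop) 0
    simpa using this.mono_left nhdsWithin_le_nhds
  have hVG : Tendsto (fun h => (h ^ 2)⁻¹ • V h) (𝓝[>] 0) (𝓝 G) := by
    refine tendsto_iff_norm_sub_tendsto_zero.2 ?_
    exact squeeze_zero' (Eventually.of_forall fun _ => norm_nonneg _)
      (hVξ.mono fun h hh => hh.1) hlin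
  have hV1 : Tendsto (fun h => 1 + ξ h • V h) (𝓝[>] 0) (𝓝 (1 : M3)) := by
    refine tendsto_iff_norm_sub_tendsto_zero.2 ?_
    refine squeeze_zero' (Eventually.of_forall fun _ => norm_nonneg _)
      (hVξ.mono fun h hh => ?_) hquad
    rw [add_sub_cancel_left, norm_smul, Real.norm_of_nonneg hh.2.2.1.1]
    exact (mul_le_of_le_one_left (norm_nonneg _) hh.2.2.1.2).trans hh.2.1
  have hcont : ContinuousAt (fderiv ℝ (fderiv ℝ fun F' => (f F').toReal)) 1 :=
    (((hf.smooth.contDiffAt ((isOpen_tube δ).mem_nhds (one_mem_tube hf.pos))).fderiv_right (m := 1)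
      (by norm_num)).fderiv_right (m := 0) (by norm_num)).continuousAt
  have hD : Tendsto (fun h => D2 f (1 + ξ h • V h) ((h ^ 2)⁻¹ • V h) ((h ^ 2)⁻¹ • V h)) (𝓝[>] 0)
      (𝓝 (D2 f 1 G G)) := by
    simp only [D2_eq]
    have h1 : Tendsto (fun h => fderiv ℝ (fderiv ℝ fun F' => (f F').toReal) (1 + ξ h • V h))
        (𝓝[>] 0) (𝓝 (fderiv ℝ (fderiv ℝ fun F' => (f F').toReal) 1)) := hcont.tendsto.comp hV1
    exact tendsto_clm_apply (tendsto_clm_apply h1 hVG) hVG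
  refine (ENNReal.tendsto_ofReal (hD.const_mul (1 / 2))).congr' ?_
  filter_upwards [hVξ] with h hh
  exact hh.2.2.2.symm

end IsDensity

end Density

/-! ### The stored energy on a domain -/

section Energy

variable {Ω : Set V3} {W : V3 → M3 → ℝ≥0∞}

theorem IsStoredEnergy.exists_isDensity (hW : IsStoredEnergy Ω W) : ∃ δ > 0, ∃ c > 0,
    (∀ᵐ x ∂(volume.restrict Ω), IsDensity δ c (W x)) ∧
    ∀ G H, AEMeasurable (fun x => D2 (W x) 1 G H) (volume.restrict Ω) := by
  obtain ⟨δ, hδ, h1, h2, -, c, hc, h4⟩ := hW.smooth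
  refine ⟨δ, hδ, c, hc, ?_, fun G H => h2 1 (one_mem_tube hδ) G H⟩
  filter_upwards [h1, h4, hW.frame_indifferent, hW.zero_on_rotations] with x h1 h4 hf hz
  exact ⟨hδ, hc, h1.1, h1.2, h4, hf, hz 1 one_mem_SO3⟩

/-- The Carathéodory argument: for simple `F` the composition is a finite sum over the values, and
continuity of W(x, ·) for a.e. x passes to the limit of simple approximations. -/
theorem IsStoredEnergy.aemeasurable_comp (hW : IsStoredEnergy Ω W) {F : V3 → M3}
    (hF : AEStronglyMeasurable F (volume.restrict Ω)) :
    AEMeasurable (fun x => W x (F x)) (volume.restrict Ω) := by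
  obtain ⟨F', hF', hFF'⟩ := hF
  refine AEMeasurable.congr (f := fun x => W x (F' x)) ?_
    (hFF'.mono fun x hx => by simp only [hx])
  refine aemeasurable_of_tendsto_metrizable_ae atTop
    (f := fun n x => W x (hF'.approx n x)) (fun n => ?_) ?_
  · have : (fun x => W x (hF'.approx n x)) = fun x => ∑ A ∈ (hF'.approx n).range,
        ((hF'.approx n) ⁻¹' {A}).indicator (fun x => W x A) x := by
      ext x
      rw [Finset.sum_eq_single (hF'.approx n x)]
      · simp
      · intro A _ hA
        exact indicator_of_notMem (fun h => hA h.symm) _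
      · intro h
        exact absurd (SimpleFunc.mem_range_self _ x) h
    rw [this]
    exact Finset.aemeasurable_fun_sum _ fun A _ =>
      (hW.measurable A).indicator ((hF'.approx n).measurableSet_fiber A)
  · filter_upwards [hW.continuous] with x hx
    exact (hx.tendsto _).comp (hF'.tendsto_approx x)

theorem aestronglyMeasurable_matrix {μ : Measure V3} {F : V3 → M3}
    (hF : ∀ i j, AEStronglyMeasurable (fun x => F x i j) μ) : AEStronglyMeasurable F μ := by
  have : F = fun x => ∑ i, ∑ j, F x i j • Matrix.single i j (1 : ℝ) := by
    ext x : 1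
    conv_lhs => rw [Matrix.matrix_eq_sum_single (F x)]
    simp
  rw [this]
  exact Finset.aestronglyMeasurable_fun_sum _ fun i _ =>
    Finset.aestronglyMeasurable_fun_sum _ fun j _ => (hF i j).smul_const _

/-- Measurability of the form in x is assumed for fixed matrices only; expanding in matrix units
yields it for variable matrices. -/
theorem D2_expand (f : M3 → ℝ≥0∞) (F G : M3) : D2 f F G G = ∑ i, ∑ j, ∑ k, ∑ l,
    G i j * G k l * D2 f F (Matrix.single i j 1) (Matrix.single k l 1) := by
  have hG : G = ∑ i, ∑ j, G i j • Matrix.single i j (1 : ℝ) := by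
    conv_lhs => rw [Matrix.matrix_eq_sum_single G]
    simp
  simp only [D2_eq]
  set T := fderiv ℝ (fderiv ℝ fun F' => (f F').toReal) F
  have h1 : ∀ H : M3, T G H = ∑ i, ∑ j, G i j * T (Matrix.single i j 1) H := fun H => by
    conv_lhs => rw [hG]
    simp only [map_sum, map_smul, sum_apply, smul_apply, smul_eq_mul]
  have h2 : ∀ H : M3, T H G = ∑ k, ∑ l, G k l * T H (Matrix.single k l 1) := fun H => by
    conv_lhs => rw [hG]
    simp only [map_sum, map_smul, smul_eq_mul]
  rw [h1]
  refine Finset.sum_congr rfl fun i _ => Finset.sum_congr rfl fun j _ => ?_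
  rw [h2, Finset.mul_sum]
  refine Finset.sum_congr rfl fun k _ => ?_
  rw [Finset.mul_sum]
  exact Finset.sum_congr rfl fun l _ => by ring

theorem IsStoredEnergy.aestronglyMeasurable_Q3 (hW : IsStoredEnergy Ω W) {G : V3 → M3}
    (hG : ∀ i j, AEStronglyMeasurable (fun x => G x i j) (volume.restrict Ω)) :
    AEStronglyMeasurable (fun x => Q3 W x (G x)) (volume.restrict Ω) := by
  obtain ⟨δ, -, c, -, -, hm⟩ := hW.exists_isDensity
  simp only [Q3, D2_expand _ _ (G _)]
  exact Finset.aestronglyMeasurable_fun_sum _ fun i _ =>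
    Finset.aestronglyMeasurable_fun_sum _ fun j _ =>
    Finset.aestronglyMeasurable_fun_sum _ fun k _ =>
    Finset.aestronglyMeasurable_fun_sum _ fun l _ =>
    ((hG i j).mul (hG k l)).mul (hm _ _).aestronglyMeasurable

theorem integrable_frobenius_sq {μ : Measure V3} {G : V3 → M3}
    (hG : ∀ i j, MemLp (fun x => G x i j) 2 μ) : Integrable (fun x => ‖G x‖ ^ 2) μ := by
  simp only [frobenius_sq]
  exact integrable_finsetSum _ fun i _ => integrable_finsetSum _ fun j _ => (hG i j).integrable_sq

theorem IsStoredEnergy.integrable_Q3 (hW : IsStoredEnergy Ω W) {G : V3 → M3}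
    (hG : ∀ i j, MemLp (fun x => G x i j) 2 (volume.restrict Ω)) (hs : ∀ x, (G x)ᵀ = G x) :
    IntegrableOn (fun x => Q3 W x (G x)) Ω := by
  obtain ⟨δ, hδ, c, -, hd, -⟩ := hW.exists_isDensity
  refine Integrable.mono' ((integrable_frobenius_sq hG).const_mul c)
    (hW.aestronglyMeasurable_Q3 fun i j => (hG i j).1) ?_
  filter_upwards [hd] with x hx
  exact hx.bound 1 (one_mem_tube hδ) _ (hs x)

theorem integral_sq_eq {μ : Measure V3} {f : V3 → ℝ} (hf : MemLp f 2 μ) :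
    ∫ x, f x ^ 2 ∂μ = (eLpNorm f 2 μ ^ 2).toReal := by
  rw [eLpNorm_two_sq, integral_eq_lintegral_of_nonneg_ae (ae_of_all _ fun _ => sq_nonneg _)
    (hf.1.pow 2)]
  congr 1
  refine lintegral_congr fun x => ?_
  rw [← ofReal_norm, ← ENNReal.ofReal_pow (norm_nonneg _), Real.norm_eq_abs, sq_abs]

/-- The limit energy is continuous in `L²`. -/
theorem IsStoredEnergy.exists_abs_integral_Q3_sub_le (hW : IsStoredEnergy Ω W) {G : V3 → M3}
    (hG : ∀ i j, MemLp (fun x => G x i j) 2 (volume.restrict Ω)) (hs : ∀ x, (G x)ᵀ = G x)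
    {ε : ℝ} (hε : 0 < ε) : ∃ η > 0, ∀ G' : V3 → M3, (∀ x, (G' x)ᵀ = G' x) →
      (∀ i j, MemLp (fun x => G' x i j) 2 (volume.restrict Ω)) →
      (∀ i j, eLpNorm (fun x => G' x i j - G x i j) 2 (volume.restrict Ω) ≤ ENNReal.ofReal η) →
      |(∫ x in Ω, Q3 W x (G' x)) - ∫ x in Ω, Q3 W x (G x)| ≤ ε := by
  obtain ⟨δ, hδ, c, hc, hd, -⟩ := hW.exists_isDensity
  set I := ∫ x in Ω, ‖G x‖ ^ 2 with hI
  have hI0 : 0 ≤ I := integral_nonneg fun _ => by positivity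
  -- This choice makes the part proportional to ‖G‖² at most ε/2; `K` collects the nine entries of
  -- the difference, and η ≤ 1 allows η² ≤ η.
  set t := ε / (4 * c * (I + 1)) with ht
  have ht0 : 0 < t := by positivity
  set K := c * (2 / t + 1) * 9 with hK
  have hK0 : 0 < K := by positivity
  set η := min 1 (ε / (2 * K)) with hη
  have hη0 : 0 < η := by positivity
  refine ⟨η, hη0, fun G' hs' hG' hclose => ?_⟩
  set D : V3 → M3 := fun x => G' x - G x with hD
  have hDm : ∀ i j, MemLp (fun x => D x i j) 2 (volume.restrict Ω) := fun i j =>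
    (hG' i j).sub (hG i j)
  have hDs : ∀ x, (D x)ᵀ = D x := fun x => by rw [hD, Matrix.transpose_sub, hs', hs]
  have hDI : ∫ x in Ω, ‖D x‖ ^ 2 ≤ 9 * η := by
    simp only [frobenius_sq]
    rw [integral_finsetSum _ fun i _ => integrable_finsetSum _ fun j _ => (hDm i j).integrable_sq]
    have h1 : ∀ i, ∫ x in Ω, ∑ j, D x i j ^ 2 ≤ 3 * η := fun i => by
      rw [integral_finsetSum _ fun j _ => (hDm i j).integrable_sq]
      have h2 : ∀ j, ∫ x in Ω, D x i j ^ 2 ≤ η := fun j => by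
        rw [integral_sq_eq (hDm i j)]
        refine ENNReal.toReal_le_of_le_ofReal hη0.le ?_
        refine (pow_le_pow_left' (hclose i j) 2).trans ?_
        rw [← ENNReal.ofReal_pow hη0.le]
        refine ENNReal.ofReal_le_ofReal ?_
        have : η ≤ 1 := min_le_left _ _
        nlinarith
      refine (Finset.sum_le_sum fun j _ => h2 j).trans (by simp)
    refine (Finset.sum_le_sum fun j _ => h1 j).trans (le_of_eq ?_)
    simp
    ring
  rw [← integral_sub (hW.integrable_Q3 hG' hs') (hW.integrable_Q3 hG hs)]
  have hint1 := (integrable_frobenius_sq hG).const_mul (c * (2 * t))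
  have hint2 := (integrable_frobenius_sq hDm).const_mul (c * (2 / t + 1))
  rw [← Real.norm_eq_abs]
  calc _ ≤ ∫ x in Ω, (c * (2 * t) * ‖G x‖ ^ 2 + c * (2 / t + 1) * ‖D x‖ ^ 2) := by
        refine norm_integral_le_of_norm_le (hint1.add hint2) ?_
        filter_upwards [hd] with x hx
        have h1 := hx.abs_D2_sub_le (one_mem_tube hδ) (hs x) (hDs x) ht0
        rw [hD, add_sub_cancel] at h1
        refine h1.trans (le_of_eq ?_)
        ring
    _ = c * (2 * t) * I + c * (2 / t + 1) * ∫ x in Ω, ‖D x‖ ^ 2 := by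
        rw [integral_add hint1 hint2, integral_const_mul, integral_const_mul]
    _ ≤ c * (2 * t) * (I + 1) + c * (2 / t + 1) * (9 * η) := by gcongr; linarith
    _ = ε / 2 + K * η := by rw [hK, ht]; field_simp; ring
    _ ≤ ε / 2 + K * (ε / (2 * K)) := by gcongr; exact min_le_right _ _
    _ = ε := by field_simp; ring

/-- Convergence of the scaled energies, for uniformly controlled deformation gradients. -/
theorem IsStoredEnergy.tendsto_energy (hW : IsStoredEnergy Ω W) (hΩ : MeasurableSet Ω)
    (hfin : volume Ω ≠ ⊤) {F : ℝ → V3 → M3} {G : V3 → M3} {C : ℝ}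
    (hFm : ∀ᶠ h in 𝓝[>] (0 : ℝ), ∀ i j,
      AEStronglyMeasurable (fun x => F h x i j) (volume.restrict Ω))
    (hG : ∀ i j, MemLp (fun x => G x i j) 2 (volume.restrict Ω)) (hs : ∀ x, (G x)ᵀ = G x)
    (hGb : ∀ x ∈ Ω, ‖G x‖ ≤ C)
    (hF : ∀ᶠ h in 𝓝[>] (0 : ℝ), ∀ x ∈ Ω, 0 < (F h x).det ∧
      ‖(F h x)ᵀ * F h x - 1 - (2 * h ^ 2) • G x‖ ≤ C * h ^ 3) :
    Tendsto (fun h => (ENNReal.ofReal (h ^ 4))⁻¹ * ∫⁻ x in Ω, W x (F h x)) (𝓝[>] 0)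
      (𝓝 (ENNReal.ofReal (1 / 2 * ∫ x in Ω, Q3 W x (G x)))) := by
  obtain ⟨δ, hδ, c, hc, hd, -⟩ := hW.exists_isDensity
  have hlim : ENNReal.ofReal (1 / 2 * ∫ x in Ω, Q3 W x (G x)) =
      ∫⁻ x in Ω, ENNReal.ofReal (1 / 2 * Q3 W x (G x)) := by
    rw [← integral_const_mul]
    refine ofReal_integral_eq_lintegral_ofReal ((hW.integrable_Q3 hG hs).const_mul _) ?_
    filter_upwards [hd] with x hx
    exact mul_nonneg (by norm_num) (hx.D2_one_nonneg _)
  have hpos : ∀ᶠ h in 𝓝[>] (0 : ℝ), h ∈ Ioc (0 : ℝ) 1 := Ioc_mem_nhdsGT one_pos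
  have hmul : ∀ᶠ h in 𝓝[>] (0 : ℝ), (∫⁻ x in Ω, (ENNReal.ofReal (h ^ 4))⁻¹ * W x (F h x)) =
      (ENNReal.ofReal (h ^ 4))⁻¹ * ∫⁻ x in Ω, W x (F h x) := by
    filter_upwards [hpos] with h hh
    refine lintegral_const_mul' _ _ (ENNReal.inv_ne_top.2 ?_)
    simpa using pow_pos hh.1 4
  rw [hlim]
  refine Tendsto.congr' hmul ?_
  have hsmall : ∀ᶠ h in 𝓝[>] (0 : ℝ), 3 * |C| * h ^ 2 < δ := by
    have h1 : Tendsto (fun h : ℝ => 3 * |C| * h ^ 2) (𝓝[>] 0) (𝓝 0) := by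
      have : Tendsto (fun h : ℝ => 3 * |C| * h ^ 2) (𝓝 0) (𝓝 (3 * |C| * 0 ^ 2)) :=
        Continuous.tendsto (by fun_prop) 0
      simpa using this.mono_left nhdsWithin_le_nhds
    exact h1.eventually_lt_const hδ
  -- The strain is at most 3|C|h², so the energy is at most c(3|C|)²h⁴ and its h⁻⁴ multiple is
  -- dominated by a constant on a set of finite measure.
  refine tendsto_lintegral_filter_of_dominated_convergence'
    (fun _ => ENNReal.ofReal (c * (3 * |C|) ^ 2)) ?_ ?_ ?_ ?_
  · filter_upwards [hFm] with h hh
    exact (hW.aemeasurable_comp (aestronglyMeasurable_matrix hh)).const_mul _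
  · filter_upwards [hF, hpos, hsmall] with h hFh hh hsm
    filter_upwards [hd, ae_restrict_mem hΩ] with x hx hxΩ
    obtain ⟨hdet, hE⟩ := hFh x hxΩ
    have hG' := (hGb x hxΩ).trans (le_abs_self C)
    have h0 := hh.1
    have hE' : ‖(F h x)ᵀ * F h x - 1‖ ≤ 3 * |C| * h ^ 2 := by
      have e1 : (F h x)ᵀ * F h x - 1 = ((F h x)ᵀ * F h x - 1 - (2 * h ^ 2) • G x) +
        (2 * h ^ 2) • G x := by abel
      have e2 : C * h ^ 3 ≤ |C| * h ^ 2 := by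
        calc C * h ^ 3 ≤ |C| * h ^ 3 := by gcongr; exact le_abs_self _
          _ ≤ |C| * h ^ 2 := by
            gcongr ?_ * ?_; exact pow_le_pow_of_le_one h0.le hh.2 (by norm_num)
      rw [e1]
      refine (norm_add_le _ _).trans ?_
      rw [norm_smul, Real.norm_of_nonneg (by positivity)]
      have e3 : 2 * h ^ 2 * ‖G x‖ ≤ 2 * h ^ 2 * |C| := by gcongr
      linarith
    have h1 := hx.le_of_strain hdet (hE'.trans_lt hsm)
    calc _ ≤ (ENNReal.ofReal (h ^ 4))⁻¹ * ENNReal.ofReal (c * (3 * |C| * h ^ 2) ^ 2) := by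
          refine mul_le_mul_right (h1.trans (ENNReal.ofReal_le_ofReal ?_)) _
          gcongr
      _ = _ := by
          rw [← ENNReal.ofReal_inv_of_pos (by positivity), ← ENNReal.ofReal_mul (by positivity)]
          congr 1
          field_simp
  · rw [lintegral_const]
    exact ENNReal.mul_ne_top ENNReal.ofReal_ne_top (by simpa using hfin)
  · filter_upwards [hd, ae_restrict_mem hΩ] with x hx hxΩ
    exact hx.tendsto_of_strain (hF.mono fun h hh => hh x hxΩ)

end Energy

/-! ### Recovery deformations of smooth displacements -/

section Recovery

variable {L : ℝ} {ω : Set V2} {θ₂ θ₃ : ℝ → ℝ}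

/-- The skew matrix with entries `a`, `b`, `w`. -/
def skewM (a b w : ℝ) : M3 := !![0, -a, -b; a, 0, -w; b, w, 0]

variable (θ₂ θ₃) in
/-- The derivatives of `κ` in terms of `D = ∇γ`. -/
def kapD (x : V3) (D : Fin 3 → Fin 3 → ℝ) (k i : Fin 3) : ℝ :=
  Re θ₂ θ₃ (x 0) k 1 * (D i 1 - fN θ₂ θ₃ (x 0) i) + Re θ₂ θ₃ (x 0) k 2 * (D i 2 - fB θ₂ θ₃ (x 0) i)

variable (θ₂ θ₃) in
/-- The coefficient of order `h²` of the deformation gradient, in terms of the derivatives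
`u'`, `v' = (a, b)`, `w`, `v'' = (a', b')`, `w'` and `D = ∇γ`. -/
def bMat (x : V3) (u' a b w a' b' w' : ℝ) (D : Fin 3 → Fin 3 → ℝ) : M3 :=
  !![u' + a * deriv θ₂ (x 0) + b * deriv θ₃ (x 0) - xp θ₂ θ₃ x 1 * a' - xp θ₂ θ₃ x 2 * b',
      kapD θ₂ θ₃ x D 1 0, kapD θ₂ θ₃ x D 2 0;
     w * deriv θ₃ (x 0) - xp θ₂ θ₃ x 2 * w',
      a * deriv θ₂ (x 0) + kapD θ₂ θ₃ x D 1 1, a * deriv θ₃ (x 0) + kapD θ₂ θ₃ x D 2 1;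
     -(w * deriv θ₂ (x 0)) + xp θ₂ θ₃ x 1 * w',
      b * deriv θ₂ (x 0) + kapD θ₂ θ₃ x D 1 2, b * deriv θ₃ (x 0) + kapD θ₂ θ₃ x D 2 2]

variable (θ₂ θ₃) in
/-- The coefficient of order `h` of `frameMat`. -/
def frameMat₁ (x : V3) : M3 :=
  !![0, -aCoef θ₂ θ₃ (x 0), -cCoef θ₂ θ₃ (x 0);
     deriv θ₂ (x 0) + (x 1 * deriv (p₂ θ₂ θ₃) (x 0) - x 2 * deriv (p₃ θ₂ θ₃) (x 0)), 0, 0;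
     deriv θ₃ (x 0) + (x 1 * deriv (p₃ θ₂ θ₃) (x 0) + x 2 * deriv (p₂ θ₂ θ₃) (x 0)), 0, 0]

/-- A displacement: stretch, bending, twist and warping. -/
structure Disp where
  /-- the stretch -/
  u : ℝ → ℝ
  /-- the twist -/
  w : ℝ → ℝ
  /-- the first bending component -/
  v₂ : ℝ → ℝ
  /-- the second bending component -/
  v₃ : ℝ → ℝ
  /-- the warping -/
  γ : V3 → V3

variable (L ω θ₂ θ₃) in
/-- Smooth displacements that satisfy the constraints on every cross-section. -/
structure Disp.IsSmooth (d : Disp) : Prop where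
  u : ContDiff ℝ 1 d.u
  w : ContDiff ℝ 1 d.w
  v₂ : ContDiff ℝ 2 d.v₂
  v₃ : ContDiff ℝ 2 d.v₃
  diff : ∀ x ∈ cyl L ω, ∀ i, DifferentiableAt ℝ (fun z => d.γ z i) x
  bound : ∀ i, Ob (cyl L ω) 0 (fun _ x => d.γ x i)
  bound_fderiv : ∀ i k, Ob (cyl L ω) 0 (fun _ x => fderiv ℝ (fun z => d.γ z i) x (e k))
  mean : ∀ t ∈ Ioo 0 L, ∀ i, secInt ω (fun x => d.γ x i) t = 0
  twist : ∀ t ∈ Ioo 0 L, secInt ω (fun x => xp θ₂ θ₃ x 2 * d.γ x 1 - xp θ₂ θ₃ x 1 * d.γ x 2) t = 0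

namespace Disp

variable (d : Disp)

/-- The part of the recovery deformation that is constant on cross-sections. -/
def zA (h t : ℝ) : V3 := ![h ^ 2 * d.u t, h * d.v₂ t, h * d.v₃ t]

variable (θ₂ θ₃)

/-- The coefficient of `x₂` in the recovery deformation. -/
def zB (h t : ℝ) : V3 :=
  ![-(h ^ 2 * (p₂ θ₂ θ₃ t * deriv d.v₂ t + p₃ θ₂ θ₃ t * deriv d.v₃ t)),
    -(h ^ 2 * (p₃ θ₂ θ₃ t * d.w t)), h ^ 2 * (p₂ θ₂ θ₃ t * d.w t)] - h • nuN θ₂ θ₃ h t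

/-- The coefficient of `x₃` in the recovery deformation. -/
def zC (h t : ℝ) : V3 :=
  ![-(h ^ 2 * (p₂ θ₂ θ₃ t * deriv d.v₃ t - p₃ θ₂ θ₃ t * deriv d.v₂ t)),
    -(h ^ 2 * (p₂ θ₂ θ₃ t * d.w t)), -(h ^ 2 * (p₃ θ₂ θ₃ t * d.w t))] - h • nuB θ₂ θ₃ h t

/-- The recovery deformation, in the coordinates of the cylinder. -/
def recov (h : ℝ) (x : V3) : V3 := fun i => ThetaP θ₂ θ₃ h x i +
  ((d.zA h (x 0) i + x 1 * d.zB θ₂ θ₃ h (x 0) i + x 2 * d.zC θ₂ θ₃ h (x 0) i) +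
    h ^ 3 * d.γ x i)

/-- The coefficient of order `h` of the deformation gradient. -/
def A (t : ℝ) : M3 := skewM (deriv d.v₂ t) (deriv d.v₃ t) (d.w t)

/-- The coefficient of order `h²` of the deformation gradient. -/
def B (x : V3) : M3 := bMat θ₂ θ₃ x (deriv d.u (x 0)) (deriv d.v₂ (x 0)) (deriv d.v₃ (x 0))
  (d.w (x 0)) (deriv (deriv d.v₂) (x 0)) (deriv (deriv d.v₃) (x 0)) (deriv d.w (x 0))
  fun i k => fderiv ℝ (fun z => d.γ z i) x (e k)

/-- The remainder in the gradient of the recovery deformation. -/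
def remQ (h : ℝ) (x : V3) : M3 := Matrix.of fun i =>
  ![h ^ 3 * fderiv ℝ (fun z => d.γ z i) x (e 0) -
      h * (x 1 * deriv (fun t => nuN θ₂ θ₃ h t i) (x 0) +
        x 2 * deriv (fun t => nuB θ₂ θ₃ h t i) (x 0)),
    -(nuN θ₂ θ₃ h (x 0) i - h ^ 2 * fN θ₂ θ₃ (x 0) i),
    -(nuB θ₂ θ₃ h (x 0) i - h ^ 2 * fB θ₂ θ₃ (x 0) i)]

/-- The scaled gradient of the recovery displacement. -/
def Q (h : ℝ) (x : V3) : M3 := h • (d.A (x 0) * Re θ₂ θ₃ (x 0)) +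
  h ^ 2 • (d.A (x 0) * frameMat₁ θ₂ θ₃ x + d.B θ₂ θ₃ x * Re θ₂ θ₃ (x 0)) + d.remQ θ₂ θ₃ h x

variable {θ₂ θ₃ d}

theorem Q_apply (h : ℝ) (x : V3) (i j : Fin 3) : d.Q θ₂ θ₃ h x i j =
    h * (d.A (x 0) i 0 * Re θ₂ θ₃ (x 0) 0 j + d.A (x 0) i 1 * Re θ₂ θ₃ (x 0) 1 j +
      d.A (x 0) i 2 * Re θ₂ θ₃ (x 0) 2 j) +
    h ^ 2 * (d.A (x 0) i 0 * frameMat₁ θ₂ θ₃ x 0 j + d.A (x 0) i 1 * frameMat₁ θ₂ θ₃ x 1 j +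
      d.A (x 0) i 2 * frameMat₁ θ₂ θ₃ x 2 j + (d.B θ₂ θ₃ x i 0 * Re θ₂ θ₃ (x 0) 0 j +
      d.B θ₂ θ₃ x i 1 * Re θ₂ θ₃ (x 0) 1 j + d.B θ₂ θ₃ x i 2 * Re θ₂ θ₃ (x 0) 2 j)) +
    (![h ^ 3 * fderiv ℝ (fun z => d.γ z i) x (e 0) -
      h * (x 1 * deriv (fun t => nuN θ₂ θ₃ h t i) (x 0) +
        x 2 * deriv (fun t => nuB θ₂ θ₃ h t i) (x 0)),
      -(nuN θ₂ θ₃ h (x 0) i - h ^ 2 * fN θ₂ θ₃ (x 0) i),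
      -(nuB θ₂ θ₃ h (x 0) i - h ^ 2 * fB θ₂ θ₃ (x 0) i)] : V3) j := by
  simp only [Q, Matrix.add_apply, Matrix.smul_apply, Matrix.mul_apply, Fin.sum_univ_three, remQ,
    Matrix.of_apply, smul_eq_mul]

theorem hasFDerivAt_rowL_fderiv {f : V3 → ℝ} {x : V3} (hf : DifferentiableAt ℝ f x) :
    HasFDerivAt f (rowL fun k => fderiv ℝ f x (e k)) x := by
  convert! hf.hasFDerivAt using 1
  ext w
  rw [rowL_apply]
  conv_rhs => rw [pi_eq_sum_univ' w, map_sum]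
  refine Finset.sum_congr rfl fun k _ => ?_
  rw [map_smul, smul_eq_mul, mul_comm, e]

/-- `Q` is arranged so that `Q * scaleMat` is the derivative of the recovery map minus Θ^h∘P^h. The
entries of `B` contain derivatives of `κ` in rotated variables; multiplying by `Re` rotates them
back, by p₂² + p₃² = 1. -/
theorem IsSmooth.hasFDerivAt_recov (hd : d.IsSmooth L ω θ₂ θ₃) (hc : IsCurve L θ₂ θ₃) {h : ℝ}
    (hh : h ∈ Ioc (0 : ℝ) 1) {x : V3} (hx : x ∈ cyl L ω) :
    HasFDerivAt (d.recov θ₂ θ₃ h)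
      (matL ((frameMat θ₂ θ₃ h x + d.Q θ₂ θ₃ h x) * scaleMat h)) x := by
  have hx0 := hx.1
  have hps := hc.p_sq hx0
  have hu := (strictDeriv_of_contDiffOn hd.u.contDiffOn hx0)
  have hw := (strictDeriv_of_contDiffOn hd.w.contDiffOn hx0)
  have hv2 := (strictDeriv_of_contDiffOn (hd.v₂.of_le (by norm_num)).contDiffOn hx0)
  have hv3 := (strictDeriv_of_contDiffOn (hd.v₃.of_le (by norm_num)).contDiffOn hx0)
  have hv2' := strictDeriv_of_contDiffOn
    ((contDiff_succ_iff_deriv (n := 1)).1 hd.v₂).2.2.contDiffOn hx0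
  have hv3' := strictDeriv_of_contDiffOn
    ((contDiff_succ_iff_deriv (n := 1)).1 hd.v₃).2.2.contDiffOn hx0
  have hp2 := hc.p₂.toO1.strictDeriv hh hx0
  have hp3 := hc.p₃.toO1.strictDeriv hh hx0
  have hN := fun i => ((hc.O1_nuN' i).strictDeriv hh hx0).const_mul h
  have hB := fun i => ((hc.O1_nuB' i).strictDeriv hh hx0).const_mul h
  have key : ∀ i, ∃ A' B' C' : ℝ, HasStrictDerivAt (fun t => d.zA h t i) A' (x 0) ∧
      HasStrictDerivAt (fun t => d.zB θ₂ θ₃ h t i) B' (x 0) ∧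
      HasStrictDerivAt (fun t => d.zC θ₂ θ₃ h t i) C' (x 0) ∧
      (d.Q θ₂ θ₃ h x * scaleMat h) i = ![A' + x 1 * B' + x 2 * C' +
        h ^ 3 * fderiv ℝ (fun z => d.γ z i) x (e 0),
        d.zB θ₂ θ₃ h (x 0) i + h ^ 3 * fderiv ℝ (fun z => d.γ z i) x (e 1),
        d.zC θ₂ θ₃ h (x 0) i + h ^ 3 * fderiv ℝ (fun z => d.γ z i) x (e 2)] := by
    intro i
    fin_cases i
    · refine ⟨_, _, _, hu.const_mul (h ^ 2), (((hp2.mul hv2').add (hp3.mul hv3')).const_mul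
        (h ^ 2)).neg.sub (hN 0), (((hp2.mul hv3').sub (hp3.mul hv2')).const_mul
        (h ^ 2)).neg.sub (hB 0), ?_⟩
      ext j
      rw [scaleMat, Matrix.mul_diagonal]
      fin_cases j
      · simp [Q_apply, A, B, bMat, kapD, skewM, frameMat₁, Re, aCoef, cCoef, xp, Matrix.mulVec, dotProduct, Fin.sum_univ_three]
        ring
      · simp [Q_apply, A, B, bMat, kapD, skewM, frameMat₁, Re, aCoef, cCoef, zB, zC]
        linear_combination (h ^ 3 * (fderiv ℝ (fun z => d.γ z 0) x (e 1) - fN θ₂ θ₃ (x 0) 0)) * hps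
      · simp [Q_apply, A, B, bMat, kapD, skewM, frameMat₁, Re, aCoef, cCoef, zB, zC]
        linear_combination (h ^ 3 * (fderiv ℝ (fun z => d.γ z 0) x (e 2) - fB θ₂ θ₃ (x 0) 0)) * hps
    · refine ⟨_, _, _, hv2.const_mul h, ((hp3.mul hw).const_mul (h ^ 2)).neg.sub (hN 1),
        ((hp2.mul hw).const_mul (h ^ 2)).neg.sub (hB 1), ?_⟩
      ext j
      rw [scaleMat, Matrix.mul_diagonal]
      fin_cases j
      · simp [Q_apply, A, B, bMat, kapD, skewM, frameMat₁, Re, aCoef, cCoef, xp, Matrix.mulVec, dotProduct, Fin.sum_univ_three]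
        ring
      · simp [Q_apply, A, B, bMat, kapD, skewM, frameMat₁, Re, aCoef, cCoef, zB, zC]
        linear_combination (h ^ 3 * (fderiv ℝ (fun z => d.γ z 1) x (e 1) - fN θ₂ θ₃ (x 0) 1)) * hps
      · simp [Q_apply, A, B, bMat, kapD, skewM, frameMat₁, Re, aCoef, cCoef, zB, zC]
        linear_combination (h ^ 3 * (fderiv ℝ (fun z => d.γ z 1) x (e 2) - fB θ₂ θ₃ (x 0) 1)) * hps
    · refine ⟨_, _, _, hv3.const_mul h, ((hp2.mul hw).const_mul (h ^ 2)).sub (hN 2),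
        ((hp3.mul hw).const_mul (h ^ 2)).neg.sub (hB 2), ?_⟩
      ext j
      rw [scaleMat, Matrix.mul_diagonal]
      fin_cases j
      · simp [Q_apply, A, B, bMat, kapD, skewM, frameMat₁, Re, aCoef, cCoef, xp, Matrix.mulVec, dotProduct, Fin.sum_univ_three]
        ring
      · simp [Q_apply, A, B, bMat, kapD, skewM, frameMat₁, Re, aCoef, cCoef, zB, zC]
        linear_combination (h ^ 3 * (fderiv ℝ (fun z => d.γ z 2) x (e 1) - fN θ₂ θ₃ (x 0) 2)) * hps
      · simp [Q_apply, A, B, bMat, kapD, skewM, frameMat₁, Re, aCoef, cCoef, zB, zC]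
        linear_combination (h ^ 3 * (fderiv ℝ (fun z => d.γ z 2) x (e 2) - fB θ₂ θ₃ (x 0) 2)) * hps
  rw [hasFDerivAt_matL_iff]
  intro i
  obtain ⟨A', B', C', hA, hB, hC, hQ⟩ := key i
  have h1 := hasFDerivAt_matL_iff.1 (hc.hasStrictFDerivAt_ThetaP hh hx0).hasFDerivAt i
  have h2 := (hasStrictFDerivAt_affine hA hB hC).hasFDerivAt
  have h3 := (hasFDerivAt_rowL_fderiv (hd.diff x hx i)).const_mul (h ^ 3)
  refine (h1.add (h2.add h3)).congr_fderiv ?_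
  ext z
  simp only [add_apply, smul_apply, rowL_apply, smul_eq_mul, Matrix.add_mul, Matrix.add_apply,
    Fin.sum_univ_three, hQ]
  simp
  ring

end Disp

end Recovery

/-! ### Expansion of the deformation gradient -/

section Expansion

variable {L : ℝ} {ω : Set V2} {θ₂ θ₃ : ℝ → ℝ} {d : Disp}

theorem Ob.exists_norm_le {Ω : Set V3} {k : ℕ} {G : ℝ → V3 → M3}
    (hG : ∀ i j, Ob Ω k (fun h x => G h x i j)) :
    ∃ C : ℝ, 0 ≤ C ∧ ∀ h ∈ Ioc (0 : ℝ) 1, ∀ x ∈ Ω, ‖G h x‖ ≤ C * h ^ k := by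
  choose C hC using hG
  refine ⟨∑ i, ∑ j, |C i j|, by positivity, fun h hh x hx => ?_⟩
  refine (frobenius_le_sum _).trans ?_
  simp only [Finset.sum_mul]
  refine Finset.sum_le_sum fun i _ => Finset.sum_le_sum fun j _ => (hC i j h hh x hx).trans ?_
  have := pow_nonneg hh.1.le k
  gcongr
  exact le_abs_self _

theorem Ob_of_continuous {f : ℝ → ℝ} (hf : Continuous f) :
    Ob (cyl L ω) 0 (fun _ x => f (x 0)) := by
  obtain ⟨C, hC⟩ := (isCompact_Icc (a := (0 : ℝ)) (b := L)).exists_bound_of_continuousOn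
    hf.continuousOn
  exact ⟨C, fun h _ x hx => by simpa using hC (x 0) (Ioo_subset_Icc_self hx.1)⟩

namespace IsCurve

theorem Ob_frameMat₁ (hc : IsCurve L θ₂ θ₃) (hω : IsCrossSection ω) (i j : Fin 3) :
    Ob (cyl L ω) 0 (fun _ x => frameMat₁ θ₂ θ₃ x i j) := by
  have h2 := hc.memC₂.O1_deriv.toOb (ω := ω)
  have h3 := hc.memC₃.O1_deriv.toOb (ω := ω)
  have x1 := Ob_coord (L := L) hω 1
  have x2 := Ob_coord (L := L) hω 2
  have ha := hc.O1_a.toOb (ω := ω)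
  have hcc := hc.O1_c.toOb (ω := ω)
  have hp2 := hc.p₂.toO1.toOb_deriv (ω := ω)
  have hp3 := hc.p₃.toO1.toOb_deriv (ω := ω)
  fin_cases i <;> fin_cases j
  · exact Ob.const _ 0
  · exact ha.neg
  · exact hcc.neg
  · exact h2.add ((x1.mul hp2).sub (x2.mul hp3))
  · exact Ob.const _ 0
  · exact Ob.const _ 0
  · exact h3.add ((x1.mul hp3).add (x2.mul hp2))
  · exact Ob.const _ 0
  · exact Ob.const _ 0

theorem deriv_normal (hc : IsCurve L θ₂ θ₃) {h : ℝ} (hh : h ∈ Ioc (0 : ℝ) 1) {t : ℝ}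
    (ht : t ∈ Ioo 0 L) (i : Fin 3) : deriv (fun t => normal θ₂ θ₃ h t i) t =
      deriv (fun t => nuN θ₂ θ₃ h t i) t +
      (![-(h * deriv (aCoef θ₂ θ₃) t), deriv (CurvedRod.p₂ θ₂ θ₃) t,
        deriv (CurvedRod.p₃ θ₂ θ₃) t] : V3) i := by
  have h1 := ((hc.O1_nuN' i).strictDeriv hh ht).hasDerivAt
  simp only [normal_apply]
  refine (h1.add ?_).deriv
  fin_cases i
  · exact ((hc.O1_a.strictDeriv hh ht).hasDerivAt.const_mul h).neg
  · exact (hc.p₂.toO1.strictDeriv hh ht).hasDerivAt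
  · exact (hc.p₃.toO1.strictDeriv hh ht).hasDerivAt

theorem deriv_binormal (hc : IsCurve L θ₂ θ₃) {h : ℝ} (hh : h ∈ Ioc (0 : ℝ) 1) {t : ℝ}
    (ht : t ∈ Ioo 0 L) (i : Fin 3) : deriv (fun t => binormal θ₂ θ₃ h t i) t =
      deriv (fun t => nuB θ₂ θ₃ h t i) t +
      (![-(h * deriv (cCoef θ₂ θ₃) t), -deriv (CurvedRod.p₃ θ₂ θ₃) t,
        deriv (CurvedRod.p₂ θ₂ θ₃) t] : V3) i := by
  have h1 := ((hc.O1_nuB' i).strictDeriv hh ht).hasDerivAt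
  simp only [binormal_apply]
  refine (h1.add ?_).deriv
  fin_cases i
  · exact ((hc.O1_c.strictDeriv hh ht).hasDerivAt.const_mul h).neg
  · exact (hc.p₃.toO1.strictDeriv hh ht).hasDerivAt.neg
  · exact (hc.p₂.toO1.strictDeriv hh ht).hasDerivAt

theorem sub_sub_smul_apply (A B C : M3) (h : ℝ) (i j : Fin 3) :
    (A - B - h • C) i j = A i j - B i j - h * C i j := rfl

theorem Ob_frameMat_sub (hc : IsCurve L θ₂ θ₃) (hω : IsCrossSection ω) (i j : Fin 3) :
    Ob (cyl L ω) 2 (fun h x =>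
      (frameMat θ₂ θ₃ h x - Re θ₂ θ₃ (x 0) - h • frameMat₁ θ₂ θ₃ x) i j) := by
  have hn := fun i => (hc.O1_nuN' i).toOb (ω := ω)
  have hb := fun i => (hc.O1_nuB' i).toOb (ω := ω)
  have hn' := fun i => (hc.O1_nuN' i).toOb_deriv (ω := ω)
  have hb' := fun i => (hc.O1_nuB' i).toOb_deriv (ω := ω)
  have h1 := Ob.pow (cyl L ω) 1
  have h2 := Ob.pow (cyl L ω) 2
  have x1 := Ob_coord (L := L) hω 1
  have x2 := Ob_coord (L := L) hω 2
  have ha := hc.O1_a.toOb_deriv (ω := ω)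
  have hcc := hc.O1_c.toOb_deriv (ω := ω)
  have hcol : ∀ i, Ob (cyl L ω) 2 (fun h x =>
      h * (x 1 * deriv (fun t => nuN θ₂ θ₃ h t i) (x 0) +
      x 2 * deriv (fun t => nuB θ₂ θ₃ h t i) (x 0))) := fun i =>
    ((h1.mul ((x1.mul (hn' i)).add (x2.mul (hb' i)))).mono (k := 2) (by norm_num)).congr
      fun h _ x _ => by ring
  fin_cases j
  · fin_cases i
    · refine ((hcol 0).sub (h2.mul ((x1.mul ha).add (x2.mul hcc)))).congr fun h hh x hx => ?_
      rw [sub_sub_smul_apply]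
      simp [frameMat, frameMat₁, Re, hc.deriv_normal hh hx.1, hc.deriv_binormal hh hx.1]; ring
    · refine (hcol 1).congr fun h hh x hx => ?_
      rw [sub_sub_smul_apply]
      simp [frameMat, frameMat₁, Re, hc.deriv_normal hh hx.1, hc.deriv_binormal hh hx.1]; ring
    · refine (hcol 2).congr fun h hh x hx => ?_
      rw [sub_sub_smul_apply]
      simp [frameMat, frameMat₁, Re, hc.deriv_normal hh hx.1, hc.deriv_binormal hh hx.1]; ring
  · fin_cases i
    · exact (hn 0).congr fun h hh x hx => by
        rw [sub_sub_smul_apply]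
        simp [frameMat, frameMat₁, Re, normal_apply]
    · exact (hn 1).congr fun h hh x hx => by
        rw [sub_sub_smul_apply]
        simp [frameMat, frameMat₁, Re, normal_apply]
    · exact (hn 2).congr fun h hh x hx => by
        rw [sub_sub_smul_apply]
        simp [frameMat, frameMat₁, Re, normal_apply]
  · fin_cases i
    · exact (hb 0).congr fun h hh x hx => by
        rw [sub_sub_smul_apply]
        simp [frameMat, frameMat₁, Re, binormal_apply]
    · exact (hb 1).congr fun h hh x hx => by
        rw [sub_sub_smul_apply]
        simp [frameMat, frameMat₁, Re, binormal_apply]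
    · exact (hb 2).congr fun h hh x hx => by
        rw [sub_sub_smul_apply]
        simp [frameMat, frameMat₁, Re, binormal_apply]

/-- The adjugate has bounded entries and the determinant is at least 1/2. -/
theorem exists_norm_inv_frameMat_le (hc : IsCurve L θ₂ θ₃) (hω : IsCrossSection ω) :
    ∃ C : ℝ, 0 ≤ C ∧ ∀ h ∈ Ioc (0 : ℝ) 1, ∀ x ∈ cyl L ω, 1 / 2 ≤ (frameMat θ₂ θ₃ h x).det →
      ‖(frameMat θ₂ θ₃ h x)⁻¹‖ ≤ C := by
  have hp : ∀ i j, Ob (cyl L ω) 0 (fun h x => frameMat θ₂ θ₃ h x i j) := fun i j =>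
    (((hc.Ob_frameMat hω i j).mono (by norm_num)).add (hc.Ob_Re i j)).congr fun h _ x _ => by ring
  have hm : ∀ i j k l i' j' k' l', Ob (cyl L ω) 0 (fun h x =>
      frameMat θ₂ θ₃ h x i j * frameMat θ₂ θ₃ h x k l -
      frameMat θ₂ θ₃ h x i' j' * frameMat θ₂ θ₃ h x k' l') := fun i j k l i' j' k' l' =>
    ((hp i j).mul (hp k l)).sub ((hp i' j').mul (hp k' l'))
  have hm' : ∀ i j k l i' j' k' l', Ob (cyl L ω) 0 (fun h x =>
      -(frameMat θ₂ θ₃ h x i j * frameMat θ₂ θ₃ h x k l) +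
      frameMat θ₂ θ₃ h x i' j' * frameMat θ₂ θ₃ h x k' l') := fun i j k l i' j' k' l' =>
    ((hp i j).mul (hp k l)).neg.add ((hp i' j').mul (hp k' l'))
  have hadj : ∀ i j, Ob (cyl L ω) 0 (fun h x => (frameMat θ₂ θ₃ h x).adjugate i j) := by
    intro i j
    simp only [Matrix.adjugate_fin_three]
    fin_cases i <;> fin_cases j <;>
      first
      | exact hm _ _ _ _ _ _ _ _
      | exact hm' _ _ _ _ _ _ _ _
  obtain ⟨C, hC0, hC⟩ := Ob.exists_norm_le hadj
  refine ⟨2 * C, by positivity, fun h hh x hx hdet => ?_⟩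
  rw [Matrix.inv_def, norm_smul, Ring.inverse_eq_inv', norm_inv,
    Real.norm_of_nonneg (by linarith)]
  have h1 := hC h hh x hx
  rw [pow_zero, mul_one] at h1
  refine mul_le_mul ?_ h1 (norm_nonneg _) (by norm_num)
  rw [inv_le_comm₀ (by linarith) (by norm_num)]
  linarith

end IsCurve

namespace Disp

theorem IsSmooth.Ob_A (hd : d.IsSmooth L ω θ₂ θ₃) (i j : Fin 3) :
    Ob (cyl L ω) 0 (fun _ x => d.A (x 0) i j) := by
  have h2 := Ob_of_continuous (L := L) (ω := ω) (hd.v₂.continuous_deriv (by norm_num))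
  have h3 := Ob_of_continuous (L := L) (ω := ω) (hd.v₃.continuous_deriv (by norm_num))
  have hw := Ob_of_continuous (L := L) (ω := ω) hd.w.continuous
  fin_cases i <;> fin_cases j
  · exact Ob.const _ 0
  · exact h2.neg
  · exact h3.neg
  · exact h2
  · exact Ob.const _ 0
  · exact hw.neg
  · exact h3
  · exact hw
  · exact Ob.const _ 0

theorem IsSmooth.Ob_B (hd : d.IsSmooth L ω θ₂ θ₃) (hc : IsCurve L θ₂ θ₃) (hω : IsCrossSection ω)
    (i j : Fin 3) : Ob (cyl L ω) 0 (fun _ x => d.B θ₂ θ₃ x i j) := by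
  have hC2 : ∀ {f : ℝ → ℝ}, ContDiff ℝ 2 f → ContDiff ℝ 1 (deriv f) := fun hf =>
    ((contDiff_succ_iff_deriv (n := 1)).1 hf).2.2
  have hu := Ob_of_continuous (L := L) (ω := ω) (hd.u.continuous_deriv le_rfl)
  have h2 := Ob_of_continuous (L := L) (ω := ω) (hC2 hd.v₂).continuous
  have h3 := Ob_of_continuous (L := L) (ω := ω) (hC2 hd.v₃).continuous
  have h2' := Ob_of_continuous (L := L) (ω := ω) ((hC2 hd.v₂).continuous_deriv le_rfl)
  have h3' := Ob_of_continuous (L := L) (ω := ω) ((hC2 hd.v₃).continuous_deriv le_rfl)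
  have hw := Ob_of_continuous (L := L) (ω := ω) hd.w.continuous
  have hw' := Ob_of_continuous (L := L) (ω := ω) (hd.w.continuous_deriv le_rfl)
  have t2 := hc.memC₂.O1_deriv.toOb (ω := ω)
  have t3 := hc.memC₃.O1_deriv.toOb (ω := ω)
  have hx : ∀ k, Ob (cyl L ω) 0 (fun _ x => xp θ₂ θ₃ x k) := fun k =>
    ((((hc.Ob_Re k 0).mul (Ob_coord hω 0)).add ((hc.Ob_Re k 1).mul (Ob_coord hω 1))).add
      ((hc.Ob_Re k 2).mul (Ob_coord hω 2))).congr fun h _ x _ => by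
        simp [xp, Matrix.mulVec, dotProduct, Fin.sum_univ_three]
  have hk : ∀ k i, Ob (cyl L ω) 0 (fun _ x => kapD θ₂ θ₃ x
      (fun i k => fderiv ℝ (fun z => d.γ z i) x (e k)) k i) := fun k i =>
    ((hc.Ob_Re k 1).mul ((hd.bound_fderiv i 1).sub (hc.O1_fN i).toOb)).add
      ((hc.Ob_Re k 2).mul ((hd.bound_fderiv i 2).sub (hc.O1_fB i).toOb))
  fin_cases i <;> fin_cases j
  · exact (((hu.add (h2.mul t2)).add (h3.mul t3)).sub ((hx 1).mul h2')).sub ((hx 2).mul h3')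
  · exact hk 1 0
  · exact hk 2 0
  · exact (hw.mul t3).sub ((hx 2).mul hw')
  · exact (h2.mul t2).add (hk 1 1)
  · exact (h2.mul t3).add (hk 2 1)
  · exact (hw.mul t2).neg.add ((hx 1).mul hw')
  · exact (h3.mul t2).add (hk 1 2)
  · exact (h3.mul t3).add (hk 2 2)

theorem IsSmooth.Ob_remQ (hd : d.IsSmooth L ω θ₂ θ₃) (hc : IsCurve L θ₂ θ₃)
    (hω : IsCrossSection ω) (i j : Fin 3) :
    Ob (cyl L ω) 3 (fun h x => d.remQ θ₂ θ₃ h x i j) := by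
  fin_cases j
  · refine (((Ob.pow _ 3).mul (hd.bound_fderiv i 0)).sub
      ((Ob.pow _ 1).mul (((Ob_coord hω 1).mul (hc.O1_nuN' i).toOb_deriv).add
      ((Ob_coord hω 2).mul (hc.O1_nuB' i).toOb_deriv)))).congr fun h _ x _ => ?_
    simp [remQ]
  · exact (hc.O1_nuN i).toOb.neg
  · exact (hc.O1_nuB i).toOb.neg

variable (θ₂ θ₃) in
/-- The deformation gradient of the recovery deformation. -/
def F (d : Disp) (h : ℝ) (x : V3) : M3 :=
  (frameMat θ₂ θ₃ h x + d.Q θ₂ θ₃ h x) * (frameMat θ₂ θ₃ h x)⁻¹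

/-- With P = `frameMat` one has F = 1 + Q P⁻¹. Since P = Re + h P₁ + O(h²), the part of `Q` of
orders h and h² is exactly what (hA + h²B)P produces at these orders, so Q - (hA + h²B)P = O(h³),
and P⁻¹ is bounded. -/
theorem IsSmooth.exists_expansion (hd : d.IsSmooth L ω θ₂ θ₃) (hc : IsCurve L θ₂ θ₃)
    (hω : IsCrossSection ω) : ∃ C : ℝ, 1 ≤ C ∧ ∀ h ∈ Ioc (0 : ℝ) 1, ∀ x ∈ cyl L ω,
      1 / 2 ≤ (frameMat θ₂ θ₃ h x).det → ‖d.A (x 0)‖ ≤ C ∧ ‖d.B θ₂ θ₃ x‖ ≤ C ∧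
      ‖d.F θ₂ θ₃ h x - 1 - h • d.A (x 0) - h ^ 2 • d.B θ₂ θ₃ x‖ ≤ C * h ^ 3 := by
  obtain ⟨C₁, hC₁, h1⟩ := Ob.exists_norm_le hd.Ob_A
  obtain ⟨C₂, hC₂, h2⟩ := Ob.exists_norm_le (hd.Ob_B hc hω)
  obtain ⟨C₃, hC₃, h3⟩ := Ob.exists_norm_le (hd.Ob_remQ hc hω)
  obtain ⟨C₄, hC₄, h4⟩ := Ob.exists_norm_le (hc.Ob_frameMat_sub hω)
  obtain ⟨C₅, hC₅, h5⟩ := Ob.exists_norm_le (hc.Ob_frameMat₁ hω)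
  obtain ⟨C₆, hC₆, h6⟩ := hc.exists_norm_inv_frameMat_le hω
  set K := (C₃ + (C₁ + C₂) * C₄ + C₂ * C₅) * C₆ with hK
  have hK0 : 0 ≤ K := by positivity
  refine ⟨1 + C₁ + C₂ + K, by linarith, fun h hh x hx hdet => ?_⟩
  have h0 := hh.1
  have hA := h1 h hh x hx
  have hB := h2 h hh x hx
  have hP1 := h5 h hh x hx
  rw [pow_zero, mul_one] at hA hB hP1
  refine ⟨by linarith, by linarith, ?_⟩
  have hR := h3 h hh x hx
  have hP2 := h4 h hh x hx
  have hinv := h6 h hh x hx hdet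
  set A := d.A (x 0)
  set B := d.B θ₂ θ₃ x
  set R := d.remQ θ₂ θ₃ h x
  set P := frameMat θ₂ θ₃ h x with hP
  set P1 := frameMat₁ θ₂ θ₃ x
  set P2 := P - Re θ₂ θ₃ (x 0) - h • P1 with hP2def
  have hu : IsUnit P.det := (by linarith : (0 : ℝ) < P.det).ne'.isUnit
  have hX : d.F θ₂ θ₃ h x - 1 - h • A - h ^ 2 • B =
      (R - (h • A + h ^ 2 • B) * P2 - h ^ 3 • (B * P1)) * P⁻¹ := by
    -- The three leftovers are the remainder of `Q`, the O(h²) part of P hit by hA + h²B, and the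
    -- product h²B · hP₁.
    have e1 : R - (h • A + h ^ 2 • B) * P2 - h ^ 3 • (B * P1) =
        d.Q θ₂ θ₃ h x - (h • A + h ^ 2 • B) * P := by
      have e2 : P = Re θ₂ θ₃ (x 0) + h • P1 + P2 := by rw [hP2def]; abel
      conv_rhs => rw [e2]
      simp only [Q, Matrix.mul_add, Matrix.add_mul, Matrix.smul_mul, Matrix.mul_smul]
      module
    rw [e1, Matrix.sub_mul, Matrix.mul_assoc, Matrix.mul_nonsing_inv _ hu, Matrix.mul_one, F,
      Matrix.add_mul, ← hP, Matrix.mul_nonsing_inv _ hu]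
    abel
  rw [hX]
  have hlin : ‖h • A + h ^ 2 • B‖ ≤ (C₁ + C₂) * h := by
    refine (norm_add_le _ _).trans ?_
    rw [norm_smul, norm_smul, Real.norm_of_nonneg h0.le, Real.norm_of_nonneg (by positivity)]
    have e3 : h ^ 2 ≤ h := by nlinarith [hh.2]
    calc _ ≤ h * C₁ + h * C₂ := by gcongr
      _ = _ := by ring
  have hin : ‖R - (h • A + h ^ 2 • B) * P2 - h ^ 3 • (B * P1)‖ ≤
      (C₃ + (C₁ + C₂) * C₄ + C₂ * C₅) * h ^ 3 := by
    have e4 := (Matrix.frobenius_norm_mul (h • A + h ^ 2 • B) P2).trans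
      (mul_le_mul hlin hP2 (norm_nonneg _) (by positivity))
    have e5 := (Matrix.frobenius_norm_mul B P1).trans
      (mul_le_mul hB hP1 (norm_nonneg _) (by positivity))
    have e6 : ‖h ^ 3 • (B * P1)‖ ≤ h ^ 3 * (C₂ * C₅) := by
      rw [norm_smul, Real.norm_of_nonneg (by positivity)]
      gcongr
    refine (norm_sub_le _ _).trans ((add_le_add ((norm_sub_le _ _).trans
      (add_le_add hR e4)) e6).trans (le_of_eq ?_))
    ring
  refine ((Matrix.frobenius_norm_mul _ _).trans (mul_le_mul hin hinv (norm_nonneg _)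
    (by positivity))).trans ?_
  have e7 : 0 ≤ (1 + C₁ + C₂) * h ^ 3 := by positivity
  calc _ = K * h ^ 3 := by rw [hK]; ring
    _ ≤ _ := by linarith

end Disp

/-- The strain of a deformation gradient `1 + h A + h² B + O(h³)` with skew `A`. -/
theorem norm_strain_sub_le {A B F : M3} {C h : ℝ} (hC : 1 ≤ C) (h0 : 0 < h) (h1 : h ≤ 1)
    (hAs : Aᵀ = -A) (hA : ‖A‖ ≤ C) (hB : ‖B‖ ≤ C)
    (hF : ‖F - 1 - h • A - h ^ 2 • B‖ ≤ C * h ^ 3) :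
    ‖Fᵀ * F - 1 - (2 * h ^ 2) • symPart (B - (1 / 2 : ℝ) • (A * A))‖ ≤ 10 * C ^ 2 * h ^ 3 ∧
    ‖F - 1 - h • A‖ ≤ 2 * C * h ^ 2 := by
  set E := F - 1 - h • A - h ^ 2 • B with hE
  set Z := F - 1 - h • A with hZ
  set X := F - 1 with hX
  have hh2 : h ^ 3 ≤ h ^ 2 := pow_le_pow_of_le_one h0.le h1 (by norm_num)
  have hh1 : h ^ 2 ≤ h := by nlinarith
  have hZn : ‖Z‖ ≤ 2 * C * h ^ 2 := by
    rw [show Z = E + h ^ 2 • B by rw [hE]; abel]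
    refine (norm_add_le _ _).trans ?_
    rw [norm_smul, Real.norm_of_nonneg (by positivity)]
    calc _ ≤ C * h ^ 2 + h ^ 2 * C := by gcongr; exact hF.trans (by gcongr)
      _ = _ := by ring
  refine ⟨?_, hZn⟩
  have hAn : ‖h • A‖ ≤ C * h := by
    rw [norm_smul, Real.norm_of_nonneg h0.le, mul_comm]; gcongr
  have hXn : ‖X‖ ≤ 3 * C * h := by
    rw [show X = Z + h • A by rw [hZ]; abel]
    refine (norm_add_le _ _).trans ?_
    calc _ ≤ 2 * C * h + C * h := by gcongr; exact hZn.trans (by gcongr)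
      _ = _ := by ring
  -- Write F = 1 + X and X = hA + Z. As A is skew, the order-h part of X + Xᵀ cancels and AᵀA = -A²
  -- yields the quadratic term; every remaining product contains E or is of order h · h².
  have key : Fᵀ * F - 1 - (2 * h ^ 2) • symPart (B - (1 / 2 : ℝ) • (A * A)) =
      E + Eᵀ + Xᵀ * Z + Zᵀ * (h • A) := by
    have e1 : F = 1 + X := by rw [hX]; abel
    have e2 : X = h • A + Z := by rw [hZ]; abel
    have e3 : Z = h ^ 2 • B + E := by rw [hE]; abel
    have e4 : Xᵀ = -(h • A) + Zᵀ := by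
      rw [e2, Matrix.transpose_add, Matrix.transpose_smul, hAs, smul_neg]
    have e5 : Zᵀ = h ^ 2 • Bᵀ + Eᵀ := by
      rw [e3, Matrix.transpose_add, Matrix.transpose_smul]
    rw [e1, Matrix.transpose_add, Matrix.transpose_one]
    have e6 : (1 + Xᵀ) * (1 + X) = 1 + X + Xᵀ + Xᵀ * X := by noncomm_ring
    have e7 : symPart (B - (1 / 2 : ℝ) • (A * A)) =
        (1 / 2 : ℝ) • (B + Bᵀ - A * A) := by
      rw [symPart, Matrix.transpose_sub, Matrix.transpose_smul, Matrix.transpose_mul, hAs]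
      simp only [Matrix.neg_mul, Matrix.mul_neg, neg_neg]
      module
    have e8 : Xᵀ * X = Xᵀ * Z + Zᵀ * (h • A) - h ^ 2 • (A * A) := by
      have e9 : Xᵀ * X = Xᵀ * (h • A) + Xᵀ * Z := by rw [← Matrix.mul_add, ← e2]
      have e10 : Xᵀ * (h • A) = Zᵀ * (h • A) - h ^ 2 • (A * A) := by
        rw [e4]
        simp only [Matrix.add_mul, Matrix.neg_mul, Matrix.smul_mul, Matrix.mul_smul]
        module
      rw [e9, e10]
      abel
    rw [e6, e7, e8, e4, e5, e2, e3]
    module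
  rw [key]
  have f1 : ‖Eᵀ‖ ≤ C * h ^ 3 := by rwa [Matrix.frobenius_norm_transpose]
  have f2 : ‖Xᵀ * Z‖ ≤ 3 * C * h * (2 * C * h ^ 2) := (Matrix.frobenius_norm_mul _ _).trans
    (mul_le_mul (by rwa [Matrix.frobenius_norm_transpose]) hZn (norm_nonneg _) (by positivity))
  have f3 : ‖Zᵀ * (h • A)‖ ≤ 2 * C * h ^ 2 * (C * h) := (Matrix.frobenius_norm_mul _ _).trans
    (mul_le_mul (by rwa [Matrix.frobenius_norm_transpose]) hAn (norm_nonneg _) (by positivity))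
  have f4 : C * h ^ 3 ≤ C ^ 2 * h ^ 3 := by gcongr; nlinarith
  refine (norm_add_le _ _).trans ((add_le_add ((norm_add_le _ _).trans
    (add_le_add ((norm_add_le _ _).trans (add_le_add hF f1)) f2)) f3).trans ?_)
  linarith

end Expansion

/-! ### Scaled displacements of the recovery deformation -/

section RecoveryDisplacements

variable {L : ℝ} {ω : Set V2} {θ₂ θ₃ : ℝ → ℝ} {d : Disp}

theorem xp_one (x : V3) : xp θ₂ θ₃ x 1 = p₂ θ₂ θ₃ (x 0) * x 1 - p₃ θ₂ θ₃ (x 0) * x 2 := by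
  simp [xp, Re, Matrix.mulVec, dotProduct, Fin.sum_univ_three]
  ring

theorem xp_two (x : V3) : xp θ₂ θ₃ x 2 = p₃ θ₂ θ₃ (x 0) * x 1 + p₂ θ₂ θ₃ (x 0) * x 2 := by
  simp [xp, Re, Matrix.mulVec, dotProduct, Fin.sum_univ_three]

theorem ThetaP_zero (h : ℝ) (x : V3) : ThetaP θ₂ θ₃ h x 0 =
    x 0 - h ^ 2 * (xp θ₂ θ₃ x 1 * deriv θ₂ (x 0) + xp θ₂ θ₃ x 2 * deriv θ₃ (x 0)) +
      h * (x 1 * nuN θ₂ θ₃ h (x 0) 0 + x 2 * nuB θ₂ θ₃ h (x 0) 0) := by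
  rw [IsCurve.ThetaP_apply, IsCurve.normal_apply, IsCurve.binormal_apply, xp_one, xp_two]
  simp [aCoef, cCoef]
  ring

theorem ThetaP_one (h : ℝ) (x : V3) : ThetaP θ₂ θ₃ h x 1 = h * θ₂ (x 0) + h * xp θ₂ θ₃ x 1 +
      h * (x 1 * nuN θ₂ θ₃ h (x 0) 1 + x 2 * nuB θ₂ θ₃ h (x 0) 1) := by
  rw [IsCurve.ThetaP_apply, IsCurve.normal_apply, IsCurve.binormal_apply, xp_one]
  simp
  ring

theorem ThetaP_two (h : ℝ) (x : V3) : ThetaP θ₂ θ₃ h x 2 = h * θ₃ (x 0) + h * xp θ₂ θ₃ x 2 +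
      h * (x 1 * nuN θ₂ θ₃ h (x 0) 2 + x 2 * nuB θ₂ θ₃ h (x 0) 2) := by
  rw [IsCurve.ThetaP_apply, IsCurve.normal_apply, IsCurve.binormal_apply, xp_two]
  simp
  ring

namespace Disp

/-- The frame deviations subtracted in `zB` and `zC` cancel those in Θ^h∘P^h, leaving a closed
formula without remainder. -/
theorem recov_zero (h : ℝ) (x : V3) : d.recov θ₂ θ₃ h x 0 = x 0 + h ^ 2 * (d.u (x 0) -
    xp θ₂ θ₃ x 1 * (deriv d.v₂ (x 0) + deriv θ₂ (x 0)) -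
    xp θ₂ θ₃ x 2 * (deriv d.v₃ (x 0) + deriv θ₃ (x 0)) + h * d.γ x 0) := by
  rw [recov, ThetaP_zero, xp_one, xp_two]
  simp [zA, zB, zC]
  ring

theorem recov_one (h : ℝ) (x : V3) : d.recov θ₂ θ₃ h x 1 = h * (θ₂ (x 0) + xp θ₂ θ₃ x 1 +
    d.v₂ (x 0) - h * xp θ₂ θ₃ x 2 * d.w (x 0) + h ^ 2 * d.γ x 1) := by
  rw [recov, ThetaP_one, xp_one, xp_two]
  simp [zA, zB, zC]
  ring

theorem recov_two (h : ℝ) (x : V3) : d.recov θ₂ θ₃ h x 2 = h * (θ₃ (x 0) + xp θ₂ θ₃ x 2 +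
    d.v₃ (x 0) + h * xp θ₂ θ₃ x 1 * d.w (x 0) + h ^ 2 * d.γ x 2) := by
  rw [recov, ThetaP_two, xp_one, xp_two]
  simp [zA, zB, zC]
  ring

variable (L ω θ₂ θ₃ d) in
/-- The recovery deformation. -/
def recY (h : ℝ) (z : V3) : V3 :=
  d.recov θ₂ θ₃ h (Function.invFunOn (ThetaP θ₂ θ₃ h) (cyl L ω) z)

theorem cons_mem_cyl {t : ℝ} (ht : t ∈ Ioo 0 L) {s : V2} (hs : s ∈ ω) :
    (![t, s 0, s 1] : V3) ∈ cyl L ω := by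
  refine ⟨ht, ?_⟩
  convert! hs using 1
  ext i; fin_cases i <;> simp

theorem integrableOn_section (hω : IsCrossSection ω) {f : V3 → ℝ}
    (hf : ∀ x ∈ cyl L ω, ContinuousAt f x) (hb : Ob (cyl L ω) 0 (fun _ x => f x)) {t : ℝ}
    (ht : t ∈ Ioo 0 L) : IntegrableOn (fun s : V2 => f ![t, s 0, s 1]) ω := by
  obtain ⟨C, hC⟩ := hb
  have hcont : Continuous fun s : V2 => (![t, s 0, s 1] : V3) := by
    refine continuous_pi fun i => ?_
    fin_cases i <;> simp <;> fun_prop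
  have : IsFiniteMeasure (volume.restrict ω) := ⟨by simpa using hω.volume_lt_top⟩
  refine memLp_one_iff_integrable.1 (memLp_of_bounded' (C := C) ?_ ?_ 1)
  · have hco : ContinuousOn (fun s : V2 => f ![t, s 0, s 1]) ω := fun s hs =>
      ((hf _ (cons_mem_cyl ht hs)).comp (f := fun s : V2 => (![t, s 0, s 1] : V3))
        hcont.continuousAt).continuousWithinAt
    exact hco.aestronglyMeasurable hω.isOpen.measurableSet
  · filter_upwards [ae_restrict_mem hω.isOpen.measurableSet] with s hs
    simpa using hC 1 ⟨one_pos, le_rfl⟩ _ (cons_mem_cyl ht hs)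

/-- The first moments of the cross-section vanish, so only the constant part survives. -/
theorem secInt_affine (hω : IsCrossSection ω) {f g : V3 → ℝ} {t α β β' : ℝ}
    (ht : t ∈ Ioo 0 L)
    (hg : IntegrableOn (fun s : V2 => g ![t, s 0, s 1]) ω) (hg0 : secInt ω g t = 0)
    (hf : ∀ x ∈ cyl L ω, x 0 = t → f x = α + β * x 1 + β' * x 2 + g x) :
    secInt ω f t = α * area ω := by
  have h1 : secInt ω f t = ∫ s in ω, (α + β * s 0 + β' * s 1 + g ![t, s 0, s 1]) :=
    setIntegral_congr_fun hω.isOpen.measurableSet fun s hs => by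
      simpa using hf _ (cons_mem_cyl ht hs) rfl
  have i0 : IntegrableOn (fun _ : V2 => α) ω := integrableOn_of_continuous hω continuous_const
  have i1 : IntegrableOn (fun s : V2 => β * s 0) ω :=
    integrableOn_of_continuous hω (by fun_prop)
  have i2 : IntegrableOn (fun s : V2 => β' * s 1) ω :=
    integrableOn_of_continuous hω (by fun_prop)
  have i01 : IntegrableOn (fun s : V2 => α + β * s 0) ω := i0.add i1
  have i012 : IntegrableOn (fun s : V2 => α + β * s 0 + β' * s 1) ω := i01.add i2
  rw [h1, integral_add i012 hg, integral_add i01 i2,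
    integral_add i0 i1, integral_const_mul, integral_const_mul, hω.moment₂, hω.moment₃]
  rw [secInt] at hg0
  rw [hg0]
  simp [area, Measure.real, mul_comm]

theorem secInt_quadratic (hω : IsCrossSection ω) {f g : V3 → ℝ} {t α β β' : ℝ}
    (ht : t ∈ Ioo 0 L)
    (hg : IntegrableOn (fun s : V2 => g ![t, s 0, s 1]) ω) (hg0 : secInt ω g t = 0)
    (hf : ∀ x ∈ cyl L ω, x 0 = t → f x = α * (x 1 ^ 2 + x 2 ^ 2) + β * x 1 + β' * x 2 + g x) :
    secInt ω f t = α * polarMoment ω := by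
  have h1 : secInt ω f t =
      ∫ s in ω, (α * (s 0 ^ 2 + s 1 ^ 2) + β * s 0 + β' * s 1 + g ![t, s 0, s 1]) :=
    setIntegral_congr_fun hω.isOpen.measurableSet fun s hs => by
      simpa using hf _ (cons_mem_cyl ht hs) rfl
  have i0 : IntegrableOn (fun s : V2 => α * (s 0 ^ 2 + s 1 ^ 2)) ω :=
    integrableOn_of_continuous hω (by fun_prop)
  have i1 : IntegrableOn (fun s : V2 => β * s 0) ω :=
    integrableOn_of_continuous hω (by fun_prop)
  have i2 : IntegrableOn (fun s : V2 => β' * s 1) ω :=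
    integrableOn_of_continuous hω (by fun_prop)
  have i01 : IntegrableOn (fun s : V2 => α * (s 0 ^ 2 + s 1 ^ 2) + β * s 0) ω := i0.add i1
  have i012 : IntegrableOn (fun s : V2 => α * (s 0 ^ 2 + s 1 ^ 2) + β * s 0 + β' * s 1) ω :=
    i01.add i2
  rw [h1, integral_add i012 hg, integral_add i01 i2,
    integral_add i0 i1, integral_const_mul, integral_const_mul, integral_const_mul, hω.moment₂,
    hω.moment₃]
  rw [secInt] at hg0
  rw [hg0, polarMoment]
  ring

namespace IsSmooth

theorem integrableOn_γ {t : ℝ} (hd : d.IsSmooth L ω θ₂ θ₃) (hω : IsCrossSection ω)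
    (ht : t ∈ Ioo 0 L) (i : Fin 3) :
    IntegrableOn (fun s : V2 => d.γ ![t, s 0, s 1] i) ω :=
  integrableOn_section (f := fun x => d.γ x i) hω (fun x hx => (hd.diff x hx i).continuousAt)
    (hd.bound i) ht

/-- An identity for each fixed h, not a limit: x₂' and x₃' have zero mean on the section, and so has
`γ`. -/
theorem uOf_eq (hd : d.IsSmooth L ω θ₂ θ₃) (hω : IsCrossSection ω) {h : ℝ} (h0 : 0 < h)
    (hinv : ∀ x ∈ cyl L ω, d.recY L ω θ₂ θ₃ h (ThetaP θ₂ θ₃ h x) = d.recov θ₂ θ₃ h x) :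
    EqOn (uOf θ₂ θ₃ ω h (d.recY L ω θ₂ θ₃ h)) d.u (Ioo 0 L) := by
  intro t ht
  have hA := (area_pos hω).ne'
  rw [uOf, secInt_affine hω (g := fun x => h * d.γ x 0) (α := d.u t)
    (β := -(p₂ θ₂ θ₃ t * (deriv d.v₂ t + deriv θ₂ t) + p₃ θ₂ θ₃ t * (deriv d.v₃ t + deriv θ₃ t)))
    (β' := p₃ θ₂ θ₃ t * (deriv d.v₂ t + deriv θ₂ t) - p₂ θ₂ θ₃ t * (deriv d.v₃ t + deriv θ₃ t)) ht
    ((integrableOn_γ hd hω ht 0).const_mul h)]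
  · field_simp
  · have := hd.mean t ht 0
    rw [secInt] at this ⊢
    rw [integral_const_mul, this, mul_zero]
  · rintro x hx rfl
    rw [hinv x hx, recov_zero, xp_one, xp_two]
    field_simp
    ring

theorem v₂Of_eq (hd : d.IsSmooth L ω θ₂ θ₃) (hω : IsCrossSection ω) {h : ℝ} (h0 : 0 < h)
    (hinv : ∀ x ∈ cyl L ω, d.recY L ω θ₂ θ₃ h (ThetaP θ₂ θ₃ h x) = d.recov θ₂ θ₃ h x) :
    EqOn (v₂Of θ₂ θ₃ ω h (d.recY L ω θ₂ θ₃ h)) d.v₂ (Ioo 0 L) := by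
  intro t ht
  have hA := (area_pos hω).ne'
  rw [v₂Of, secInt_affine hω (g := fun x => h ^ 2 * d.γ x 1) (α := d.v₂ t)
    (β := p₂ θ₂ θ₃ t - h * p₃ θ₂ θ₃ t * d.w t)
    (β' := -p₃ θ₂ θ₃ t - h * p₂ θ₂ θ₃ t * d.w t) ht
    ((integrableOn_γ hd hω ht 1).const_mul (h ^ 2))]
  · field_simp
  · have := hd.mean t ht 1
    rw [secInt] at this ⊢
    rw [integral_const_mul, this, mul_zero]
  · rintro x hx rfl
    rw [hinv x hx, recov_one, xp_one, xp_two]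
    field_simp
    ring

theorem v₃Of_eq (hd : d.IsSmooth L ω θ₂ θ₃) (hω : IsCrossSection ω) {h : ℝ} (h0 : 0 < h)
    (hinv : ∀ x ∈ cyl L ω, d.recY L ω θ₂ θ₃ h (ThetaP θ₂ θ₃ h x) = d.recov θ₂ θ₃ h x) :
    EqOn (v₃Of θ₂ θ₃ ω h (d.recY L ω θ₂ θ₃ h)) d.v₃ (Ioo 0 L) := by
  intro t ht
  have hA := (area_pos hω).ne'
  rw [v₃Of, secInt_affine hω (g := fun x => h ^ 2 * d.γ x 2) (α := d.v₃ t)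
    (β := p₃ θ₂ θ₃ t + h * p₂ θ₂ θ₃ t * d.w t)
    (β' := p₂ θ₂ θ₃ t - h * p₃ θ₂ θ₃ t * d.w t) ht
    ((integrableOn_γ hd hω ht 2).const_mul (h ^ 2))]
  · field_simp
  · have := hd.mean t ht 2
    rw [secInt] at this ⊢
    rw [integral_const_mul, this, mul_zero]
  · rintro x hx rfl
    rw [hinv x hx, recov_two, xp_one, xp_two]
    field_simp
    ring

/-- The rotation preserves x₂² + x₃², so the twist contributes w times the polar moment; the θ and v
terms are linear in the section variables and drop out, and the twist constraint kills the warping.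
-/
theorem wOf_eq (hd : d.IsSmooth L ω θ₂ θ₃) (hω : IsCrossSection ω) {h : ℝ} (h0 : 0 < h)
    (hinv : ∀ x ∈ cyl L ω, d.recY L ω θ₂ θ₃ h (ThetaP θ₂ θ₃ h x) = d.recov θ₂ θ₃ h x)
    (hc : IsCurve L θ₂ θ₃) :
    EqOn (wOf θ₂ θ₃ ω h (d.recY L ω θ₂ θ₃ h)) d.w (Ioo 0 L) := by
  intro t ht
  have hA := (polarMoment_pos hω).ne'
  have hg : IntegrableOn (fun s : V2 => -h * (xp θ₂ θ₃ ![t, s 0, s 1] 2 * d.γ ![t, s 0, s 1] 1 -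
      xp θ₂ θ₃ ![t, s 0, s 1] 1 * d.γ ![t, s 0, s 1] 2)) ω := by
    obtain ⟨M, -, hM⟩ := exists_bound_sec hω
    have hl : ∀ (α β : ℝ) (i : Fin 3), IntegrableOn (fun s : V2 => (α * s 0 + β * s 1) *
        d.γ ![t, s 0, s 1] i) ω := fun α β i => by
      refine (integrableOn_γ hd hω ht i).bdd_mul (c := |α| * M + |β| * M)
        (Continuous.aestronglyMeasurable (by fun_prop)) ?_
      filter_upwards [ae_restrict_mem hω.isOpen.measurableSet] with s hs
      have := hM s hs
      refine (norm_add_le _ _).trans ?_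
      rw [norm_mul, norm_mul]
      simp only [Real.norm_eq_abs]
      gcongr
      exacts [this.1, this.2]
    refine (((hl (p₃ θ₂ θ₃ t) (p₂ θ₂ θ₃ t) 1).sub (hl (p₂ θ₂ θ₃ t) (-p₃ θ₂ θ₃ t) 2)).const_mul
      (-h)).congr (ae_of_all _ fun s => ?_)
    simp only [xp_one, xp_two, Matrix.cons_val_zero, Matrix.cons_val_one, Matrix.cons_val,
      Pi.sub_apply]
    ring
  rw [wOf, secInt_quadratic hω (g := fun x => -h * (xp θ₂ θ₃ x 2 * d.γ x 1 -
    xp θ₂ θ₃ x 1 * d.γ x 2)) (α := d.w t)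
    (β := (p₂ θ₂ θ₃ t * (θ₃ t + d.v₃ t) - p₃ θ₂ θ₃ t * (θ₂ t + d.v₂ t)) / h)
    (β' := (-p₃ θ₂ θ₃ t * (θ₃ t + d.v₃ t) - p₂ θ₂ θ₃ t * (θ₂ t + d.v₂ t)) / h) ht hg]
  · field_simp
  · have := hd.twist t ht
    rw [secInt] at this ⊢
    rw [integral_const_mul, this, mul_zero]
  · rintro x hx rfl
    rw [hinv x hx, recov_one, recov_two, xp_one, xp_two]
    have hps := hc.p_sq hx.1
    field_simp
    linear_combination (h * d.w (x 0) * (x 1 ^ 2 + x 2 ^ 2)) * hps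

/-- The weak derivatives of v_k^h are determined only almost everywhere, so their values at x₀ enter
as hypotheses. In η^h the reference is Θ^h∘P^h itself, whose frame deviations therefore remain. -/
theorem gammaOf_eq (hd : d.IsSmooth L ω θ₂ θ₃) (hω : IsCrossSection ω) {h : ℝ} (h0 : 0 < h)
    (hinv : ∀ x ∈ cyl L ω, d.recY L ω θ₂ θ₃ h (ThetaP θ₂ θ₃ h x) = d.recov θ₂ θ₃ h x)
    {x : V3} (hx : x ∈ cyl L ω)
    (h2 : wd L (v₂Of θ₂ θ₃ ω h (d.recY L ω θ₂ θ₃ h)) (x 0) = deriv d.v₂ (x 0))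
    (h3 : wd L (v₃Of θ₂ θ₃ ω h (d.recY L ω θ₂ θ₃ h)) (x 0) = deriv d.v₃ (x 0))
    (hw : wOf θ₂ θ₃ ω h (d.recY L ω θ₂ θ₃ h) (x 0) = d.w (x 0)) :
    gammaOf θ₂ θ₃ L ω h (d.recY L ω θ₂ θ₃ h) x = d.γ x ∧
    etaOf θ₂ θ₃ L ω h (d.recY L ω θ₂ θ₃ h) x = fun i => d.γ x i -
      (h ^ 2)⁻¹ * (x 1 * nuN θ₂ θ₃ h (x 0) i + x 2 * nuB θ₂ θ₃ h (x 0) i) := by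
  have eu := uOf_eq hd hω h0 hinv hx.1
  have e2 := v₂Of_eq hd hω h0 hinv hx.1
  have e3 := v₃Of_eq hd hω h0 hinv hx.1
  constructor
  · ext i
    fin_cases i
    · simp only [gammaOf, h2, h3, hw, eu, e2, e3, hinv x hx, recov_zero]
      simp
      field_simp
      ring
    · simp only [gammaOf, h2, h3, hw, eu, e2, e3, hinv x hx, recov_one, perp]
      simp
      field_simp
      ring
    · simp only [gammaOf, h2, h3, hw, eu, e2, e3, hinv x hx, recov_two, perp]
      simp
      field_simp
      ring
  · ext i
    fin_cases i
    · simp only [etaOf, h2, h3, hw, eu, e2, e3, hinv x hx, recov_zero, ThetaP_zero]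
      simp
      field_simp
      ring
    · simp only [etaOf, h2, h3, hw, eu, e2, e3, hinv x hx, recov_one, perp, ThetaP_one]
      simp
      field_simp
      ring
    · simp only [etaOf, h2, h3, hw, eu, e2, e3, hinv x hx, recov_two, perp, ThetaP_two]
      simp
      field_simp
      ring

end IsSmooth

end Disp

end RecoveryDisplacements

/-! ### Closeness to the limit -/

section Near

section L2

variable {α : Type*} [MeasurableSpace α] {μ : Measure α} {ε ε' : ℝ≥0∞} {f f' g g' k : α → ℝ}

/-- `f` is in `L²` and within `ε` of `g`. -/
def L2Near (μ : Measure α) (ε : ℝ≥0∞) (f g : α → ℝ) : Prop :=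
  MemLp f 2 μ ∧ eLpNorm (fun x => f x - g x) 2 μ ≤ ε

theorem L2Near.mono (h : L2Near μ ε f g) (hε : ε ≤ ε') : L2Near μ ε' f g :=
  ⟨h.1, h.2.trans hε⟩

theorem L2Near.congr (h : L2Near μ ε f g) (hf : f =ᵐ[μ] f') (hg : g =ᵐ[μ] g') :
    L2Near μ ε f' g' :=
  ⟨h.1.ae_eq hf, (eLpNorm_congr_ae (by
    filter_upwards [hf, hg] with x h1 h2
    rw [h1, h2])).symm.trans_le h.2⟩

theorem L2Near.trans (h : L2Near μ ε f g) (h' : L2Near μ ε' g k)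
    (hk : AEStronglyMeasurable k μ) : L2Near μ (ε + ε') f k := by
  refine ⟨h.1, ?_⟩
  have e1 : (fun x => f x - k x) = (fun x => f x - g x) + fun x => g x - k x := by
    ext x; simp
  rw [e1]
  exact (eLpNorm_add_le (h.1.1.sub h'.1.1) (h'.1.1.sub hk) (by norm_num)).trans
    (add_le_add h.2 h'.2)

theorem L2Near.of_ae_eq (hf : MemLp f 2 μ) (h : f =ᵐ[μ] g) : L2Near μ ε f g := by
  refine ⟨hf, ?_⟩
  rw [eLpNorm_congr_ae (g := fun _ => (0 : ℝ)) (h.mono fun x hx => by simp [hx])]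
  simp

end L2

/-- `f` is in `W^{1,2}(0,L)` and within `ε` of `g`. -/
def W12Near (L : ℝ) (ε : ℝ≥0∞) (f g : ℝ → ℝ) : Prop :=
  MemW12 L f ∧ L2Near (volume.restrict (Ioo 0 L)) ε f g ∧
    L2Near (volume.restrict (Ioo 0 L)) ε (wd L f) (wd L g)

/-- `F` and its derivatives along the cross-section are in `L²` and within `ε` of those of `f`. -/
def SectionNear (U : Set V3) (ε : ℝ≥0∞) (F f : V3 → V3) : Prop :=
  ∀ i, L2Near (volume.restrict U) ε (fun x => F x i) (fun x => f x i) ∧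
    ∀ k : Fin 3, k ≠ 0 → HasL2Deriv U (e k) (fun x => F x i) ∧
      L2Near (volume.restrict U) ε (pd U k fun x => F x i) (pd U k fun x => f x i)

/-- The deformation `y` of the rod of thickness `h` is within `ε` of the limit displacement, and
its scaled energy is within `ε` of `E`. -/
structure Near (θ₂ θ₃ : ℝ → ℝ) (L : ℝ) (ω : Set V2) (Wh : ℝ → V3 → M3 → ℝ≥0∞) (d : Disp) (E : ℝ)
    (ε : ℝ≥0∞) (h : ℝ) (y : V3 → V3) : Prop where
  mem : MemW12V (rodHat θ₂ θ₃ L ω h) y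
  u : W12Near L ε (uOf θ₂ θ₃ ω h y) d.u
  v₂ : W12Near L ε (v₂Of θ₂ θ₃ ω h y) d.v₂
  v₃ : W12Near L ε (v₃Of θ₂ θ₃ ω h y) d.v₃
  w : W12Near L ε (wOf θ₂ θ₃ ω h y) d.w
  grad : ∀ i j, L2Near (volume.restrict (cyl L ω)) ε
    (fun x => (grad (rodHat θ₂ θ₃ L ω h) y (ThetaP θ₂ θ₃ h x) i j - (1 : M3) i j) / h)
    (fun x => Amat L d.v₂ d.v₃ d.w (x 0) i j)
  γ : SectionNear (cyl L ω) ε (gammaOf θ₂ θ₃ L ω h y) d.γ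
  η : SectionNear (cyl L ω) ε (etaOf θ₂ θ₃ L ω h y) (eta θ₂ θ₃ d.γ)
  energy_le : (ENNReal.ofReal (h ^ 6))⁻¹ * ∫⁻ z in rodHat θ₂ θ₃ L ω h,
    Wh h z (CurvedRod.grad (rodHat θ₂ θ₃ L ω h) y z) ≤ ENNReal.ofReal E + ε
  le_energy : ENNReal.ofReal E ≤ (ENNReal.ofReal (h ^ 6))⁻¹ * (∫⁻ z in rodHat θ₂ θ₃ L ω h,
    Wh h z (CurvedRod.grad (rodHat θ₂ θ₃ L ω h) y z)) + ε

end Near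

/-! ### Measurability and weak derivatives for regular displacements -/

section SmoothStage

variable {L : ℝ} {ω : Set V2} {θ₂ θ₃ : ℝ → ℝ} {d : Disp}

theorem eventually_eLpNorm_le {Ω : Set V3} (hΩ : MeasurableSet Ω) (hfin : volume Ω ≠ ⊤)
    {F : ℝ → V3 → ℝ} {C : ℝ} (hF : ∀ᶠ h in 𝓝[>] (0 : ℝ), ∀ x ∈ Ω, |F h x| ≤ C * h) {ε : ℝ≥0∞}
    (hε : ε ≠ 0) : ∀ᶠ h in 𝓝[>] (0 : ℝ), eLpNorm (F h) 2 (volume.restrict Ω) ≤ ε := by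
  have hlim : Tendsto (fun h : ℝ => volume Ω ^ (2 : ℝ)⁻¹ * ENNReal.ofReal (C * h)) (𝓝[>] 0)
      (𝓝 0) := by
    have h1 : Tendsto (fun h : ℝ => C * h) (𝓝[>] 0) (𝓝 0) := by
      have : Tendsto (fun h : ℝ => C * h) (𝓝 0) (𝓝 (C * 0)) := Continuous.tendsto (by fun_prop) 0
      simpa using this.mono_left nhdsWithin_le_nhds
    have h2 := ENNReal.Tendsto.const_mul (a := volume Ω ^ (2 : ℝ)⁻¹) (ENNReal.tendsto_ofReal h1)
      (Or.inr (ENNReal.rpow_ne_top_of_nonneg (by norm_num) hfin))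
    simpa using h2
  filter_upwards [hF, hlim.eventually_lt_const (pos_iff_ne_zero.2 hε)] with h h1 h2
  refine (eLpNorm_le_of_ae_bound (C := C * h) ?_).trans ?_
  · filter_upwards [ae_restrict_mem hΩ] with x hx
    exact h1 x hx
  · simpa using h2.le

theorem aestronglyMeasurable_of_hasFDerivAt {Ω : Set V3} (hΩ : MeasurableSet Ω) {Y : V3 → V3}
    {M : V3 → M3} (hY : ∀ x ∈ Ω, HasFDerivAt Y (matL (M x)) x) (i j : Fin 3) :
    AEStronglyMeasurable (fun x => M x i j) (volume.restrict Ω) := by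
  refine AEStronglyMeasurable.congr (f := fun x => fderiv ℝ (fun z => Y z i) x (e j))
    (measurable_fderiv_apply_const ℝ _ _).aestronglyMeasurable ?_
  filter_upwards [ae_restrict_mem hΩ] with x hx
  rw [(hasFDerivAt_matL_iff.1 (hY x hx) i).fderiv]
  exact matL_e (M x) i j

theorem aestronglyMeasurable_mul_inv {μ : Measure V3} {M N : V3 → M3}
    (hM : ∀ i j, AEStronglyMeasurable (fun x => M x i j) μ)
    (hN : ∀ i j, AEStronglyMeasurable (fun x => N x i j) μ) (i j : Fin 3) :
    AEStronglyMeasurable (fun x => (M x * (N x)⁻¹) i j) μ := by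
  have hm : ∀ i j k l i' j' k' l', AEStronglyMeasurable (fun x =>
      N x i j * N x k l - N x i' j' * N x k' l') μ := fun i j k l i' j' k' l' =>
    ((hN i j).mul (hN k l)).sub ((hN i' j').mul (hN k' l'))
  have hm' : ∀ i j k l i' j' k' l', AEStronglyMeasurable (fun x =>
      -(N x i j * N x k l) + N x i' j' * N x k' l') μ := fun i j k l i' j' k' l' =>
    ((hN i j).mul (hN k l)).neg.add ((hN i' j').mul (hN k' l'))
  have hadj : ∀ i j, AEStronglyMeasurable (fun x => (N x).adjugate i j) μ := by
    intro i j
    simp only [Matrix.adjugate_fin_three]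
    fin_cases i <;> fin_cases j <;>
      first
      | exact hm _ _ _ _ _ _ _ _
      | exact hm' _ _ _ _ _ _ _ _
  have hdet : AEMeasurable (fun x => (N x).det) μ := by
    have h3 : ∀ i j k l m n, AEStronglyMeasurable (fun x => N x i j * N x k l * N x m n) μ :=
      fun i j k l m n => ((hN i j).mul (hN k l)).mul (hN m n)
    simp only [Matrix.det_fin_three]
    exact ((((((h3 _ _ _ _ _ _).sub (h3 _ _ _ _ _ _)).sub (h3 _ _ _ _ _ _)).add
      (h3 _ _ _ _ _ _)).add (h3 _ _ _ _ _ _)).sub (h3 _ _ _ _ _ _)).aemeasurable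
  have hinv : ∀ i j, AEStronglyMeasurable (fun x => (N x)⁻¹ i j) μ := fun i j => by
    simp only [Matrix.inv_def, Ring.inverse_eq_inv', Matrix.smul_apply, smul_eq_mul]
    exact hdet.inv.aestronglyMeasurable.mul (hadj i j)
  simp only [Matrix.mul_apply, Fin.sum_univ_three]
  exact (((hM i 0).mul (hinv 0 j)).add ((hM i 1).mul (hinv 1 j))).add ((hM i 2).mul (hinv 2 j))

namespace Disp

/-- Cross-sectional derivatives of the warping minus a section-wise linear map. -/
theorem IsSmooth.pd_sub (hd : d.IsSmooth L ω θ₂ θ₃) (hω : IsCrossSection ω) (i : Fin 3)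
    {b c : ℝ → ℝ} (hb : ContDiffOn ℝ 1 b (Ioo 0 L)) (hc : ContDiffOn ℝ 1 c (Ioo 0 L))
    (hbb : Ob (cyl L ω) 0 (fun _ x => b (x 0))) (hcb : Ob (cyl L ω) 0 (fun _ x => c (x 0))) :
    MemLp (fun x => d.γ x i - (x 1 * b (x 0) + x 2 * c (x 0))) 2 (volume.restrict (cyl L ω)) ∧
    ∀ k : Fin 3, k ≠ 0 → ∃ g : V3 → ℝ,
      IsWeakDeriv (cyl L ω) (e k) (fun x => d.γ x i - (x 1 * b (x 0) + x 2 * c (x 0))) g ∧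
      MemLp g 2 (volume.restrict (cyl L ω)) ∧ ∀ x ∈ cyl L ω,
        g x = fderiv ℝ (fun z => d.γ z i) x (e k) - (![0, b (x 0), c (x 0)] : V3) k := by
  have hU := isOpen_cyl (L := L) hω.isOpen
  have := isFiniteMeasure_cyl (L := L) hω
  have hder : ∀ x ∈ cyl L ω, HasFDerivAt (fun x => d.γ x i - (x 1 * b (x 0) + x 2 * c (x 0)))
      (fderiv ℝ (fun z => d.γ z i) x - rowL ![0 + x 1 * deriv b (x 0) + x 2 * deriv c (x 0),
        b (x 0), c (x 0)]) x := fun x hx => by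
    have h1 := (hasStrictFDerivAt_affine (x := x) (hasStrictDerivAt_const (x 0) (0 : ℝ))
      (strictDeriv_of_contDiffOn hb hx.1) (strictDeriv_of_contDiffOn hc hx.1)).hasFDerivAt
    simp only [zero_add] at h1 ⊢
    exact (hd.diff x hx i).hasFDerivAt.sub h1
  have hval : ∀ x ∈ cyl L ω, ∀ k : Fin 3, k ≠ 0 →
      fderiv ℝ (fun x => d.γ x i - (x 1 * b (x 0) + x 2 * c (x 0))) x (e k) =
        fderiv ℝ (fun z => d.γ z i) x (e k) - (![0, b (x 0), c (x 0)] : V3) k := by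
    intro x hx k hk
    rw [(hder x hx).fderiv]
    fin_cases k
    · exact absurd rfl hk
    · simp [rowL_apply, e, Fin.sum_univ_three]
    · simp [rowL_apply, e, Fin.sum_univ_three]
  have hbound : Ob (cyl L ω) 0 (fun _ x => d.γ x i - (x 1 * b (x 0) + x 2 * c (x 0))) :=
    (hd.bound i).sub (((Ob_coord hω 1).mul hbb).add ((Ob_coord hω 2).mul hcb))
  refine ⟨?_, fun k hk =>
    ⟨fun x => fderiv ℝ (fun x => d.γ x i - (x 1 * b (x 0) + x 2 * c (x 0))) x (e k), ?_⟩⟩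
  · obtain ⟨C, hC⟩ := hbound
    refine memLp_of_bounded' (C := C) ?_ ?_ 2
    · have hco : ContinuousOn (fun x => d.γ x i - (x 1 * b (x 0) + x 2 * c (x 0))) (cyl L ω) :=
        fun x hx => (hder x hx).continuousAt.continuousWithinAt
      exact hco.aestronglyMeasurable hU.measurableSet
    · filter_upwards [ae_restrict_mem hU.measurableSet] with x hx
      simpa using hC 1 ⟨one_pos, le_rfl⟩ x hx
  · have hgb : ∃ C, ∀ x ∈ cyl L ω,
        |fderiv ℝ (fun x => d.γ x i - (x 1 * b (x 0) + x 2 * c (x 0))) x (e k)| ≤ C := by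
      have hv : Ob (cyl L ω) 0 (fun _ x => (![0, b (x 0), c (x 0)] : V3) k) := by
        fin_cases k
        · exact Ob.const _ 0
        · exact hbb
        · exact hcb
      obtain ⟨C, hC⟩ := (hd.bound_fderiv i k).sub hv
      refine ⟨C, fun x hx => ?_⟩
      rw [hval x hx k hk]
      simpa using hC 1 ⟨one_pos, le_rfl⟩ x hx
    obtain ⟨C, hC⟩ := hgb
    refine ⟨isWeakDeriv_of_bounded hU (fun x hx => (hder x hx).differentiableAt) hC, ?_,
      fun x hx => hval x hx k hk⟩
    refine memLp_of_bounded' (C := C)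
      (measurable_fderiv_apply_const ℝ _ _).aestronglyMeasurable ?_ 2
    filter_upwards [ae_restrict_mem hU.measurableSet] with x hx
    exact hC x hx

end Disp

end SmoothStage

/-! ### The deformation gradient of the recovery deformation -/

section SmoothStage

variable {L : ℝ} {ω : Set V2} {θ₂ θ₃ : ℝ → ℝ} {d : Disp}

theorem W12Near.of_eqOn {f F : ℝ → ℝ} {ε : ℝ≥0∞} (hF : ContDiff ℝ 1 F) (h : EqOn f F (Ioo 0 L)) :
    W12Near L ε f F := by
  have h1 := memW12_of_eqOn hF h
  have h2 := memW12_of_eqOn hF (eqOn_refl F (Ioo 0 L))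
  exact ⟨h1.1, .of_ae_eq h1.1.1 ((ae_restrict_mem measurableSet_Ioo).mono h),
    .of_ae_eq (h1.1.2.memLp isOpen_Ioo) (h1.2.trans h2.2.symm)⟩

theorem exists_det_pos : ∃ δ > 0, ∀ X : M3, ‖X - 1‖ < δ → 0 < X.det := by
  have h1 : ∀ᶠ X in 𝓝 (1 : M3), 0 < X.det := by
    have hc : Continuous fun X : M3 => X.det := continuous_id.matrix_det
    exact hc.continuousAt.eventually_const_lt (by simp)
  obtain ⟨δ, hδ, h⟩ := Metric.eventually_nhds_iff.1 h1
  exact ⟨δ, hδ, fun X hX => h (by rwa [dist_eq_norm])⟩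

namespace Disp

variable (θ₂ θ₃ d) in
/-- The limit strain of a smooth displacement. -/
def G (x : V3) : M3 := symPart (d.B θ₂ θ₃ x - (1 / 2 : ℝ) • (d.A (x 0) * d.A (x 0)))

namespace IsSmooth

theorem Ob_recov (hd : d.IsSmooth L ω θ₂ θ₃) (hc : IsCurve L θ₂ θ₃) (hω : IsCrossSection ω)
    (i : Fin 3) : Ob (cyl L ω) 0 (fun h x => d.recov θ₂ θ₃ h x i) := by
  have hx := Ob_coord (L := L) hω
  have p2 := hc.p₂.toO1.toOb (ω := ω)
  have p3 := hc.p₃.toO1.toOb (ω := ω)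
  have x1 : Ob (cyl L ω) 0 (fun _ x => xp θ₂ θ₃ x 1) := by
    simp only [xp_one]; exact (p2.mul (hx 1)).sub (p3.mul (hx 2))
  have x2 : Ob (cyl L ω) 0 (fun _ x => xp θ₂ θ₃ x 2) := by
    simp only [xp_two]; exact (p3.mul (hx 1)).add (p2.mul (hx 2))
  have t2 := hc.memC₂.O1_self.toOb (ω := ω)
  have t3 := hc.memC₃.O1_self.toOb (ω := ω)
  have t2' := hc.memC₂.O1_deriv.toOb (ω := ω)
  have t3' := hc.memC₃.O1_deriv.toOb (ω := ω)
  have hp : ∀ k, Ob (cyl L ω) 0 (fun h _ => h ^ k) := fun k => (Ob.pow _ k).mono (Nat.zero_le k)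
  have h1 : Ob (cyl L ω) 0 (fun h _ => h) := (hp 1).congr fun h _ x _ => by simp
  have u := Ob_of_continuous (L := L) (ω := ω) hd.u.continuous
  have w := Ob_of_continuous (L := L) (ω := ω) hd.w.continuous
  have v2 := Ob_of_continuous (L := L) (ω := ω) hd.v₂.continuous
  have v3 := Ob_of_continuous (L := L) (ω := ω) hd.v₃.continuous
  have v2' := Ob_of_continuous (L := L) (ω := ω) (hd.v₂.continuous_deriv (by norm_num))
  have v3' := Ob_of_continuous (L := L) (ω := ω) (hd.v₃.continuous_deriv (by norm_num))
  fin_cases i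
  · simp only [Fin.zero_eta, recov_zero]
    exact (hx 0).add ((hp 2).mul (((u.sub (x1.mul (v2'.add t2'))).sub
      (x2.mul (v3'.add t3'))).add (h1.mul (hd.bound 0))))
  · simp only [Fin.mk_one, recov_one]
    exact h1.mul ((((t2.add x1).add v2).sub ((h1.mul x2).mul w)).add ((hp 2).mul (hd.bound 1)))
  · simp only [Fin.reduceFinMk, recov_two]
    exact h1.mul ((((t3.add x2).add v3).add ((h1.mul x1).mul w)).add ((hp 2).mul (hd.bound 2)))

theorem F_mul {h : ℝ} {x : V3} (hdet : 0 < (frameMat θ₂ θ₃ h x).det) :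
    d.F θ₂ θ₃ h x * (frameMat θ₂ θ₃ h x * scaleMat h) =
      (frameMat θ₂ θ₃ h x + d.Q θ₂ θ₃ h x) * scaleMat h := by
  rw [F, ← Matrix.mul_assoc, Matrix.mul_assoc _ _ (frameMat θ₂ θ₃ h x),
    Matrix.nonsing_inv_mul _ (isUnit_iff_ne_zero.2 hdet.ne'), Matrix.mul_one]

theorem recY_ThetaP {h : ℝ} {M : V3 → M3} (hΦ : IsChart (cyl L ω) (ThetaP θ₂ θ₃ h) M) {x : V3}
    (hx : x ∈ cyl L ω) : d.recY L ω θ₂ θ₃ h (ThetaP θ₂ θ₃ h x) = d.recov θ₂ θ₃ h x := by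
  rw [recY, hΦ.leftInv hx]

theorem norm_F_sub_one_le {C h : ℝ} {A F : M3} (hC : 1 ≤ C) (hh : h ∈ Ioc (0 : ℝ) 1)
    (hA : ‖A‖ ≤ C) (hF : ‖F - 1 - h • A‖ ≤ 2 * C * h ^ 2) : ‖F - 1‖ ≤ 3 * C * h := by
  have h2 : h ^ 2 ≤ h := by nlinarith [hh.1, hh.2]
  have e1 : F - 1 = (F - 1 - h • A) + h • A := by abel
  rw [e1]
  refine (norm_add_le _ _).trans ?_
  rw [norm_smul, Real.norm_of_nonneg hh.1.le]
  have := mul_le_mul_of_nonneg_left hA hh.1.le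
  nlinarith

/-- Collects, with one constant, the estimates needed for the energy (strain to order h³) and for
the convergence of the gradient (to order h²). -/
theorem exists_expansion' (hd : d.IsSmooth L ω θ₂ θ₃) (hc : IsCurve L θ₂ θ₃)
    (hω : IsCrossSection ω) : ∃ C : ℝ, 1 ≤ C ∧ ∀ h ∈ Ioc (0 : ℝ) 1, ∀ x ∈ cyl L ω,
      1 / 2 ≤ (frameMat θ₂ θ₃ h x).det → ‖d.A (x 0)‖ ≤ C ∧ ‖d.G θ₂ θ₃ x‖ ≤ C ∧
      ‖(d.F θ₂ θ₃ h x)ᵀ * d.F θ₂ θ₃ h x - 1 - (2 * h ^ 2) • d.G θ₂ θ₃ x‖ ≤ C * h ^ 3 ∧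
      ‖d.F θ₂ θ₃ h x - 1 - h • d.A (x 0)‖ ≤ C * h ^ 2 ∧ ‖d.F θ₂ θ₃ h x - 1‖ ≤ C * h := by
  obtain ⟨C, hC, h1⟩ := hd.exists_expansion hc hω
  refine ⟨10 * C ^ 2, by nlinarith, fun h hh x hx hdet => ?_⟩
  obtain ⟨hA, hB, hF⟩ := h1 h hh x hx hdet
  have hAs : (d.A (x 0))ᵀ = -d.A (x 0) := by
    ext i j; fin_cases i <;> fin_cases j <;> simp [A, skewM]
  obtain ⟨h2, h3⟩ := norm_strain_sub_le hC hh.1 hh.2 hAs hA hB hF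
  have h4 := norm_F_sub_one_le hC hh hA h3
  have hCC : C ≤ C ^ 2 := by nlinarith
  refine ⟨by linarith, ?_, h2, h3.trans ?_, h4.trans ?_⟩
  · rw [G, symPart, norm_smul]
    have h5 : ‖d.B θ₂ θ₃ x - (1 / 2 : ℝ) • (d.A (x 0) * d.A (x 0))‖ ≤ C + 1 / 2 * (C * C) := by
      refine (norm_sub_le _ _).trans (add_le_add hB ?_)
      rw [norm_smul, Real.norm_of_nonneg (by norm_num)]
      gcongr
      exact (Matrix.frobenius_norm_mul _ _).trans (mul_le_mul hA hA (norm_nonneg _) (by linarith))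
    have h6 := norm_add_le (d.B θ₂ θ₃ x - (1 / 2 : ℝ) • (d.A (x 0) * d.A (x 0)))
      (d.B θ₂ θ₃ x - (1 / 2 : ℝ) • (d.A (x 0) * d.A (x 0)))ᵀ
    rw [Matrix.frobenius_norm_transpose] at h6
    rw [Real.norm_of_nonneg (by norm_num)]
    nlinarith
  · have := pow_nonneg hh.1.le 2
    gcongr
    linarith
  · have := hh.1.le
    gcongr
    linarith

/-- `F` is the derivative of the recovery map times the inverse of the derivative of the chart, and
classical derivatives are measurable. -/
theorem aestronglyMeasurable_F (hd : d.IsSmooth L ω θ₂ θ₃) (hc : IsCurve L θ₂ θ₃)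
    (hω : IsCrossSection ω) {h : ℝ} (hh : h ∈ Ioc (0 : ℝ) 1)
    (i j : Fin 3) :
    AEStronglyMeasurable (fun x => d.F θ₂ θ₃ h x i j) (volume.restrict (cyl L ω)) := by
  have hm := (isOpen_cyl (L := L) hω.isOpen).measurableSet
  have h1 := aestronglyMeasurable_mul_inv
    (aestronglyMeasurable_of_hasFDerivAt hm fun x hx => hd.hasFDerivAt_recov hc hh hx)
    (aestronglyMeasurable_of_hasFDerivAt hm fun x hx =>
      (hc.hasStrictFDerivAt_ThetaP hh hx.1).hasFDerivAt) i j
  have hS : IsUnit (scaleMat h).det := by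
    rw [scaleMat, Matrix.det_diagonal, Fin.prod_univ_three]
    simpa using hh.1.ne'
  refine h1.congr (ae_of_all _ fun x => ?_)
  simp only
  rw [Matrix.mul_inv_rev, ← Matrix.mul_assoc, Matrix.mul_assoc _ (scaleMat h),
    Matrix.mul_nonsing_inv _ hS, Matrix.mul_one, F]

/-- The chart argument applies since F (∇Θ^h∘P^h) is the derivative of the recovery map; the a.e.
identity on the rod is pulled back to the cylinder. -/
theorem recY_grad (hd : d.IsSmooth L ω θ₂ θ₃) (hc : IsCurve L θ₂ θ₃) (hω : IsCrossSection ω)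
    {h : ℝ} (hh : h ∈ Ioc (0 : ℝ) 1)
    (hΦ : IsChart (cyl L ω) (ThetaP θ₂ θ₃ h) (fun x => frameMat θ₂ θ₃ h x * scaleMat h))
    (hdet : ∀ x ∈ cyl L ω, 1 / 2 ≤ (frameMat θ₂ θ₃ h x).det) :
    MemW12V (rodHat θ₂ θ₃ L ω h) (d.recY L ω θ₂ θ₃ h) ∧
    ∀ᵐ x ∂volume.restrict (cyl L ω),
      grad (rodHat θ₂ θ₃ L ω h) (d.recY L ω θ₂ θ₃ h) (ThetaP θ₂ θ₃ h x) = d.F θ₂ θ₃ h x := by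
  choose C hC using fun i => hd.Ob_recov hc hω i
  obtain ⟨C', hC1, hC'⟩ := hd.exists_expansion' hc hω
  have hCb : ∀ i, C i ≤ |C 0| + |C 1| + |C 2| := by
    intro i
    have h0 := abs_nonneg (C 0)
    have h1 := abs_nonneg (C 1)
    have h2 := abs_nonneg (C 2)
    have := le_abs_self (C i)
    fin_cases i <;> simp at this ⊢ <;> linarith
  have h1 := hΦ.weak_gradient (Y := d.recov θ₂ θ₃ h) (F := d.F θ₂ θ₃ h)
    (C := |C 0| + |C 1| + |C 2| + (C' + 1)) (fun x hx => ?_) (fun x hx i => ?_)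
    (fun x hx i j => ?_)
  · rw [← IsCurve.rodHat_eq hh.1] at h1
    refine ⟨h1.1, ?_⟩
    have h2 := h1.2
    rw [IsCurve.rodHat_eq hh.1] at h2
    have h3 := hΦ.ae_comp h2
    rw [← IsCurve.rodHat_eq hh.1] at h3
    filter_upwards [h3, ae_mem_cyl (L := L) hω.isOpen] with x hx hxm
    exact hx.trans (by rw [hΦ.leftInv hxm])
  · rw [F_mul (lt_of_lt_of_le (by norm_num) (hdet x hx))]
    exact hd.hasFDerivAt_recov hc hh hx
  · have := hC i h hh x hx
    rw [pow_zero, mul_one] at this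
    linarith [hCb i]
  · have h2 := (hC' h hh x hx (hdet x hx)).2.2.2.2
    have h3 := abs_apply_le_frobenius (d.F θ₂ θ₃ h x - 1) i j
    rw [Matrix.sub_apply] at h3
    have h4 : |(1 : M3) i j| ≤ 1 := by
      rw [Matrix.one_apply]; split <;> simp
    have h5 := abs_sub_abs_le_abs_sub (d.F θ₂ θ₃ h x i j) ((1 : M3) i j)
    have h6 : C' * h ≤ C' := by nlinarith [hh.2]
    have := abs_nonneg (C 0)
    have := abs_nonneg (C 1)
    have := abs_nonneg (C 2)
    linarith

end IsSmooth

end Disp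

end SmoothStage

/-! ### Convergence of the recovery deformations of a regular displacement -/

section SmoothLimit

variable {L : ℝ} {ω : Set V2} {θ₂ θ₃ : ℝ → ℝ} {d : Disp}

namespace Disp.IsSmooth

/-- Two functions that differ from the same `γ i` by section-wise linear maps: `γ` cancels in the
difference, and the cross-sectional derivatives of the linear parts are their coefficients. -/
theorem l2Near_section (hd : d.IsSmooth L ω θ₂ θ₃) (hω : IsCrossSection ω) (i : Fin 3)
    {b c b' c' : ℝ → ℝ} (hb : ContDiffOn ℝ 1 b (Ioo 0 L)) (hc : ContDiffOn ℝ 1 c (Ioo 0 L))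
    (hbb : Ob (cyl L ω) 0 (fun _ x => b (x 0))) (hcb : Ob (cyl L ω) 0 (fun _ x => c (x 0)))
    (hb' : ContDiffOn ℝ 1 b' (Ioo 0 L)) (hc' : ContDiffOn ℝ 1 c' (Ioo 0 L))
    (hbb' : Ob (cyl L ω) 0 (fun _ x => b' (x 0))) (hcb' : Ob (cyl L ω) 0 (fun _ x => c' (x 0)))
    {ε : ℝ≥0∞}
    (h0 : eLpNorm (fun x => x 1 * (b' (x 0) - b (x 0)) + x 2 * (c' (x 0) - c (x 0))) 2
      (volume.restrict (cyl L ω)) ≤ ε)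
    (h1 : eLpNorm (fun x => b' (x 0) - b (x 0)) 2 (volume.restrict (cyl L ω)) ≤ ε)
    (h2 : eLpNorm (fun x => c' (x 0) - c (x 0)) 2 (volume.restrict (cyl L ω)) ≤ ε)
    {F f : V3 → ℝ}
    (hF : F =ᵐ[volume.restrict (cyl L ω)] fun x => d.γ x i - (x 1 * b (x 0) + x 2 * c (x 0)))
    (hf : f =ᵐ[volume.restrict (cyl L ω)] fun x => d.γ x i - (x 1 * b' (x 0) + x 2 * c' (x 0))) :
    L2Near (volume.restrict (cyl L ω)) ε F f ∧
    ∀ k : Fin 3, k ≠ 0 → HasL2Deriv (cyl L ω) (e k) F ∧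
      L2Near (volume.restrict (cyl L ω)) ε (pd (cyl L ω) k F) (pd (cyl L ω) k f) := by
  have hU := isOpen_cyl (L := L) hω.isOpen
  obtain ⟨m1, w1⟩ := hd.pd_sub hω i hb hc hbb hcb
  obtain ⟨m2, w2⟩ := hd.pd_sub hω i hb' hc' hbb' hcb'
  refine ⟨L2Near.congr ⟨m1, ?_⟩ hF.symm hf.symm, fun k hk => ?_⟩
  · refine (eLpNorm_congr_ae (ae_of_all _ fun x => ?_)).trans_le h0
    ring
  · obtain ⟨g1, d1, e1, v1⟩ := w1 k hk
    obtain ⟨g2, d2, e2, v2⟩ := w2 k hk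
    have d1' := d1.congr hF.symm (ae_eq_refl _)
    have d2' := d2.congr hf.symm (ae_eq_refl _)
    refine ⟨⟨g1, d1', e1⟩, L2Near.congr ⟨e1, ?_⟩ (d1'.weakDeriv_ae_eq hU).symm
      (d2'.weakDeriv_ae_eq hU).symm⟩
    fin_cases k
    · exact absurd rfl hk
    · refine (eLpNorm_congr_ae ?_).trans_le h1
      filter_upwards [ae_mem_cyl hω.isOpen] with x hx
      rw [v1 x hx, v2 x hx]
      simp
    · refine (eLpNorm_congr_ae ?_).trans_le h2
      filter_upwards [ae_mem_cyl hω.isOpen] with x hx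
      rw [v1 x hx, v2 x hx]
      simp

theorem l2Near_self (hd : d.IsSmooth L ω θ₂ θ₃) (hω : IsCrossSection ω) (i : Fin 3) {ε : ℝ≥0∞}
    {F : V3 → ℝ} (hF : F =ᵐ[volume.restrict (cyl L ω)] fun x => d.γ x i) :
    L2Near (volume.restrict (cyl L ω)) ε F (fun x => d.γ x i) ∧
    ∀ k : Fin 3, k ≠ 0 → HasL2Deriv (cyl L ω) (e k) F ∧
      L2Near (volume.restrict (cyl L ω)) ε (pd (cyl L ω) k F)
        (pd (cyl L ω) k fun x => d.γ x i) := by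
  have h0 : Ob (cyl L ω) 0 (fun _ _ => 0) := Ob.const _ 0
  exact hd.l2Near_section hω i (b := fun _ => 0) (c := fun _ => 0) (b' := fun _ => 0)
    (c' := fun _ => 0) contDiffOn_const contDiffOn_const h0 h0 contDiffOn_const contDiffOn_const
    h0 h0 (by simp) (by simp) (by simp) (hF.trans (ae_of_all _ fun x => by simp))
    (ae_of_all _ fun x => by simp)

/-- The coefficients h⁻²ν_N and h⁻²ν_B differ from `fN` and `fB` by O(h), uniformly; this is where
the frame is needed to order h³. -/
theorem eventually_l2Near_eta (hd : d.IsSmooth L ω θ₂ θ₃) (hc : IsCurve L θ₂ θ₃)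
    (hω : IsCrossSection ω) (i : Fin 3) {ε : ℝ≥0∞} (hε : ε ≠ 0) :
    ∀ᶠ h in 𝓝[>] (0 : ℝ), ∀ F : V3 → ℝ, (F =ᵐ[volume.restrict (cyl L ω)] fun x => d.γ x i -
      (h ^ 2)⁻¹ * (x 1 * nuN θ₂ θ₃ h (x 0) i + x 2 * nuB θ₂ θ₃ h (x 0) i)) →
    L2Near (volume.restrict (cyl L ω)) ε F (fun x => eta θ₂ θ₃ d.γ x i) ∧
    ∀ k : Fin 3, k ≠ 0 → HasL2Deriv (cyl L ω) (e k) F ∧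
      L2Near (volume.restrict (cyl L ω)) ε (pd (cyl L ω) k F)
        (pd (cyl L ω) k fun x => eta θ₂ θ₃ d.γ x i) := by
  have hm := (isOpen_cyl (L := L) hω.isOpen).measurableSet
  have hfin := (hω.volume_cyl_lt_top (L := L)).ne
  have hI : ∀ᶠ h in 𝓝[>] (0 : ℝ), h ∈ Ioc (0 : ℝ) 1 := Ioc_mem_nhdsGT one_pos
  have key : ∀ {φ : ℝ → ℝ → ℝ} {f : ℝ → ℝ}, O1 L 3 (fun h t => φ h t - h ^ 2 * f t) →
      Ob (cyl L ω) 0 (fun h x => (f (x 0) - (h ^ 2)⁻¹ * φ h (x 0)) * h⁻¹) := by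
    intro φ f hφ
    obtain ⟨C, hC⟩ := hφ.toOb (ω := ω)
    refine ⟨C, fun h hh x hx => ?_⟩
    have h1 : (f (x 0) - (h ^ 2)⁻¹ * φ h (x 0)) * h⁻¹ =
        -((h ^ 3)⁻¹ * (φ h (x 0) - h ^ 2 * f (x 0))) := by
      have := hh.1.ne'
      field_simp
      ring
    have h3 : 0 < h ^ 3 := pow_pos hh.1 3
    simp only
    rw [h1, abs_neg, abs_mul, abs_of_pos (inv_pos.2 h3), pow_zero, mul_one,
      inv_mul_le_iff₀ h3]
    exact (hC h hh x hx).trans_eq (mul_comm _ _)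
  have N := key (hc.O1_nuN i)
  have B := key (hc.O1_nuB i)
  have S := ((Ob_coord hω 1).mul N).add ((Ob_coord hω 2).mul B)
  have fin : ∀ {G : ℝ → V3 → ℝ}, Ob (cyl L ω) 0 (fun h x => G h x * h⁻¹) →
      ∀ᶠ h in 𝓝[>] (0 : ℝ), eLpNorm (G h) 2 (volume.restrict (cyl L ω)) ≤ ε := by
    rintro G ⟨C, hC⟩
    refine eventually_eLpNorm_le hm hfin (C := C) (hI.mono fun h hh x hx => ?_) hε
    have := hC h hh x hx
    rwa [abs_mul, abs_of_pos (inv_pos.2 hh.1), pow_zero, mul_one, mul_inv_le_iff₀ hh.1] at this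
  have bd : ∀ {φ : ℝ → ℝ → ℝ} {h : ℝ}, O1 L 2 φ → h ∈ Ioc (0 : ℝ) 1 →
      ContDiffOn ℝ 1 (fun t => (h ^ 2)⁻¹ * φ h t) (Ioo 0 L) ∧
      Ob (cyl L ω) 0 (fun _ x => (h ^ 2)⁻¹ * φ h (x 0)) := by
    intro φ h hφ hh
    obtain ⟨C, hC⟩ := hφ
    refine ⟨contDiffOn_const.mul (hC h hh).1, (h ^ 2)⁻¹ * (C * h ^ 2), fun _ _ x hx => ?_⟩
    rw [abs_mul, abs_of_pos (inv_pos.2 (pow_pos hh.1 2)), pow_zero, mul_one]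
    have := inv_pos.2 (pow_pos hh.1 2)
    gcongr
    exact ((hC h hh).2 _ hx.1).1
  have lim : ∀ {f : ℝ → ℝ}, O1 L 0 (fun _ => f) → ContDiffOn ℝ 1 f (Ioo 0 L) := fun hf => by
    obtain ⟨C, hC⟩ := hf
    exact (hC 1 ⟨one_pos, le_rfl⟩).1
  filter_upwards [hI, fin N, fin B, fin (G := fun h x => x 1 * (fN θ₂ θ₃ (x 0) i -
    (h ^ 2)⁻¹ * nuN θ₂ θ₃ h (x 0) i) + x 2 * (fB θ₂ θ₃ (x 0) i -
    (h ^ 2)⁻¹ * nuB θ₂ θ₃ h (x 0) i)) (S.congr fun h _ x _ => by ring)] with h hh e1 e2 e3 F hF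
  obtain ⟨cn, bn⟩ := bd (hc.O1_nuN' i) hh
  obtain ⟨cb, bb⟩ := bd (hc.O1_nuB' i) hh
  refine hd.l2Near_section hω i cn cb bn bb (lim (hc.O1_fN i)) (lim (hc.O1_fB i))
    (hc.O1_fN i).toOb (hc.O1_fB i).toOb e3 e1 e2 (hF.trans (ae_of_all _ fun x => by ring))
    (ae_of_all _ fun x => ?_)
  simp [eta]
  ring

/-- The limit strain is the pointwise limit of (FᵀF - 1)/(2h²) along a sequence h → 0, so it
inherits measurability from `F`. -/
theorem aestronglyMeasurable_G (hd : d.IsSmooth L ω θ₂ θ₃) (hc : IsCurve L θ₂ θ₃)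
    (hω : IsCrossSection ω) (i j : Fin 3) :
    AEStronglyMeasurable (fun x => d.G θ₂ θ₃ x i j) (volume.restrict (cyl L ω)) := by
  obtain ⟨h₁, hh₁, hch⟩ := hc.isChart_ThetaP hω
  obtain ⟨C, hC1, hC⟩ := hd.exists_expansion' hc hω
  -- The sequence stays below the chart threshold, so the determinant bound and hence the expansion
  -- hold along it.
  have hs : ∀ n : ℕ, h₁ / (n + 1) ∈ Ioc 0 h₁ := fun n =>
    ⟨div_pos hh₁.1 (by positivity), div_le_self hh₁.1.le (by simp)⟩
  have hs' : ∀ n : ℕ, h₁ / (n + 1) ∈ Ioc (0 : ℝ) 1 := fun n =>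
    ⟨(hs n).1, (hs n).2.trans hh₁.2⟩
  have hs0 : Tendsto (fun n : ℕ => C * (h₁ / (n + 1))) atTop (𝓝 0) := by
    have h2 := (tendsto_one_div_add_atTop_nhds_zero_nat (𝕜 := ℝ)).const_mul (C * h₁)
    rw [mul_zero] at h2
    exact h2.congr fun n => by ring
  refine aestronglyMeasurable_of_tendsto_ae atTop (f := fun (n : ℕ) x =>
    (2 * (h₁ / (n + 1)) ^ 2)⁻¹ * (((d.F θ₂ θ₃ (h₁ / (n + 1)) x)ᵀ *
      d.F θ₂ θ₃ (h₁ / (n + 1)) x) i j - (1 : M3) i j)) (fun n => ?_) ?_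
  · have hF := hd.aestronglyMeasurable_F hc hω (hs' n)
    simp only [Matrix.mul_apply, Fin.sum_univ_three, Matrix.transpose_apply]
    exact (((((hF 0 i).mul (hF 0 j)).add ((hF 1 i).mul (hF 1 j))).add
      ((hF 2 i).mul (hF 2 j))).sub aestronglyMeasurable_const).const_mul _
  · filter_upwards [ae_mem_cyl hω.isOpen] with x hx
    refine tendsto_iff_norm_sub_tendsto_zero.2 (squeeze_zero (fun _ => norm_nonneg _)
      (fun n => ?_) hs0)
    have h2 := (hC _ (hs' n) x hx ((hch _ (hs n)).2 x hx)).2.2.1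
    have h3 := (abs_apply_le_frobenius _ i j).trans h2
    rw [IsCurve.sub_sub_smul_apply] at h3
    have hp := (hs' n).1
    generalize h₁ / ((n : ℝ) + 1) = s at h3 hp ⊢
    have h4 : (2 * s ^ 2)⁻¹ * (((d.F θ₂ θ₃ s x)ᵀ * d.F θ₂ θ₃ s x) i j - (1 : M3) i j) -
        d.G θ₂ θ₃ x i j = (2 * s ^ 2)⁻¹ * (((d.F θ₂ θ₃ s x)ᵀ * d.F θ₂ θ₃ s x) i j -
          (1 : M3) i j - 2 * s ^ 2 * d.G θ₂ θ₃ x i j) := by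
      field_simp
    have hs2 : 0 < 2 * s ^ 2 := by positivity
    rw [h4, Real.norm_eq_abs, abs_mul, abs_of_pos (inv_pos.2 hs2), inv_mul_le_iff₀ hs2]
    have h5 : 0 ≤ C * s ^ 3 := by positivity
    linarith [show 2 * s ^ 2 * (C * s) = 2 * (C * s ^ 3) by ring]

/-- The Jacobian of Θ^h∘P^h is h² det ∇Θ^h, and the normalisation of W^h turns det ∇Θ^h · W^h into
W. Thus h⁻⁶ times the energy of the rod equals h⁻⁴∫W(x, F), to which dominated convergence applies.
-/
theorem eventually_energy (hd : d.IsSmooth L ω θ₂ θ₃) (hc : IsCurve L θ₂ θ₃)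
    (hω : IsCrossSection ω) {W : V3 → M3 → ℝ≥0∞} (hW : IsStoredEnergy (cyl L ω) W) {h₀ : ℝ}
    (hh₀ : 0 < h₀) {Wh : ℝ → V3 → M3 → ℝ≥0∞}
    (hWh : ∀ h ∈ Ioc 0 h₀, ∀ x ∈ cyl L ω, ∀ F : M3,
      ENNReal.ofReal (detTheta θ₂ θ₃ h (P h x)) * Wh h (ThetaP θ₂ θ₃ h x) F = W x F) :
    Tendsto (fun h => (ENNReal.ofReal (h ^ 6))⁻¹ * ∫⁻ z in rodHat θ₂ θ₃ L ω h,
      Wh h z (grad (rodHat θ₂ θ₃ L ω h) (d.recY L ω θ₂ θ₃ h) z)) (𝓝[>] 0)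
      (𝓝 (ENNReal.ofReal (1 / 2 * ∫ x in cyl L ω, Q3 W x (d.G θ₂ θ₃ x)))) := by
  have hU := isOpen_cyl (L := L) hω.isOpen
  have hm := hU.measurableSet
  have hfin := (hω.volume_cyl_lt_top (L := L)).ne
  have := isFiniteMeasure_cyl (L := L) hω
  obtain ⟨h₁, hh₁, hch⟩ := hc.isChart_ThetaP hω
  obtain ⟨C, hC1, hC⟩ := hd.exists_expansion' hc hω
  obtain ⟨δ, hδ, hdp⟩ := exists_det_pos
  have hI : ∀ᶠ h in 𝓝[>] (0 : ℝ), h ∈ Ioc (0 : ℝ) h₁ := Ioc_mem_nhdsGT hh₁.1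
  have hI0 : ∀ᶠ h in 𝓝[>] (0 : ℝ), h ∈ Ioc (0 : ℝ) h₀ := Ioc_mem_nhdsGT hh₀
  have hIδ : ∀ᶠ h in 𝓝[>] (0 : ℝ), h ∈ Ioo (0 : ℝ) (δ / C) :=
    Ioo_mem_nhdsGT (div_pos hδ (by linarith))
  have hG : ∀ x ∈ cyl L ω, ‖d.G θ₂ θ₃ x‖ ≤ C := fun x hx =>
    (hC h₁ ⟨hh₁.1, hh₁.2⟩ x hx ((hch h₁ ⟨hh₁.1, le_rfl⟩).2 x hx)).2.1
  have hGs : ∀ x, (d.G θ₂ θ₃ x)ᵀ = d.G θ₂ θ₃ x := fun x => by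
    simp only [G, symPart, Matrix.transpose_smul, Matrix.transpose_add, Matrix.transpose_transpose]
    rw [add_comm]
  have hGm : ∀ i j, AEStronglyMeasurable (fun x => d.G θ₂ θ₃ x i j)
      (volume.restrict (cyl L ω)) := hd.aestronglyMeasurable_G hc hω
  have hlim := hW.tendsto_energy (F := fun h x => d.F θ₂ θ₃ h x) (G := d.G θ₂ θ₃) (C := C) hm hfin
    (hI.mono fun h hh => hd.aestronglyMeasurable_F hc hω ⟨hh.1, hh.2.trans hh₁.2⟩)
    (fun i j => memLp_of_bounded' (C := C) (hGm i j) ((ae_restrict_mem hm).mono fun x hx =>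
      (abs_apply_le_frobenius _ i j).trans (hG x hx)) 2) hGs hG
    (by
      filter_upwards [hI, hIδ] with h hh hhδ x hx
      have h2 := hC h ⟨hh.1, hh.2.trans hh₁.2⟩ x hx ((hch h hh).2 x hx)
      refine ⟨hdp _ (h2.2.2.2.2.trans_lt ?_), h2.2.2.1⟩
      have := hhδ.2
      rwa [lt_div_iff₀ (by linarith), mul_comm] at this)
  refine hlim.congr' ?_
  filter_upwards [hI, hI0] with h hh hh0
  obtain ⟨hΦ, hdet⟩ := hch h hh
  have hh' : h ∈ Ioc (0 : ℝ) 1 := ⟨hh.1, hh.2.trans hh₁.2⟩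
  obtain ⟨-, hgr⟩ := hd.recY_grad hc hω hh' hΦ hdet
  have e1 : ∫⁻ z in rodHat θ₂ θ₃ L ω h,
      Wh h z (grad (rodHat θ₂ θ₃ L ω h) (d.recY L ω θ₂ θ₃ h) z) =
      ENNReal.ofReal (h ^ 2) * ∫⁻ x in cyl L ω, W x (d.F θ₂ θ₃ h x) := by
    rw [← lintegral_const_mul' _ _ ENNReal.ofReal_ne_top]
    conv_lhs => rw [IsCurve.rodHat_eq hh.1, hΦ.lintegral_image, ← IsCurve.rodHat_eq hh.1]
    refine lintegral_congr_ae ?_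
    filter_upwards [hgr, ae_mem_cyl hω.isOpen] with x hx hxm
    have hdp := hdet x hxm
    rw [hx, ← hWh h hh0 x hxm, hc.detTheta_eq hh' hxm.1, ← mul_assoc,
      ← ENNReal.ofReal_mul (by positivity), Matrix.det_mul, scaleMat, Matrix.det_diagonal,
      Fin.prod_univ_three, abs_of_nonneg]
    · congr 2
      simp
      ring
    · have := hh.1
      simp
      exact mul_nonneg (by linarith) (by positivity)
  rw [e1, ← mul_assoc]
  congr 1
  have h2 : ENNReal.ofReal (h ^ 2) ≠ 0 := by
    rw [Ne, ENNReal.ofReal_eq_zero, not_le]; exact pow_pos hh.1 2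
  rw [show h ^ 6 = h ^ 4 * h ^ 2 by ring, ENNReal.ofReal_mul (pow_nonneg hh.1.le 4),
    ENNReal.mul_inv (Or.inr ENNReal.ofReal_ne_top) (Or.inr h2), mul_assoc,
    ENNReal.inv_mul_cancel h2 ENNReal.ofReal_ne_top, mul_one]

theorem eventually_grad (hd : d.IsSmooth L ω θ₂ θ₃) (hc : IsCurve L θ₂ θ₃)
    (hω : IsCrossSection ω) {ε : ℝ≥0∞} (hε : ε ≠ 0) : ∀ᶠ h in 𝓝[>] (0 : ℝ), ∀ i j,
    L2Near (volume.restrict (cyl L ω)) ε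
    (fun x => (grad (rodHat θ₂ θ₃ L ω h) (d.recY L ω θ₂ θ₃ h) (ThetaP θ₂ θ₃ h x) i j -
      (1 : M3) i j) / h)
    (fun x => Amat L d.v₂ d.v₃ d.w (x 0) i j) := by
  have hU := isOpen_cyl (L := L) hω.isOpen
  have hm := hU.measurableSet
  have hfin := (hω.volume_cyl_lt_top (L := L)).ne
  have := isFiniteMeasure_cyl (L := L) hω
  obtain ⟨h₁, hh₁, hch⟩ := hc.isChart_ThetaP hω
  obtain ⟨C, hC1, hC⟩ := hd.exists_expansion' hc hω
  have hI : ∀ᶠ h in 𝓝[>] (0 : ℝ), h ∈ Ioc (0 : ℝ) h₁ := Ioc_mem_nhdsGT hh₁.1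
  have hA : ∀ᵐ x ∂volume.restrict (cyl L ω), Amat L d.v₂ d.v₃ d.w (x 0) = d.A (x 0) := by
    filter_upwards [ae_cyl_of_ae (memW12_of_eqOn (hd.v₂.of_le (by norm_num))
      (eqOn_refl d.v₂ (Ioo 0 L))).2, ae_cyl_of_ae (memW12_of_eqOn (hd.v₃.of_le (by norm_num))
      (eqOn_refl d.v₃ (Ioo 0 L))).2] with x h2 h3
    rw [Amat, A, skewM, h2, h3]
  have hlt : ∀ i j, ∀ᶠ h in 𝓝[>] (0 : ℝ), eLpNorm (fun x => (d.F θ₂ θ₃ h x i j - (1 : M3) i j) / h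
      - d.A (x 0) i j) 2 (volume.restrict (cyl L ω)) ≤ ε := fun i j => by
    refine eventually_eLpNorm_le hm hfin (C := C) (hI.mono fun h hh x hx => ?_) hε
    have h2 := (hC h ⟨hh.1, hh.2.trans hh₁.2⟩ x hx ((hch h hh).2 x hx)).2.2.2.1
    have h3 := (abs_apply_le_frobenius _ i j).trans h2
    rw [IsCurve.sub_sub_smul_apply] at h3
    have h4 : (d.F θ₂ θ₃ h x i j - (1 : M3) i j) / h - d.A (x 0) i j =
        h⁻¹ * (d.F θ₂ θ₃ h x i j - (1 : M3) i j - h * d.A (x 0) i j) := by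
      have := hh.1.ne'
      field_simp
    rw [h4, abs_mul, abs_of_pos (inv_pos.2 hh.1), inv_mul_le_iff₀ hh.1]
    exact h3.trans_eq (by ring)
  filter_upwards [hI, eventually_all.2 fun i => eventually_all.2 fun j => hlt i j] with h hh hl i j
  obtain ⟨hΦ, hdet⟩ := hch h hh
  have hh' : h ∈ Ioc (0 : ℝ) 1 := ⟨hh.1, hh.2.trans hh₁.2⟩
  obtain ⟨-, hgr⟩ := hd.recY_grad hc hω hh' hΦ hdet
  refine L2Near.congr (f := fun x => (d.F θ₂ θ₃ h x i j - (1 : M3) i j) / h)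
    (g := fun x => d.A (x 0) i j) ⟨?_, hl i j⟩ (hgr.mono fun x hx => by simp only; rw [hx])
    (hA.mono fun x hx => by simp only; rw [hx])
  refine memLp_of_bounded' (C := C) ?_ ?_ 2
  · simp only [div_eq_mul_inv]
    exact ((hd.aestronglyMeasurable_F hc hω hh' i j).sub aestronglyMeasurable_const).mul_const _
  · filter_upwards [ae_restrict_mem hm] with x hx
    have h2 := (hC h hh' x hx (hdet x hx)).2.2.2.2
    have h3 := (abs_apply_le_frobenius _ i j).trans h2
    rw [Matrix.sub_apply] at h3
    rw [abs_div, abs_of_pos hh.1, div_le_iff₀ hh.1]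
    exact h3

theorem eventually_near (hd : d.IsSmooth L ω θ₂ θ₃) (hc : IsCurve L θ₂ θ₃)
    (hω : IsCrossSection ω) {W : V3 → M3 → ℝ≥0∞} (hW : IsStoredEnergy (cyl L ω) W) {h₀ : ℝ}
    (hh₀ : 0 < h₀) {Wh : ℝ → V3 → M3 → ℝ≥0∞}
    (hWh : ∀ h ∈ Ioc 0 h₀, ∀ x ∈ cyl L ω, ∀ F : M3,
      ENNReal.ofReal (detTheta θ₂ θ₃ h (P h x)) * Wh h (ThetaP θ₂ θ₃ h x) F = W x F)
    {ε : ℝ≥0∞} (hε : ε ≠ 0) : ∀ᶠ h in 𝓝[>] (0 : ℝ),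
      Near θ₂ θ₃ L ω Wh d (1 / 2 * ∫ x in cyl L ω, Q3 W x (d.G θ₂ θ₃ x)) ε h
        (d.recY L ω θ₂ θ₃ h) := by
  obtain ⟨h₁, hh₁, hch⟩ := hc.isChart_ThetaP hω
  have hI : ∀ᶠ h in 𝓝[>] (0 : ℝ), h ∈ Ioc (0 : ℝ) h₁ := Ioc_mem_nhdsGT hh₁.1
  have hE := hd.eventually_energy hc hω hW hh₀ hWh
  have hE1 := hE.eventually_le_const (u := ENNReal.ofReal (1 / 2 * ∫ x in cyl L ω,
    Q3 W x (d.G θ₂ θ₃ x)) + ε) (ENNReal.lt_add_right ENNReal.ofReal_ne_top hε)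
  have hE2 := (hE.add (tendsto_const_nhds (x := ε))).eventually_const_le
    (u := ENNReal.ofReal (1 / 2 * ∫ x in cyl L ω, Q3 W x (d.G θ₂ θ₃ x)))
    (ENNReal.lt_add_right ENNReal.ofReal_ne_top hε)
  filter_upwards [hI, hE1, hE2, hd.eventually_grad hc hω hε,
    eventually_all.2 fun i => hd.eventually_l2Near_eta hc hω i hε] with h hh e1 e2 hg hη
  obtain ⟨hΦ, hdet⟩ := hch h hh
  have hh' : h ∈ Ioc (0 : ℝ) 1 := ⟨hh.1, hh.2.trans hh₁.2⟩
  have hinv : ∀ x ∈ cyl L ω, d.recY L ω θ₂ θ₃ h (ThetaP θ₂ θ₃ h x) = d.recov θ₂ θ₃ h x :=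
    fun x hx => recY_ThetaP hΦ hx
  have hv2 := hd.v₂.of_le (m := 1) (by norm_num)
  have hv3 := hd.v₃.of_le (m := 1) (by norm_num)
  have hae : ∀ᵐ x ∂volume.restrict (cyl L ω),
      gammaOf θ₂ θ₃ L ω h (d.recY L ω θ₂ θ₃ h) x = d.γ x ∧
      etaOf θ₂ θ₃ L ω h (d.recY L ω θ₂ θ₃ h) x = fun i => d.γ x i -
        (h ^ 2)⁻¹ * (x 1 * nuN θ₂ θ₃ h (x 0) i + x 2 * nuB θ₂ θ₃ h (x 0) i) := by
    filter_upwards [ae_cyl_of_ae (memW12_of_eqOn hv2 (hd.v₂Of_eq hω hh.1 hinv)).2,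
      ae_cyl_of_ae (memW12_of_eqOn hv3 (hd.v₃Of_eq hω hh.1 hinv)).2,
      ae_mem_cyl hω.isOpen] with x h2 h3 hx
    exact hd.gammaOf_eq hω hh.1 hinv hx h2 h3 (hd.wOf_eq hω hh.1 hinv hc hx.1)
  exact {
    mem := (hd.recY_grad hc hω hh' hΦ hdet).1
    u := .of_eqOn hd.u (hd.uOf_eq hω hh.1 hinv)
    v₂ := .of_eqOn hv2 (hd.v₂Of_eq hω hh.1 hinv)
    v₃ := .of_eqOn hv3 (hd.v₃Of_eq hω hh.1 hinv)
    w := .of_eqOn hd.w (hd.wOf_eq hω hh.1 hinv hc)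
    grad := hg
    γ := fun i => hd.l2Near_self hω i (hae.mono fun x hx => by simp only; rw [hx.1])
    η := fun i => hη i _ (hae.mono fun x hx => by simp only; rw [hx.2])
    energy_le := e1
    le_energy := e2 }

end Disp.IsSmooth

end SmoothLimit

/-! ### Smooth approximation of the warping -/

section Warping

variable {L : ℝ} {ω : Set V2} {θ₂ θ₃ : ℝ → ℝ}

theorem continuous_section (t : ℝ) : Continuous fun s : V2 => (![t, s 0, s 1] : V3) := by
  refine continuous_pi fun i => ?_
  fin_cases i <;> simp <;> fun_prop

theorem exists_bound_contDiff (hω : IsCrossSection ω) {f : V3 → ℝ} (hf : ContDiff ℝ 1 f) :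
    ∃ C : ℝ, ∀ x ∈ cyl L ω, |f x| ≤ C ∧ ∀ k, |fderiv ℝ f x (e k)| ≤ C := by
  have hK := (isBounded_cyl (L := L) hω.isBounded).isCompact_closure
  obtain ⟨C, hC⟩ := hK.exists_bound_of_continuousOn hf.continuous.continuousOn
  choose D hD using fun k => hK.exists_bound_of_continuousOn
    (continuous_fderiv_apply' hf (e k)).continuousOn
  refine ⟨|C| + ∑ k, |D k|, fun x hx => ⟨?_, fun k => ?_⟩⟩
  · have h1 := hC x (subset_closure hx)
    have h2 : 0 ≤ ∑ k, |D k| := by positivity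
    linarith [le_abs_self C, Real.norm_eq_abs (f x)]
  · have h1 := hD k x (subset_closure hx)
    have h2 := Finset.single_le_sum (f := fun k => |D k|) (fun i _ => abs_nonneg _)
      (Finset.mem_univ k)
    rw [Real.norm_eq_abs] at h1
    linarith [le_abs_self (D k), abs_nonneg C]

theorem abs_secInt_le (hω : IsCrossSection ω) {f : V3 → ℝ} {C : ℝ}
    (hC : ∀ x ∈ cyl L ω, |f x| ≤ C) {t : ℝ} (ht : t ∈ Ioo 0 L) :
    |secInt ω f t| ≤ C * area ω :=
  norm_setIntegral_le_of_norm_le_const (f := fun s : V2 => f ![t, s 0, s 1]) hω.volume_lt_top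
    fun _ hs => hC _ (Disp.cons_mem_cyl ht hs)

/-- Differentiation under the integral; the bound on the gradient is uniform because the cylinder is
bounded and `f` is C¹ on the whole space. -/
theorem hasDerivAt_secInt (hω : IsCrossSection ω) {f : V3 → ℝ} (hf : ContDiff ℝ 1 f) {t : ℝ}
    (ht : t ∈ Ioo 0 L) :
    HasDerivAt (secInt ω f) (secInt ω (fun x => fderiv ℝ f x (e 0)) t) t := by
  obtain ⟨C, hC⟩ := exists_bound_contDiff (L := L) hω hf
  have : IsFiniteMeasure (volume.restrict ω) := ⟨by simpa using hω.volume_lt_top⟩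
  refine (hasDerivAt_integral_of_dominated_loc_of_deriv_le (bound := fun _ => C)
    (F := fun t (s : V2) => f ![t, s 0, s 1])
    (F' := fun t (s : V2) => fderiv ℝ f ![t, s 0, s 1] (e 0))
    (Ioo_mem_nhds ht.1 ht.2) (Eventually.of_forall fun t' => ?_) ?_ ?_ ?_ (integrable_const C)
    ?_).2
  · exact (hf.continuous.comp (continuous_section t')).aestronglyMeasurable
  · exact integrableOn_of_continuous hω (hf.continuous.comp (continuous_section t))
  · exact ((continuous_fderiv_apply' hf (e 0)).comp (continuous_section t)).aestronglyMeasurable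
  · filter_upwards [ae_restrict_mem hω.isOpen.measurableSet] with s hs t' ht'
    exact (hC _ (Disp.cons_mem_cyl ht' hs)).2 0
  · filter_upwards with s t' _
    have h1 : HasDerivAt (fun t : ℝ => (![t, s 0, s 1] : V3)) (e 0) t' := by
      refine hasDerivAt_pi.2 fun i => ?_
      fin_cases i
      · simp only [Fin.zero_eta, Matrix.cons_val_zero, e, Pi.single_eq_same]
        exact hasDerivAt_id' t'
      · simpa [e] using hasDerivAt_const t' (s 0)
      · simpa [e] using hasDerivAt_const t' (s 1)
    exact ((hf.differentiable one_ne_zero _).hasFDerivAt).comp_hasDerivAt t' h1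

theorem exists_deriv_secInt (hω : IsCrossSection ω) {f : V3 → ℝ} (hf : ContDiff ℝ 1 f) :
    (∀ t ∈ Ioo 0 L, DifferentiableAt ℝ (secInt ω f) t) ∧
    Ob (cyl L ω) 0 (fun _ x => secInt ω f (x 0)) ∧
    Ob (cyl L ω) 0 (fun _ x => deriv (secInt ω f) (x 0)) := by
  obtain ⟨C, hC⟩ := exists_bound_contDiff (L := L) hω hf
  refine ⟨fun t ht => (hasDerivAt_secInt hω hf ht).differentiableAt,
    ⟨C * area ω, fun _ _ x hx => ?_⟩, ⟨C * area ω, fun _ _ x hx => ?_⟩⟩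
  · rw [pow_zero, mul_one]
    exact abs_secInt_le hω (fun x hx => (hC x hx).1) hx.1
  · simp only
    rw [pow_zero, mul_one, (hasDerivAt_secInt hω hf hx.1).deriv]
    exact abs_secInt_le hω (fun x hx => (hC x hx).2 0) hx.1

theorem ae_integrableOn_section {ψ : V3 → ℝ} (hψ : IntegrableOn ψ (cyl L ω)) :
    ∀ᵐ t ∂volume.restrict (Ioo 0 L), IntegrableOn (fun s : V2 => ψ ![t, s 0, s 1]) ω := by
  have h1 := (measurePreserving_cylEquiv_restrict.integrable_comp_emb
    (cylEquiv.measurableEmbedding)).2 hψ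
  filter_upwards [h1.prod_right_ae] with t ht
  simpa only [IntegrableOn, Function.comp_def, cylEquiv_apply] using ht

/-- Cauchy–Schwarz on each section contributes √|ω|, and extending a function of x₁ to the cylinder
contributes another √|ω|. -/
theorem eLpNorm_section_le (hω : IsCrossSection ω) {φ : V3 → ℝ} {h : ℝ → ℝ}
    (hφ : AEStronglyMeasurable φ (volume.restrict (cyl L ω)))
    (hh : AEStronglyMeasurable h (volume.restrict (Ioo 0 L)))
    (hle : ∀ᵐ t ∂volume.restrict (Ioo 0 L), ‖h t‖ₑ ≤ ∫⁻ s in ω, ‖φ ![t, s 0, s 1]‖ₑ) :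
    eLpNorm (fun x : V3 => h (x 0)) 2 (volume.restrict (cyl L ω)) ≤
      volume ω * eLpNorm φ 2 (volume.restrict (cyl L ω)) := by
  have hsec : ∀ᵐ t ∂volume.restrict (Ioo 0 L), AEStronglyMeasurable
      (fun s : V2 => φ ![t, s 0, s 1]) (volume.restrict ω) := by
    have h1 := hφ.comp_measurePreserving measurePreserving_cylEquiv_restrict
    filter_upwards [h1.prodMk_left] with t ht
    simpa only [Function.comp_def, cylEquiv_apply] using ht
  have hsq : eLpNorm h 2 (volume.restrict (Ioo 0 L)) ^ 2 ≤
      volume ω * eLpNorm φ 2 (volume.restrict (cyl L ω)) ^ 2 := by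
    rw [eLpNorm_two_sq, eLpNorm_two_sq, lintegral_cyl (hφ.enorm.pow_const 2),
      ← lintegral_const_mul' _ _ hω.volume_lt_top.ne]
    refine lintegral_mono_ae ?_
    filter_upwards [hle, hsec] with t h1 h2
    have h3 := eLpNorm_le_eLpNorm_mul_rpow_measure_univ (p := 1) (q := 2) (by norm_num) h2
    rw [eLpNorm_one_eq_lintegral_enorm, Measure.restrict_apply_univ] at h3
    calc ‖h t‖ₑ ^ 2 ≤ (eLpNorm (fun s : V2 => φ ![t, s 0, s 1]) 2 (volume.restrict ω) *
          volume ω ^ (1 / (1 : ℝ≥0∞).toReal - 1 / (2 : ℝ≥0∞).toReal)) ^ 2 := by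
          gcongr
          exact h1.trans h3
      _ = volume ω * ∫⁻ s in ω, ‖φ ![t, s 0, s 1]‖ₑ ^ 2 := by
          rw [mul_pow, eLpNorm_two_sq, ← ENNReal.rpow_natCast (volume ω ^ _), ← ENNReal.rpow_mul,
            mul_comm]
          congr 1
          norm_num
  rw [eLpNorm_fst_cyl hh]
  have h5 : (volume ω ^ (1 / 2 : ℝ) * eLpNorm h 2 (volume.restrict (Ioo 0 L))) ^ 2 ≤
      (volume ω * eLpNorm φ 2 (volume.restrict (cyl L ω))) ^ 2 := by
    calc _ = volume ω * eLpNorm h 2 (volume.restrict (Ioo 0 L)) ^ 2 := by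
          rw [mul_pow, ← ENNReal.rpow_natCast (volume ω ^ _), ← ENNReal.rpow_mul]
          norm_num
      _ ≤ volume ω * (volume ω * eLpNorm φ 2 (volume.restrict (cyl L ω)) ^ 2) := by gcongr
      _ = _ := by ring
  exact (ENNReal.pow_le_pow_left_iff two_ne_zero).1 h5

/-- Because the section integrals of `ψ` vanish, those of `Ψ` are the integrals of `Ψ - ψ`: an
approximation violates the constraint only by its own error. -/
theorem eLpNorm_secInt_le (hω : IsCrossSection ω) {Ψ ψ : V3 → ℝ}
    (hψ : MemLp ψ 2 (volume.restrict (cyl L ω)))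
    (hΨ : MemLp Ψ 2 (volume.restrict (cyl L ω)))
    (hh : AEStronglyMeasurable (secInt ω Ψ) (volume.restrict (Ioo 0 L)))
    (h0 : ∀ᵐ t ∂volume.restrict (Ioo 0 L), secInt ω ψ t = 0) :
    eLpNorm (fun x : V3 => secInt ω Ψ (x 0)) 2 (volume.restrict (cyl L ω)) ≤
      volume ω * eLpNorm (fun x => Ψ x - ψ x) 2 (volume.restrict (cyl L ω)) := by
  have := isFiniteMeasure_cyl (L := L) hω
  refine eLpNorm_section_le hω (hΨ.1.sub hψ.1) hh ?_
  filter_upwards [h0, ae_integrableOn_section (hψ.integrable (by norm_num)),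
    ae_integrableOn_section (hΨ.integrable (by norm_num))] with t h1 h2 h3
  have h4 : secInt ω Ψ t = ∫ s in ω, (Ψ ![t, s 0, s 1] - ψ ![t, s 0, s 1]) := by
    rw [integral_sub h3 h2]
    rw [secInt] at h1
    rw [h1, sub_zero, secInt]
  rw [h4]
  exact enorm_integral_le_lintegral_enorm _

end Warping

/-! ### Restoring the mean and twist constraints of a warping -/

section WarpingApprox

variable {L : ℝ} {ω : Set V2} {θ₂ θ₃ : ℝ → ℝ}

theorem eLpNorm_mul_le_of_bound {μ : Measure V3} {b f : V3 → ℝ} {R : ℝ}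
    (hb : ∀ᵐ x ∂μ, |b x| ≤ R) :
    eLpNorm (fun x => b x * f x) 2 μ ≤ ENNReal.ofReal R * eLpNorm f 2 μ :=
  eLpNorm_le_mul_eLpNorm_of_ae_le_mul (hb.mono fun x hx => by
    rw [norm_mul]
    exact mul_le_mul_of_nonneg_right hx (norm_nonneg _)) 2

variable (θ₂ θ₃ ω) in
/-- The twisting moment of a warping. -/
def twistOf (F : Fin 3 → V3 → ℝ) (t : ℝ) : ℝ :=
  (polarMoment ω)⁻¹ * secInt ω (fun x => xp θ₂ θ₃ x 2 * F 1 x - xp θ₂ θ₃ x 1 * F 2 x) t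

variable (θ₂ θ₃ ω) in
/-- The warping `F` without its means and its twist. -/
def centred (F : Fin 3 → V3 → ℝ) (x : V3) : V3 := fun i =>
  F i x - (area ω)⁻¹ * secInt ω (F i) (x 0) + twistOf ω θ₂ θ₃ F (x 0) * perp θ₂ θ₃ x i

theorem perp_apply (x : V3) (i : Fin 3) : perp θ₂ θ₃ x i =
    x 1 * (![0, -p₃ θ₂ θ₃ (x 0), p₂ θ₂ θ₃ (x 0)] : V3) i +
    x 2 * (![0, -p₂ θ₂ θ₃ (x 0), -p₃ θ₂ θ₃ (x 0)] : V3) i := by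
  fin_cases i
  · simp [perp]
  · simp [perp, xp_two]; ring
  · simp [perp, xp_one]; ring

/-- Separates the rotation coefficients, which are merely C¹ on the open interval, from section
moments of C¹ functions; this makes the twist differentiable with bounded derivative. -/
theorem twistOf_eq (hω : IsCrossSection ω) {F : Fin 3 → V3 → ℝ} (hF : ∀ i, ContDiff ℝ 1 (F i))
    (t : ℝ) : twistOf ω θ₂ θ₃ F t = (polarMoment ω)⁻¹ *
      (p₃ θ₂ θ₃ t * secInt ω (fun x => x 1 * F 1 x) t + p₂ θ₂ θ₃ t *
        secInt ω (fun x => x 2 * F 1 x) t - p₂ θ₂ θ₃ t * secInt ω (fun x => x 1 * F 2 x) t +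
        p₃ θ₂ θ₃ t * secInt ω (fun x => x 2 * F 2 x) t) := by
  have hint : ∀ j i, IntegrableOn (fun s : V2 => (![t, s 0, s 1] : V3) j * F i ![t, s 0, s 1]) ω :=
    fun j i => integrableOn_of_continuous hω
      (((continuous_apply j).comp (continuous_section t)).mul
        ((hF i).continuous.comp (continuous_section t)))
  rw [twistOf]
  congr 1
  simp only [secInt]
  rw [← integral_const_mul, ← integral_const_mul, ← integral_const_mul, ← integral_const_mul]
  have i1 := (hint 1 1).const_mul (p₃ θ₂ θ₃ t)
  have i2 := (hint 2 1).const_mul (p₂ θ₂ θ₃ t)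
  have i3 := (hint 1 2).const_mul (p₂ θ₂ θ₃ t)
  have i4 := (hint 2 2).const_mul (p₃ θ₂ θ₃ t)
  refine Eq.trans ?_ ((integral_add ((i1.add i2).sub i3) i4).trans (congrArg (· + _)
    ((integral_sub (i1.add i2) i3).trans (congrArg (· - _) (integral_add i1 i2)))))
  refine integral_congr_ae (ae_of_all _ fun s => ?_)
  simp [xp_one, xp_two]
  ring

theorem IsCurve.exists_deriv_twistOf (hc : IsCurve L θ₂ θ₃) (hω : IsCrossSection ω)
    {F : Fin 3 → V3 → ℝ} (hF : ∀ i, ContDiff ℝ 1 (F i)) :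
    (∀ t ∈ Ioo 0 L, DifferentiableAt ℝ (twistOf ω θ₂ θ₃ F) t) ∧
    Ob (cyl L ω) 0 (fun _ x => twistOf ω θ₂ θ₃ F (x 0)) ∧
    Ob (cyl L ω) 0 (fun _ x => deriv (twistOf ω θ₂ θ₃ F) (x 0)) := by
  have hx : ∀ j : Fin 3, ContDiff ℝ 1 fun x : V3 => x j := fun j => contDiff_apply ℝ ℝ j
  have S := fun j i => exists_deriv_secInt (L := L) hω ((hx j).mul (hF i))
  have e1 : twistOf ω θ₂ θ₃ F = _ := funext fun t => twistOf_eq hω hF t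
  have p2 := hc.p₂.toO1
  have p3 := hc.p₃.toO1
  have one : (1 : ℝ) ∈ Ioc (0 : ℝ) 1 := ⟨one_pos, le_rfl⟩
  have hd : ∀ t ∈ Ioo 0 L, HasDerivAt (twistOf ω θ₂ θ₃ F) _ t := fun t ht => by
    rw [e1]
    have d2 := (p2.strictDeriv one ht).hasDerivAt
    have d3 := (p3.strictDeriv one ht).hasDerivAt
    have s := fun j i => ((S j i).1 t ht).hasDerivAt
    exact (((((d3.mul (s 1 1)).add (d2.mul (s 2 1))).sub (d2.mul (s 1 2))).add
      (d3.mul (s 2 2))).const_mul _)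
  refine ⟨fun t ht => (hd t ht).differentiableAt, ?_, ?_⟩
  · rw [e1]
    have s := fun j i => (S j i).2.1
    have q2 := p2.toOb (ω := ω)
    have q3 := p3.toOb (ω := ω)
    exact (Ob.const _ _).mul ((((q3.mul (s 1 1)).add (q2.mul (s 2 1))).sub (q2.mul (s 1 2))).add
      (q3.mul (s 2 2)))
  · have s := fun j i => (S j i).2.1
    have s' := fun j i => (S j i).2.2
    have q2 := p2.toOb (ω := ω)
    have q3 := p3.toOb (ω := ω)
    have q2' := p2.toOb_deriv (ω := ω)
    have q3' := p3.toOb_deriv (ω := ω)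
    refine ((Ob.const _ (polarMoment ω)⁻¹).mul (((((q3'.mul (s 1 1)).add (q3.mul (s' 1 1))).add
      ((q2'.mul (s 2 1)).add (q2.mul (s' 2 1)))).sub ((q2'.mul (s 1 2)).add
      (q2.mul (s' 1 2)))).add ((q3'.mul (s 2 2)).add (q3.mul (s' 2 2))))).congr fun h _ x hx => ?_
    exact (hd _ hx.1).deriv

theorem hasFDerivAt_fst {f : ℝ → ℝ} {x : V3} (hf : DifferentiableAt ℝ f (x 0)) :
    HasFDerivAt (fun z : V3 => f (z 0)) (rowL ![deriv f (x 0), 0, 0]) x := by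
  have h1 : HasFDerivAt (fun z : V3 => z 0)
      (ContinuousLinearMap.proj (R := ℝ) (φ := fun _ : Fin 3 => ℝ) 0) x :=
    (ContinuousLinearMap.proj (R := ℝ) (φ := fun _ : Fin 3 => ℝ) 0).hasFDerivAt
  refine (hf.hasDerivAt.comp_hasFDerivAt x h1).congr_fderiv ?_
  ext z
  simp [rowL_apply, Fin.sum_univ_three]

theorem IsCurve.hasFDerivAt_perp (hc : IsCurve L θ₂ θ₃) {x : V3} (hx : x 0 ∈ Ioo 0 L) (i : Fin 3) :
    HasFDerivAt (fun z => perp θ₂ θ₃ z i) (rowL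
      ![x 1 * (![0, -deriv (CurvedRod.p₃ θ₂ θ₃) (x 0), deriv (CurvedRod.p₂ θ₂ θ₃) (x 0)] : V3) i +
        x 2 * (![0, -deriv (CurvedRod.p₂ θ₂ θ₃) (x 0), -deriv (CurvedRod.p₃ θ₂ θ₃) (x 0)] : V3) i,
        (![0, -CurvedRod.p₃ θ₂ θ₃ (x 0), CurvedRod.p₂ θ₂ θ₃ (x 0)] : V3) i,
        (![0, -CurvedRod.p₂ θ₂ θ₃ (x 0), -CurvedRod.p₃ θ₂ θ₃ (x 0)] : V3) i]) x := by
  have one : (1 : ℝ) ∈ Ioc (0 : ℝ) 1 := ⟨one_pos, le_rfl⟩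
  have d2 := hc.p₂.toO1.strictDeriv one hx
  have d3 := hc.p₃.toO1.strictDeriv one hx
  have d0 := hasStrictDerivAt_const (x 0) (0 : ℝ)
  have key : ∃ B' C' : ℝ,
      HasStrictDerivAt (fun t => (![0, -CurvedRod.p₃ θ₂ θ₃ t, CurvedRod.p₂ θ₂ θ₃ t] : V3) i)
        B' (x 0) ∧
      HasStrictDerivAt (fun t => (![0, -CurvedRod.p₂ θ₂ θ₃ t, -CurvedRod.p₃ θ₂ θ₃ t] : V3) i)
        C' (x 0) ∧
      B' = (![0, -deriv (CurvedRod.p₃ θ₂ θ₃) (x 0), deriv (CurvedRod.p₂ θ₂ θ₃) (x 0)] : V3) i ∧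
      C' = (![0, -deriv (CurvedRod.p₂ θ₂ θ₃) (x 0), -deriv (CurvedRod.p₃ θ₂ θ₃) (x 0)] : V3) i := by
    fin_cases i
    · exact ⟨_, _, d0, d0, rfl, rfl⟩
    · exact ⟨_, _, d3.neg, d2.neg, rfl, rfl⟩
    · exact ⟨_, _, d2, d3.neg, rfl, rfl⟩
  obtain ⟨B', C', hB, hC, rfl, rfl⟩ := key
  simp only [perp_apply]
  have h1 := (hasStrictFDerivAt_affine d0 hB hC).hasFDerivAt
  simp only [zero_add] at h1
  exact h1

theorem IsCurve.Ob_perp (hc : IsCurve L θ₂ θ₃) (hω : IsCrossSection ω) (i : Fin 3) :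
    Ob (cyl L ω) 0 (fun _ x => perp θ₂ θ₃ x i) ∧
    ∀ k, Ob (cyl L ω) 0 (fun _ x => fderiv ℝ (fun z => perp θ₂ θ₃ z i) x (e k)) := by
  have q2 := hc.p₂.toO1.toOb (ω := ω)
  have q3 := hc.p₃.toO1.toOb (ω := ω)
  have q2' := hc.p₂.toO1.toOb_deriv (ω := ω)
  have q3' := hc.p₃.toO1.toOb_deriv (ω := ω)
  have q0 := Ob.const (cyl L ω) 0
  have B : Ob (cyl L ω) 0 fun _ x =>
      (![0, -CurvedRod.p₃ θ₂ θ₃ (x 0), CurvedRod.p₂ θ₂ θ₃ (x 0)] : V3) i := by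
    fin_cases i; exacts [q0, q3.neg, q2]
  have C : Ob (cyl L ω) 0 fun _ x =>
      (![0, -CurvedRod.p₂ θ₂ θ₃ (x 0), -CurvedRod.p₃ θ₂ θ₃ (x 0)] : V3) i := by
    fin_cases i; exacts [q0, q2.neg, q3.neg]
  have B' : Ob (cyl L ω) 0 fun _ x =>
      (![0, -deriv (CurvedRod.p₃ θ₂ θ₃) (x 0), deriv (CurvedRod.p₂ θ₂ θ₃) (x 0)] : V3) i := by
    fin_cases i; exacts [q0, q3'.neg, q2']
  have C' : Ob (cyl L ω) 0 fun _ x =>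
      (![0, -deriv (CurvedRod.p₂ θ₂ θ₃) (x 0), -deriv (CurvedRod.p₃ θ₂ θ₃) (x 0)] : V3) i := by
    fin_cases i; exacts [q0, q2'.neg, q3'.neg]
  have x1 := Ob_coord (L := L) hω 1
  have x2 := Ob_coord (L := L) hω 2
  refine ⟨by simp only [perp_apply]; exact (x1.mul B).add (x2.mul C), fun k => ?_⟩
  have hrow : ∀ v : V3, rowL v (e k) = v k := fun v => by
    rw [rowL_apply]
    simp [e, Pi.single_apply]
  refine Ob.congr ?_ fun _ _ x hx => ((congrArg (fun T => T (e k))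
    (hc.hasFDerivAt_perp hx.1 i).fderiv).trans (hrow _))
  fin_cases k
  · exact (x1.mul B').add (x2.mul C')
  · exact B
  · exact C

theorem IsCurve.hasFDerivAt_centred (hc : IsCurve L θ₂ θ₃) (hω : IsCrossSection ω)
    {F : Fin 3 → V3 → ℝ} (hF : ∀ i, ContDiff ℝ 1 (F i)) {x : V3} (hx : x ∈ cyl L ω) (i : Fin 3) :
    HasFDerivAt (fun z => centred ω θ₂ θ₃ F z i)
      (fderiv ℝ (F i) x - (area ω)⁻¹ • rowL ![deriv (secInt ω (F i)) (x 0), 0, 0] +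
        (twistOf ω θ₂ θ₃ F (x 0) • fderiv ℝ (fun z => perp θ₂ θ₃ z i) x +
          perp θ₂ θ₃ x i • rowL ![deriv (twistOf ω θ₂ θ₃ F) (x 0), 0, 0])) x :=
  ((((hF i).differentiable one_ne_zero x).hasFDerivAt).sub
    ((hasFDerivAt_fst ((exists_deriv_secInt (L := L) hω (hF i)).1 _ hx.1)).const_mul _)).add
    ((hasFDerivAt_fst ((hc.exists_deriv_twistOf hω hF).1 _ hx.1)).mul
      (hc.hasFDerivAt_perp hx.1 i).differentiableAt.hasFDerivAt)

/-- In cross-sectional directions the factors `(e k) 0` vanish, so the derivatives of the mean and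
of the twist in x₁ do not enter; only the twist itself has to be small. -/
theorem IsCurve.fderiv_centred (hc : IsCurve L θ₂ θ₃) (hω : IsCrossSection ω)
    {F : Fin 3 → V3 → ℝ} (hF : ∀ i, ContDiff ℝ 1 (F i)) {x : V3} (hx : x ∈ cyl L ω) (i k : Fin 3) :
    fderiv ℝ (fun z => centred ω θ₂ θ₃ F z i) x (e k) = fderiv ℝ (F i) x (e k) -
      (area ω)⁻¹ * (deriv (secInt ω (F i)) (x 0) * (e k) 0) +
      (twistOf ω θ₂ θ₃ F (x 0) * fderiv ℝ (fun z => perp θ₂ θ₃ z i) x (e k) +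
        perp θ₂ θ₃ x i * (deriv (twistOf ω θ₂ θ₃ F) (x 0) * (e k) 0)) := by
  rw [(hc.hasFDerivAt_centred hω hF hx i).fderiv]
  simp [rowL_apply, Fin.sum_univ_three]

theorem IsCurve.Ob_centred (hc : IsCurve L θ₂ θ₃) (hω : IsCrossSection ω)
    {F : Fin 3 → V3 → ℝ} (hF : ∀ i, ContDiff ℝ 1 (F i)) (i : Fin 3) :
    Ob (cyl L ω) 0 (fun _ x => centred ω θ₂ θ₃ F x i) ∧
    ∀ k, Ob (cyl L ω) 0 (fun _ x => fderiv ℝ (fun z => centred ω θ₂ θ₃ F z i) x (e k)) := by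
  obtain ⟨C, hC⟩ := exists_bound_contDiff (L := L) hω (hF i)
  have f0 : Ob (cyl L ω) 0 (fun _ x => F i x) :=
    ⟨C, fun _ _ x hx => by simpa using (hC x hx).1⟩
  have f1 : ∀ k, Ob (cyl L ω) 0 (fun _ x => fderiv ℝ (F i) x (e k)) :=
    fun k => ⟨C, fun _ _ x hx => by simpa using (hC x hx).2 k⟩
  obtain ⟨-, s0, s1⟩ := exists_deriv_secInt (L := L) hω (hF i)
  obtain ⟨-, t0, t1⟩ := hc.exists_deriv_twistOf hω hF
  obtain ⟨q0, q1⟩ := hc.Ob_perp hω i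
  exact ⟨(f0.sub ((Ob.const _ _).mul s0)).add (t0.mul q0), fun k =>
    (((f1 k).sub ((Ob.const _ (area ω)⁻¹).mul (s1.mul (Ob.const _ ((e k) 0))))).add
      ((t0.mul (q1 k)).add (q0.mul (t1.mul (Ob.const _ ((e k) 0)))))).congr
      fun _ _ x hx => hc.fderiv_centred hω hF hx i k⟩

/-- The vector field `perp` is linear on each section and has zero mean, so removing the twist does
not disturb the means. -/
theorem secInt_centred (hω : IsCrossSection ω) {F : Fin 3 → V3 → ℝ}
    (hF : ∀ i, ContDiff ℝ 1 (F i)) {t : ℝ} (ht : t ∈ Ioo 0 L) (i : Fin 3) :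
    secInt ω (fun x => centred ω θ₂ θ₃ F x i) t = 0 := by
  set f : V3 → ℝ := fun x => -((area ω)⁻¹ * secInt ω (F i) (x 0)) +
    twistOf ω θ₂ θ₃ F (x 0) * perp θ₂ θ₃ x i with hf
  have h1 : secInt ω f t = -((area ω)⁻¹ * secInt ω (F i) t) * area ω :=
    Disp.secInt_affine hω (L := L) (g := fun _ => 0)
      (β := twistOf ω θ₂ θ₃ F t * (![0, -p₃ θ₂ θ₃ t, p₂ θ₂ θ₃ t] : V3) i)
      (β' := twistOf ω θ₂ θ₃ F t * (![0, -p₂ θ₂ θ₃ t, -p₃ θ₂ θ₃ t] : V3) i) ht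
      integrableOn_zero (by simp [secInt]) (by
        rintro x hx rfl
        simp only [hf, perp_apply]
        ring)
  have hA := (area_pos hω).ne'
  have h2 : secInt ω (fun x => centred ω θ₂ θ₃ F x i) t = secInt ω (F i) t + secInt ω f t := by
    simp only [secInt]
    rw [← integral_add]
    · refine integral_congr_ae (ae_of_all _ fun s => ?_)
      simp only [centred, hf]
      ring
    · exact integrableOn_of_continuous hω ((hF i).continuous.comp (continuous_section t))
    · refine integrableOn_of_continuous hω ?_
      simp only [hf, perp_apply, Matrix.cons_val_zero, Matrix.cons_val_one, Matrix.cons_val]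
      fun_prop
  rw [h2, h1]
  field_simp
  ring

/-- The subtracted means enter multiplied by x₂', x₃' and integrate to zero, while `perp`
contributes -(x₂'² + x₃'²), that is, minus the polar moment. -/
theorem IsCurve.twist_centred (hc : IsCurve L θ₂ θ₃) (hω : IsCrossSection ω) {F : Fin 3 → V3 → ℝ}
    (hF : ∀ i, ContDiff ℝ 1 (F i)) {t : ℝ} (ht : t ∈ Ioo 0 L) :
    secInt ω (fun x => xp θ₂ θ₃ x 2 * centred ω θ₂ θ₃ F x 1 -
      xp θ₂ θ₃ x 1 * centred ω θ₂ θ₃ F x 2) t = 0 := by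
  set f : V3 → ℝ := fun x => -twistOf ω θ₂ θ₃ F (x 0) * (xp θ₂ θ₃ x 2 ^ 2 + xp θ₂ θ₃ x 1 ^ 2) -
    xp θ₂ θ₃ x 2 * ((area ω)⁻¹ * secInt ω (F 1) (x 0)) +
    xp θ₂ θ₃ x 1 * ((area ω)⁻¹ * secInt ω (F 2) (x 0)) with hf
  have h1 : secInt ω f t = -twistOf ω θ₂ θ₃ F t * polarMoment ω :=
    Disp.secInt_quadratic hω (L := L) (g := fun _ => 0)
      (β := -(CurvedRod.p₃ θ₂ θ₃ t * ((area ω)⁻¹ * secInt ω (F 1) t)) +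
        CurvedRod.p₂ θ₂ θ₃ t * ((area ω)⁻¹ * secInt ω (F 2) t))
      (β' := -(CurvedRod.p₂ θ₂ θ₃ t * ((area ω)⁻¹ * secInt ω (F 1) t)) -
        CurvedRod.p₃ θ₂ θ₃ t * ((area ω)⁻¹ * secInt ω (F 2) t)) ht
      integrableOn_zero (by simp [secInt]) (by
        rintro x hx rfl
        have hps := hc.p_sq hx.1
        simp only [hf, xp_one, xp_two]
        linear_combination (-twistOf ω θ₂ θ₃ F (x 0) * (x 1 ^ 2 + x 2 ^ 2)) * hps)
  have hA := (polarMoment_pos hω).ne'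
  have h2 : secInt ω (fun x => xp θ₂ θ₃ x 2 * centred ω θ₂ θ₃ F x 1 -
      xp θ₂ θ₃ x 1 * centred ω θ₂ θ₃ F x 2) t =
      secInt ω (fun x => xp θ₂ θ₃ x 2 * F 1 x - xp θ₂ θ₃ x 1 * F 2 x) t + secInt ω f t := by
    simp only [secInt]
    rw [← integral_add]
    · refine integral_congr_ae (ae_of_all _ fun s => ?_)
      simp [centred, hf, perp]
      ring
    · have c1 := (hF 1).continuous.comp (continuous_section t)
      have c2 := (hF 2).continuous.comp (continuous_section t)
      simp only [Function.comp_def] at c1 c2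
      refine integrableOn_of_continuous hω ?_
      simp only [xp_one, xp_two, Matrix.cons_val_zero, Matrix.cons_val_one, Matrix.cons_val]
      fun_prop
    · refine integrableOn_of_continuous hω ?_
      simp only [hf, xp_one, xp_two, Matrix.cons_val_zero, Matrix.cons_val_one, Matrix.cons_val]
      fun_prop
  rw [h2, h1, twistOf]
  field_simp
  ring

end WarpingApprox

/-! ### Density of regular warpings in the constrained space -/

section WarpingClose

variable {L : ℝ} {ω : Set V2} {θ₂ θ₃ : ℝ → ℝ}

theorem memLp_mul_of_bound {μ : Measure V3} {b f : V3 → ℝ} {R : ℝ}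
    (hbm : AEStronglyMeasurable b μ) (hb : ∀ᵐ x ∂μ, |b x| ≤ R) (hf : MemLp f 2 μ) :
    MemLp (fun x => b x * f x) 2 μ :=
  hf.of_le_mul (c := R) (hbm.mul hf.1) (hb.mono fun x hx => by
    rw [norm_mul]
    exact mul_le_mul_of_nonneg_right hx (norm_nonneg _))

theorem aestronglyMeasurable_of_differentiableAt {f : ℝ → ℝ}
    (hf : ∀ t ∈ Ioo 0 L, DifferentiableAt ℝ f t) :
    AEStronglyMeasurable f (volume.restrict (Ioo 0 L)) :=
  ContinuousOn.aestronglyMeasurable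
    (fun t ht => (hf t ht).continuousAt.continuousWithinAt) measurableSet_Ioo

theorem IsCurve.exists_bound_perp (hc : IsCurve L θ₂ θ₃) (hω : IsCrossSection ω) :
    ∃ R : ℝ, 0 ≤ R ∧ ∀ x ∈ cyl L ω, ∀ i, |perp θ₂ θ₃ x i| ≤ R ∧
      ∀ k, |fderiv ℝ (fun z => perp θ₂ θ₃ z i) x (e k)| ≤ R := by
  choose C hC using fun i => (hc.Ob_perp hω i).1
  choose D hD using fun i k => (hc.Ob_perp hω i).2 k
  refine ⟨∑ i, (|C i| + ∑ k, |D i k|), by positivity, fun x hx i => ?_⟩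
  have h1 : |C i| + ∑ k, |D i k| ≤ ∑ i, (|C i| + ∑ k, |D i k|) :=
    Finset.single_le_sum (f := fun i => |C i| + ∑ k, |D i k|) (fun i _ => by positivity)
      (Finset.mem_univ i)
  have h2 := hC i 1 ⟨one_pos, le_rfl⟩ x hx
  rw [pow_zero, mul_one] at h2
  refine ⟨?_, fun k => ?_⟩
  · have h3 : 0 ≤ ∑ k, |D i k| := by positivity
    linarith [le_abs_self (C i)]
  · have h3 := hD i k 1 ⟨one_pos, le_rfl⟩ x hx
    rw [pow_zero, mul_one] at h3
    have h4 : |D i k| ≤ ∑ k, |D i k| :=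
      Finset.single_le_sum (f := fun k => |D i k|) (fun k _ => by positivity) (Finset.mem_univ k)
    linarith [le_abs_self (D i k), abs_nonneg (C i)]

/-- Approximate without constraints, then recentre. The limit has zero means and zero twist, so the
corrections are bounded by the approximation error. -/
theorem MemSpaceC.exists_approx (hL : 0 < L) (hc : IsCurve L θ₂ θ₃) (hω : IsCrossSection ω)
    {γ : V3 → V3} (hγ : MemSpaceC θ₂ θ₃ L ω γ) {ε : ℝ≥0∞} (hε : ε ≠ 0) :
    ∃ F : Fin 3 → V3 → ℝ, (∀ i, ContDiff ℝ 1 (F i)) ∧ ∀ i,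
      eLpNorm (fun x => centred ω θ₂ θ₃ F x i - γ x i) 2 (volume.restrict (cyl L ω)) ≤ ε ∧
      ∀ k : Fin 3, k ≠ 0 →
        eLpNorm (fun x => fderiv ℝ (fun z => centred ω θ₂ θ₃ F z i) x (e k) -
          pd (cyl L ω) k (fun z => γ z i) x) 2 (volume.restrict (cyl L ω)) ≤ ε := by
  have hU := isOpen_cyl (L := L) hω.isOpen
  have := isFiniteMeasure_cyl (L := L) hω
  obtain ⟨R, hR0, hR⟩ := hc.exists_bound_perp hω
  -- `T` bounds the twist of the approximation relative to its error; `K` adds the error itself, the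
  -- mean correction and the twist correction.
  set T : ℝ≥0∞ := ENNReal.ofReal (polarMoment ω)⁻¹ *
    (volume ω * (ENNReal.ofReal R + ENNReal.ofReal R)) with hT
  set K : ℝ≥0∞ := 1 + ENNReal.ofReal (area ω)⁻¹ * volume ω + ENNReal.ofReal R * T with hK
  have hTt : T ≠ ⊤ := ENNReal.mul_ne_top ENNReal.ofReal_ne_top
    (ENNReal.mul_ne_top hω.volume_lt_top.ne
      (ENNReal.add_ne_top.2 ⟨ENNReal.ofReal_ne_top, ENNReal.ofReal_ne_top⟩))
  have hKt : K ≠ ⊤ := ENNReal.add_ne_top.2 ⟨ENNReal.add_ne_top.2 ⟨ENNReal.one_ne_top,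
    ENNReal.mul_ne_top ENNReal.ofReal_ne_top hω.volume_lt_top.ne⟩,
    ENNReal.mul_ne_top ENNReal.ofReal_ne_top hTt⟩
  obtain ⟨δ, hδ, -, hδε⟩ := exists_pos_mul_le hKt hε
  -- Only the two cross-sectional directions are listed: a warping in the limit space has no
  -- derivative along the rod.
  have happ := fun i => exists_contDiff_approx hU (isBounded_cyl hω.isBounded)
    (hasConeProperty_cyl hL hω) (f := fun x => γ x i) (v := fun k : {k : Fin 3 // k ≠ 0} => e k)
    (fun k => ((hγ.1 i).2 k.1 k.2).isWeakDeriv) (hγ.1 i).1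
    (fun k => ((hγ.1 i).2 k.1 k.2).memLp hU) hδ
  choose F hF hF0 hF1 using happ
  refine ⟨F, hF, ?_⟩
  have hFm : ∀ i, MemLp (F i) 2 (volume.restrict (cyl L ω)) := fun i => by
    obtain ⟨C, hC⟩ := exists_bound_contDiff (L := L) hω (hF i)
    exact memLp_of_bounded' (C := C) (hF i).continuous.aestronglyMeasurable
      ((ae_restrict_mem hU.measurableSet).mono fun x hx => (hC x hx).1) 2
  have hpm : ∀ i, AEStronglyMeasurable (fun x => perp θ₂ θ₃ x i) (volume.restrict (cyl L ω)) :=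
    fun i => ContinuousOn.aestronglyMeasurable (fun x hx =>
      (hc.hasFDerivAt_perp hx.1 i).continuousAt.continuousWithinAt) hU.measurableSet
  have hpb : ∀ i, ∀ᵐ x ∂volume.restrict (cyl L ω), |perp θ₂ θ₃ x i| ≤ R := fun i =>
    (ae_restrict_mem hU.measurableSet).mono fun x hx => (hR x hx i).1
  have htm := aestronglyMeasurable_of_differentiableAt (hc.exists_deriv_twistOf hω hF).1
  have hsm := fun i => aestronglyMeasurable_of_differentiableAt
    (exists_deriv_secInt (L := L) hω (hF i)).1
  have hm : ∀ i, eLpNorm (fun x => (area ω)⁻¹ * secInt ω (F i) (x 0)) 2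
      (volume.restrict (cyl L ω)) ≤ ENNReal.ofReal (area ω)⁻¹ * volume ω * δ := fun i => by
    refine (eLpNorm_mul_le_of_bound (b := fun _ => (area ω)⁻¹) (R := (area ω)⁻¹)
      (ae_of_all _ fun x => (abs_of_pos (inv_pos.2 (area_pos hω))).le)).trans ?_
    rw [mul_assoc]
    gcongr
    refine (eLpNorm_secInt_le hω (hγ.1 i).1 (hFm i) (hsm i) (hγ.2.mono fun t ht => ht.1 i)).trans ?_
    gcongr
    exact hF0 i
  have hM : eLpNorm (fun x => twistOf ω θ₂ θ₃ F (x 0)) 2 (volume.restrict (cyl L ω)) ≤ T * δ := by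
    have hsub : ∀ G : V3 → V3, (fun x => xp θ₂ θ₃ x 2 * G x 1 - xp θ₂ θ₃ x 1 * G x 2) =
        fun x => -(perp θ₂ θ₃ x 1 * G x 1 + perp θ₂ θ₃ x 2 * G x 2) := fun G => by
      ext x; simp [perp]; ring
    have hmem : ∀ G : V3 → V3, (∀ i, MemLp (fun x => G x i) 2 (volume.restrict (cyl L ω))) →
        MemLp (fun x => xp θ₂ θ₃ x 2 * G x 1 - xp θ₂ θ₃ x 1 * G x 2) 2
          (volume.restrict (cyl L ω)) := fun G hG => by
      rw [hsub]
      exact ((memLp_mul_of_bound (hpm 1) (hpb 1) (hG 1)).add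
        (memLp_mul_of_bound (hpm 2) (hpb 2) (hG 2))).neg
    have hsec : secInt ω (fun x => xp θ₂ θ₃ x 2 * F 1 x - xp θ₂ θ₃ x 1 * F 2 x) =
        fun t => polarMoment ω * twistOf ω θ₂ θ₃ F t := by
      ext t
      rw [twistOf, mul_inv_cancel_left₀ (polarMoment_pos hω).ne']
    refine (eLpNorm_mul_le_of_bound (b := fun _ => (polarMoment ω)⁻¹) (R := (polarMoment ω)⁻¹)
      (ae_of_all _ fun x => (abs_of_pos (inv_pos.2 (polarMoment_pos hω))).le)).trans ?_
    rw [hT, mul_assoc, mul_assoc]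
    gcongr
    refine (eLpNorm_secInt_le hω (hmem γ fun i => (hγ.1 i).1) (hmem (fun x i => F i x) hFm)
      (by rw [hsec]; exact htm.const_mul _) (hγ.2.mono fun t ht => ht.2)).trans ?_
    gcongr
    have e1 : (fun x => xp θ₂ θ₃ x 2 * F 1 x - xp θ₂ θ₃ x 1 * F 2 x -
        (xp θ₂ θ₃ x 2 * γ x 1 - xp θ₂ θ₃ x 1 * γ x 2)) = -((fun x => perp θ₂ θ₃ x 1 *
          (F 1 x - γ x 1)) + fun x => perp θ₂ θ₃ x 2 * (F 2 x - γ x 2)) := by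
      ext x; simp [perp]; ring
    rw [e1, eLpNorm_neg, add_mul]
    refine (eLpNorm_add_le ((hpm 1).mul ((hFm 1).1.sub (hγ.1 1).1.1))
      ((hpm 2).mul ((hFm 2).1.sub (hγ.1 2).1.1)) (by norm_num)).trans ?_
    gcongr
    · exact (eLpNorm_mul_le_of_bound (hpb 1)).trans (by gcongr; exact hF0 1)
    · exact (eLpNorm_mul_le_of_bound (hpb 2)).trans (by gcongr; exact hF0 2)
  have htm' : AEStronglyMeasurable (fun x : V3 => twistOf ω θ₂ θ₃ F (x 0))
      (volume.restrict (cyl L ω)) := htm.comp_quasiMeasurePreserving quasiMeasurePreserving_fst_cyl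
  have hsm' : ∀ i, AEStronglyMeasurable (fun x : V3 => (area ω)⁻¹ * secInt ω (F i) (x 0))
      (volume.restrict (cyl L ω)) := fun i =>
    ((hsm i).comp_quasiMeasurePreserving quasiMeasurePreserving_fst_cyl).const_mul _
  refine fun i => ⟨?_, fun k hk => ?_⟩
  · have e1 : (fun x => centred ω θ₂ θ₃ F x i - γ x i) = ((fun x => F i x - γ x i) -
        fun x => (area ω)⁻¹ * secInt ω (F i) (x 0)) +
        fun x => perp θ₂ θ₃ x i * twistOf ω θ₂ θ₃ F (x 0) := by
      ext x; simp [centred]; ring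
    rw [e1]
    refine (eLpNorm_add_le (((hFm i).1.sub (hγ.1 i).1.1).sub (hsm' i)) ((hpm i).mul htm')
      (by norm_num)).trans ((add_le_add ((eLpNorm_sub_le ((hFm i).1.sub (hγ.1 i).1.1) (hsm' i)
      (by norm_num)).trans (add_le_add (hF0 i) (hm i))) ((eLpNorm_mul_le_of_bound (hpb i)).trans
      (mul_le_mul_right hM _))).trans (le_trans (le_of_eq ?_) hδε))
    rw [hK]
    ring
  · have hval : ∀ᵐ x ∂volume.restrict (cyl L ω),
        fderiv ℝ (fun z => centred ω θ₂ θ₃ F z i) x (e k) -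
          pd (cyl L ω) k (fun z => γ z i) x = (fderiv ℝ (F i) x (e k) -
          pd (cyl L ω) k (fun z => γ z i) x) +
          fderiv ℝ (fun z => perp θ₂ θ₃ z i) x (e k) * twistOf ω θ₂ θ₃ F (x 0) := by
      filter_upwards [ae_restrict_mem hU.measurableSet] with x hx
      have hk0 : (e k) 0 = 0 := by simp [e, hk.symm]
      rw [hc.fderiv_centred hω hF hx i k, hk0]
      ring
    rw [eLpNorm_congr_ae hval]
    refine (eLpNorm_add_le (f := fun x => fderiv ℝ (F i) x (e k) -
      pd (cyl L ω) k (fun z => γ z i) x) (g := fun x => fderiv ℝ (fun z => perp θ₂ θ₃ z i) x (e k) *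
      twistOf ω θ₂ θ₃ F (x 0))
      ((measurable_fderiv_apply_const ℝ _ _).aestronglyMeasurable.sub
        (((hγ.1 i).2 k hk).memLp hU).1)
      ((measurable_fderiv_apply_const ℝ _ _).aestronglyMeasurable.mul htm')
      (by norm_num)).trans ((add_le_add (hF1 i ⟨k, hk⟩) ((eLpNorm_mul_le_of_bound
        ((ae_restrict_mem hU.measurableSet).mono fun x hx => (hR x hx i).2 k)).trans
      (mul_le_mul_right hM _))).trans (le_trans ?_ hδε))
    rw [hK, add_mul, add_mul, one_mul, ← mul_assoc]
    gcongr
    exact le_self_add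

end WarpingClose

/-! ### Weak derivatives in the rotated coordinates -/

section Rotation

variable {L : ℝ} {ω : Set V2} {θ₂ θ₃ : ℝ → ℝ}

theorem xp_zero (x : V3) : xp θ₂ θ₃ x 0 = x 0 := by
  simp [xp, Re, Matrix.mulVec, dotProduct, Fin.sum_univ_three]

theorem xpInv_zero (z : V3) : xpInv θ₂ θ₃ z 0 = z 0 := by
  simp [xpInv, Re, Matrix.mulVec, dotProduct, Fin.sum_univ_three]

theorem xpInv_one (z : V3) :
    xpInv θ₂ θ₃ z 1 = p₂ θ₂ θ₃ (z 0) * z 1 + p₃ θ₂ θ₃ (z 0) * z 2 := by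
  simp [xpInv, Re, Matrix.mulVec, dotProduct, Fin.sum_univ_three]

theorem xpInv_two (z : V3) :
    xpInv θ₂ θ₃ z 2 = -p₃ θ₂ θ₃ (z 0) * z 1 + p₂ θ₂ θ₃ (z 0) * z 2 := by
  simp [xpInv, Re, Matrix.mulVec, dotProduct, Fin.sum_univ_three]

theorem measurable_p₂ : Measurable (p₂ θ₂ θ₃) :=
  (measurable_deriv _).div
    (Real.continuous_sqrt.measurable.comp
      (((measurable_deriv _).pow_const 2).add ((measurable_deriv _).pow_const 2)))

theorem measurable_p₃ : Measurable (p₃ θ₂ θ₃) :=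
  (measurable_deriv _).div
    (Real.continuous_sqrt.measurable.comp
      (((measurable_deriv _).pow_const 2).add ((measurable_deriv _).pow_const 2)))

theorem measurable_xp : Measurable (xp θ₂ θ₃) := by
  have m2 : Measurable fun x : V3 => p₂ θ₂ θ₃ (x 0) := measurable_p₂.comp (measurable_pi_apply 0)
  have m3 : Measurable fun x : V3 => p₃ θ₂ θ₃ (x 0) := measurable_p₃.comp (measurable_pi_apply 0)
  have x1 : Measurable fun x : V3 => x 1 := measurable_pi_apply 1
  have x2 : Measurable fun x : V3 => x 2 := measurable_pi_apply 2
  refine measurable_pi_iff.2 fun i => ?_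
  fin_cases i
  · simp only [Fin.zero_eta, xp_zero]; exact measurable_pi_apply 0
  · simp only [Fin.mk_one, xp_one]; exact (m2.mul x1).sub (m3.mul x2)
  · simp only [Fin.reduceFinMk, xp_two]; exact (m3.mul x1).add (m2.mul x2)

theorem measurable_xpInv : Measurable (xpInv θ₂ θ₃) := by
  have m2 : Measurable fun x : V3 => p₂ θ₂ θ₃ (x 0) := measurable_p₂.comp (measurable_pi_apply 0)
  have m3 : Measurable fun x : V3 => p₃ θ₂ θ₃ (x 0) := measurable_p₃.comp (measurable_pi_apply 0)
  have x1 : Measurable fun x : V3 => x 1 := measurable_pi_apply 1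
  have x2 : Measurable fun x : V3 => x 2 := measurable_pi_apply 2
  refine measurable_pi_iff.2 fun i => ?_
  fin_cases i
  · simp only [Fin.zero_eta, xpInv_zero]; exact measurable_pi_apply 0
  · simp only [Fin.mk_one, xpInv_one]; exact (m2.mul x1).add (m3.mul x2)
  · simp only [Fin.reduceFinMk, xpInv_two]; exact (m3.neg.mul x1).add (m2.mul x2)

namespace IsCurve

theorem xpInv_xp (hc : IsCurve L θ₂ θ₃) {x : V3} (hx : x 0 ∈ Ioo 0 L) :
    xpInv θ₂ θ₃ (xp θ₂ θ₃ x) = x := by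
  have hps := hc.p_sq hx
  ext i
  fin_cases i
  · simp only [Fin.zero_eta, xpInv_zero, xp_zero]
  · simp only [Fin.mk_one, xpInv_one, xp_zero, xp_one, xp_two]
    linear_combination x 1 * hps
  · simp only [Fin.reduceFinMk, xpInv_two, xp_zero, xp_one, xp_two]
    linear_combination x 2 * hps

theorem xp_xpInv (hc : IsCurve L θ₂ θ₃) {z : V3} (hz : z 0 ∈ Ioo 0 L) :
    xp θ₂ θ₃ (xpInv θ₂ θ₃ z) = z := by
  have hps := hc.p_sq hz
  ext i
  fin_cases i
  · simp only [Fin.zero_eta, xpInv_zero, xp_zero]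
  · simp only [Fin.mk_one, xpInv_one, xpInv_zero, xp_one, xpInv_two]
    linear_combination z 1 * hps
  · simp only [Fin.reduceFinMk, xpInv_two, xpInv_zero, xp_two, xpInv_one]
    linear_combination z 2 * hps

theorem continuousOn_xpInv (hc : IsCurve L θ₂ θ₃) :
    ContinuousOn (xpInv θ₂ θ₃) {z | z 0 ∈ Ioo 0 L} := by
  have c0 : ContinuousOn (fun z : V3 => z 0) {z : V3 | z 0 ∈ Ioo 0 L} :=
    (continuous_apply 0).continuousOn
  have m2 := hc.p₂.1.continuousOn.comp c0 (fun z hz => hz)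
  have m3 := hc.p₃.1.continuousOn.comp c0 (fun z hz => hz)
  have x1 : ContinuousOn (fun z : V3 => z 1) {z : V3 | z 0 ∈ Ioo 0 L} :=
    (continuous_apply 1).continuousOn
  have x2 : ContinuousOn (fun z : V3 => z 2) {z : V3 | z 0 ∈ Ioo 0 L} :=
    (continuous_apply 2).continuousOn
  refine continuousOn_pi.2 fun i => ?_
  fin_cases i
  · simp only [Fin.zero_eta, xpInv_zero]; exact c0
  · simp only [Fin.mk_one, xpInv_one]; exact (m2.mul x1).add (m3.mul x2)
  · simp only [Fin.reduceFinMk, xpInv_two]; exact (m3.neg.mul x1).add (m2.mul x2)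

theorem image_xp (hc : IsCurve L θ₂ θ₃) :
    xp θ₂ θ₃ '' cyl L ω = {z | z 0 ∈ Ioo 0 L} ∩ xpInv θ₂ θ₃ ⁻¹' cyl L ω := by
  ext z
  constructor
  · rintro ⟨x, hx, rfl⟩
    refine ⟨?_, ?_⟩
    · rw [mem_ofPred_eq, xp_zero]; exact hx.1
    · rw [mem_preimage, hc.xpInv_xp hx.1]; exact hx
  · rintro ⟨h1, h2⟩
    exact ⟨_, h2, hc.xp_xpInv h1⟩

theorem isOpen_image_xp (hc : IsCurve L θ₂ θ₃) (hω : IsCrossSection ω) :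
    IsOpen (xp θ₂ θ₃ '' cyl L ω) := by
  rw [hc.image_xp]
  exact hc.continuousOn_xpInv.isOpen_inter_preimage
    (isOpen_Ioo.preimage (continuous_apply 0)) (isOpen_cyl hω.isOpen)

/-- The gradient of the rotation of the coordinates. -/
def gradXp (θ₂ θ₃ : ℝ → ℝ) (x : V3) : M3 :=
  !![1, 0, 0;
     x 1 * deriv (CurvedRod.p₂ θ₂ θ₃) (x 0) + x 2 * -deriv (CurvedRod.p₃ θ₂ θ₃) (x 0),
      CurvedRod.p₂ θ₂ θ₃ (x 0), -CurvedRod.p₃ θ₂ θ₃ (x 0);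
     x 1 * deriv (CurvedRod.p₃ θ₂ θ₃) (x 0) + x 2 * deriv (CurvedRod.p₂ θ₂ θ₃) (x 0),
      CurvedRod.p₃ θ₂ θ₃ (x 0), CurvedRod.p₂ θ₂ θ₃ (x 0)]

theorem hasFDerivAt_xp (hc : IsCurve L θ₂ θ₃) {x : V3} (hx : x 0 ∈ Ioo 0 L) :
    HasFDerivAt (xp θ₂ θ₃) (matL (gradXp θ₂ θ₃ x)) x := by
  have one : (1 : ℝ) ∈ Ioc (0 : ℝ) 1 := ⟨one_pos, le_rfl⟩
  have d2 := hc.p₂.toO1.strictDeriv one hx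
  have d3 := hc.p₃.toO1.strictDeriv one hx
  have d0 := hasStrictDerivAt_const (x 0) (0 : ℝ)
  rw [hasFDerivAt_matL_iff]
  intro i
  fin_cases i
  · have h1 := hasFDerivAt_fst (f := id) (x := x) differentiableAt_id
    simp only [Fin.zero_eta, xp_zero]
    simp only [id, deriv_id] at h1
    exact h1
  · have h1 := (hasStrictFDerivAt_affine d0 d2 d3.neg).hasFDerivAt
    simp only [zero_add] at h1
    refine h1.congr_of_eventuallyEq (Eventually.of_forall fun z => ?_)
    simp only [Fin.mk_one, xp_one, Pi.neg_apply]
    ring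
  · have h1 := (hasStrictFDerivAt_affine d0 d3 d2).hasFDerivAt
    simp only [zero_add] at h1
    refine h1.congr_of_eventuallyEq (Eventually.of_forall fun z => ?_)
    simp only [Fin.reduceFinMk, xp_two]
    ring

/-- The gradient of the rotated coordinates is block triangular with a rotation as its lower block,
so its determinant is 1. -/
theorem measurePreserving_xp (hc : IsCurve L θ₂ θ₃) (hω : IsCrossSection ω) :
    MeasurePreserving (xp θ₂ θ₃) (volume.restrict (cyl L ω))
      (volume.restrict (xp θ₂ θ₃ '' cyl L ω)) := by
  have hm := (isOpen_cyl (L := L) hω.isOpen).measurableSet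
  refine ⟨measurable_xp, ?_⟩
  have h1 := map_withDensity_abs_det_fderiv_eq_addHaar volume hm.nullMeasurableSet
    (fun x hx => (hc.hasFDerivAt_xp hx.1).hasFDerivWithinAt)
    (fun x hx y hy hxy => by rw [← hc.xpInv_xp hx.1, hxy, hc.xpInv_xp hy.1])
  rw [← h1]
  congr 1
  rw [withDensity_congr_ae (g := 1), withDensity_one]
  filter_upwards [ae_restrict_mem hm] with x hx
  rw [det_matL, gradXp, Matrix.det_fin_three]
  have hps := hc.p_sq hx.1
  have h2 : CurvedRod.p₂ θ₂ θ₃ (x 0) * CurvedRod.p₂ θ₂ θ₃ (x 0) +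
      CurvedRod.p₃ θ₂ θ₃ (x 0) * CurvedRod.p₃ θ₂ θ₃ (x 0) = 1 := by
    linear_combination hps
  simp [h2]

theorem measurePreserving_xpInv (hc : IsCurve L θ₂ θ₃) (hω : IsCrossSection ω) :
    MeasurePreserving (xpInv θ₂ θ₃) (volume.restrict (xp θ₂ θ₃ '' cyl L ω))
      (volume.restrict (cyl L ω)) := by
  refine ⟨measurable_xpInv, ?_⟩
  rw [← (hc.measurePreserving_xp hω).map_eq, Measure.map_map measurable_xpInv measurable_xp]
  conv_rhs => rw [← Measure.map_id (μ := volume.restrict (cyl L ω))]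
  refine Measure.map_congr ?_
  filter_upwards [ae_mem_cyl hω.isOpen] with x hx
  exact hc.xpInv_xp hx.1

end IsCurve

end Rotation

/-! ### Transport of cross-sectional weak derivatives by the rotation -/

section RotatedDerivative

variable {L : ℝ} {ω : Set V2} {θ₂ θ₃ : ℝ → ℝ}

theorem Re_apply_zero_contDiff (hc : IsCurve L θ₂ θ₃) (k j : Fin 3) :
    ContDiffOn ℝ 1 (fun t => Re θ₂ θ₃ t k j) (Ioo 0 L) := by
  have h2 := hc.p₂.1
  have h3 := hc.p₃.1
  have h0 : ∀ c : ℝ, ContDiffOn ℝ 1 (fun _ : ℝ => c) (Ioo 0 L) := fun c => contDiffOn_const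
  fin_cases k <;> fin_cases j
  exacts [h0 1, h0 0, h0 0, h0 0, h2, h3.neg, h0 0, h3, h2]

theorem contDiffAt_fst {f : ℝ → ℝ} (hf : ContDiffOn ℝ 1 f (Ioo 0 L)) {x : V3}
    (hx : x 0 ∈ Ioo 0 L) : ContDiffAt ℝ 1 (fun z : V3 => f (z 0)) x :=
  (hf.contDiffAt (Ioo_mem_nhds hx.1 hx.2)).comp x (contDiff_apply ℝ ℝ (0 : Fin 3)).contDiffAt

theorem IsCurve.contDiffAt_xp (hc : IsCurve L θ₂ θ₃) {x : V3} (hx : x 0 ∈ Ioo 0 L) :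
    ContDiffAt ℝ 1 (xp θ₂ θ₃) x := by
  have h2 := contDiffAt_fst hc.p₂.1 hx
  have h3 := contDiffAt_fst hc.p₃.1 hx
  have x1 : ContDiffAt ℝ 1 (fun z : V3 => z 1) x := (contDiff_apply ℝ ℝ (1 : Fin 3)).contDiffAt
  have x2 : ContDiffAt ℝ 1 (fun z : V3 => z 2) x := (contDiff_apply ℝ ℝ (2 : Fin 3)).contDiffAt
  refine contDiffAt_pi.2 fun i => ?_
  fin_cases i
  · simp only [Fin.zero_eta, xp_zero]; exact (contDiff_apply ℝ ℝ (0 : Fin 3)).contDiffAt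
  · simp only [Fin.mk_one, xp_one]; exact (h2.mul x1).sub (h3.mul x2)
  · simp only [Fin.reduceFinMk, xp_two]; exact (h3.mul x1).add (h2.mul x2)

open Classical in
variable (L ω θ₂ θ₃) in
/-- The test function on the cylinder that corresponds to `φ` on the rotated cylinder. -/
def pullTest (φ : V3 → ℝ) (k j : Fin 3) (x : V3) : ℝ :=
  if x ∈ cyl L ω then Re θ₂ θ₃ (x 0) k j * φ (xp θ₂ θ₃ x) else 0

/-- The rotation is a C¹ homeomorphism onto its image, so the support of φ pulls back to a compact
subset of the cylinder and the extension by zero stays C¹. -/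
theorem IsCurve.pullTest_props (hc : IsCurve L θ₂ θ₃) (hω : IsCrossSection ω) {φ : V3 → ℝ}
    (hφ : ContDiff ℝ 1 φ) (hφc : HasCompactSupport φ) (hφs : tsupport φ ⊆ xp θ₂ θ₃ '' cyl L ω)
    (k j : Fin 3) : ContDiff ℝ 1 (pullTest L ω θ₂ θ₃ φ k j) ∧
      HasCompactSupport (pullTest L ω θ₂ θ₃ φ k j) ∧
      tsupport (pullTest L ω θ₂ θ₃ φ k j) ⊆ cyl L ω := by
  have hU := isOpen_cyl (L := L) hω.isOpen
  set S := xpInv θ₂ θ₃ '' tsupport φ with hS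
  have hsub : tsupport φ ⊆ {z | z 0 ∈ Ioo 0 L} := fun z hz => by
    have := hφs hz
    rw [hc.image_xp] at this
    exact this.1
  have hSc : IsCompact S := IsCompact.image_of_continuousOn hφc (hc.continuousOn_xpInv.mono hsub)
  have hSU : S ⊆ cyl L ω := by
    rintro _ ⟨z, hz, rfl⟩
    have := hφs hz
    rw [hc.image_xp] at this
    exact this.2
  have hsupp : Function.support (pullTest L ω θ₂ θ₃ φ k j) ⊆ S := by
    intro x hx
    rw [Function.mem_support, pullTest] at hx
    split at hx
    · rename_i hxU
      refine ⟨xp θ₂ θ₃ x, subset_tsupport _ ?_, hc.xpInv_xp hxU.1⟩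
      exact fun h0 => hx (by rw [h0, mul_zero])
    · exact absurd rfl hx
  have hts : tsupport (pullTest L ω θ₂ θ₃ φ k j) ⊆ S :=
    closure_minimal hsupp hSc.isClosed
  refine ⟨contDiff_iff_contDiffAt.2 fun x => ?_, hSc.of_isClosed_subset isClosed_closure hts,
    hts.trans hSU⟩
  by_cases hx : x ∈ cyl L ω
  · refine ContDiffAt.congr_of_eventuallyEq (f := fun z => Re θ₂ θ₃ (z 0) k j * φ (xp θ₂ θ₃ z))
      ((contDiffAt_fst (Re_apply_zero_contDiff hc k j) hx.1).mul
        (hφ.contDiffAt.comp x (hc.contDiffAt_xp hx.1))) ?_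
    filter_upwards [hU.mem_nhds hx] with z hz
    rw [pullTest, if_pos hz]
  · refine ContDiffAt.congr_of_eventuallyEq (f := fun _ => (0 : ℝ)) contDiffAt_const ?_
    filter_upwards [hSc.isClosed.isOpen_compl.mem_nhds fun h => hx (hSU h)] with z hz
    by_contra h0
    exact hz (hsupp h0)

/-- The coefficients depend on x₁ only, so cross-sectional derivatives pass through them;
orthogonality of the rotation then collapses the sum over j to the single derivative in the
direction `e k`. -/
theorem IsCurve.fderiv_pullTest (hc : IsCurve L θ₂ θ₃) (hω : IsCrossSection ω) {φ : V3 → ℝ}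
    (hφ : ContDiff ℝ 1 φ) {x : V3} (hx : x ∈ cyl L ω) {k : Fin 3} (hk : k ≠ 0) :
    fderiv ℝ (pullTest L ω θ₂ θ₃ φ k 1) x (e 1) + fderiv ℝ (pullTest L ω θ₂ θ₃ φ k 2) x (e 2) =
      fderiv ℝ φ (xp θ₂ θ₃ x) (e k) := by
  have hU := isOpen_cyl (L := L) hω.isOpen
  have hps := hc.p_sq hx.1
  set T := fderiv ℝ φ (xp θ₂ θ₃ x) with hT
  have key : ∀ j : Fin 3, j ≠ 0 → fderiv ℝ (pullTest L ω θ₂ θ₃ φ k j) x (e j) =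
      Re θ₂ θ₃ (x 0) k j * T (gradXp θ₂ θ₃ x *ᵥ e j) := by
    intro j hj
    have h1 : HasFDerivAt (fun z => Re θ₂ θ₃ (z 0) k j * φ (xp θ₂ θ₃ z)) _ x :=
      (hasFDerivAt_fst (strictDeriv_of_contDiffOn (Re_apply_zero_contDiff hc k j)
        hx.1).hasDerivAt.differentiableAt).mul
        (((hφ.differentiable one_ne_zero _).hasFDerivAt).comp x (hc.hasFDerivAt_xp hx.1))
    have h2 : pullTest L ω θ₂ θ₃ φ k j =ᶠ[𝓝 x] fun z => Re θ₂ θ₃ (z 0) k j * φ (xp θ₂ θ₃ z) := by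
      filter_upwards [hU.mem_nhds hx] with z hz
      rw [pullTest, if_pos hz]
    rw [h2.fderiv_eq, h1.fderiv]
    have h3 : (rowL ![deriv (fun t => Re θ₂ θ₃ t k j) (x 0), 0, 0]) (e j) = 0 := by
      fin_cases j
      · exact absurd rfl hj
      · simp [rowL_apply, e, Fin.sum_univ_three]
      · simp [rowL_apply, e, Fin.sum_univ_three]
    simp [h3, matL_apply, hT]
  have g1 : gradXp θ₂ θ₃ x *ᵥ e 1 =
      CurvedRod.p₂ θ₂ θ₃ (x 0) • e 1 + CurvedRod.p₃ θ₂ θ₃ (x 0) • e 2 := by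
    ext i; fin_cases i <;> simp [gradXp, e, Matrix.mulVec, dotProduct, Fin.sum_univ_three]
  have g2 : gradXp θ₂ θ₃ x *ᵥ e 2 =
      -CurvedRod.p₃ θ₂ θ₃ (x 0) • e 1 + CurvedRod.p₂ θ₂ θ₃ (x 0) • e 2 := by
    ext i; fin_cases i <;> simp [gradXp, e, Matrix.mulVec, dotProduct, Fin.sum_univ_three]
  rw [key 1 (by decide), key 2 (by decide), g1, g2]
  simp only [map_add, map_smul, smul_eq_mul]
  fin_cases k
  · exact absurd rfl hk
  · simp [Re]
    linear_combination T (e 1) * hps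
  · simp [Re]
    linear_combination T (e 2) * hps

/-- A direct verification by change of variables. The rotation coefficients are put into the test
functions, so no derivative along the rod is needed and the result applies to warpings. -/
theorem IsCurve.isWeakDeriv_comp_xpInv (hc : IsCurve L θ₂ θ₃) (hω : IsCrossSection ω)
    {f g₁ g₂ : V3 → ℝ} (h₁ : IsWeakDeriv (cyl L ω) (e 1) f g₁)
    (h₂ : IsWeakDeriv (cyl L ω) (e 2) f g₂) (hf : IntegrableOn f (cyl L ω))
    (hg₁ : IntegrableOn g₁ (cyl L ω)) (hg₂ : IntegrableOn g₂ (cyl L ω)) {k : Fin 3} (hk : k ≠ 0) :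
    IsWeakDeriv (xp θ₂ θ₃ '' cyl L ω) (e k) (fun z => f (xpInv θ₂ θ₃ z)) (fun z =>
      Re θ₂ θ₃ (xpInv θ₂ θ₃ z 0) k 1 * g₁ (xpInv θ₂ θ₃ z) +
      Re θ₂ θ₃ (xpInv θ₂ θ₃ z 0) k 2 * g₂ (xpInv θ₂ θ₃ z)) := by
  have hU := isOpen_cyl (L := L) hω.isOpen
  have hm := hU.measurableSet
  have hmp := hc.measurePreserving_xp hω
  have hmi := hc.measurePreserving_xpInv hω
  have hRb : ∀ j, ∃ C : ℝ, ∀ x ∈ cyl L ω, ‖Re θ₂ θ₃ (x 0) k j‖ ≤ C := fun j => by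
    obtain ⟨C, hC⟩ := hc.Ob_Re (ω := ω) k j
    exact ⟨C, fun x hx => by simpa using hC 1 ⟨one_pos, le_rfl⟩ x hx⟩
  have hRm : ∀ j, AEStronglyMeasurable (fun x : V3 => Re θ₂ θ₃ (x 0) k j)
      (volume.restrict (cyl L ω)) := fun j => ContinuousOn.aestronglyMeasurable (fun x hx =>
      (contDiffAt_fst (Re_apply_zero_contDiff hc k j) hx.1).continuousAt.continuousWithinAt) hm
  have hRg : ∀ j (g : V3 → ℝ), IntegrableOn g (cyl L ω) →
      IntegrableOn (fun x => Re θ₂ θ₃ (x 0) k j * g x) (cyl L ω) := fun j g hg => by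
    obtain ⟨C, hC⟩ := hRb j
    exact hg.bdd_mul (c := C) (hRm j) ((ae_restrict_mem hm).mono hC)
  have hG : IntegrableOn (fun x => Re θ₂ θ₃ (x 0) k 1 * g₁ x + Re θ₂ θ₃ (x 0) k 2 * g₂ x)
      (cyl L ω) := (hRg 1 _ hg₁).add (hRg 2 _ hg₂)
  have hloc : ∀ {F : V3 → ℝ}, IntegrableOn F (cyl L ω) →
      IntegrableOn (fun z => F (xpInv θ₂ θ₃ z)) (xp θ₂ θ₃ '' cyl L ω) := fun {F} hF =>
    hmi.integrable_comp_of_integrable hF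
  have hint : ∀ {F : V3 → ℝ} {ψ : V3 → ℝ}, IntegrableOn F (cyl L ω) → Continuous ψ →
      ∫ z in xp θ₂ θ₃ '' cyl L ω, F (xpInv θ₂ θ₃ z) * ψ z =
        ∫ x in cyl L ω, F x * ψ (xp θ₂ θ₃ x) := fun {F ψ} hF hψ => by
    have h3 : AEStronglyMeasurable (fun z => F (xpInv θ₂ θ₃ z) * ψ z)
        (volume.restrict (xp θ₂ θ₃ '' cyl L ω)) :=
      (hloc hF).aestronglyMeasurable.mul hψ.aestronglyMeasurable
    rw [← hmp.map_eq] at h3 ⊢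
    rw [integral_map measurable_xp.aemeasurable h3]
    refine setIntegral_congr_fun hm fun x hx => ?_
    rw [hc.xpInv_xp hx.1]
  refine ⟨(hloc hf).locallyIntegrableOn, (hloc hG).locallyIntegrableOn, fun φ hφ hφc hφs => ?_⟩
  have hp := hc.pullTest_props hω hφ hφc hφs k
  have i1 : ∀ j (g : V3 → ℝ), LocallyIntegrableOn g (cyl L ω) → IntegrableOn (fun x => g x *
      fderiv ℝ (pullTest L ω θ₂ θ₃ φ k j) x (e j)) (cyl L ω) := fun j g hg =>
    (integrableOn_mul_of_tsupport_subset hg (continuous_fderiv_apply' (hp j).1 (e j))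
      (hasCompactSupport_fderiv_apply' (hp j).2.1 (e j))
      ((tsupport_fderiv_apply_subset' _ _).trans (hp j).2.2)).integrableOn
  have i2 : ∀ j (g : V3 → ℝ), LocallyIntegrableOn g (cyl L ω) → IntegrableOn (fun x => g x *
      pullTest L ω θ₂ θ₃ φ k j x) (cyl L ω) := fun j g hg =>
    (integrableOn_mul_of_tsupport_subset hg (hp j).1.continuous (hp j).2.1
      (hp j).2.2).integrableOn
  have e1 := h₁.2.2 _ (hp 1).1 (hp 1).2.1 (hp 1).2.2
  have e2 := h₂.2.2 _ (hp 2).1 (hp 2).2.1 (hp 2).2.2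
  rw [hint hf (continuous_fderiv_apply' hφ (e k)), hint hG hφ.continuous]
  calc ∫ x in cyl L ω, f x * fderiv ℝ φ (xp θ₂ θ₃ x) (e k)
      = ∫ x in cyl L ω, (f x * fderiv ℝ (pullTest L ω θ₂ θ₃ φ k 1) x (e 1) +
          f x * fderiv ℝ (pullTest L ω θ₂ θ₃ φ k 2) x (e 2)) :=
        setIntegral_congr_fun hm fun x hx => by
          rw [← hc.fderiv_pullTest hω hφ hx hk, mul_add]
    _ = -((∫ x in cyl L ω, g₁ x * pullTest L ω θ₂ θ₃ φ k 1 x) +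
          ∫ x in cyl L ω, g₂ x * pullTest L ω θ₂ θ₃ φ k 2 x) := by
        rw [integral_add (i1 1 f h₁.1) (i1 2 f h₁.1), e1, e2]
        ring
    _ = _ := by
        rw [← integral_add (i2 1 _ h₁.2.1) (i2 2 _ h₂.2.1)]
        congr 1
        refine setIntegral_congr_fun hm fun x hx => ?_
        simp only [pullTest, if_pos hx]
        ring

end RotatedDerivative

/-! ### The limit strain on the cylinder -/

section LimitStrain

variable {L : ℝ} {ω : Set V2} {θ₂ θ₃ : ℝ → ℝ}

/-- The cross-sectional gradient of `x₂ b + x₃ c`. -/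
theorem isWeakDeriv_affine (hω : IsCrossSection ω) {b c : ℝ → ℝ} (hb : O1 L 0 fun _ => b)
    (hc : O1 L 0 fun _ => c) {k : Fin 3} (hk : k ≠ 0) :
    IsWeakDeriv (cyl L ω) (e k) (fun x => x 1 * b (x 0) + x 2 * c (x 0))
      (fun x => (![0, b (x 0), c (x 0)] : V3) k) := by
  have hU := isOpen_cyl (L := L) hω.isOpen
  have one : (1 : ℝ) ∈ Ioc (0 : ℝ) 1 := ⟨one_pos, le_rfl⟩
  have hder : ∀ x ∈ cyl L ω, HasFDerivAt (fun x => x 1 * b (x 0) + x 2 * c (x 0))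
      (rowL ![x 1 * deriv b (x 0) + x 2 * deriv c (x 0), b (x 0), c (x 0)]) x := fun x hx => by
    have h1 := (hasStrictFDerivAt_affine (x := x) (hasStrictDerivAt_const (x 0) (0 : ℝ))
      (hb.strictDeriv one hx.1) (hc.strictDeriv one hx.1)).hasFDerivAt
    simpa only [zero_add] using h1
  have hval : ∀ x ∈ cyl L ω, fderiv ℝ (fun x => x 1 * b (x 0) + x 2 * c (x 0)) x (e k) =
      (![0, b (x 0), c (x 0)] : V3) k := fun x hx => by
    rw [(hder x hx).fderiv]
    fin_cases k
    · exact absurd rfl hk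
    · simp [rowL_apply, e, Fin.sum_univ_three]
    · simp [rowL_apply, e, Fin.sum_univ_three]
  obtain ⟨C, hC⟩ : Ob (cyl L ω) 0 (fun _ x => (![0, b (x 0), c (x 0)] : V3) k) := by
    fin_cases k
    · exact Ob.const _ 0
    · exact hb.toOb
    · exact hc.toOb
  refine (isWeakDeriv_of_bounded hU (fun x hx => (hder x hx).differentiableAt) (C := C)
    fun x hx => ?_).congr (ae_eq_refl _) ((ae_restrict_mem hU.measurableSet).mono hval)
  rw [hval x hx]
  simpa using hC 1 one x hx

theorem memLp_of_Ob (hω : IsCrossSection ω) {f : V3 → ℝ} (hf : Ob (cyl L ω) 0 fun _ => f)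
    (hm : AEStronglyMeasurable f (volume.restrict (cyl L ω))) :
    MemLp f 2 (volume.restrict (cyl L ω)) := by
  have := isFiniteMeasure_cyl (L := L) hω
  obtain ⟨C, hC⟩ := hf
  refine memLp_of_bounded' (C := C) hm ?_ 2
  filter_upwards [ae_mem_cyl hω.isOpen] with x hx
  simpa using hC 1 ⟨one_pos, le_rfl⟩ x hx

theorem O1.aestronglyMeasurable {f : ℝ → ℝ} (hf : O1 L 0 fun _ => f) :
    AEStronglyMeasurable (fun x : V3 => f (x 0)) (volume.restrict (cyl L ω)) :=
  (aestronglyMeasurable_of_differentiableAt fun _ ht => (hf.strictDeriv (h := 1)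
    ⟨one_pos, le_rfl⟩ ht).hasDerivAt.differentiableAt).comp_quasiMeasurePreserving
    quasiMeasurePreserving_fst_cyl

theorem memLp_section_affine (hω : IsCrossSection ω) {b c : ℝ → ℝ} (hb : O1 L 0 fun _ => b)
    (hc : O1 L 0 fun _ => c) : MemLp (fun x => x 1 * b (x 0) + x 2 * c (x 0)) 2
      (volume.restrict (cyl L ω)) ∧
    ∀ k, MemLp (fun x => (![0, b (x 0), c (x 0)] : V3) k) 2 (volume.restrict (cyl L ω)) := by
  have mb := hb.aestronglyMeasurable (ω := ω)
  have mc := hc.aestronglyMeasurable (ω := ω)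
  have mx : ∀ i : Fin 3, AEStronglyMeasurable (fun x : V3 => x i) (volume.restrict (cyl L ω)) :=
    fun i => (continuous_apply i).aestronglyMeasurable
  refine ⟨memLp_of_Ob hω (((Ob_coord hω 1).mul hb.toOb).add ((Ob_coord hω 2).mul hc.toOb))
    (((mx 1).mul mb).add ((mx 2).mul mc)), fun k => ?_⟩
  fin_cases k
  · exact memLp_of_Ob hω (Ob.const _ 0) aestronglyMeasurable_const
  · exact memLp_of_Ob hω hb.toOb mb
  · exact memLp_of_Ob hω hc.toOb mc

theorem eta_apply (γ : V3 → V3) (x : V3) (i : Fin 3) : eta θ₂ θ₃ γ x i =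
    γ x i - (x 1 * fN θ₂ θ₃ (x 0) i + x 2 * fB θ₂ θ₃ (x 0) i) := by
  simp [eta]
  ring

theorem IsCurve.eta_props (hc : IsCurve L θ₂ θ₃) (hω : IsCrossSection ω) {γ : V3 → V3}
    (hγ : ∀ i, MemLp (fun x => γ x i) 2 (volume.restrict (cyl L ω)) ∧
      ∀ k : Fin 3, k ≠ 0 → HasL2Deriv (cyl L ω) (e k) (fun x => γ x i)) (i : Fin 3) :
    MemLp (fun x => eta θ₂ θ₃ γ x i) 2 (volume.restrict (cyl L ω)) ∧
    ∀ k : Fin 3, k ≠ 0 → HasL2Deriv (cyl L ω) (e k) (fun x => eta θ₂ θ₃ γ x i) ∧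
      pd (cyl L ω) k (fun x => eta θ₂ θ₃ γ x i) =ᵐ[volume.restrict (cyl L ω)] fun x =>
        pd (cyl L ω) k (fun x => γ x i) x -
          (![0, fN θ₂ θ₃ (x 0) i, fB θ₂ θ₃ (x 0) i] : V3) k := by
  have hU := isOpen_cyl (L := L) hω.isOpen
  have ha := memLp_section_affine hω (hc.O1_fN i) (hc.O1_fB i)
  simp only [eta_apply]
  refine ⟨(hγ i).1.sub ha.1, fun k hk => ?_⟩
  have h1 := ((hγ i).2 k hk).isWeakDeriv.sub
    (isWeakDeriv_affine hω (hc.O1_fN i) (hc.O1_fB i) hk)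
  exact ⟨⟨_, h1, (((hγ i).2 k hk).memLp hU).sub (ha.2 k)⟩, h1.weakDeriv_ae_eq hU⟩

/-- `dkappa` is a weak derivative on the rotated cylinder, evaluated at x'(x). The a.e. identity
there is carried back by the measure-preserving rotation, under which κ becomes `eta`. -/
theorem IsCurve.dkappa_ae_eq (hc : IsCurve L θ₂ θ₃) (hω : IsCrossSection ω) {γ : V3 → V3}
    (hγ : ∀ i, MemLp (fun x => γ x i) 2 (volume.restrict (cyl L ω)) ∧
      ∀ k : Fin 3, k ≠ 0 → HasL2Deriv (cyl L ω) (e k) (fun x => γ x i)) (i : Fin 3) {k : Fin 3}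
    (hk : k ≠ 0) : ∀ᵐ x ∂volume.restrict (cyl L ω), dkappa θ₂ θ₃ L ω γ k i x =
      kapD θ₂ θ₃ x (fun i j => pd (cyl L ω) j (fun x => γ x i) x) k i := by
  have hU := isOpen_cyl (L := L) hω.isOpen
  have := isFiniteMeasure_cyl (L := L) hω
  obtain ⟨hm, hd⟩ := hc.eta_props hω hγ i
  obtain ⟨d1, e1⟩ := hd 1 (by decide)
  obtain ⟨d2, e2⟩ := hd 2 (by decide)
  have h1 := hc.isWeakDeriv_comp_xpInv hω d1.isWeakDeriv d2.isWeakDeriv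
    (hm.integrable (by norm_num)) ((d1.memLp hU).integrable (by norm_num))
    ((d2.memLp hU).integrable (by norm_num)) hk
  have h2 := (hc.measurePreserving_xp hω).quasiMeasurePreserving.ae
    (h1.weakDeriv_ae_eq (hc.isOpen_image_xp hω))
  filter_upwards [h2, e1, e2, ae_mem_cyl hω.isOpen] with x hx e1 e2 hxU
  rw [hc.xpInv_xp hxU.1] at hx
  refine hx.trans ?_
  rw [kapD]
  exact congrArg₂ (· + ·) (congrArg _ e1) (congrArg _ e2)

variable (θ₂ θ₃) in
/-- The limit strain in terms of the derivatives of the displacement. -/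
def gMat (x : V3) (u' a b w a' b' w' : ℝ) (D : Fin 3 → Fin 3 → ℝ) : M3 :=
  symPart (bMat θ₂ θ₃ x u' a b w a' b' w' D - (1 / 2 : ℝ) • (skewM a b w * skewM a b w))

theorem IsCurve.Gmat_ae_eq (hc : IsCurve L θ₂ θ₃) (hω : IsCrossSection ω) {γ : V3 → V3}
    (hγ : ∀ i, MemLp (fun x => γ x i) 2 (volume.restrict (cyl L ω)) ∧
      ∀ k : Fin 3, k ≠ 0 → HasL2Deriv (cyl L ω) (e k) (fun x => γ x i)) (u w v₂ v₃ : ℝ → ℝ) :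
    ∀ᵐ x ∂volume.restrict (cyl L ω), Gmat θ₂ θ₃ L ω u v₂ v₃ w γ x =
      gMat θ₂ θ₃ x (wd L u (x 0)) (wd L v₂ (x 0)) (wd L v₃ (x 0)) (w (x 0))
        (wd L (wd L v₂) (x 0)) (wd L (wd L v₃) (x 0)) (wd L w (x 0))
        (fun i j => pd (cyl L ω) j (fun x => γ x i) x) := by
  filter_upwards [ae_all_iff.2 fun i => hc.dkappa_ae_eq hω hγ i (k := 1) (by decide),
    ae_all_iff.2 fun i => hc.dkappa_ae_eq hω hγ i (k := 2) (by decide)] with x h1 h2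
  rw [Gmat, gMat, add_comm, ← add_sub_assoc, add_comm (Kmat _ _ _ _ _ _ _ _ _)]
  refine congrArg symPart (congrArg₂ (· - ·) ?_ rfl)
  ext i j
  rw [Matrix.add_apply, Jmat, Kmat, bMat]
  fin_cases i <;> fin_cases j <;> simp [h1, h2]
  all_goals ring

end LimitStrain

/-! ### Strong convergence of the limit strains -/

section StrongConvergence

variable {μ : Measure V3} {f g : ℕ → V3 → ℝ} {f₀ g₀ b : V3 → ℝ}

/-- `f n → f₀` strongly in `L²(μ)`. -/
def Cv (μ : Measure V3) (f : ℕ → V3 → ℝ) (f₀ : V3 → ℝ) : Prop :=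
  MemLp f₀ 2 μ ∧ (∀ n, MemLp (f n) 2 μ) ∧
    Tendsto (fun n => eLpNorm (fun x => f n x - f₀ x) 2 μ) atTop (𝓝 0)

/-- A bounded coefficient. -/
def Bdd (μ : Measure V3) (b : V3 → ℝ) : Prop :=
  AEStronglyMeasurable b μ ∧ ∃ R : ℝ, ∀ᵐ x ∂μ, |b x| ≤ R

/-- A sequence that is uniformly bounded together with its limit. -/
def UBdd (μ : Measure V3) (f : ℕ → V3 → ℝ) (f₀ : V3 → ℝ) : Prop :=
  ∃ R : ℝ, (∀ᵐ x ∂μ, |f₀ x| ≤ R) ∧ ∀ n, ∀ᵐ x ∂μ, |f n x| ≤ R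

namespace Cv

theorem const (hf : MemLp f₀ 2 μ) : Cv μ (fun _ => f₀) f₀ := ⟨hf, fun _ => hf, by simp⟩

theorem of_le (hf : MemLp f₀ 2 μ) (hfn : ∀ n, MemLp (f n) 2 μ) {ε : ℕ → ℝ≥0∞}
    (hε : Tendsto ε atTop (𝓝 0)) (h : ∀ n, eLpNorm (fun x => f n x - f₀ x) 2 μ ≤ ε n) :
    Cv μ f f₀ :=
  ⟨hf, hfn, tendsto_of_tendsto_of_tendsto_of_le_of_le tendsto_const_nhds hε
    (fun _ => zero_le) h⟩

theorem eventually_le (h : Cv μ f f₀) {ε : ℝ≥0∞} (hε : ε ≠ 0) :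
    ∀ᶠ n in atTop, eLpNorm (fun x => f n x - f₀ x) 2 μ ≤ ε :=
  h.2.2.eventually_le_const (pos_iff_ne_zero.2 hε)

theorem congr (h : Cv μ f f₀) (hf : ∀ n, g n =ᵐ[μ] f n) (h0 : g₀ =ᵐ[μ] f₀) : Cv μ g g₀ := by
  refine ⟨h.1.ae_eq h0.symm, fun n => (h.2.1 n).ae_eq (hf n).symm, h.2.2.congr fun n => ?_⟩
  refine eLpNorm_congr_ae ?_
  filter_upwards [hf n, h0] with x h1 h2
  rw [h1, h2]

theorem add (hf : Cv μ f f₀) (hg : Cv μ g g₀) :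
    Cv μ (fun n x => f n x + g n x) (fun x => f₀ x + g₀ x) := by
  refine of_le (hf.1.add hg.1) (fun n => (hf.2.1 n).add (hg.2.1 n))
    (by simpa using hf.2.2.add hg.2.2) fun n => ?_
  have e1 : (fun x => f n x + g n x - (f₀ x + g₀ x)) =
      (fun x => f n x - f₀ x) + fun x => g n x - g₀ x := by ext x; simp; ring
  rw [e1]
  exact eLpNorm_add_le ((hf.2.1 n).1.sub hf.1.1) ((hg.2.1 n).1.sub hg.1.1) (by norm_num)

theorem bdd_mul (hb : Bdd μ b) (hf : Cv μ f f₀) :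
    Cv μ (fun n x => b x * f n x) (fun x => b x * f₀ x) := by
  obtain ⟨hm, R, hR⟩ := hb
  refine of_le (memLp_mul_of_bound hm hR hf.1) (fun n => memLp_mul_of_bound hm hR (hf.2.1 n))
    (ε := fun n => ENNReal.ofReal R * eLpNorm (fun x => f n x - f₀ x) 2 μ)
    (by simpa using ENNReal.Tendsto.const_mul hf.2.2 (Or.inr ENNReal.ofReal_ne_top)) fun n => ?_
  simp only [← mul_sub]
  exact eLpNorm_mul_le_of_bound hR

theorem mul_bdd (hf : Cv μ f f₀) (hb : Bdd μ b) :
    Cv μ (fun n x => f n x * b x) (fun x => f₀ x * b x) := by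
  simpa only [mul_comm] using hf.bdd_mul hb

theorem neg (hf : Cv μ f f₀) : Cv μ (fun n x => -f n x) (fun x => -f₀ x) := by
  simpa using hf.bdd_mul (b := fun _ => -1) ⟨aestronglyMeasurable_const, 1, by simp⟩

theorem sub (hf : Cv μ f f₀) (hg : Cv μ g g₀) :
    Cv μ (fun n x => f n x - g n x) (fun x => f₀ x - g₀ x) := by
  simpa only [← sub_eq_add_neg] using hf.add hg.neg

/-- Products of L²-convergent sequences converge in L² once each sequence is uniformly bounded
together with its limit. -/
theorem mul (hf : Cv μ f f₀) (hg : Cv μ g g₀) (hfb : UBdd μ f f₀) (hgb : UBdd μ g g₀) :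
    Cv μ (fun n x => f n x * g n x) (fun x => f₀ x * g₀ x) := by
  obtain ⟨R, hR0, hR⟩ := hfb
  obtain ⟨S, hS0, hS⟩ := hgb
  refine of_le (memLp_mul_of_bound hf.1.1 hR0 hg.1)
    (fun n => memLp_mul_of_bound (hf.2.1 n).1 (hR n) (hg.2.1 n))
    (ε := fun n => ENNReal.ofReal R * eLpNorm (fun x => g n x - g₀ x) 2 μ +
      ENNReal.ofReal S * eLpNorm (fun x => f n x - f₀ x) 2 μ) ?_ fun n => ?_
  · simpa using (ENNReal.Tendsto.const_mul hg.2.2 (Or.inr ENNReal.ofReal_ne_top)).add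
      (ENNReal.Tendsto.const_mul hf.2.2 (Or.inr ENNReal.ofReal_ne_top))
  · have e1 : (fun x => f n x * g n x - f₀ x * g₀ x) =
        (fun x => f n x * (g n x - g₀ x)) + fun x => g₀ x * (f n x - f₀ x) := by
      ext x; simp; ring
    rw [e1]
    exact (eLpNorm_add_le ((hf.2.1 n).1.mul ((hg.2.1 n).1.sub hg.1.1))
      (hg.1.1.mul ((hf.2.1 n).1.sub hf.1.1)) (by norm_num)).trans
      (add_le_add (eLpNorm_mul_le_of_bound (hR n)) (eLpNorm_mul_le_of_bound hS0))

end Cv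

theorem UBdd.neg (h : UBdd μ f f₀) : UBdd μ (fun n x => -f n x) (fun x => -f₀ x) := by
  simpa only [UBdd, abs_neg] using h

theorem UBdd.zero : UBdd μ (fun _ _ => 0) (fun _ => 0) := ⟨0, by simp, by simp⟩

/-! ### Strong convergence of the strain matrices -/

section Strain

variable {L : ℝ} {ω : Set V2} {θ₂ θ₃ : ℝ → ℝ}

theorem Bdd.of_Ob (hω : IsCrossSection ω) (hb : Ob (cyl L ω) 0 fun _ => b)
    (hm : AEStronglyMeasurable b (volume.restrict (cyl L ω))) :
    Bdd (volume.restrict (cyl L ω)) b := by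
  obtain ⟨C, hC⟩ := hb
  refine ⟨hm, C, ?_⟩
  filter_upwards [ae_mem_cyl hω.isOpen] with x hx
  simpa using hC 1 ⟨one_pos, le_rfl⟩ x hx

theorem skewM_cv {a b w : ℕ → V3 → ℝ} {a₀ b₀ w₀ : V3 → ℝ} (ha : Cv μ a a₀) (hb : Cv μ b b₀)
    (hw : Cv μ w w₀) (i j : Fin 3) :
    Cv μ (fun n x => skewM (a n x) (b n x) (w n x) i j)
      (fun x => skewM (a₀ x) (b₀ x) (w₀ x) i j) := by
  have h0 : Cv μ (fun _ _ => 0) (fun _ => 0) := .const (MemLp.zero' )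
  fin_cases i <;> fin_cases j
  exacts [h0, ha.neg, hb.neg, ha, h0, hw.neg, hb, hw, h0]

theorem skewM_ubdd {a b w : ℕ → V3 → ℝ} {a₀ b₀ w₀ : V3 → ℝ} (ha : UBdd μ a a₀) (hb : UBdd μ b b₀)
    (hw : UBdd μ w w₀) (i j : Fin 3) :
    UBdd μ (fun n x => skewM (a n x) (b n x) (w n x) i j)
      (fun x => skewM (a₀ x) (b₀ x) (w₀ x) i j) := by
  fin_cases i <;> fin_cases j
  exacts [.zero, ha.neg, hb.neg, ha, .zero, hw.neg, hb, hw, .zero]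

/-- The strain is affine in the derivatives with bounded coefficients, apart from the quadratic term
in the skew matrix; that term is why uniform bounds on v₂', v₃' and w are assumed. -/
theorem IsCurve.gMat_cv (hc : IsCurve L θ₂ θ₃) (hω : IsCrossSection ω)
    {u' a b w a' b' w' : ℕ → V3 → ℝ} {u'₀ a₀ b₀ w₀ a'₀ b'₀ w'₀ : V3 → ℝ}
    {D : ℕ → V3 → Fin 3 → Fin 3 → ℝ} {D₀ : V3 → Fin 3 → Fin 3 → ℝ}
    (hu : Cv (volume.restrict (cyl L ω)) u' u'₀) (ha : Cv (volume.restrict (cyl L ω)) a a₀)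
    (hb : Cv (volume.restrict (cyl L ω)) b b₀) (hw : Cv (volume.restrict (cyl L ω)) w w₀)
    (ha' : Cv (volume.restrict (cyl L ω)) a' a'₀) (hb' : Cv (volume.restrict (cyl L ω)) b' b'₀)
    (hw' : Cv (volume.restrict (cyl L ω)) w' w'₀)
    (hD : ∀ i k, k ≠ 0 → Cv (volume.restrict (cyl L ω)) (fun n x => D n x i k) fun x => D₀ x i k)
    (ua : UBdd (volume.restrict (cyl L ω)) a a₀) (ub : UBdd (volume.restrict (cyl L ω)) b b₀)
    (uw : UBdd (volume.restrict (cyl L ω)) w w₀) (i j : Fin 3) :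
    Cv (volume.restrict (cyl L ω))
      (fun n x => gMat θ₂ θ₃ x (u' n x) (a n x) (b n x) (w n x) (a' n x) (b' n x) (w' n x)
        (D n x) i j)
      (fun x => gMat θ₂ θ₃ x (u'₀ x) (a₀ x) (b₀ x) (w₀ x) (a'₀ x) (b'₀ x) (w'₀ x) (D₀ x) i j) := by
  have hm := (isOpen_cyl (L := L) hω.isOpen).measurableSet
  have t2 : Bdd (volume.restrict (cyl L ω)) fun x => deriv θ₂ (x 0) :=
    .of_Ob hω hc.memC₂.O1_deriv.toOb hc.memC₂.O1_deriv.aestronglyMeasurable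
  have t3 : Bdd (volume.restrict (cyl L ω)) fun x => deriv θ₃ (x 0) :=
    .of_Ob hω hc.memC₃.O1_deriv.toOb hc.memC₃.O1_deriv.aestronglyMeasurable
  have hpm : ∀ i, AEStronglyMeasurable (fun x => perp θ₂ θ₃ x i) (volume.restrict (cyl L ω)) :=
    fun i => ContinuousOn.aestronglyMeasurable (fun x hx =>
      (hc.hasFDerivAt_perp hx.1 i).continuousAt.continuousWithinAt) hm
  have x1 : Bdd (volume.restrict (cyl L ω)) fun x => xp θ₂ θ₃ x 1 :=
    .of_Ob hω (hc.Ob_perp hω 2).1 (hpm 2)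
  have x2 : Bdd (volume.restrict (cyl L ω)) fun x => xp θ₂ θ₃ x 2 := by
    have h1 : Bdd (volume.restrict (cyl L ω)) fun x => -perp θ₂ θ₃ x 1 :=
      .of_Ob hω (hc.Ob_perp hω 1).1.neg (hpm 1).neg
    simpa [perp] using h1
  have hR : ∀ k j, Bdd (volume.restrict (cyl L ω)) fun x => Re θ₂ θ₃ (x 0) k j := fun k j =>
    .of_Ob hω (hc.Ob_Re k j) (ContinuousOn.aestronglyMeasurable (fun x hx =>
      (contDiffAt_fst (Re_apply_zero_contDiff hc k j) hx.1).continuousAt.continuousWithinAt) hm)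
  have h0 : Cv (volume.restrict (cyl L ω)) (fun _ _ => 0) (fun _ => 0) := .const (MemLp.zero')
  have hf := fun i => memLp_section_affine hω (hc.O1_fN i) (hc.O1_fB i)
  have hk : ∀ k i, Cv (volume.restrict (cyl L ω)) (fun n x => kapD θ₂ θ₃ x (D n x) k i)
      (fun x => kapD θ₂ θ₃ x (D₀ x) k i) := fun k i =>
    (((hD i 1 (by decide)).sub (.const ((hf i).2 1))).bdd_mul (hR k 1)).add
      (((hD i 2 (by decide)).sub (.const ((hf i).2 2))).bdd_mul (hR k 2))
  have hB : ∀ i j, Cv (volume.restrict (cyl L ω))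
      (fun n x => bMat θ₂ θ₃ x (u' n x) (a n x) (b n x) (w n x) (a' n x) (b' n x) (w' n x)
        (D n x) i j)
      (fun x => bMat θ₂ θ₃ x (u'₀ x) (a₀ x) (b₀ x) (w₀ x) (a'₀ x) (b'₀ x) (w'₀ x) (D₀ x) i j) := by
    intro i j
    fin_cases i <;> fin_cases j
    · exact (((hu.add (ha.mul_bdd t2)).add (hb.mul_bdd t3)).sub (ha'.bdd_mul x1)).sub
        (hb'.bdd_mul x2)
    · exact hk 1 0
    · exact hk 2 0
    · exact (hw.mul_bdd t3).sub (hw'.bdd_mul x2)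
    · exact (ha.mul_bdd t2).add (hk 1 1)
    · exact (ha.mul_bdd t3).add (hk 2 1)
    · exact (hw.mul_bdd t2).neg.add (hw'.bdd_mul x1)
    · exact (hb.mul_bdd t2).add (hk 1 2)
    · exact (hb.mul_bdd t3).add (hk 2 2)
  have half : Bdd (volume.restrict (cyl L ω)) fun _ => (1 / 2 : ℝ) :=
    ⟨aestronglyMeasurable_const, 1 / 2, by simp⟩
  have hS : ∀ i j k l, Cv (volume.restrict (cyl L ω))
      (fun n x => skewM (a n x) (b n x) (w n x) i j * skewM (a n x) (b n x) (w n x) k l)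
      (fun x => skewM (a₀ x) (b₀ x) (w₀ x) i j * skewM (a₀ x) (b₀ x) (w₀ x) k l) := fun i j k l =>
    (skewM_cv ha hb hw i j).mul (skewM_cv ha hb hw k l) (skewM_ubdd ua ub uw i j)
      (skewM_ubdd ua ub uw k l)
  have hM := fun i j => (hB i j).sub ((((hS i 0 0 j).add (hS i 1 1 j)).add (hS i 2 2 j)).bdd_mul
    half)
  have hG := ((hM i j).add (hM j i)).bdd_mul half
  simpa only [gMat, symPart, Matrix.smul_apply, Matrix.add_apply, Matrix.sub_apply,
    Matrix.transpose_apply, Matrix.mul_apply, Fin.sum_univ_three, smul_eq_mul] using hG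

end Strain

end StrongConvergence

/-! ### Approximation of the limit displacement -/

section Approximation

variable {L : ℝ} {ω : Set V2} {θ₂ θ₃ : ℝ → ℝ} {ε ε' : ℝ≥0∞}

theorem W12Near.trans {f g k : ℝ → ℝ} (h : W12Near L ε f g) (h' : W12Near L ε' g k)
    (hk : MemW12 L k) : W12Near L (ε + ε') f k :=
  ⟨h.1, h.2.1.trans h'.2.1 hk.1.1, h.2.2.trans h'.2.2 (hk.2.memLp isOpen_Ioo).1⟩

/-- `f` and its derivatives along the cross-section are in `L²`. -/
def MemSection (U : Set V3) (f : V3 → V3) : Prop :=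
  ∀ i, MemLp (fun x => f x i) 2 (volume.restrict U) ∧
    ∀ k : Fin 3, k ≠ 0 → HasL2Deriv U (e k) (fun x => f x i)

theorem SectionNear.trans {U : Set V3} (hU : IsOpen U) {f g k : V3 → V3} (h : SectionNear U ε f g)
    (h' : SectionNear U ε' g k) (hk : MemSection U k) : SectionNear U (ε + ε') f k := fun i =>
  ⟨(h i).1.trans (h' i).1 (hk i).1.1, fun j hj => ⟨((h i).2 j hj).1,
    ((h i).2 j hj).2.trans ((h' i).2 j hj).2 (((hk i).2 j hj).memLp hU).1⟩⟩

/-- The limit displacements of the theory. -/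
structure Disp.IsAdmissible (L : ℝ) (ω : Set V2) (θ₂ θ₃ : ℝ → ℝ) (d : Disp) : Prop where
  u : MemW12 L d.u
  w : MemW12 L d.w
  v₂ : MemW22 L d.v₂
  v₃ : MemW22 L d.v₃
  γ : MemSpaceC θ₂ θ₃ L ω d.γ

theorem MemLp.amat {d : Disp} (hω : IsCrossSection ω) (hd : d.IsAdmissible L ω θ₂ θ₃)
    (i j : Fin 3) : MemLp (fun x : V3 => Amat L d.v₂ d.v₃ d.w (x 0) i j) 2
      (volume.restrict (cyl L ω)) := by
  have h2 := memLp_fst_cyl hω hd.v₂.2.1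
  have h3 := memLp_fst_cyl hω hd.v₃.2.1
  have hw := memLp_fst_cyl hω hd.w.1
  have h0 : MemLp (fun _ : V3 => (0 : ℝ)) 2 (volume.restrict (cyl L ω)) := MemLp.zero'
  fin_cases i <;> fin_cases j
  exacts [h0, h2.neg, h3.neg, h2, h0, hw.neg, h3, hw, h0]

/-- The triangle inequality in every component of `Near`; the extended nonnegative energies are
compared through the real limits `E` and `E₀`. -/
theorem Near.trans {Wh : ℝ → V3 → M3 → ℝ≥0∞} {d d₀ : Disp} {E E₀ r h : ℝ} {y : V3 → V3}
    (hN : Near θ₂ θ₃ L ω Wh d E ε h y) (hc : IsCurve L θ₂ θ₃) (hω : IsCrossSection ω)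
    (hd₀ : d₀.IsAdmissible L ω θ₂ θ₃)
    (hu : W12Near L ε' d.u d₀.u) (hw : W12Near L ε' d.w d₀.w) (hv₂ : W12Near L ε' d.v₂ d₀.v₂)
    (hv₃ : W12Near L ε' d.v₃ d₀.v₃)
    (hA : ∀ i j, L2Near (volume.restrict (cyl L ω)) ε'
      (fun x => Amat L d.v₂ d.v₃ d.w (x 0) i j) (fun x => Amat L d₀.v₂ d₀.v₃ d₀.w (x 0) i j))
    (hγ : SectionNear (cyl L ω) ε' d.γ d₀.γ)
    (hη : SectionNear (cyl L ω) ε' (eta θ₂ θ₃ d.γ) (eta θ₂ θ₃ d₀.γ))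
    (hE : |E - E₀| ≤ r) (hr : ENNReal.ofReal r ≤ ε') :
    Near θ₂ θ₃ L ω Wh d₀ E₀ (ε + ε') h y where
  mem := hN.mem
  u := hN.u.trans hu hd₀.u
  v₂ := hN.v₂.trans hv₂ hd₀.v₂.1
  v₃ := hN.v₃.trans hv₃ hd₀.v₃.1
  w := hN.w.trans hw hd₀.w
  grad := fun i j => (hN.grad i j).trans (hA i j) (MemLp.amat hω hd₀ i j).1
  γ := hN.γ.trans (isOpen_cyl hω.isOpen) hγ hd₀.γ.1
  η := hN.η.trans (isOpen_cyl hω.isOpen) hη fun i =>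
    ⟨(hc.eta_props hω hd₀.γ.1 i).1, fun k hk => ((hc.eta_props hω hd₀.γ.1 i).2 k hk).1⟩
  energy_le := hN.energy_le.trans (by
    have h1 : ENNReal.ofReal E ≤ ENNReal.ofReal E₀ + ENNReal.ofReal r :=
      (ENNReal.ofReal_le_ofReal (by linarith [(abs_le.1 hE).2])).trans ENNReal.ofReal_add_le
    calc _ ≤ ENNReal.ofReal E₀ + ε' + ε := by gcongr; exact h1.trans (by gcongr)
      _ = _ := by ring)
  le_energy := by
    have h1 : ENNReal.ofReal E₀ ≤ ENNReal.ofReal E + ENNReal.ofReal r :=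
      (ENNReal.ofReal_le_ofReal (by linarith [(abs_le.1 hE).1])).trans ENNReal.ofReal_add_le
    refine (h1.trans (add_le_add hN.le_energy hr)).trans_eq ?_
    ring

/-- The smooth displacement `d` is within `ε` of `d₀`. -/
structure Disp.IsClose (L : ℝ) (ω : Set V2) (d d₀ : Disp) (ε : ℝ≥0∞) : Prop where
  u : eLpNorm (fun t => d.u t - d₀.u t) 2 (volume.restrict (Ioo 0 L)) ≤ ε
  u' : eLpNorm (fun t => deriv d.u t - wd L d₀.u t) 2 (volume.restrict (Ioo 0 L)) ≤ ε
  w : eLpNorm (fun t => d.w t - d₀.w t) 2 (volume.restrict (Ioo 0 L)) ≤ ε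
  w' : eLpNorm (fun t => deriv d.w t - wd L d₀.w t) 2 (volume.restrict (Ioo 0 L)) ≤ ε
  w_sup : ∀ᵐ t ∂volume.restrict (Ioo 0 L), ‖d.w t - d₀.w t‖ₑ ≤ ε
  v₂ : eLpNorm (fun t => d.v₂ t - d₀.v₂ t) 2 (volume.restrict (Ioo 0 L)) ≤ ε
  v₂' : eLpNorm (fun t => deriv d.v₂ t - wd L d₀.v₂ t) 2 (volume.restrict (Ioo 0 L)) ≤ ε
  v₂'' : eLpNorm (fun t => deriv (deriv d.v₂) t - wd L (wd L d₀.v₂) t) 2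
    (volume.restrict (Ioo 0 L)) ≤ ε
  v₂_sup : ∀ᵐ t ∂volume.restrict (Ioo 0 L), ‖deriv d.v₂ t - wd L d₀.v₂ t‖ₑ ≤ ε
  v₃ : eLpNorm (fun t => d.v₃ t - d₀.v₃ t) 2 (volume.restrict (Ioo 0 L)) ≤ ε
  v₃' : eLpNorm (fun t => deriv d.v₃ t - wd L d₀.v₃ t) 2 (volume.restrict (Ioo 0 L)) ≤ ε
  v₃'' : eLpNorm (fun t => deriv (deriv d.v₃) t - wd L (wd L d₀.v₃) t) 2
    (volume.restrict (Ioo 0 L)) ≤ ε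
  v₃_sup : ∀ᵐ t ∂volume.restrict (Ioo 0 L), ‖deriv d.v₃ t - wd L d₀.v₃ t‖ₑ ≤ ε
  γ : ∀ i, eLpNorm (fun x => d.γ x i - d₀.γ x i) 2 (volume.restrict (cyl L ω)) ≤ ε
  γ' : ∀ i, ∀ k : Fin 3, k ≠ 0 → eLpNorm (fun x => fderiv ℝ (fun z => d.γ z i) x (e k) -
    pd (cyl L ω) k (fun z => d₀.γ z i) x) 2 (volume.restrict (cyl L ω)) ≤ ε

namespace Disp

theorem IsAdmissible.exists_isClose (hL : 0 < L) (hc : IsCurve L θ₂ θ₃) (hω : IsCrossSection ω)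
    {d₀ : Disp} (hd₀ : d₀.IsAdmissible L ω θ₂ θ₃) (hε : ε ≠ 0) :
    ∃ d : Disp, d.IsSmooth L ω θ₂ θ₃ ∧ d.IsClose L ω d₀ ε := by
  obtain ⟨u, su, u0, u1, -⟩ := hd₀.u.exists_approx hL hε
  obtain ⟨w, sw, w0, w1, ws⟩ := hd₀.w.exists_approx hL hε
  obtain ⟨v, sv, v0, v1, v2, vs⟩ := hd₀.v₂.exists_approx hL hε
  obtain ⟨z, sz, z0, z1, z2, zs⟩ := hd₀.v₃.exists_approx hL hε
  obtain ⟨F, hF, hF'⟩ := hd₀.γ.exists_approx hL hc hω hε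
  exact ⟨⟨u, w, v, z, centred ω θ₂ θ₃ F⟩, ⟨su, sw, sv, sz,
    fun x hx i => (hc.hasFDerivAt_centred hω hF hx i).differentiableAt,
    fun i => (hc.Ob_centred hω hF i).1, fun i => (hc.Ob_centred hω hF i).2,
    fun t ht i => secInt_centred hω hF ht i, fun t ht => hc.twist_centred hω hF ht⟩,
    ⟨u0, u1, w0, w1, ws, v0, v1, v2, vs, z0, z1, z2, zs, fun i => (hF' i).1,
      fun i => (hF' i).2⟩⟩

theorem W12Near_of_le {F f : ℝ → ℝ} (hF : ContDiff ℝ 1 F)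
    (h0 : eLpNorm (fun t => F t - f t) 2 (volume.restrict (Ioo 0 L)) ≤ ε)
    (h1 : eLpNorm (fun t => deriv F t - wd L f t) 2 (volume.restrict (Ioo 0 L)) ≤ ε) :
    W12Near L ε F f := by
  have h2 := memW12_of_eqOn hF (eqOn_refl F (Ioo 0 L))
  exact ⟨h2.1, ⟨h2.1.1, h0⟩, L2Near.congr (f := deriv F) (g := wd L f)
    ⟨(h2.1.2.memLp isOpen_Ioo).ae_eq h2.2, h1⟩ h2.2.symm (ae_eq_refl _)⟩

theorem IsSmooth.pd_ae_eq {d : Disp} (hd : d.IsSmooth L ω θ₂ θ₃) (hω : IsCrossSection ω)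
    (i k : Fin 3) : pd (cyl L ω) k (fun z => d.γ z i) =ᵐ[volume.restrict (cyl L ω)]
      fun x => fderiv ℝ (fun z => d.γ z i) x (e k) := by
  have hU := isOpen_cyl (L := L) hω.isOpen
  obtain ⟨C, hC⟩ := hd.bound_fderiv i k
  exact (isWeakDeriv_of_bounded hU (fun x hx => hd.diff x hx i) (C := C)
    fun x hx => by simpa using hC 1 ⟨one_pos, le_rfl⟩ x hx).weakDeriv_ae_eq hU

theorem IsSmooth.memSection {d : Disp} (hd : d.IsSmooth L ω θ₂ θ₃) (hω : IsCrossSection ω) :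
    MemSection (cyl L ω) d.γ := fun i =>
  have h := hd.l2Near_self hω i (ε := 0) (ae_eq_refl _)
  ⟨h.1.1, fun k hk => (h.2 k hk).1⟩

theorem IsClose.sectionNear {d d₀ : Disp} (h : d.IsClose L ω d₀ ε) (hd : d.IsSmooth L ω θ₂ θ₃)
    (hω : IsCrossSection ω) : SectionNear (cyl L ω) ε d.γ d₀.γ := fun i =>
  have hU := isOpen_cyl (L := L) hω.isOpen
  ⟨⟨(hd.memSection hω i).1, h.γ i⟩, fun k hk => ⟨(hd.memSection hω i).2 k hk,
    ((hd.memSection hω i).2 k hk).memLp hU, (eLpNorm_congr_ae (by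
      filter_upwards [hd.pd_ae_eq hω i k] with x hx
      rw [hx])).trans_le (h.γ' i k hk)⟩⟩

end Disp

theorem SectionNear.eta {γ γ₀ : V3 → V3} (h : SectionNear (cyl L ω) ε γ γ₀)
    (hc : IsCurve L θ₂ θ₃) (hω : IsCrossSection ω) (hγ : MemSection (cyl L ω) γ)
    (hγ₀ : MemSection (cyl L ω) γ₀) :
    SectionNear (cyl L ω) ε (eta θ₂ θ₃ γ) (eta θ₂ θ₃ γ₀) := fun i => by
  have hU := isOpen_cyl (L := L) hω.isOpen
  obtain ⟨m, p⟩ := hc.eta_props hω hγ i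
  obtain ⟨m₀, p₀⟩ := hc.eta_props hω hγ₀ i
  refine ⟨⟨m, (eLpNorm_congr_ae (ae_of_all _ fun x => ?_)).trans_le (h i).1.2⟩, fun k hk =>
    ⟨(p k hk).1, (p k hk).1.memLp hU, (eLpNorm_congr_ae ?_).trans_le ((h i).2 k hk).2.2⟩⟩
  · simp only [eta_apply]
    ring
  · filter_upwards [(p k hk).2, (p₀ k hk).2] with x h1 h2
    rw [h1, h2]
    ring

theorem Cv.fst {F : ℕ → ℝ → ℝ} {f : ℝ → ℝ} {ε : ℕ → ℝ≥0∞} (hω : IsCrossSection ω)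
    (hf : MemLp f 2 (volume.restrict (Ioo 0 L))) (hF : ∀ n, Continuous (F n))
    (hε : Tendsto ε atTop (𝓝 0))
    (h : ∀ n, eLpNorm (fun t => F n t - f t) 2 (volume.restrict (Ioo 0 L)) ≤ ε n) :
    Cv (volume.restrict (cyl L ω)) (fun n x => F n (x 0)) (fun x => f (x 0)) := by
  have hFm : ∀ n, MemLp (F n) 2 (volume.restrict (Ioo 0 L)) := fun n =>
    memLp_Ioo_of_continuous (hF n) 2
  refine .of_le (memLp_fst_cyl hω hf) (fun n => memLp_fst_cyl hω (hFm n))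
    (ε := fun n => volume ω ^ (1 / 2 : ℝ) * ε n) ?_ fun n => ?_
  · simpa using ENNReal.Tendsto.const_mul hε (Or.inr
      (ENNReal.rpow_ne_top_of_nonneg (by norm_num) hω.volume_lt_top.ne))
  · rw [eLpNorm_fst_cyl (f := fun t => F n t - f t) ((hFm n).1.sub hf.1)]
    gcongr
    exact h n

/-- One continuous member bounds the limit, and the limit bounds all the others, each being within 1
of it. -/
theorem UBdd.fst {F : ℕ → ℝ → ℝ} {f : ℝ → ℝ} (hF : Continuous (F 0))
    (h : ∀ n, ∀ᵐ t ∂volume.restrict (Ioo 0 L), ‖F n t - f t‖ₑ ≤ 1) :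
    UBdd (volume.restrict (cyl L ω)) (fun n x => F n (x 0)) (fun x => f (x 0)) := by
  obtain ⟨C, hC⟩ := (isCompact_Icc (a := (0 : ℝ)) (b := L)).exists_bound_of_continuousOn
    hF.continuousOn
  have h1 : ∀ n, ∀ᵐ t ∂volume.restrict (Ioo 0 L), |F n t - f t| ≤ 1 := fun n =>
    (h n).mono fun t ht => by
      rw [Real.enorm_eq_ofReal_abs, ENNReal.ofReal_le_one] at ht
      exact ht
  have h2 : ∀ᵐ t ∂volume.restrict (Ioo 0 L), |f t| ≤ C + 1 := by
    filter_upwards [h1 0, ae_restrict_mem measurableSet_Ioo] with t ht hm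
    have h3 := hC t (Ioo_subset_Icc_self hm)
    rw [Real.norm_eq_abs] at h3
    have h4 := abs_sub_abs_le_abs_sub (f t) (F 0 t)
    rw [abs_sub_comm] at h4
    linarith
  refine ⟨C + 2, ae_cyl_of_ae (p := fun t => |f t| ≤ C + 2) (h2.mono fun t ht => by linarith),
    fun n => ae_cyl_of_ae (p := fun t => |F n t| ≤ C + 2) ?_⟩
  filter_upwards [h1 n, h2] with t ht h3
  have h4 := abs_sub_abs_le_abs_sub (F n t) (f t)
  linarith

end Approximation

/-! ### Recovery deformations of admissible displacements -/

section Recovery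

variable {L : ℝ} {ω : Set V2} {θ₂ θ₃ : ℝ → ℝ} {ε : ℝ≥0∞}

theorem transpose_symPart (M : M3) : (symPart M)ᵀ = symPart M := by
  simp only [symPart, Matrix.transpose_smul, Matrix.transpose_add, Matrix.transpose_transpose]
  rw [add_comm]

namespace Disp

variable (L ω θ₂ θ₃) in
/-- The limit strain, in terms of the derivatives of the displacement on the cylinder. -/
def strain (d : Disp) (x : V3) : M3 :=
  gMat θ₂ θ₃ x (wd L d.u (x 0)) (wd L d.v₂ (x 0)) (wd L d.v₃ (x 0)) (d.w (x 0))
    (wd L (wd L d.v₂) (x 0)) (wd L (wd L d.v₃) (x 0)) (wd L d.w (x 0))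
    (fun i j => pd (cyl L ω) j (fun x => d.γ x i) x)

theorem IsAdmissible.exists_seq (hL : 0 < L) (hc : IsCurve L θ₂ θ₃) (hω : IsCrossSection ω)
    {d₀ : Disp} (hd₀ : d₀.IsAdmissible L ω θ₂ θ₃) :
    ∃ d : ℕ → Disp, (∀ n, (d n).IsSmooth L ω θ₂ θ₃) ∧
      (∀ ε : ℝ≥0∞, ε ≠ 0 → ∀ᶠ n in atTop, (d n).IsClose L ω d₀ ε) ∧
      (∀ i j, Cv (volume.restrict (cyl L ω)) (fun n x => Amat L (d n).v₂ (d n).v₃ (d n).w (x 0) i j)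
        (fun x => Amat L d₀.v₂ d₀.v₃ d₀.w (x 0) i j)) ∧
      ∀ i j, Cv (volume.restrict (cyl L ω)) (fun n x => (d n).G θ₂ θ₃ x i j)
        (fun x => d₀.strain L ω θ₂ θ₃ x i j) := by
  have hU := isOpen_cyl (L := L) hω.isOpen
  set δ : ℕ → ℝ≥0∞ := fun n => ((n + 1 : ℕ) : ℝ≥0∞)⁻¹ with hδ
  have hδ0 : ∀ n, δ n ≠ 0 := fun n => ENNReal.inv_ne_zero.2 (ENNReal.natCast_ne_top _)
  have hδ1 : ∀ n, δ n ≤ 1 := fun n => ENNReal.inv_le_one.2 (by simp)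
  have hδt : Tendsto δ atTop (𝓝 0) :=
    ENNReal.tendsto_inv_nat_nhds_zero.comp (tendsto_add_atTop_nat 1)
  choose d hd hcl using fun n => hd₀.exists_isClose hL hc hω (hδ0 n)
  have c2 : ∀ n, Continuous (deriv (d n).v₂) := fun n => (hd n).v₂.continuous_deriv (by norm_num)
  have c3 : ∀ n, Continuous (deriv (d n).v₃) := fun n => (hd n).v₃.continuous_deriv (by norm_num)
  have hv2 : Cv (volume.restrict (cyl L ω)) (fun n x => deriv (d n).v₂ (x 0))
      fun x => wd L d₀.v₂ (x 0) := .fst hω hd₀.v₂.2.1 c2 hδt fun n => (hcl n).v₂'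
  have hv3 : Cv (volume.restrict (cyl L ω)) (fun n x => deriv (d n).v₃ (x 0))
      fun x => wd L d₀.v₃ (x 0) := .fst hω hd₀.v₃.2.1 c3 hδt fun n => (hcl n).v₃'
  have hw : Cv (volume.restrict (cyl L ω)) (fun n x => (d n).w (x 0)) fun x => d₀.w (x 0) :=
    .fst hω hd₀.w.1 (fun n => (hd n).w.continuous) hδt fun n => (hcl n).w
  have hD : ∀ i k, k ≠ 0 → Cv (volume.restrict (cyl L ω))
      (fun n x => fderiv ℝ (fun z => (d n).γ z i) x (e k))
      (fun x => pd (cyl L ω) k (fun x => d₀.γ x i) x) := fun i k hk =>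
    .of_le (((hd₀.γ.1 i).2 k hk).memLp hU) (fun n =>
      ((((hd n).memSection hω i).2 k hk).memLp hU).ae_eq ((hd n).pd_ae_eq hω i k)) hδt
      fun n => (hcl n).γ' i k hk
  refine ⟨d, hd, fun ε hε => ?_, fun i j => ?_, fun i j => ?_⟩
  · filter_upwards [hδt.eventually_le_const (pos_iff_ne_zero.2 hε)] with n hn
    have h := hcl n
    exact ⟨h.u.trans hn, h.u'.trans hn, h.w.trans hn, h.w'.trans hn,
      h.w_sup.mono fun _ ht => ht.trans hn, h.v₂.trans hn, h.v₂'.trans hn, h.v₂''.trans hn,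
      h.v₂_sup.mono fun _ ht => ht.trans hn, h.v₃.trans hn, h.v₃'.trans hn, h.v₃''.trans hn,
      h.v₃_sup.mono fun _ ht => ht.trans hn, fun i => (h.γ i).trans hn,
      fun i k hk => (h.γ' i k hk).trans hn⟩
  · refine (skewM_cv hv2 hv3 hw i j).congr (fun n => ?_) (ae_eq_refl _)
    filter_upwards [ae_cyl_of_ae (memW12_of_eqOn ((hd n).v₂.of_le (by norm_num))
      (eqOn_refl (d n).v₂ (Ioo 0 L))).2, ae_cyl_of_ae (memW12_of_eqOn
      ((hd n).v₃.of_le (by norm_num)) (eqOn_refl (d n).v₃ (Ioo 0 L))).2] with x h2 h3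
    rw [Amat, skewM, h2, h3]
  · exact hc.gMat_cv hω (.fst hω (hd₀.u.2.memLp isOpen_Ioo) (fun n => (hd n).u.continuous_deriv le_rfl) hδt
      fun n => (hcl n).u') hv2 hv3 hw
      (.fst hω (hd₀.v₂.2.2.memLp isOpen_Ioo) (fun n => ((contDiff_succ_iff_deriv (n := 1)).1
        (hd n).v₂).2.2.continuous_deriv le_rfl) hδt fun n => (hcl n).v₂'')
      (.fst hω (hd₀.v₃.2.2.memLp isOpen_Ioo) (fun n => ((contDiff_succ_iff_deriv (n := 1)).1
        (hd n).v₃).2.2.continuous_deriv le_rfl) hδt fun n => (hcl n).v₃'')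
      (.fst hω (hd₀.w.2.memLp isOpen_Ioo) (fun n => (hd n).w.continuous_deriv le_rfl) hδt
        fun n => (hcl n).w') hD
      (.fst (c2 0) fun n => (hcl n).v₂_sup.mono fun _ ht => ht.trans (hδ1 n))
      (.fst (c3 0) fun n => (hcl n).v₃_sup.mono fun _ ht => ht.trans (hδ1 n))
      (.fst (hd 0).w.continuous fun n => (hcl n).w_sup.mono fun _ ht => ht.trans (hδ1 n)) i j

/-- Half of the accuracy is spent on replacing the displacement by a regular one, the other half on
the recovery deformation of that regular displacement. -/
theorem IsAdmissible.eventually_exists_near (hL : 0 < L) (hc : IsCurve L θ₂ θ₃)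
    (hω : IsCrossSection ω) {W : V3 → M3 → ℝ≥0∞} (hW : IsStoredEnergy (cyl L ω) W) {h₀ : ℝ}
    (hh₀ : 0 < h₀) {Wh : ℝ → V3 → M3 → ℝ≥0∞}
    (hWh : ∀ h ∈ Ioc 0 h₀, ∀ x ∈ cyl L ω, ∀ F : M3,
      ENNReal.ofReal (detTheta θ₂ θ₃ h (P h x)) * Wh h (ThetaP θ₂ θ₃ h x) F = W x F)
    {d₀ : Disp} (hd₀ : d₀.IsAdmissible L ω θ₂ θ₃) (hε : ε ≠ 0) :
    ∀ᶠ h in 𝓝[>] (0 : ℝ), ∃ y, Near θ₂ θ₃ L ω Wh d₀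
      (1 / 2 * ∫ x in cyl L ω, Q3 W x (d₀.strain L ω θ₂ θ₃ x)) ε h y := by
  obtain ⟨d, hd, hcl, hA, hG⟩ := hd₀.exists_seq hL hc hω
  have hε2 : ε / 2 ≠ 0 := (ENNReal.half_pos hε).ne'
  obtain ⟨r, hr0, hr⟩ := ENNReal.lt_iff_exists_nnreal_btwn.1 (pos_iff_ne_zero.2 hε2)
  have hr0' : (0 : ℝ) < r := by exact_mod_cast hr0
  obtain ⟨η, hη, hQ⟩ := hW.exists_abs_integral_Q3_sub_le (fun i j => (hG i j).1)
    (fun x => transpose_symPart _) hr0'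
  obtain ⟨n, hn, hnA, hnG⟩ := ((hcl _ hε2).and ((eventually_all.2 fun i => eventually_all.2 fun j =>
    (hA i j).eventually_le hε2).and (eventually_all.2 fun i => eventually_all.2 fun j =>
    (hG i j).eventually_le (ENNReal.ofReal_pos.2 hη).ne'))).exists
  have hE := hQ ((d n).G θ₂ θ₃) (fun x => transpose_symPart _) (fun i j => (hG i j).2.1 n) hnG
  have hs := hn.sectionNear (hd n) hω
  filter_upwards [(hd n).eventually_near hc hω hW hh₀ hWh hε2] with h hN
  refine ⟨_, ENNReal.add_halves ε ▸ hN.trans (r := r) hc hω hd₀ (W12Near_of_le (hd n).u hn.u hn.u')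
    (W12Near_of_le (hd n).w hn.w hn.w')
    (W12Near_of_le ((hd n).v₂.of_le (by norm_num)) hn.v₂ hn.v₂')
    (W12Near_of_le ((hd n).v₃.of_le (by norm_num)) hn.v₃ hn.v₃')
    (fun i j => ⟨(hA i j).2.1 n, hnA i j⟩) hs (hs.eta hc hω ((hd n).memSection hω) hd₀.γ.1) ?_ ?_⟩
  · rw [← mul_sub, abs_mul, abs_of_pos (by norm_num : (0 : ℝ) < 1 / 2)]
    linarith [abs_nonneg ((∫ x in cyl L ω, Q3 W x ((d n).G θ₂ θ₃ x)) -
      ∫ x in cyl L ω, Q3 W x (d₀.strain L ω θ₂ θ₃ x))]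
  · rw [ENNReal.ofReal_coe_nnreal]
    exact hr.le

end Disp

end Recovery

/-! ### The recovery sequence -/

section Diagonal

/-- A family of properties that can eventually be met to every accuracy can be met by a single
choice, with accuracy tending to zero. -/
theorem exists_diagonal {Y : Type*} (y₀ : ℝ → Y) {P : ℝ≥0∞ → ℝ → Y → Prop}
    (hmono : ∀ {ε ε' : ℝ≥0∞} {h : ℝ} {y : Y}, ε ≤ ε' → P ε h y → P ε' h y)
    (hP : ∀ ε : ℝ≥0∞, ε ≠ 0 → ∀ᶠ h in 𝓝[>] (0 : ℝ), ∃ y, P ε h y) :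
    ∃ y : ℝ → Y, (∀ h, y h = y₀ h ∨ ∃ ε, P ε h (y h)) ∧
      ∀ ε : ℝ≥0∞, ε ≠ 0 → ∀ᶠ h in 𝓝[>] (0 : ℝ), P ε h (y h) := by
  classical
  set δ : ℕ → ℝ≥0∞ := fun n => ((n + 1 : ℕ) : ℝ≥0∞)⁻¹ with hδ
  have hδ0 : ∀ n, δ n ≠ 0 := fun n => ENNReal.inv_ne_zero.2 (ENNReal.natCast_ne_top _)
  have hδt : Tendsto δ atTop (𝓝 0) :=
    ENNReal.tendsto_inv_nat_nhds_zero.comp (tendsto_add_atTop_nat 1)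
  have hanti : ∀ {m n : ℕ}, m ≤ n → δ n ≤ δ m := fun h =>
    ENNReal.inv_le_inv.2 (by exact_mod_cast Nat.succ_le_succ h)
  set N : ℝ → ℕ := fun h => Nat.findGreatest (fun n => ∃ y, P (δ n) h y) ⌈h⁻¹⌉₊ with hN
  refine ⟨fun h => if H : ∃ y, P (δ (N h)) h y then H.choose else y₀ h, fun h => ?_,
    fun ε hε => ?_⟩
  · by_cases H : ∃ y, P (δ (N h)) h y
    · exact Or.inr ⟨δ (N h), by simp only [dif_pos H]; exact H.choose_spec⟩
    · exact Or.inl (dif_neg H)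
  · obtain ⟨n, hn⟩ := (hδt.eventually_le_const (pos_iff_ne_zero.2 hε)).exists
    have h1 : ∀ᶠ h : ℝ in 𝓝[>] 0, (n : ℝ) ≤ h⁻¹ :=
      tendsto_inv_nhdsGT_zero.eventually_ge_atTop (n : ℝ)
    filter_upwards [hP _ (hδ0 n), h1] with h hy hh
    have hle : n ≤ ⌈h⁻¹⌉₊ := by exact_mod_cast hh.trans (Nat.le_ceil _)
    have H : ∃ y, P (δ (N h)) h y :=
      Nat.findGreatest_spec (P := fun n => ∃ y, P (δ n) h y) hle hy
    rw [dif_pos H]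
    exact hmono ((hanti (Nat.le_findGreatest hle hy)).trans hn) H.choose_spec

end Diagonal

section Limits

variable {α : Type*} [MeasurableSpace α] {μ : Measure α} {F : ℝ → α → ℝ} {f : α → ℝ}

theorem TendstoL2.of_near (hf : MemLp f 2 μ)
    (h : ∀ ε : ℝ≥0∞, ε ≠ 0 → ∀ᶠ h in 𝓝[>] (0 : ℝ), L2Near μ ε (F h) f) : TendstoL2 μ F f :=
  ⟨hf, (h 1 one_ne_zero).mono fun _ hh => hh.1, ENNReal.tendsto_nhds_zero.2 fun ε hε =>
    (h ε hε.ne').mono fun _ hh => hh.2⟩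

theorem TendstoL2.weak (h : TendstoL2 μ F f) : TendstoWeakL2 μ F f := by
  refine ⟨h.1, h.2.1, fun φ hφ => ?_⟩
  have hlim : Tendsto (fun s => (eLpNorm (fun x => F s x - f x) 2 μ * eLpNorm φ 2 μ).toReal)
      (𝓝[>] 0) (𝓝 0) := by
    have h1 := ENNReal.Tendsto.mul_const h.2.2 (Or.inr hφ.eLpNorm_ne_top)
    rw [zero_mul] at h1
    exact (ENNReal.tendsto_toReal ENNReal.zero_ne_top).comp h1
  rw [tendsto_iff_norm_sub_tendsto_zero]
  refine squeeze_zero' (Eventually.of_forall fun _ => norm_nonneg _) ?_ hlim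
  filter_upwards [h.2.1] with s hs
  have hsub : MemLp (fun x => F s x - f x) 2 μ := hs.sub h.1
  have e1 : ∫ x, F s x * φ x ∂μ - ∫ x, f x * φ x ∂μ = ∫ x, (F s x - f x) * φ x ∂μ := by
    have i1 : Integrable (fun x => F s x * φ x) μ := hs.integrable_mul hφ
    have i2 : Integrable (fun x => f x * φ x) μ := h.1.integrable_mul hφ
    rw [← integral_sub i1 i2]
    exact integral_congr_ae (Eventually.of_forall fun x => (sub_mul _ _ _).symm)
  rw [e1]
  have h2 := eLpNorm_smul_le_mul_eLpNorm (p := 2) (q := 2) (r := 1) hφ.1 hsub.1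
  rw [eLpNorm_one_eq_lintegral_enorm] at h2
  rw [← toReal_enorm]
  exact ENNReal.toReal_mono (ENNReal.mul_ne_top hsub.eLpNorm_ne_top hφ.eLpNorm_ne_top)
    ((enorm_integral_le_lintegral_enorm _).trans h2)

theorem TendstoW12.of_near {L : ℝ} {F : ℝ → ℝ → ℝ} {f : ℝ → ℝ} (hf : MemW12 L f)
    (h : ∀ ε : ℝ≥0∞, ε ≠ 0 → ∀ᶠ h in 𝓝[>] (0 : ℝ), W12Near L ε (F h) f) : TendstoW12 L F f :=
  ⟨hf, (h 1 one_ne_zero).mono fun _ hh => hh.1,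
    .of_near hf.1 fun ε hε => (h ε hε).mono fun _ hh => hh.2.1,
    .of_near (hf.2.memLp isOpen_Ioo) fun ε hε => (h ε hε).mono fun _ hh => hh.2.2⟩

theorem TendstoW12.weak {L : ℝ} {F : ℝ → ℝ → ℝ} {f : ℝ → ℝ} (h : TendstoW12 L F f) :
    TendstoWeakW12 L F f := ⟨h.1, h.2.1, h.2.2.1.weak, h.2.2.2.weak⟩

theorem TendstoWeakSection.of_near {U : Set V3} (hU : IsOpen U) {F : ℝ → V3 → V3} {f : V3 → V3}
    (hf : MemSection U f)
    (h : ∀ ε : ℝ≥0∞, ε ≠ 0 → ∀ᶠ h in 𝓝[>] (0 : ℝ), SectionNear U ε (F h) f) :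
    TendstoWeakSection U F f := fun i =>
  ⟨(TendstoL2.of_near (hf i).1 fun ε hε => (h ε hε).mono fun _ hh => (hh i).1).weak, fun k hk =>
    ⟨(hf i).2 k hk, (h 1 one_ne_zero).mono fun _ hh => ((hh i).2 k hk).1,
      (TendstoL2.of_near (((hf i).2 k hk).memLp hU) fun ε hε =>
        (h ε hε).mono fun _ hh => ((hh i).2 k hk).2).weak⟩⟩

theorem tendsto_of_le_add {l : Filter ℝ} {f : ℝ → ℝ≥0∞} {a : ℝ≥0∞} (ha : a ≠ ⊤)
    (h : ∀ ε : ℝ≥0∞, ε ≠ 0 → ∀ᶠ h in l, f h ≤ a + ε ∧ a ≤ f h + ε) : Tendsto f l (𝓝 a) :=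
  (ENNReal.tendsto_nhds ha).2 fun ε hε => (h ε hε.ne').mono fun _ hh =>
    ⟨tsub_le_iff_right.2 hh.2, hh.1⟩

end Limits

section Main

variable {L : ℝ} {ω : Set V2} {θ₂ θ₃ : ℝ → ℝ}

theorem memW12V_zero (U : Set V3) : MemW12V U 0 := fun _ =>
  ⟨MemLp.zero', fun _ => ⟨0, ⟨locallyIntegrable_zero.locallyIntegrableOn _,
    locallyIntegrable_zero.locallyIntegrableOn _, fun φ _ _ _ => by simp⟩, MemLp.zero'⟩⟩

theorem W12Near.mono {ε ε' : ℝ≥0∞} {f g : ℝ → ℝ} (h : W12Near L ε f g) (hε : ε ≤ ε') :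
    W12Near L ε' f g := ⟨h.1, h.2.1.mono hε, h.2.2.mono hε⟩

theorem SectionNear.mono {U : Set V3} {ε ε' : ℝ≥0∞} {F f : V3 → V3} (h : SectionNear U ε F f)
    (hε : ε ≤ ε') : SectionNear U ε' F f := fun i =>
  ⟨(h i).1.mono hε, fun k hk => ⟨((h i).2 k hk).1, ((h i).2 k hk).2.mono hε⟩⟩

theorem Near.mono {Wh : ℝ → V3 → M3 → ℝ≥0∞} {d : Disp} {E h : ℝ} {ε ε' : ℝ≥0∞} {y : V3 → V3}
    (H : Near θ₂ θ₃ L ω Wh d E ε h y) (hε : ε ≤ ε') : Near θ₂ θ₃ L ω Wh d E ε' h y where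
  mem := H.mem
  u := H.u.mono hε
  v₂ := H.v₂.mono hε
  v₃ := H.v₃.mono hε
  w := H.w.mono hε
  grad := fun i j => (H.grad i j).mono hε
  γ := H.γ.mono hε
  η := H.η.mono hε
  energy_le := H.energy_le.trans (by gcongr)
  le_energy := H.le_energy.trans (by gcongr)

theorem Disp.IsAdmissible.memLp_strain {d : Disp} (hd : d.IsAdmissible L ω θ₂ θ₃) (hL : 0 < L)
    (hc : IsCurve L θ₂ θ₃) (hω : IsCrossSection ω) (i j : Fin 3) :
    MemLp (fun x => d.strain L ω θ₂ θ₃ x i j) 2 (volume.restrict (cyl L ω)) := by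
  obtain ⟨_, _, _, _, h⟩ := hd.exists_seq hL hc hω
  exact (h i j).1

end Main

end CurvedRod

end

open CurvedRod

theorem mainTheorem4
    (L : ℝ) (hL : 0 < L) (ω : Set V2) (hω : IsCrossSection ω)
    (θ₂ θ₃ : ℝ → ℝ) (hθ₂ : MemC 3 L θ₂) (hθ₃ : MemC 3 L θ₃)
    (hθ : ∀ t ∈ Ioo 0 L, deriv (deriv θ₂) t ^ 2 + deriv (deriv θ₃) t ^ 2 ≠ 0)
    (hp₂ : MemC 1 L (p₂ θ₂ θ₃)) (hp₃ : MemC 1 L (p₃ θ₂ θ₃))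
    (W : V3 → M3 → ℝ≥0∞) (hW : IsStoredEnergy (cyl L ω) W)
    (h₀ : ℝ) (hh₀ : 0 < h₀) (hh₀' : h₀ ≤ 1) (Wh : ℝ → V3 → M3 → ℝ≥0∞)
    (hWh : ∀ h ∈ Ioc 0 h₀, ∀ x ∈ cyl L ω, ∀ F : M3,
      ENNReal.ofReal (detTheta θ₂ θ₃ h (P h x)) * Wh h (ThetaP θ₂ θ₃ h x) F = W x F)
    (u w v₂ v₃ : ℝ → ℝ) (hu : MemW12 L u) (hw : MemW12 L w)
    (hv₂ : MemW22 L v₂) (hv₃ : MemW22 L v₃)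
    (γ : V3 → V3) (hγ : MemSpaceC θ₂ θ₃ L ω γ) :
    ∃ y : ℝ → V3 → V3,
      (∀ h ∈ Ioc 0 h₀, MemW12V (rodHat θ₂ θ₃ L ω h) (y h)) ∧
      -- (a)
      TendstoWeakW12 L (fun h => uOf θ₂ θ₃ ω h (y h)) u ∧
      -- (b)
      TendstoW12 L (fun h => v₂Of θ₂ θ₃ ω h (y h)) v₂ ∧
      TendstoW12 L (fun h => v₃Of θ₂ θ₃ ω h (y h)) v₃ ∧
      -- (c)
      TendstoWeakW12 L (fun h => wOf θ₂ θ₃ ω h (y h)) w ∧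
      -- (d)
      (∀ i j, TendstoL2 (volume.restrict (cyl L ω))
        (fun h x => (grad (rodHat θ₂ θ₃ L ω h) (y h) (ThetaP θ₂ θ₃ h x) i j
          - (1 : M3) i j) / h)
        (fun x => Amat L v₂ v₃ w (x 0) i j)) ∧
      -- (f), also in its formulation with `η`
      TendstoWeakSection (cyl L ω) (fun h => gammaOf θ₂ θ₃ L ω h (y h)) γ ∧
      TendstoWeakSection (cyl L ω) (fun h => etaOf θ₂ θ₃ L ω h (y h)) (eta θ₂ θ₃ γ) ∧
      -- convergence of the energy
      IntegrableOn (fun x => Q3 W x (Gmat θ₂ θ₃ L ω u v₂ v₃ w γ x)) (cyl L ω) ∧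
      Tendsto
        (fun h : ℝ => (ENNReal.ofReal (h ^ 6))⁻¹ *
          ∫⁻ z in rodHat θ₂ θ₃ L ω h, Wh h z (grad (rodHat θ₂ θ₃ L ω h) (y h) z))
        (𝓝[>] 0)
        (𝓝 (ENNReal.ofReal
          (1 / 2 * ∫ x in cyl L ω, Q3 W x (Gmat θ₂ θ₃ L ω u v₂ v₃ w γ x)))) := by
  have hc : IsCurve L θ₂ θ₃ := ⟨hθ₂, hθ₃, hθ, hp₂, hp₃⟩
  have hU := isOpen_cyl (L := L) hω.isOpen
  set d : Disp := ⟨u, w, v₂, v₃, γ⟩ with hd_def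
  have hd : d.IsAdmissible L ω θ₂ θ₃ := ⟨hu, hw, hv₂, hv₃, hγ⟩
  have hG : ∀ᵐ x ∂volume.restrict (cyl L ω), Gmat θ₂ θ₃ L ω u v₂ v₃ w γ x =
      d.strain L ω θ₂ θ₃ x := hc.Gmat_ae_eq hω hγ.1 u w v₂ v₃
  have hE : ∫ x in cyl L ω, Q3 W x (Gmat θ₂ θ₃ L ω u v₂ v₃ w γ x) =
      ∫ x in cyl L ω, Q3 W x (d.strain L ω θ₂ θ₃ x) :=
    integral_congr_ae (hG.mono fun x hx => congrArg (Q3 W x) hx)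
  have hη : MemSection (cyl L ω) (eta θ₂ θ₃ γ) := fun i =>
    ⟨(hc.eta_props hω hγ.1 i).1, fun k hk => ((hc.eta_props hω hγ.1 i).2 k hk).1⟩
  obtain ⟨y, hy, hN⟩ := exists_diagonal (fun _ => (0 : V3 → V3)) (P := Near θ₂ θ₃ L ω Wh d
    (1 / 2 * ∫ x in cyl L ω, Q3 W x (d.strain L ω θ₂ θ₃ x))) (fun hε H => H.mono hε)
    fun ε hε => hd.eventually_exists_near hL hc hω hW hh₀ hWh hε
  refine ⟨y, fun h _ => ?_, ?_, ?_, ?_, ?_, fun i j => ?_, ?_, ?_, ?_, ?_⟩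
  · rcases hy h with h0 | ⟨ε, H⟩
    · rw [h0]
      exact memW12V_zero _
    · exact H.mem
  · exact (TendstoW12.of_near hu fun ε hε => (hN ε hε).mono fun _ H => H.u).weak
  · exact TendstoW12.of_near hv₂.1 fun ε hε => (hN ε hε).mono fun _ H => H.v₂
  · exact TendstoW12.of_near hv₃.1 fun ε hε => (hN ε hε).mono fun _ H => H.v₃
  · exact (TendstoW12.of_near hw fun ε hε => (hN ε hε).mono fun _ H => H.w).weak
  · exact TendstoL2.of_near (MemLp.amat hω hd i j) fun ε hε =>
      (hN ε hε).mono fun _ H => H.grad i j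
  · exact TendstoWeakSection.of_near hU hγ.1 fun ε hε => (hN ε hε).mono fun _ H => H.γ
  · exact TendstoWeakSection.of_near hU hη fun ε hε => (hN ε hε).mono fun _ H => H.η
  · exact hW.integrable_Q3 (fun i j => (hd.memLp_strain hL hc hω i j).ae_eq
      (hG.mono fun x hx => congrFun (congrFun hx.symm i) j)) fun x => transpose_symPart _
  · rw [hE]
    exact tendsto_of_le_add ENNReal.ofReal_ne_top fun ε hε =>
      (hN ε hε).mono fun _ H => ⟨H.energy_le, H.le_energy⟩
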